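/- A polyhedron $P\subset\mathbb{R}^3$ is a nonempty compact solid, not necessarily convex, that is the closure of its interior and whose boundary lies in finitely many planes. Its Melzak ratio is $m(P)=e(P)^3/v(P)$, where $e(P)$ is the total length of its edges and $v(P)$ its volume. A vertex $H$ of $P$ is exposed if it has an open neighbourhood $U$ such that $U\cap P$ is convex; its degree is the number of edges of $P$ that emanate from it. Theorem. Let $F$ be a face of a polyhedron $P$, and let $A,B$ be two adjacent vertices of $F$ (joined by an edge of $P$ contained in $F$) such that every vertex of $F$ other than $A$ and $B$ is exposed. Suppose that some exposed vertex $H$ of $F$ that does not lie on the line $AB$ (if $F$ is convex, this only says $H\neq A,B$) has degree greater than $3$. Then $P$ can be perturbed by rotating the plane of $F$ about the edge $AB$ so as to decrease the Melzak ratio. That is, for one of the two senses of rotation there are $\varepsilon>0$ and polyhedra $P_t$, $0\le t\le\varepsilon$, with $P_0=P$, where $P_t$ is obtained from $P$ by rotating by the angle $t$ about the line $AB$ the plane that bounds $P$ along $F$, the planes of the other faces being kept, such that the one-sided derivative of $t\mapsto m(P_t)$ at $t=0$ exists and is negative, and $m(P_t)<m(P)$ for $0<t\le\varepsilon$. Precisely,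 "rotating the plane" means: let $n$ be the outward unit normal of $F$ and $w$ one of the two unit vectors orthogonal to both $n$ and $B-A$, and put $S_t=\{y:\langle \cos t\,n+\sin t\,w,\;y-A\rangle\le 0\}$. There is a family $\mathcal U$, independent of $t$, of convex open sets that meet $F$ and together cover $F$ minus the closed edge $AB$, such that $P_t\cap U=U\cap S_t\cap N_U$ for every $U\in\mathcal U$ and $0\le t\le\varepsilon$, where $N_U$ is the intersection of the half-spaces that bound $P$ along the faces other than $F$ whose relative interiors meet $U$, and $P_t=P$ outside $\bigcup\mathcal U$. -/

import Mathlib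

noncomputable section

namespace Melzak

open Topology Set

/-- Euclidean three-space. -/
abbrev E3 : Type := EuclideanSpace ℝ (Fin 3)

/-- The closed half-space with boundary through `x` and outward normal `n`. -/
def halfspace (x n : E3) : Set E3 := {y | inner ℝ n (y - x) ≤ 0}

/-- A solid polyhedron, not necessarily convex: a nonempty compact set that is the closure of
its interior and whose boundary is contained in finitely many planes `{y | ⟪a, y⟫ = b}`. -/
structure IsPolyhedron (P : Set E3) : Prop where
  nonempty : P.Nonempty
  compact : IsCompact P
  regular : closure (interior P) = P
  planes : ∃ S : Finset (E3 × ℝ), (∀ p ∈ S, p.1 ≠ 0) ∧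
    ∀ y ∈ frontier P, ∃ p ∈ S, inner ℝ p.1 y = p.2

/-- `x` lies in the relative interior of a face of `P` with outward unit normal `n`:
near `x` the solid is a half-space. -/
def IsFacePoint (P : Set E3) (x n : E3) : Prop :=
  ‖n‖ = 1 ∧ ∀ᶠ y in 𝓝 x, (y ∈ P ↔ y ∈ halfspace x n)

/-- The union of the relative interiors of the faces. -/
def facePoints (P : Set E3) : Set E3 := {x | ∃ n, IsFacePoint P x n}

/-- The union of the relative interiors of the edges: boundary points, not in the relative
interior of a face, near which `P` is invariant under small translations along some line. -/
def edgePoints (P : Set E3) : Set E3 :=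
  {x | x ∈ frontier P ∧ x ∉ facePoints P ∧ ∃ u : E3, ‖u‖ = 1 ∧
    ∀ᶠ q : E3 × ℝ in 𝓝 (x, (0 : ℝ)), (q.1 + q.2 • u ∈ P ↔ q.1 ∈ P)}

/-- The vertices: all remaining boundary points. -/
def vertices (P : Set E3) : Set E3 :=
  {x | x ∈ frontier P ∧ x ∉ facePoints P ∧ x ∉ edgePoints P}

/-- A (closed) face: the closure of a connected component of `facePoints P`. -/
def IsFace (P F : Set E3) : Prop :=
  ∃ x ∈ facePoints P, F = closure (connectedComponentIn (facePoints P) x)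

/-- `A` and `B` are adjacent vertices of the face `F`: the segment `AB` is an edge of `P`
contained in `F`. -/
structure IsFaceEdge (P F : Set E3) (A B : E3) : Prop where
  ne : A ≠ B
  left : A ∈ vertices P ∩ F
  right : B ∈ vertices P ∩ F
  seg : openSegment ℝ A B ⊆ edgePoints P ∩ F

/-- The degree of `H`: the number of directions in which an edge of `P` leaves `H`. -/
def degree (P : Set E3) (H : E3) : ℕ :=
  Set.ncard {d : E3 | ‖d‖ = 1 ∧ ∀ᶠ s : ℝ in 𝓝[>] 0, H + s • d ∈ edgePoints P}

/-- `H` has an open neighbourhood whose intersection with `P` is convex. -/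
def IsExposed (P : Set E3) (H : E3) : Prop :=
  ∃ U : Set E3, IsOpen U ∧ H ∈ U ∧ Convex ℝ (U ∩ P)

/-- Total edge length: the one-dimensional Hausdorff measure of the union of the edges. -/
def edgeLength (P : Set E3) : ℝ :=
  (MeasureTheory.Measure.hausdorffMeasure 1 (edgePoints P)).toReal

/-- Volume (Lebesgue measure). -/
def vol (P : Set E3) : ℝ := (MeasureTheory.volume P).toReal

/-- The Melzak ratio. -/
def melzakRatio (P : Set E3) : ℝ := edgeLength P ^ 3 / vol P

/-- The intersection of the half-spaces of all faces of `P`, other than `F`, that have relative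
interior points in `U`. -/
def otherHalfspaces (P F U : Set E3) : Set E3 :=
  {y | ∀ x n, x ∈ U → x ∉ F → IsFacePoint P x n → y ∈ halfspace x n}

/-- `Q` arises from `P` by replacing, in each region `U ∈ 𝒰`, the half-space of the face `F` by
the half-space with boundary through `A` and outward normal `ν`, all other half-spaces and
everything outside the regions being kept. -/
def IsReplacement (P F : Set E3) (𝒰 : Set (Set E3)) (A ν : E3) (Q : Set E3) : Prop :=
  (∀ U ∈ 𝒰, Q ∩ U = halfspace A ν ∩ otherHalfspaces P F U ∩ U) ∧
    Q \ ⋃₀ 𝒰 = P \ ⋃₀ 𝒰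

/-- `Q t`, `0 ≤ t ≤ ε`, is a family of polyhedra starting at `P`, in which `Q t` arises from `P`
by rotating the plane of the face `F` by the angle `t` about the line `AB`.
Here `n` is the outward unit normal of `F` and `w` is one of the two unit vectors in the plane
of `F` orthogonal to `AB`; the choice of `w` is the choice of the sense of rotation.
The face without the edge `AB` is covered by convex open regions in each of which `P` is the
intersection of the half-space of `F` with the half-spaces of the other faces (this is
`IsReplacement` at `t = 0`); in these regions the half-space of `F` is rotated. -/
def IsFaceRotation (P F : Set E3) (A B : E3) (ε : ℝ) (Q : ℝ → Set E3) : Prop :=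
  Q 0 = P ∧ (∀ t ∈ Icc 0 ε, IsPolyhedron (Q t)) ∧
  ∃ (n w : E3) (𝒰 : Set (Set E3)),
    (∃ x ∈ F, IsFacePoint P x n) ∧
    ‖w‖ = 1 ∧ inner ℝ w n = 0 ∧ inner ℝ w (B - A) = 0 ∧
    (∀ U ∈ 𝒰, IsOpen U ∧ Convex ℝ U ∧ (U ∩ F).Nonempty) ∧
    F \ segment ℝ A B ⊆ ⋃₀ 𝒰 ∧
    ∀ t ∈ Icc 0 ε, IsReplacement P F 𝒰 A (Real.cos t • n + Real.sin t • w) (Q t)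

end Melzak

end

/-!
Rotating the plane of `F` by a small angle about `AB` changes the Melzak ratio `e ^ 3 / v` to first
order by `(3 * e ^ 2 * e') / v - e ^ 3 * v' / v ^ 2`. The volume is differentiable on both sides of
the angle `0` (`FaceData.exists_hasDerivAt_vol`), so its one-sided derivatives for the two senses
of rotation cancel. Hence it suffices that the one-sided derivatives of the edge length for the two
senses have a negative sum (`FaceData.exists_rightDeriv_edgeLength`): then one of the two senses
makes the derivative of the Melzak ratio negative.

Setup. All planes involved lie in a finite arrangement `T`. The star of a point consists of the
points not separated from it by a plane of `T` off the point; a set whose points are determined by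
their signs with respect to `T` is a finite union of cells. As all vertices of `F` except `A` and `B`
are exposed, `P` is convex near every point `y` of `F` off the edge `AB`: an extreme point of the
set of points at which local convexity fails is a vertex that is not exposed, hence `A` or `B`. In
the star of such a `y` the polyhedron is therefore the intersection of the half-space of `F` with
the half-spaces of the other faces there. The union of these stars is the region of the rotation, and the intersections of the
other half-spaces fit together to the body, in which the half-space of `F` is rotated. That the
result is a polyhedron for small angles rests on a compactness argument: the points of the body
between the old and the new plane lie in stars of points of `F`.

Edge length. Inside the region an edge of the rotated polyhedron is either part of an edge of the
body below the rotated plane, or the trace of a face of the body on the rotated plane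
(`FaceData.edgeLength_replaced`). To first order both lengths change only at the corners `a`, the
points of `F` off `AB` lying on at least two other faces. There the edges of the body descending
from `a` are cut and the edges ascending from it are prolonged, at a rate proportional to the
distance of `a` from `AB` (`FaceData.rightDeriv_bodyEdges`), while the ends of the traces move with
the speeds `traceSpeed` (`FaceData.rightDeriv_facet`).

The inequality at a corner. In the plane at height `-1` below `a` the cone of `a` is the
epigraph of the maximum of affine functions `Y ↦ θ i * Y - ζ i`, `i ≤ k`, one for each face other
than `F` (`CornerChart`, `Envelope`). Its vertices `p 0, …, p (k - 1)` are the descending edges, and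
the meeting point `G` of the lines of extreme slopes is opposite to the only possible ascending edge.
Adding up the two senses of rotation, the corner contributes at most the distance of `a` from `AB`
times
`∑ ‖p i - p (i - 1)‖ - ‖G - p 0‖ - ‖G - p (k - 1)‖ + ‖G‖ - ∑ ‖p i‖`.
The polygon `p 0, …, p (k - 1)` is convex and lies inside the triangle with vertices `p 0`, `G`,
`p (k - 1)`, so the first sum is at most `‖G - p 0‖ + ‖G - p (k - 1)‖`; together with triangle
inequalities from `a` this makes the expression nonpositive, and negative when `k ≥ 2`
(`Envelope.balance`). An exposed vertex of degree greater than `3` off `AB` is a corner on at least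
three other faces (`FaceData.card_normals_of_degree`), which gives the strict inequality.
-/

noncomputable section
namespace Melzak
open Topology Set MeasureTheory Filter

section

/-! ### Plane arrangements and sets determined by the signs of finitely many affine functions -/

/-- The affine function whose zero set is the plane encoded by `p`. -/
def ev (p : E3 × ℝ) (z : E3) : ℝ := inner ℝ p.1 z - p.2

/-- The open star of `y` in the arrangement `T`: the points lying strictly on the same side as `y`
of every plane of `T` that misses `y`. -/
def star (T : Finset (E3 × ℝ)) (y : E3) : Set E3 :=
  {z | ∀ p ∈ T, ev p y ≠ 0 → 0 < ev p y * ev p z}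

/-- Two points have the same position with respect to each plane of `T`. -/
def SignEq (T : Finset (E3 × ℝ)) (z z' : E3) : Prop :=
  ∀ p ∈ T, SignType.sign (ev p z) = SignType.sign (ev p z')

/-- Membership in `X` depends only on the position with respect to the planes of `T`. -/
def Sat (T : Finset (E3 × ℝ)) (X : Set E3) : Prop :=
  ∀ z z', SignEq T z z' → z ∈ X → z' ∈ X

/-- `z` lies on none of the planes of `T`. -/
def Generic (T : Finset (E3 × ℝ)) (z : E3) : Prop := ∀ p ∈ T, ev p z ≠ 0

lemma continuous_ev (p : E3 × ℝ) : Continuous (ev p) := by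
  unfold ev; fun_prop

lemma ev_add (p : E3 × ℝ) (z d : E3) : ev p (z + d) = ev p z + inner ℝ p.1 d := by
  simp [ev, inner_add_right]; ring

lemma ev_sub (p : E3 × ℝ) (z x : E3) : ev p z - ev p x = inner ℝ p.1 (z - x) := by
  simp [ev, inner_sub_right]

lemma ev_add_smul_sub (p : E3 × ℝ) (y z : E3) (s : ℝ) :
    ev p (y + s • (z - y)) = (1 - s) * ev p y + s * ev p z := by
  rw [ev_add, inner_smul_right, ← ev_sub]; ring

lemma ev_combo (p : E3 × ℝ) (y z : E3) {a b : ℝ} (h : a + b = 1) :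
    ev p (a • y + b • z) = a * ev p y + b * ev p z := by
  simp only [ev, inner_add_right, inner_smul_right]
  linear_combination p.2 * h

variable {T : Finset (E3 × ℝ)} {X : Set E3}

lemma SignEq.symm {z z' : E3} (h : SignEq T z z') : SignEq T z' z := fun p hp => (h p hp).symm

lemma Sat.iff (hX : Sat T X) {z z' : E3} (h : SignEq T z z') : z ∈ X ↔ z' ∈ X :=
  ⟨hX z z' h, hX z' z h.symm⟩

lemma sign_eq_of_mul_pos {a b : ℝ} (h : 0 < a * b) : SignType.sign a = SignType.sign b := by
  rcases pos_and_pos_or_neg_and_neg_of_mul_pos h with ⟨h1, h2⟩ | ⟨h1, h2⟩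
  · rw [sign_pos h1, sign_pos h2]
  · rw [sign_neg h1, sign_neg h2]

lemma zero_iff_of_sign_eq {a b : ℝ} (h : SignType.sign a = SignType.sign b) : a = 0 ↔ b = 0 := by
  rw [← sign_eq_zero_iff (a := a), ← sign_eq_zero_iff (a := b), h]

lemma mul_pos_of_sign_eq {a b : ℝ} (h : SignType.sign a = SignType.sign b) (ha : a ≠ 0) :
    0 < a * b := by
  have hb : b ≠ 0 := fun hb => ha ((zero_iff_of_sign_eq h).2 hb)
  rcases lt_or_gt_of_ne ha with ha' | ha' <;> rcases lt_or_gt_of_ne hb with hb' | hb'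
  · exact mul_pos_of_neg_of_neg ha' hb'
  · rw [sign_neg ha', sign_pos hb'] at h; exact absurd h (by decide)
  · rw [sign_pos ha', sign_neg hb'] at h; exact absurd h (by decide)
  · exact mul_pos ha' hb'

lemma sign_smul_pos {c a : ℝ} (hc : 0 < c) : SignType.sign (c * a) = SignType.sign a := by
  rw [sign_mul, sign_pos hc, one_mul]

lemma isOpen_star (T : Finset (E3 × ℝ)) (y : E3) : IsOpen (star T y) := by
  have : star T y = ⋂ p ∈ T, {z | ev p y ≠ 0 → 0 < ev p y * ev p z} := by
    ext z; simp [star]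
  rw [this]
  refine isOpen_biInter_finset fun p _ => ?_
  by_cases h : ev p y = 0
  · simp [h]
  · simp only [ne_eq, h, not_false_eq_true, forall_const]
    exact isOpen_lt continuous_const (continuous_const.mul (continuous_ev p))

lemma self_mem_star (T : Finset (E3 × ℝ)) (y : E3) : y ∈ star T y :=
  fun _ _ h => mul_self_pos.2 h

lemma star_mem_nhds (T : Finset (E3 × ℝ)) (y : E3) : star T y ∈ 𝓝 y :=
  (isOpen_star T y).mem_nhds (self_mem_star T y)

lemma convex_star (T : Finset (E3 × ℝ)) (y : E3) : Convex ℝ (star T y) := by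
  intro z hz z' hz' a b ha hb hab p hp h
  have h1 := hz p hp h
  have h2 := hz' p hp h
  rw [ev_combo p z z' hab]
  rcases eq_or_lt_of_le ha with rfl | ha
  · have : b = 1 := by linarith
    subst this; simpa using h2
  · have := mul_pos ha h1
    have := mul_nonneg hb h2.le
    nlinarith

lemma signEq_star_congr {z z' : E3} (h : SignEq T z z') (y : E3) :
    z ∈ star T y → z' ∈ star T y := by
  intro hz p hp hy
  have h1 := hz p hp hy
  have h2 := sign_eq_of_mul_pos h1
  exact mul_pos_of_sign_eq (h2.trans (h p hp)) hy

/-- Inside the star of `y` the arrangement is a cone with apex `y`. -/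
lemma signEq_of_mem_star {y z : E3} (hz : z ∈ star T y) {s : ℝ} (hs : 0 < s) (hs1 : s ≤ 1) :
    SignEq T z (y + s • (z - y)) := by
  intro p hp
  rw [ev_add_smul_sub]
  by_cases h : ev p y = 0
  · rw [h, mul_zero, zero_add, sign_smul_pos hs]
  · have h1 := hz p hp h
    refine sign_eq_of_mul_pos ?_
    have hzz : ev p z ≠ 0 := fun h0 => by simp [h0] at h1
    have := mul_pos hs (mul_self_pos.2 hzz)
    have := mul_nonneg (sub_nonneg.2 hs1) h1.le
    nlinarith

/-- Points with the same position have the same arrangement germ. -/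
lemma SignEq.germ {z z' : E3} (h : SignEq T z z') :
    ∀ᶠ d in 𝓝 (0 : E3), SignEq T (z + d) (z' + d) := by
  unfold SignEq
  rw [Filter.eventually_all_finset]
  intro p hp
  by_cases h0 : ev p z = 0
  · have h0' : ev p z' = 0 := (zero_iff_of_sign_eq (h p hp)).1 h0
    simp [ev_add, h0, h0']
  · have h2 := mul_pos_of_sign_eq (h p hp) h0
    have hc : ContinuousAt (fun d : E3 => ev p z * ev p (z + d)) 0 := by
      have := continuous_ev p; fun_prop
    have hc' : ContinuousAt (fun d : E3 => ev p z * ev p (z' + d)) 0 := by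
      have := continuous_ev p; fun_prop
    have e1 := hc.eventually (lt_mem_nhds (a := 0) (by simpa using mul_self_pos.2 h0))
    have e2 := hc'.eventually (lt_mem_nhds (a := 0) (by simpa using h2))
    filter_upwards [e1, e2] with d hd hd'
    rw [← sign_eq_of_mul_pos hd, ← sign_eq_of_mul_pos hd']

lemma Sat.germ (hX : Sat T X) {z z' : E3} (h : SignEq T z z') :
    ∀ᶠ d in 𝓝 (0 : E3), (z + d ∈ X ↔ z' + d ∈ X) :=
  h.germ.mono fun _ hd => hX.iff hd

lemma eventually_nhds_iff_add {p : E3 → Prop} (z : E3) :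
    (∀ᶠ y in 𝓝 z, p y) ↔ ∀ᶠ d in 𝓝 (0 : E3), p (z + d) := by
  have : 𝓝 z = Filter.map (fun d => z + d) (𝓝 0) := by
    rw [map_add_left_nhds, add_zero]
  rw [this, Filter.eventually_map]

lemma mem_halfspace {x n y : E3} : y ∈ halfspace x n ↔ inner ℝ n (y - x) ≤ 0 := Iff.rfl

lemma IsFacePoint.of_signEq (hX : Sat T X) {z z' ν : E3} (h : SignEq T z z')
    (hz : IsFacePoint X z ν) : IsFacePoint X z' ν := by
  refine ⟨hz.1, ?_⟩
  have h1 := hz.2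
  rw [eventually_nhds_iff_add] at h1 ⊢
  filter_upwards [h1, hX.germ h] with d hd hd'
  rw [← hd', hd]; simp [halfspace]

/-- Finitely many planes do not cover an open set. -/
lemma exists_avoid (S : Finset (E3 × ℝ)) (hS : ∀ p ∈ S, p.1 ≠ 0) {O : Set E3} (hO : IsOpen O)
    (hne : O.Nonempty) : ∃ z ∈ O, Generic S z := by
  have key : Dense (⋂ p ∈ S, {z | ev p z ≠ 0}) := by
    refine dense_biInter_of_isOpen (S := (S : Set (E3 × ℝ))) ?_ S.countable_toSet ?_
    · intro p _
      exact isOpen_ne_fun (continuous_ev p) continuous_const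
    · intro p hp
      have : {z | ev p z ≠ 0} = {z | ev p z = 0}ᶜ := rfl
      rw [this, ← interior_eq_empty_iff_dense_compl, Set.eq_empty_iff_forall_notMem]
      intro z hz
      rw [mem_interior_iff_mem_nhds, ← eventually_mem_set, eventually_nhds_iff_add] at hz
      have hz0 : ev p z = 0 := by simpa using hz.self_of_nhds
      have ht : Tendsto (fun s : ℝ => s • p.1) (𝓝 0) (𝓝 0) := by
        have : Continuous (fun s : ℝ => s • p.1) := by fun_prop
        simpa using this.tendsto 0
      have h1 := ht.eventually hz
      obtain ⟨s, hs, hs0⟩ := ((h1.filter_mono nhdsWithin_le_nhds).and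
        (self_mem_nhdsWithin (s := Ioi (0:ℝ)))).exists
      rw [mem_ofPred_eq, ev_add, hz0, zero_add, inner_smul_right, real_inner_self_eq_norm_sq] at hs
      have := norm_pos_iff.2 (hS p hp)
      have h3 : 0 < s * ‖p.1‖ ^ 2 := mul_pos hs0 (by positivity)
      linarith
  obtain ⟨z, hz, hz'⟩ := key.inter_open_nonempty O hO hne
  exact ⟨z, hz, by simpa [Generic] using hz'⟩

lemma Generic.signEq_of_mem_star {x z : E3} (hx : Generic T x) (hz : z ∈ star T x) :
    SignEq T x z := fun p hp => sign_eq_of_mul_pos (hz p hp (hx p hp))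

lemma exists_mem_frontier_of_convex {C : Set E3} (hC : Convex ℝ C) {a b : E3} (ha : a ∈ C)
    (haX : a ∈ X) (hb : b ∈ C) (hbX : b ∉ X) : ∃ y ∈ C, y ∈ frontier X := by
  by_contra! hnfr
  have hnf : ∀ y ∈ C, y ∈ X → y ∈ interior X := fun y hy hyX => by
    by_contra hi; exact hnfr y hy ⟨subset_closure hyX, hi⟩
  have hnf' : ∀ y ∈ C, y ∉ X → y ∈ interior Xᶜ := fun y hy hyX => by
    rw [interior_compl]; exact fun hi => hnfr y hy ⟨hi, fun hii => hyX (interior_subset hii)⟩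
  -- otherwise the interiors of `X` and of its complement would disconnect `C`
  obtain ⟨y, -, hy1, hy2⟩ : (C ∩ (interior X ∩ interior Xᶜ)).Nonempty := by
    refine hC.isPreconnected (interior X) (interior Xᶜ)
      isOpen_interior isOpen_interior (fun y hy => ?_)
      ⟨a, ha, hnf a ha haX⟩ ⟨b, hb, hnf' b hb hbX⟩
    by_cases hyX : y ∈ X
    · exact Or.inl (hnf y hy hyX)
    · exact Or.inr (hnf' y hy hyX)
  exact interior_subset hy2 (interior_subset hy1)

/-- If the boundary of a set lies in the planes of `T`, each open cell of `T` lies on one side. -/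
lemma mem_of_generic_signEq (hfr : ∀ y ∈ frontier X, ∃ p ∈ T, ev p y = 0) {x z : E3}
    (hx : Generic T x) (hxX : x ∈ X) (h : SignEq T x z) : z ∈ X := by
  by_contra hzX
  obtain ⟨y, hy, hyf⟩ := exists_mem_frontier_of_convex (convex_star T x) (self_mem_star T x) hxX
    (signEq_star_congr h x (self_mem_star T x)) hzX
  obtain ⟨p, hp, hpy⟩ := hfr y hyf
  have := hy p hp (hx p hp)
  rw [hpy] at this; simp at this

/-- A regular closed set whose boundary lies in the planes of `T` is determined by signs. -/
lemma sat_of_regular (hnz : ∀ p ∈ T, p.1 ≠ 0) (hreg : closure (interior X) = X)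
    (hfr : ∀ y ∈ frontier X, ∃ p ∈ T, ev p y = 0) : Sat T X := by
  intro z z' h hz
  have hz1 : z ∈ closure (interior X) := by rwa [hreg]
  obtain ⟨x0, hx0⟩ := mem_closure_iff.1 hz1 _ (isOpen_star T z) (self_mem_star T z)
  obtain ⟨x, ⟨hxs, hxi⟩, hxg⟩ := exists_avoid T hnz ((isOpen_star T z).inter isOpen_interior)
    ⟨x0, hx0⟩
  have hcl : IsClosed X := by rw [← hreg]; exact isClosed_closure
  have hmem : ∀ s : ℝ, 0 < s → s ≤ 1 → z' + s • (x - z') ∈ X := by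
    intro s hs hs1
    refine mem_of_generic_signEq hfr hxg (interior_subset hxi) fun p hp => ?_
    have hxz' : x ∈ star T z' := by
      intro q hq hq0
      have hqz : ev q z ≠ 0 := fun h0 => hq0 ((zero_iff_of_sign_eq (h q hq)).1 h0)
      have := sign_eq_of_mul_pos (hxs q hq hqz)
      exact mul_pos_of_sign_eq ((h q hq).symm.trans this) hq0
    exact signEq_of_mem_star hxz' hs hs1 p hp
  have hlim : Tendsto (fun s : ℝ => z' + s • (x - z')) (𝓝[>] 0) (𝓝 z') := by
    have : Continuous (fun s : ℝ => z' + s • (x - z')) := by fun_prop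
    simpa using (this.tendsto 0).mono_left nhdsWithin_le_nhds
  refine hcl.mem_of_tendsto hlim ?_
  filter_upwards [Ioc_mem_nhdsGT (zero_lt_one (α := ℝ))] with s hs using hmem s hs.1 hs.2

lemma Sat.frontier (hX : Sat T X) {y : E3} (hy : y ∈ frontier X) : ∃ p ∈ T, ev p y = 0 := by
  by_contra! hc
  have hnb := star_mem_nhds T y
  by_cases hyX : y ∈ X
  · have : y ∈ interior X := mem_interior_iff_mem_nhds.2 <| mem_of_superset hnb fun z hz =>
      hX y z (Generic.signEq_of_mem_star hc hz) hyX
    exact hy.2 this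
  · have : y ∈ interior Xᶜ := mem_interior_iff_mem_nhds.2 <| mem_of_superset hnb fun z hz hzX =>
      hyX (hX z y (Generic.signEq_of_mem_star hc hz).symm hzX)
    rw [interior_compl] at this
    exact this hy.1

/-- If all planes of `T` through `a` contain the direction `u`, then near `a` every set
determined by `T` is invariant under small translations along `u`. -/
lemma Sat.invariant (hX : Sat T X) {a u : E3}
    (hu : ∀ p ∈ T, ev p a = 0 → inner ℝ p.1 u = 0) :
    ∀ᶠ q : E3 × ℝ in 𝓝 (a, (0 : ℝ)), (q.1 + q.2 • u ∈ X ↔ q.1 ∈ X) := by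
  have h1 : ∀ᶠ q : E3 × ℝ in 𝓝 (a, (0 : ℝ)), q.1 ∈ star T a :=
    (continuous_fst.tendsto (a, (0:ℝ))).eventually (star_mem_nhds T a)
  have h2 : ∀ᶠ q : E3 × ℝ in 𝓝 (a, (0 : ℝ)), q.1 + q.2 • u ∈ star T a := by
    have hc : Continuous (fun q : E3 × ℝ => q.1 + q.2 • u) := by fun_prop
    have := hc.tendsto (a, (0:ℝ))
    simp only [zero_smul, add_zero] at this
    exact this.eventually (star_mem_nhds T a)
  filter_upwards [h1, h2] with q hq1 hq2
  refine hX.iff fun p hp => ?_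
  by_cases h0 : ev p a = 0
  · rw [ev_add, inner_smul_right, hu p hp h0, mul_zero, add_zero]
  · rw [← sign_eq_of_mul_pos (hq1 p hp h0), ← sign_eq_of_mul_pos (hq2 p hp h0)]

end

section

/-! ### Face points -/

variable {T : Finset (E3 × ℝ)} {X : Set E3}

lemma tendsto_add_smul (x d : E3) : Tendsto (fun s : ℝ => x + s • d) (𝓝 0) (𝓝 x) := by
  have : Continuous (fun s : ℝ => x + s • d) := by fun_prop
  simpa using this.tendsto 0

/-- An eventual property near `x` holds at some point `x + s • d` with `s > 0`. -/
lemma exists_pos_of_eventually {x : E3} (d : E3) {p : E3 → Prop} (h : ∀ᶠ y in 𝓝 x, p y) :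
    ∃ s : ℝ, 0 < s ∧ s < 1 ∧ p (x + s • d) := by
  obtain ⟨s, hs, hs0⟩ := ((((tendsto_add_smul x d).eventually h).filter_mono
    nhdsWithin_le_nhds).and (Ioo_mem_nhdsGT (zero_lt_one (α := ℝ)))).exists
  exact ⟨s, hs0.1, hs0.2, hs⟩

/-- A half-space through `x` contained, near `x`, in another one has the same normal. -/
lemma unit_eq_of_halfspace_subset {x ν ν' : E3} (h1 : ‖ν‖ = 1) (h2 : ‖ν'‖ = 1)
    (h : ∀ᶠ y in 𝓝 x, inner ℝ ν (y - x) ≤ 0 → inner ℝ ν' (y - x) ≤ 0) : ν = ν' := by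
  have key : ∀ d : E3, inner ℝ ν d ≤ 0 → inner ℝ ν' d ≤ 0 := by
    intro d hd
    obtain ⟨s, hs, -, hs'⟩ := exists_pos_of_eventually d h
    simp only [add_sub_cancel_left, inner_smul_right] at hs'
    have := hs' (mul_nonpos_of_nonneg_of_nonpos hs.le hd)
    by_contra hc
    exact absurd this (not_le.2 (mul_pos hs (not_le.1 hc)))
  have e1 : inner ℝ ν ν = (1:ℝ) := by rw [real_inner_self_eq_norm_sq, h1]; norm_num
  have e2 : inner ℝ ν' ν' = (1:ℝ) := by rw [real_inner_self_eq_norm_sq, h2]; norm_num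
  have k1 := key (ν' - (inner ℝ ν ν' : ℝ) • ν) (by
    rw [inner_sub_right, inner_smul_right, e1]; simp)
  have k2 := key (-ν) (by rw [inner_neg_right, e1]; norm_num)
  rw [inner_sub_right, inner_smul_right, e2, real_inner_comm ν ν'] at k1
  rw [inner_neg_right, real_inner_comm] at k2
  have hle : inner ℝ ν ν' ≤ (1:ℝ) := by
    have := real_inner_le_norm ν ν'; rwa [h1, h2, one_mul] at this
  rw [← inner_eq_one_iff_of_norm_eq_one (𝕜 := ℝ) h1 h2]
  nlinarith

lemma IsFacePoint.mem {x ν : E3} (h : IsFacePoint X x ν) : x ∈ X :=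
  h.2.self_of_nhds.2 (by simp [halfspace])

lemma IsFacePoint.unique {x ν ν' : E3} (h : IsFacePoint X x ν) (h' : IsFacePoint X x ν') :
    ν = ν' := by
  refine unit_eq_of_halfspace_subset (x := x) h.1 h'.1 ?_
  filter_upwards [h.2, h'.2] with y hy hy' hh
  exact hy'.1 (hy.2 hh)

lemma IsFacePoint.congr {Y : Set E3} {x ν : E3} (hXY : ∀ᶠ y in 𝓝 x, (y ∈ X ↔ y ∈ Y))
    (h : IsFacePoint X x ν) : IsFacePoint Y x ν :=
  ⟨h.1, by filter_upwards [hXY, h.2] with y hy hy'; rw [← hy, hy']⟩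

lemma IsFacePoint.nearby {x ν : E3} (h : IsFacePoint X x ν) :
    ∀ᶠ y in 𝓝 x, inner ℝ ν (y - x) = 0 → IsFacePoint X y ν := by
  filter_upwards [eventually_eventually_nhds.2 h.2] with y hy h0
  refine ⟨h.1, ?_⟩
  filter_upwards [hy] with z hz
  rw [hz, mem_halfspace, mem_halfspace]
  have : z - x = (z - y) + (y - x) := by abel
  rw [this, inner_add_right, h0, add_zero]

lemma IsFacePoint.not_interior {x ν : E3} (h : IsFacePoint X x ν) : x ∉ interior X := by
  intro hi
  obtain ⟨s, hs, -, h1, h2⟩ := exists_pos_of_eventually ν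
    ((eventually_mem_set.2 (mem_interior_iff_mem_nhds.1 hi)).and h.2)
  have := h2.1 h1
  rw [mem_halfspace, add_sub_cancel_left, inner_smul_right, real_inner_self_eq_norm_sq, h.1] at this
  linarith

lemma IsFacePoint.frontier {x ν : E3} (h : IsFacePoint X x ν) : x ∈ frontier X :=
  ⟨subset_closure h.mem, h.not_interior⟩

lemma IsFacePoint.frontier_plane {x ν : E3} (h : IsFacePoint X x ν) :
    ∀ᶠ y in 𝓝 x, y ∈ _root_.frontier X → inner ℝ ν (y - x) = 0 := by
  filter_upwards [eventually_eventually_nhds.2 h.2] with y hy hf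
  have hc : Continuous (fun z : E3 => (inner ℝ ν (z - x) : ℝ)) := by fun_prop
  rcases lt_trichotomy (inner ℝ ν (y - x) : ℝ) 0 with h0 | h0 | h0
  · refine absurd (mem_interior_iff_mem_nhds.2 ?_) hf.2
    filter_upwards [hy, (hc.tendsto y).eventually (gt_mem_nhds h0)] with z hz hz'
    exact hz.2 (le_of_lt hz')
  · exact h0
  · refine absurd hf.1 ?_
    rw [← mem_compl_iff, ← interior_compl, mem_interior_iff_mem_nhds]
    filter_upwards [hy, (hc.tendsto y).eventually (lt_mem_nhds h0)] with z hz hz' hzX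
    exact absurd (hz.1 hzX) (not_le.2 hz')

/-- The plane of a face of a set determined by `T` belongs to `T`. -/
lemma IsFacePoint.exists_plane (hnz : ∀ p ∈ T, p.1 ≠ 0) (hX : Sat T X) {x ν : E3}
    (h : IsFacePoint X x ν) : ∃ p ∈ T, ∃ c : ℝ, c ≠ 0 ∧ p.1 = c • ν ∧ ev p x = 0 := by
  classical
  by_contra! hcon
  have hproj : ∀ p ∈ T, ev p x = 0 → p.1 - (inner ℝ ν p.1 : ℝ) • ν ≠ 0 := by
    intro p hp hpx h0
    have h1 := sub_eq_zero.1 h0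
    refine hcon p hp (inner ℝ ν p.1) (fun h2 => hnz p hp ?_) h1 hpx
    rw [h1, h2, zero_smul]
  obtain ⟨z, -, hz⟩ := exists_avoid
    ((T.filter fun p => ev p x = 0).image fun p => (p.1 - (inner ℝ ν p.1 : ℝ) • ν, (0:ℝ)))
    (by
      intro q hq
      simp only [Finset.mem_image, Finset.mem_filter] at hq
      obtain ⟨p, ⟨hp, hpx⟩, rfl⟩ := hq
      exact hproj p hp hpx) isOpen_univ ⟨(0 : E3), mem_univ _⟩
  have e1 : inner ℝ ν ν = (1:ℝ) := by rw [real_inner_self_eq_norm_sq, h.1]; norm_num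
  obtain ⟨s, hs, -, h1, h2⟩ := exists_pos_of_eventually (z - (inner ℝ ν z : ℝ) • ν)
    (h.nearby.and (star_mem_nhds T x))
  have h3 := h1 (by
    rw [add_sub_cancel_left, inner_smul_right, inner_sub_right, inner_smul_right, e1]; ring)
  obtain ⟨p, hp, hp0⟩ := hX.frontier h3.frontier
  by_cases hpx : ev p x = 0
  · have h4 := hz (p.1 - (inner ℝ ν p.1 : ℝ) • ν, (0:ℝ))
      (Finset.mem_image_of_mem (fun p : E3 × ℝ => (p.1 - (inner ℝ ν p.1 : ℝ) • ν, (0:ℝ)))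
        (Finset.mem_filter.2 ⟨hp, hpx⟩))
    rw [ev_add, hpx, zero_add, inner_smul_right, mul_eq_zero] at hp0
    rcases hp0 with hp0 | hp0
    · exact hs.ne' hp0
    · apply h4
      simp only [ev, inner_sub_left, inner_sub_right, inner_smul_left, inner_smul_right] at hp0 ⊢
      simp only [conj_trivial]
      rw [real_inner_comm ν p.1] at hp0
      linarith
  · have := h2 p hp hpx
    rw [hp0] at this; simp at this

/-- A boundary point of a regular closed set that lies on a single plane of `T` is a face point. -/
lemma exists_isFacePoint_of_parallel (hX : Sat T X)
    (hreg : closure (interior X) = X) {x ν : E3}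
    (hν : ‖ν‖ = 1) (hx : x ∈ frontier X)
    (hpar : ∀ p ∈ T, ev p x = 0 → ∃ c : ℝ, p.1 = c • ν) :
    IsFacePoint X x ν ∨ IsFacePoint X x (-ν) := by
  have hcl : IsClosed X := by rw [← hreg]; exact isClosed_closure
  have hsig : ∀ z ∈ star T x, ∀ z' ∈ star T x,
      SignType.sign (inner ℝ ν (z - x) : ℝ) = SignType.sign (inner ℝ ν (z' - x) : ℝ) →
      SignEq T z z' := by
    intro z hz z' hz' hs p hp
    by_cases h0 : ev p x = 0
    · obtain ⟨c, hc⟩ := hpar p hp h0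
      have e : ∀ y, ev p y = c * inner ℝ ν (y - x) := fun y => by
        have := ev_sub p y x
        rw [h0, sub_zero, hc, inner_smul_left] at this
        simpa using this
      rw [e z, e z', sign_mul, sign_mul, hs]
    · rw [← sign_eq_of_mul_pos (hz p hp h0), ← sign_eq_of_mul_pos (hz' p hp h0)]
  have hst := star_mem_nhds T x
  have e1 : inner ℝ ν ν = (1:ℝ) := by rw [real_inner_self_eq_norm_sq, hν]; norm_num
  -- reference points strictly on either side
  obtain ⟨s, hs, -, hsx⟩ := exists_pos_of_eventually ν hst
  obtain ⟨r, hr, -, hrx⟩ := exists_pos_of_eventually (-ν) hst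
  have vs : inner ℝ ν (x + s • ν - x) = s := by
    rw [add_sub_cancel_left, inner_smul_right, e1, mul_one]
  have vr : inner ℝ ν (x + r • -ν - x) = -r := by
    rw [add_sub_cancel_left, inner_smul_right, inner_neg_right, e1]; ring
  have hpos : ∀ z ∈ star T x, 0 < (inner ℝ ν (z - x) : ℝ) → (z ∈ X ↔ x + s • ν ∈ X) :=
    fun z hz h => hX.iff (hsig z hz _ hsx (by rw [vs, sign_pos h, sign_pos hs]))
  have hneg : ∀ z ∈ star T x, (inner ℝ ν (z - x) : ℝ) < 0 → (z ∈ X ↔ x + r • -ν ∈ X) :=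
    fun z hz h => hX.iff (hsig z hz _ hrx (by
      rw [vr, sign_neg h, sign_neg (neg_lt_zero.2 hr)]))
  -- points of the plane are limits from both sides
  have hlim : ∀ (d : E3), (∀ z ∈ star T x, (inner ℝ ν (z - x) : ℝ) = 0 →
      (∀ t : ℝ, 0 < t → z + t • d ∈ star T x → z + t • d ∈ X) → z ∈ X) := by
    intro d z hz h0 h
    refine hcl.mem_of_tendsto ((tendsto_add_smul z d).mono_left (nhdsWithin_le_nhds (s := Ioi 0))) ?_
    filter_upwards [((tendsto_add_smul z d).eventually ((isOpen_star T x).mem_nhds hz)).filter_mono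
      nhdsWithin_le_nhds, self_mem_nhdsWithin] with t ht ht0 using h t ht0 ht
  have vd : ∀ (z : E3) (t : ℝ), inner ℝ ν (z + t • ν - x) = inner ℝ ν (z - x) + t := fun z t => by
    rw [add_sub_right_comm, inner_add_right, inner_smul_right, e1, mul_one]
  have vd' : ∀ (z : E3) (t : ℝ), inner ℝ ν (z + t • -ν - x) = inner ℝ ν (z - x) - t := fun z t => by
    rw [add_sub_right_comm, inner_add_right, inner_smul_right, inner_neg_right, e1]; ring
  by_cases hP : x + s • ν ∈ X <;> by_cases hN : x + r • -ν ∈ X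
  · refine absurd (mem_interior_iff_mem_nhds.2 (mem_of_superset hst fun z hz => ?_)) hx.2
    rcases lt_trichotomy (inner ℝ ν (z - x) : ℝ) 0 with h0 | h0 | h0
    · exact (hneg z hz h0).2 hN
    · refine hlim ν z hz h0 fun t ht hts => (hpos _ hts ?_).2 hP
      rw [vd, h0, zero_add]; exact ht
    · exact (hpos z hz h0).2 hP
  · right
    refine ⟨by rw [norm_neg, hν], ?_⟩
    filter_upwards [hst] with z hz
    rw [mem_halfspace, inner_neg_left, neg_nonpos]
    rcases lt_trichotomy (inner ℝ ν (z - x) : ℝ) 0 with h0 | h0 | h0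
    · rw [hneg z hz h0]; exact iff_of_false hN (not_le.2 h0)
    · refine iff_of_true (hlim ν z hz h0 fun t ht hts => (hpos _ hts ?_).2 hP) h0.ge
      rw [vd, h0, zero_add]; exact ht
    · rw [hpos z hz h0]; exact iff_of_true hP h0.le
  · left
    refine ⟨hν, ?_⟩
    filter_upwards [hst] with z hz
    rw [mem_halfspace]
    rcases lt_trichotomy (inner ℝ ν (z - x) : ℝ) 0 with h0 | h0 | h0
    · rw [hneg z hz h0]; exact iff_of_true hN h0.le
    · refine iff_of_true (hlim (-ν) z hz h0 fun t ht hts => (hneg _ hts ?_).2 hN) h0.le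
      rw [vd', h0, zero_sub]; exact neg_lt_zero.2 ht
    · rw [hpos z hz h0]; exact iff_of_false hP (not_le.2 h0)
  · exfalso
    have hxX : x ∈ closure (interior X) := by rw [hreg, ← hcl.closure_eq]; exact hx.1
    obtain ⟨y, hy, hyi⟩ := mem_closure_iff.1 hxX _ (isOpen_star T x) (self_mem_star T x)
    have hplane : ∀ z ∈ star T x, z ∈ X → inner ℝ ν (z - x) = 0 := by
      intro z hz hzX
      rcases lt_trichotomy (inner ℝ ν (z - x) : ℝ) 0 with h0 | h0 | h0
      · exact absurd ((hneg z hz h0).1 hzX) hN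
      · exact h0
      · exact absurd ((hpos z hz h0).1 hzX) hP
    obtain ⟨t, ht, -, h1, h2⟩ := exists_pos_of_eventually ν
      ((eventually_mem_set.2 ((isOpen_star T x).mem_nhds hy)).and
        (eventually_mem_set.2 (mem_interior_iff_mem_nhds.1 hyi)))
    have := hplane _ h1 h2
    rw [vd, hplane y hy (interior_subset hyi), zero_add] at this
    exact ht.ne' this

end

section

/-! ### The local structure of a polyhedron along a face -/

/-- The data extracted from a polyhedron `P` with a face `F` in the plane through `A` with outward
normal `n`: the boundary of `P` lies in the planes of the arrangement `T`, which contains the plane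
of `F`, and `P` is locally convex along `F` away from the edge `AB`. -/
structure FaceData (P F : Set E3) (A B n : E3) (T : Finset (E3 × ℝ)) : Prop where
  nz : ∀ p ∈ T, p.1 ≠ 0
  sat : Sat T P
  compact : IsCompact P
  regular : closure (interior P) = P
  base : (n, inner ℝ n A) ∈ T
  norm_n : ‖n‖ = 1
  bdd : ∃ R : ℝ, ∀ y ∈ P, ∀ z ∈ star T y, ‖z‖ ≤ R
  closed_F : IsClosed F
  sub_P : F ⊆ P
  sub_plane : ∀ z ∈ F, inner ℝ n (z - A) = 0
  dense : F ⊆ closure {x | x ∈ F ∧ IsFacePoint P x n}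
  normal : ∀ x ∈ F, ∀ ν, IsFacePoint P x ν → ν = n
  propagate : ∀ x ∈ F, ∀ z, (∀ s ∈ Ico (0 : ℝ) 1, IsFacePoint P (x + s • (z - x)) n) → z ∈ F
  ne : A ≠ B
  seg_sub : segment ℝ A B ⊆ F
  edge : openSegment ℝ A B ⊆ edgePoints P
  vertex_left : A ∈ vertices P
  vertex_right : B ∈ vertices P
  convex : ∀ y ∈ F \ segment ℝ A B, ∃ U ∈ 𝓝 y, Convex ℝ (P ∩ U)

/-- The outward normals of the faces of `P` other than `F` that meet the star of `y`. -/
def normals (P F : Set E3) (T : Finset (E3 × ℝ)) (y : E3) : Set E3 :=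
  {ν | ∃ x ∈ star T y, x ∉ F ∧ IsFacePoint P x ν}

/-- The cone with apex `y` bounded by the faces of `P` other than `F`. -/
def cone (P F : Set E3) (T : Finset (E3 × ℝ)) (y : E3) : Set E3 :=
  {z | ∀ ν ∈ normals P F T y, inner ℝ ν (z - y) ≤ 0}

section
variable {X W : Set E3}

lemma combo_mem {C : Set E3} (hC : Convex ℝ C) {x z : E3} (hx : x ∈ C) (hz : z ∈ C) {s : ℝ}
    (h0 : 0 ≤ s) (h1 : s ≤ 1) : x + s • (z - x) ∈ C := by
  have := hC hx hz (sub_nonneg.2 h1) h0 (by ring)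
  convert this using 1
  module

lemma IsFacePoint.inner_nonpos (hc : Convex ℝ (X ∩ W)) {x ν z : E3} (hW : W ∈ 𝓝 x)
    (hx : IsFacePoint X x ν) (hz : z ∈ X ∩ W) : inner ℝ ν (z - x) ≤ 0 := by
  obtain ⟨s, hs, hs1, h⟩ := exists_pos_of_eventually (z - x) hx.2
  have h2 := h.1 (combo_mem hc ⟨hx.mem, mem_of_mem_nhds hW⟩ hz hs.le hs1.le).1
  rw [mem_halfspace, add_sub_cancel_left, inner_smul_right] at h2
  by_contra hcon
  exact absurd h2 (not_le.2 (mul_pos hs (not_le.1 hcon)))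

/-- At a second face point the inequality of the first face is strict. -/
lemma IsFacePoint.inner_neg (hc : Convex ℝ (X ∩ W)) {x x' ν ν' : E3} (hW : W ∈ 𝓝 x)
    (hW' : W ∈ 𝓝 x') (hx : IsFacePoint X x ν) (hx' : IsFacePoint X x' ν') (hne : ν ≠ ν') :
    inner ℝ ν (x' - x) < 0 := by
  refine lt_of_le_of_ne (hx.inner_nonpos hc hW ⟨hx'.mem, mem_of_mem_nhds hW'⟩) fun h0 => hne ?_
  refine (unit_eq_of_halfspace_subset (x := x') hx'.1 hx.1 ?_).symm
  filter_upwards [hx'.2, hW'] with y hy hyW hy0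
  have := hx.inner_nonpos hc hW ⟨hy.2 hy0, hyW⟩
  have e : y - x = (y - x') + (x' - x) := by abel
  rw [e, inner_add_right, h0, add_zero] at this
  exact this

lemma IsFacePoint.inner_neg_of_interior (hc : Convex ℝ (X ∩ W)) {x ν z : E3} (hW : W ∈ 𝓝 x)
    (hx : IsFacePoint X x ν) (hz : z ∈ interior X) (hzW : W ∈ 𝓝 z) :
    inner ℝ ν (z - x) < 0 := by
  obtain ⟨s, hs, -, h1, h2⟩ := exists_pos_of_eventually ν
    ((eventually_mem_set.2 (mem_interior_iff_mem_nhds.1 hz)).and (eventually_mem_set.2 hzW))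
  have := hx.inner_nonpos hc hW ⟨h1, h2⟩
  rw [add_sub_right_comm, inner_add_right, inner_smul_right, real_inner_self_eq_norm_sq, hx.1] at this
  linarith

/-- In a convex piece the face through `x` contains the half-open segment from `x` to any point
of the same plane. -/
lemma IsFacePoint.segment (hc : Convex ℝ (X ∩ W)) (hWo : IsOpen W) {x ν z : E3} (hxW : x ∈ W)
    (hx : IsFacePoint X x ν) (hz : z ∈ X ∩ W) (h0 : inner ℝ ν (z - x) = 0) {s : ℝ}
    (hs : 0 ≤ s) (hs1 : s < 1) : IsFacePoint X (x + s • (z - x)) ν := by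
  have hm := combo_mem hc ⟨hx.mem, hxW⟩ hz hs hs1.le
  set m := x + s • (z - x) with hmdef
  have hm0 : inner ℝ ν (m - x) = 0 := by
    rw [hmdef, add_sub_cancel_left, inner_smul_right, h0, mul_zero]
  refine ⟨hx.1, ?_⟩
  have h1s : (1 - s) ≠ 0 := by linarith
  have hcont : Tendsto (fun y => x + (1 - s)⁻¹ • (y - m)) (𝓝 m) (𝓝 x) := by
    have : Continuous (fun y => x + (1 - s)⁻¹ • (y - m)) := by fun_prop
    simpa using this.tendsto m
  filter_upwards [hWo.mem_nhds hm.2, hcont.eventually hx.2,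
    hcont.eventually (hWo.mem_nhds hxW)] with y hyW hy1 hy2
  constructor
  · intro hyX
    have := hx.inner_nonpos hc (hWo.mem_nhds hxW) ⟨hyX, hyW⟩
    rw [mem_halfspace]
    have e : y - m = (y - x) - (m - x) := by abel
    rwa [e, inner_sub_right, hm0, sub_zero]
  · intro hy
    have h3 : x + (1 - s)⁻¹ • (y - m) ∈ X := by
      rw [hy1, mem_halfspace, add_sub_cancel_left, inner_smul_right]
      exact mul_nonpos_of_nonneg_of_nonpos (inv_nonneg.2 (by linarith)) hy
    have h4 := (combo_mem hc ⟨h3, hy2⟩ hz hs hs1.le).1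
    convert h4 using 1
    have : x + (1 - s)⁻¹ • (y - m) + s • (z - (x + (1 - s)⁻¹ • (y - m)))
        = (x + s • (z - x)) + ((1 - s) * (1 - s)⁻¹) • (y - m) := by module
    rw [this, mul_inv_cancel₀ h1s, one_smul, ← hmdef]; abel

end

section
variable {P F : Set E3} {A B n : E3} {T : Finset (E3 × ℝ)} (D : FaceData P F A B n T)
include D

lemma FaceData.isClosed : IsClosed P := D.compact.isClosed

lemma FaceData.inner_n_sub {y z : E3} (hy : y ∈ F) :
    inner ℝ n (z - y) = (inner ℝ n (z - A) : ℝ) := by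
  have e : z - A = (z - y) + (y - A) := by abel
  rw [e, inner_add_right, D.sub_plane y hy, add_zero]

lemma FaceData.convex_star {y : E3} (hy : y ∈ F \ segment ℝ A B) : Convex ℝ (P ∩ star T y) := by
  obtain ⟨U, hU, hc⟩ := D.convex y hy
  intro z hz z' hz' a b ha hb hab
  have hst := Melzak.convex_star T y hz.2 hz'.2 ha hb hab
  refine ⟨?_, hst⟩
  have h1 := ((tendsto_add_smul y (z - y)).eventually hU).and
    ((tendsto_add_smul y (z' - y)).eventually hU)
  obtain ⟨s, ⟨hs1, hs2⟩, hs⟩ := ((h1.filter_mono nhdsWithin_le_nhds).and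
    (Ioo_mem_nhdsGT (zero_lt_one (α := ℝ)))).exists
  have k1 := (D.sat.iff (signEq_of_mem_star hz.2 hs.1 hs.2.le)).1 hz.1
  have k2 := (D.sat.iff (signEq_of_mem_star hz'.2 hs.1 hs.2.le)).1 hz'.1
  have k3 := (hc ⟨k1, hs1⟩ ⟨k2, hs2⟩ ha hb hab).1
  rw [D.sat.iff (signEq_of_mem_star hst hs.1 hs.2.le)]
  convert k3 using 1
  have hb' : b = 1 - a := by linarith
  subst hb'
  module

lemma FaceData.normals_plane {y ν : E3} (hν : ν ∈ normals P F T y) :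
    ‖ν‖ = 1 ∧ ∃ p ∈ T, ∃ c : ℝ, c ≠ 0 ∧ p.1 = c • ν ∧ ev p y = 0 ∧
      ∀ z, ev p z = c * inner ℝ ν (z - y) := by
  obtain ⟨x, hx, -, hf⟩ := hν
  obtain ⟨p, hp, c, hc, hpc, hpx⟩ := hf.exists_plane D.nz D.sat
  have hpy : ev p y = 0 := by
    by_contra h
    have := hx p hp h
    rw [hpx] at this; simp at this
  refine ⟨hf.1, p, hp, c, hc, hpc, hpy, fun z => ?_⟩
  have := ev_sub p z y
  rw [hpy, sub_zero, hpc, inner_smul_left] at this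
  simpa using this

lemma FaceData.inner_eq_of_face {y x ν : E3} (hx : x ∈ star T y) (hf : IsFacePoint P x ν)
    (z : E3) : inner ℝ ν (z - x) = (inner ℝ ν (z - y) : ℝ) := by
  obtain ⟨p, hp, c, hc, hpc, hpx⟩ := hf.exists_plane D.nz D.sat
  have hpy : ev p y = 0 := by
    by_contra h
    have := hx p hp h
    rw [hpx] at this; simp at this
  have h1 := ev_sub p x y
  rw [hpy, hpx, hpc, inner_smul_left] at h1
  have h2 : (inner ℝ ν (x - y) : ℝ) = 0 := by
    simpa [hc, eq_comm] using h1
  have e : z - y = (z - x) + (x - y) := by abel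
  rw [e, inner_add_right, h2, add_zero]

lemma FaceData.finite_normals (y : E3) : (normals P F T y).Finite := by
  refine ((T.finite_toSet.image fun p => (‖p.1‖)⁻¹ • p.1).union
    (T.finite_toSet.image fun p => -(‖p.1‖)⁻¹ • p.1)).subset fun ν hν => ?_
  obtain ⟨h1, p, hp, c, hc, hpc, -⟩ := D.normals_plane hν
  have hn : ‖p.1‖ = |c| := by rw [hpc, norm_smul, h1, mul_one, Real.norm_eq_abs]
  rcases lt_or_gt_of_ne hc with h | h
  · right
    refine ⟨p, hp, ?_⟩
    change -(‖p.1‖)⁻¹ • p.1 = ν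
    rw [hn, abs_of_neg h, hpc, smul_smul, show -(-c)⁻¹ * c = 1 by field_simp, one_smul]
  · left
    refine ⟨p, hp, ?_⟩
    change (‖p.1‖)⁻¹ • p.1 = ν
    rw [hn, abs_of_pos h, hpc, smul_smul, inv_mul_cancel₀ hc, one_smul]

lemma FaceData.mem_otherHalfspaces {y z : E3} :
    z ∈ otherHalfspaces P F (star T y) ↔ z ∈ cone P F T y := by
  constructor
  · rintro h ν ⟨x, hx, hxF, hf⟩
    rw [← D.inner_eq_of_face hx hf]
    exact h x ν hx hxF hf
  · intro h x ν hx hxF hf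
    rw [mem_halfspace, D.inner_eq_of_face hx hf]
    exact h ν ⟨x, hx, hxF, hf⟩

lemma FaceData.subset_cone {y z : E3} (hy : y ∈ F \ segment ℝ A B) (hz : z ∈ star T y)
    (hzP : z ∈ P) : z ∈ cone P F T y := by
  rintro ν ⟨x, hx, -, hf⟩
  rw [← D.inner_eq_of_face hx hf]
  exact hf.inner_nonpos (D.convex_star hy) ((isOpen_star T y).mem_nhds hx) ⟨hzP, hz⟩

lemma FaceData.exists_facePoint {y : E3} (hy : y ∈ F) {O : Set E3} (hO : O ∈ 𝓝 y) :
    ∃ x ∈ O, x ∈ F ∧ IsFacePoint P x n := by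
  obtain ⟨x, hx, hx'⟩ := mem_closure_iff_nhds.1 (D.dense hy) O hO
  exact ⟨x, hx, hx'⟩

lemma FaceData.inner_nonpos {y z : E3} (hy : y ∈ F \ segment ℝ A B) (hz : z ∈ star T y)
    (hzP : z ∈ P) : inner ℝ n (z - A) ≤ 0 := by
  obtain ⟨x, hx, hxF, hf⟩ := D.exists_facePoint hy.1 (star_mem_nhds T y)
  rw [← D.inner_n_sub hxF]
  exact hf.inner_nonpos (D.convex_star hy) ((isOpen_star T y).mem_nhds hx) ⟨hzP, hz⟩

/-- In the star of a point of `F` the polyhedron is the intersection of its half-spaces.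
A point outside `P` is joined to an interior point by a segment that meets the boundary at a point
of a single plane of `T`, hence at a face point, whose half-space it violates. -/
lemma FaceData.mem_iff {y z : E3} (hy : y ∈ F \ segment ℝ A B) (hz : z ∈ star T y) :
    z ∈ P ↔ inner ℝ n (z - A) ≤ 0 ∧ z ∈ cone P F T y := by
  classical
  refine ⟨fun h => ⟨D.inner_nonpos hy hz h, D.subset_cone hy hz h⟩, fun ⟨h1, h2⟩ => ?_⟩
  by_contra hzP
  have hyP : y ∈ closure (interior P) := by rw [D.regular]; exact D.sub_P hy.1
  obtain ⟨z1, hz1, hz1i⟩ := mem_closure_iff.1 hyP _ (isOpen_star T y) (self_mem_star T y)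
  -- a small homothetic copy of an open subset of `P`, centred at `z`, lies outside `P`
  obtain ⟨r, hr, hr1, hrP, hrs⟩ := exists_pos_of_eventually (z1 - z)
    ((eventually_mem_set.2 (D.isClosed.isOpen_compl.mem_nhds hzP)).and
      (eventually_mem_set.2 ((isOpen_star T y).mem_nhds hz)))
  have hcont : Continuous (fun v : E3 => z + r⁻¹ • (v - z)) := by fun_prop
  obtain ⟨z2, ⟨⟨hz2P, hz2s⟩, hz2i, hz2st⟩, hz2g⟩ := exists_avoid T D.nz
    ((D.isClosed.isOpen_compl.inter (isOpen_star T y)).inter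
      ((isOpen_interior.inter (isOpen_star T y)).preimage hcont))
    (show (((Pᶜ ∩ star T y) ∩ (fun v : E3 => z + r⁻¹ • (v - z)) ⁻¹' (interior P ∩ star T y))).Nonempty
      from ⟨z + r • (z1 - z), ⟨hrP, hrs⟩, by
      simp only [mem_preimage, add_sub_cancel_left, smul_smul, inv_mul_cancel₀ hr.ne', one_smul]
      rw [add_sub_cancel]; exact ⟨hz1i, hz1⟩⟩)
  set v := z + r⁻¹ • (z2 - z) with hv
  have hz2e : z2 = z + r • (v - z) := by
    rw [hv, add_sub_cancel_left, smul_smul, mul_inv_cancel₀ hr.ne', one_smul, add_sub_cancel]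
  have hvP := interior_subset hz2i
  have hz2n : inner ℝ n (z2 - A) ≤ 0 := by
    have := D.inner_nonpos hy hz2st hvP
    have e : z2 - A = (1 - r) • (z - A) + r • (v - A) := by rw [hz2e]; module
    rw [e, inner_add_right, inner_smul_right, inner_smul_right]
    nlinarith
  have hz2c : ∀ ν ∈ normals P F T y, inner ℝ ν (z2 - y) ≤ 0 := by
    intro ν hν
    have k1 := D.subset_cone hy hz2st hvP ν hν
    have k2 := h2 ν hν
    have e : z2 - y = (1 - r) • (z - y) + r • (v - y) := by rw [hz2e]; module
    rw [e, inner_add_right, inner_smul_right, inner_smul_right]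
    nlinarith
  -- an interior point `z0` such that the segment to `z2` meets no two transversal planes at once
  let vv : (E3 × ℝ) × (E3 × ℝ) → E3 × ℝ := fun q =>
    (ev q.2 z2 • q.1.1 - ev q.1 z2 • q.2.1, ev q.2 z2 * q.1.2 - ev q.1 z2 * q.2.2)
  obtain ⟨z0, ⟨hz0i, hz0s⟩, hz0g⟩ := exists_avoid
    (((T ×ˢ T).image vv).filter fun q => q.1 ≠ 0)
    (fun p hp => (Finset.mem_filter.1 hp).2)
    (isOpen_interior.inter (isOpen_star T y)) ⟨z1, hz1i, hz1⟩
  obtain ⟨x, hxs, hxf⟩ := exists_mem_frontier_of_convex (convex_segment (𝕜 := ℝ) z2 z0)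
    (right_mem_segment ℝ z2 z0) (interior_subset hz0i) (left_mem_segment ℝ z2 z0) hz2P
  have hxst : x ∈ star T y := (Melzak.convex_star T y).segment_subset hz2s hz0s hxs
  obtain ⟨a, b, ha, hb, hab, rfl⟩ := hxs
  obtain ⟨p, hp, hpx⟩ := D.sat.frontier hxf
  have hevx : ∀ q, ev q (a • z2 + b • z0) = a * ev q z2 + b * ev q z0 := fun q =>
    ev_combo q z2 z0 hab
  have hpar : ∀ q ∈ T, ev q (a • z2 + b • z0) = 0 → ∃ c : ℝ, q.1 = c • p.1 := by
    intro q hq hqx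
    by_cases hvz : (vv (p, q)).1 = 0
    · refine ⟨(ev p z2)⁻¹ * ev q z2, ?_⟩
      have := sub_eq_zero.1 hvz
      rw [mul_smul, this, smul_smul, inv_mul_cancel₀ (hz2g p hp), one_smul]
    · exfalso
      have h3 := hz0g (vv (p, q)) (Finset.mem_filter.2 ⟨Finset.mem_image_of_mem _
        (Finset.mem_product.2 ⟨hp, hq⟩), hvz⟩)
      have h4 : ev (vv (p, q)) z0 = ev q z2 * ev p z0 - ev p z2 * ev q z0 := by
        simp only [vv, ev, inner_sub_left, inner_smul_left, conj_trivial]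
        ring
      rw [hevx] at hpx hqx
      have hb0 : b ≠ 0 := by
        rintro rfl
        have : a = 1 := by linarith
        rw [this] at hpx
        exact hz2g p hp (by linarith)
      apply h3
      rw [h4]
      have : b * (ev q z2 * ev p z0 - ev p z2 * ev q z0) = 0 := by
        linear_combination ev q z2 * hpx - ev p z2 * hqx
      exact (mul_eq_zero.1 this).resolve_left hb0
  have hpn : ‖p.1‖ ≠ 0 := norm_ne_zero_iff.2 (D.nz p hp)
  obtain ⟨ν, hν⟩ : ∃ ν, IsFacePoint P (a • z2 + b • z0) ν := by
    rcases exists_isFacePoint_of_parallel D.sat D.regular (ν := (‖p.1‖)⁻¹ • p.1)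
      (by rw [norm_smul, norm_inv, norm_norm, inv_mul_cancel₀ hpn]) hxf (by
        intro q hq hqx
        obtain ⟨c, hc⟩ := hpar q hq hqx
        exact ⟨c * ‖p.1‖, by rw [hc, smul_smul, mul_assoc, mul_inv_cancel₀ hpn, mul_one]⟩) with h | h
    · exact ⟨_, h⟩
    · exact ⟨_, h⟩
  have hneg := hν.inner_neg_of_interior (D.convex_star hy) ((isOpen_star T y).mem_nhds hxst)
    hz0i ((isOpen_star T y).mem_nhds hz0s)
  have hpos : inner ℝ ν (z2 - (a • z2 + b • z0)) ≤ 0 := by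
    by_cases hxF : a • z2 + b • z0 ∈ F
    · have := D.normal _ hxF ν hν
      subst this
      rwa [D.inner_n_sub hxF]
    · rw [D.inner_eq_of_face hxst hν]
      exact hz2c ν ⟨_, hxst, hxF, hν⟩
  have e : a • (z2 - (a • z2 + b • z0)) + b • (z0 - (a • z2 + b • z0)) = 0 := by
    have hb' : b = 1 - a := by linarith
    subst hb'
    module
  have e2 := congrArg (fun u => (inner ℝ ν u : ℝ)) e
  simp only [inner_add_right, inner_smul_right, inner_zero_right] at e2
  rcases eq_or_lt_of_le hb with rfl | hb
  · have : a = 1 := by linarith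
    subst this
    simp only [one_smul, zero_smul, add_zero] at hxf
    exact hz2P (D.isClosed.frontier_subset hxf)
  · nlinarith

end

end

section

section
variable {P F : Set E3} {A B n : E3} {T : Finset (E3 × ℝ)} (D : FaceData P F A B n T)
include D

/-- The plane of `F` meets the star of a point of `F` and the cone of the other faces in `F`. -/
lemma FaceData.mem_F {y z : E3} (hy : y ∈ F \ segment ℝ A B) (hz : z ∈ star T y)
    (hc : z ∈ cone P F T y) (h0 : inner ℝ n (z - A) = 0) : z ∈ F := by
  have hzP : z ∈ P := (D.mem_iff hy hz).2 ⟨h0.le, hc⟩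
  obtain ⟨x, hx, hxF, hf⟩ := D.exists_facePoint hy.1 (star_mem_nhds T y)
  refine D.propagate x hxF z fun s hs => ?_
  refine hf.segment (D.convex_star hy) (isOpen_star T y) hx ⟨hzP, hz⟩ ?_ hs.1 hs.2
  rw [D.inner_n_sub hxF, h0]

lemma FaceData.mem_F_of_closure {y z : E3} (hy : y ∈ F \ segment ℝ A B)
    (hz : ∀ p ∈ T, ev p y ≠ 0 → 0 ≤ ev p y * ev p z)
    (hc : z ∈ cone P F T y) (h0 : inner ℝ n (z - A) = 0) : z ∈ F := by
  have hlim : Tendsto (fun s : ℝ => y + s • (z - y)) (𝓝[<] 1) (𝓝 z) := by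
    have : Continuous (fun s : ℝ => y + s • (z - y)) := by fun_prop
    simpa using (this.tendsto 1).mono_left nhdsWithin_le_nhds
  refine D.closed_F.mem_of_tendsto hlim ?_
  filter_upwards [Ioo_mem_nhdsLT (zero_lt_one (α := ℝ))] with s hs
  refine D.mem_F hy (fun p hp hpy => ?_) (fun ν hν => ?_) ?_
  · rw [ev_add_smul_sub]
    have h1 := mul_pos (sub_pos.2 hs.2) (mul_self_pos.2 hpy)
    have h2 := mul_nonneg hs.1.le (hz p hp hpy)
    nlinarith
  · rw [add_sub_cancel_left, inner_smul_right]
    exact mul_nonpos_of_nonneg_of_nonpos hs.1.le (hc ν hν)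
  · rw [← D.inner_n_sub hy.1, add_sub_cancel_left, inner_smul_right, D.inner_n_sub hy.1, h0,
      mul_zero]

lemma FaceData.normals_ne {y ν : E3} (hy : y ∈ F \ segment ℝ A B) (hν : ν ∈ normals P F T y) :
    ν ≠ n := by
  rintro rfl
  obtain ⟨x, hx, hxF, hf⟩ := hν
  obtain ⟨x1, hx1, hx1F, hf1⟩ := D.exists_facePoint hy.1 (star_mem_nhds T y)
  have h1 := hf.inner_nonpos (D.convex_star hy) ((isOpen_star T y).mem_nhds hx) ⟨hf1.mem, hx1⟩
  have h2 := hf1.inner_nonpos (D.convex_star hy) ((isOpen_star T y).mem_nhds hx1) ⟨hf.mem, hx⟩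
  rw [← neg_sub, inner_neg_right] at h1
  apply hxF
  refine D.mem_F hy hx (D.subset_cone hy hx hf.mem) ?_
  rw [← D.inner_n_sub hx1F]
  linarith

/-- A point of `F` near `y` that is strictly inside all other faces at `y`. -/
lemma FaceData.exists_inner_point {y : E3} (hy : y ∈ F \ segment ℝ A B) :
    ∃ x ∈ star T y, x ∈ F ∧ ∀ ν ∈ normals P F T y, inner ℝ ν (x - y) < 0 := by
  obtain ⟨x1, hx1, hx1F, hf1⟩ := D.exists_facePoint hy.1 (star_mem_nhds T y)
  refine ⟨x1, hx1, hx1F, fun ν hν => ?_⟩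
  have hne := D.normals_ne hy hν
  obtain ⟨x, hx, hxF, hf⟩ := hν
  rw [← D.inner_eq_of_face hx hf]
  exact hf.inner_neg (D.convex_star hy) ((isOpen_star T y).mem_nhds hx)
    ((isOpen_star T y).mem_nhds hx1) hf1 hne

/-- A point of the face with normal `ν` that is strictly inside all other faces at `y`. -/
lemma FaceData.exists_witness {y ν : E3} (hy : y ∈ F \ segment ℝ A B)
    (hν : ν ∈ normals P F T y) :
    ∃ x ∈ star T y, inner ℝ n (x - y) < 0 ∧ inner ℝ ν (x - y) = 0 ∧
      ∀ ν' ∈ normals P F T y, ν' ≠ ν → inner ℝ ν' (x - y) < 0 := by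
  have hν' := hν
  obtain ⟨x, hx, hxF, hf⟩ := hν
  refine ⟨x, hx, ?_, ?_, ?_⟩
  · rw [D.inner_n_sub hy.1]
    refine lt_of_le_of_ne (D.inner_nonpos hy hx hf.mem) fun h0 => hxF ?_
    exact D.mem_F hy hx (D.subset_cone hy hx hf.mem) h0
  · rw [← D.inner_eq_of_face hx hf, sub_self, inner_zero_right]
  · rintro ν' ⟨x', hx', hxF', hf'⟩ hne
    rw [← D.inner_eq_of_face hx' hf']
    exact hf'.inner_neg (D.convex_star hy) ((isOpen_star T y).mem_nhds hx')
      ((isOpen_star T y).mem_nhds hx) hf hne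

/-- No line lies in three different facets of a convex cone: a nontrivial relation between the
direction of such a line and one interior point of each facet would have coefficients of
pairwise opposite signs. -/
lemma FaceData.eq_zero_of_orthogonal {y ν ν' u : E3} (hy : y ∈ F \ segment ℝ A B)
    (hν : ν ∈ normals P F T y) (hν' : ν' ∈ normals P F T y) (hne : ν ≠ ν')
    (h0 : inner ℝ n u = 0) (h1 : inner ℝ ν u = 0) (h2 : inner ℝ ν' u = 0) : u = 0 := by
  by_contra hu
  obtain ⟨x0, -, hx0F, hx0⟩ := D.exists_inner_point hy
  obtain ⟨x1, -, a1, b1, c1⟩ := D.exists_witness hy hν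
  obtain ⟨x2, -, a2, b2, c2⟩ := D.exists_witness hy hν'
  have d1 := hx0 ν hν
  have d2 := hx0 ν' hν'
  have c1 := c1 ν' hν' hne.symm
  have c2 := c2 ν hν hne
  have a0 : inner ℝ n (x0 - y) = 0 := by rw [D.inner_n_sub hy.1, D.sub_plane x0 hx0F]
  have hdep : ¬ LinearIndependent ℝ ![u, x0 - y, x1 - y, x2 - y] := by
    intro h
    have := h.fintype_card_le_finrank
    simp at this
  obtain ⟨g, hg, hg0⟩ := Fintype.not_linearIndependent_iff.1 hdep
  simp only [Fin.sum_univ_four, Matrix.cons_val_zero, Matrix.cons_val_one, Matrix.cons_val] at hg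
  have e0 := congrArg (fun v => (inner ℝ n v : ℝ)) hg
  have e1 := congrArg (fun v => (inner ℝ ν v : ℝ)) hg
  have e2 := congrArg (fun v => (inner ℝ ν' v : ℝ)) hg
  simp only [inner_add_right, inner_smul_right, inner_zero_right, h0, h1, h2, a0, b1, b2,
    mul_zero, zero_add, add_zero] at e0 e1 e2
  have key : ∀ {a b s t : ℝ}, s < 0 → t < 0 → a * s + b * t = 0 → 0 < a → b < 0 := by
    intro a b s t hs ht h ha
    by_contra hb
    have := mul_neg_of_pos_of_neg ha hs
    have := mul_nonpos_of_nonneg_of_nonpos (not_lt.1 hb) ht.le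
    linarith
  have key' : ∀ {a b s t : ℝ}, s < 0 → t < 0 → a * s + b * t = 0 → a < 0 → 0 < b := by
    intro a b s t hs ht h ha
    have := key (a := -a) (b := -b) hs ht (by linarith) (by linarith)
    linarith
  have g2 : g 2 = 0 := by
    rcases lt_trichotomy (g 2) 0 with h | h | h
    · have k1 := key' a1 a2 e0 h
      have k2 := key' c1 d2 (by linarith) h
      have k3 := key d1 c2 e1 k2
      linarith
    · exact h
    · have k1 := key a1 a2 e0 h
      have k2 := key c1 d2 (by linarith) h
      have k3 := key' d1 c2 e1 k2
      linarith
  have g3 : g 3 = 0 := by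
    rw [g2, zero_mul, zero_add] at e0
    exact (mul_eq_zero.1 e0).resolve_right a2.ne
  have g1 : g 1 = 0 := by
    rw [g3, zero_mul, add_zero] at e1
    exact (mul_eq_zero.1 e1).resolve_right d1.ne
  have g0 : g 0 = 0 := by
    rw [g1, g2, g3] at hg
    simpa [hu] using hg
  obtain ⟨i, hi⟩ := hg0
  fin_cases i <;> simp_all

/-- The cones of two points of `F` agree on the intersection of the stars. The midpoint of the two
points lies in both stars and in `F`; a face bounding the first cone strictly violated in the
second would contain both points, and would be seen from the second one. -/
lemma FaceData.mem_cone_of_mem_cone {x y z : E3} (hx : x ∈ F \ segment ℝ A B)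
    (hy : y ∈ F \ segment ℝ A B) (hzx : z ∈ star T x) (hzy : z ∈ star T y)
    (hz : z ∈ cone P F T y) : z ∈ cone P F T x := by
  have hxc : ∀ ν ∈ normals P F T y, inner ℝ ν (x - y) ≤ 0 := by
    intro ν hν
    obtain ⟨-, p, hp, c, hc, hpc, hpy, hev⟩ := D.normals_plane hν
    by_contra hcon
    have hpx : ev p x ≠ 0 := by
      rw [hev]; exact mul_ne_zero hc (by linarith)
    have h1 := hzx p hp hpx
    rw [hev, hev] at h1
    have h2 := hz ν hν
    have h3 : 0 < c * c := mul_self_pos.2 hc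
    have h4 : 0 < (c * c) * (inner ℝ ν (x - y) * inner ℝ ν (z - y) : ℝ) := by linarith
    have h5 := (mul_pos_iff_of_pos_left h3).1 h4
    exact absurd h5 (not_lt.2 (mul_nonpos_of_nonneg_of_nonpos (not_le.1 hcon).le h2))
  set m := y + (2⁻¹ : ℝ) • (x - y) with hm
  have hevm : ∀ p, ev p m = 2⁻¹ * ev p y + 2⁻¹ * ev p x := fun p => by
    rw [hm, ev_add_smul_sub]; ring
  have hmstar : ∀ a b : E3, z ∈ star T a → z ∈ star T b → ∀ p ∈ T, ev p a ≠ 0 →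
      0 < ev p a * (2⁻¹ * ev p a + 2⁻¹ * ev p b) := by
    intro a b ha hb p hp hpa
    have h1 := mul_self_pos.2 hpa
    by_cases hpb : ev p b = 0
    · rw [hpb]; linarith
    · have h2 := (sign_eq_of_mul_pos (ha p hp hpa)).trans
        (sign_eq_of_mul_pos (hb p hp hpb)).symm
      have := mul_pos_of_sign_eq h2 hpa
      linarith
  have hmy : m ∈ star T y := fun p hp hpy => by
    rw [hevm]; exact hmstar y x hzy hzx p hp hpy
  have hmx : m ∈ star T x := fun p hp hpx => by
    rw [hevm, add_comm]; exact hmstar x y hzx hzy p hp hpx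
  have hmF : m ∈ F := by
    refine D.mem_F hy hmy (fun ν hν => ?_) ?_
    · rw [hm, add_sub_cancel_left, inner_smul_right]
      have := hxc ν hν
      linarith
    · rw [← D.inner_n_sub hy.1, hm, add_sub_cancel_left, inner_smul_right, D.inner_n_sub hy.1,
        D.sub_plane x hx.1, mul_zero]
  have hmP := D.sub_P hmF
  intro ν hν
  by_contra hcon
  rw [not_le] at hcon
  have hmν := D.subset_cone hx hmx hmP ν hν
  obtain ⟨-, p, hp, c, hc, hpc, hpx, hev⟩ := D.normals_plane hν
  have e1 : inner ℝ ν (m - x) = (2⁻¹ : ℝ) * inner ℝ ν (y - x) := by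
    rw [← inner_smul_right, hm]; congr 1; module
  have hyν : inner ℝ ν (y - x) = (0:ℝ) := by
    by_contra h0
    have hpy : ev p y ≠ 0 := by rw [hev]; exact mul_ne_zero hc h0
    have h1 := hzy p hp hpy
    rw [hev, hev] at h1
    have h3 : 0 < c * c := mul_self_pos.2 hc
    have h4 : 0 < (c * c) * (inner ℝ ν (y - x) * inner ℝ ν (z - x) : ℝ) := by linarith
    have h5 := (mul_pos_iff_of_pos_left h3).1 h4
    have h6 := (pos_iff_pos_of_mul_pos h5).2 hcon
    linarith
  have hm0 : inner ℝ ν (m - x) = (0:ℝ) := by rw [e1, hyν, mul_zero]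
  have hν2 := hν
  obtain ⟨f, hfx, hfF, hf⟩ := hν
  have hmf : inner ℝ ν (m - f) = (0:ℝ) := by rw [D.inner_eq_of_face hfx hf, hm0]
  -- face points with normal `ν` accumulate at the midpoint, inside the star of `y`
  have hlim : Tendsto (fun s : ℝ => f + s • (m - f)) (𝓝[<] 1) (𝓝 m) := by
    have : Continuous (fun s : ℝ => f + s • (m - f)) := by fun_prop
    simpa using (this.tendsto 1).mono_left nhdsWithin_le_nhds
  obtain ⟨s, hs, hs1⟩ := ((hlim.eventually ((isOpen_star T y).mem_nhds hmy)).and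
    (Ioo_mem_nhdsLT (zero_lt_one (α := ℝ)))).exists
  have hg := hf.segment (D.convex_star hx) (isOpen_star T x) hfx ⟨hmP, hmx⟩ hmf hs1.1.le hs1.2
  have hmem : ν ∈ normals P F T y := by
    refine ⟨_, hs, fun hF => ?_, hg⟩
    exact D.normals_ne hx hν2 (D.normal _ hF ν hg)
  have := hz ν hmem
  have e2 : z - y = (z - x) - (y - x) := by abel
  rw [e2, inner_sub_right, hyν, sub_zero] at this
  linarith

end

/-! ### The solid obtained by removing the constraint of the face -/

/-- The union of the stars of the points of `F` off the edge. -/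
def region (F : Set E3) (A B : E3) (T : Finset (E3 × ℝ)) : Set E3 :=
  {z | ∃ y ∈ F \ segment ℝ A B, z ∈ star T y}

/-- The part of the region bounded by the faces other than `F`. -/
def body (P F : Set E3) (A B : E3) (T : Finset (E3 × ℝ)) : Set E3 :=
  {z | ∃ y ∈ F \ segment ℝ A B, z ∈ star T y ∧ z ∈ cone P F T y}

section
variable {P F : Set E3} {A B n : E3} {T : Finset (E3 × ℝ)}

lemma isOpen_region : IsOpen (region F A B T) := by
  have : region F A B T = ⋃ y ∈ F \ segment ℝ A B, star T y := by
    ext z; simp [region]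
  rw [this]
  exact isOpen_biUnion fun y _ => isOpen_star T y

lemma body_subset_region : body P F A B T ⊆ region F A B T :=
  fun _ ⟨y, hy, hz, _⟩ => ⟨y, hy, hz⟩

lemma star_subset_region {y : E3} (hy : y ∈ F \ segment ℝ A B) : star T y ⊆ region F A B T :=
  fun _ hz => ⟨y, hy, hz⟩

lemma mem_region_self {y : E3} (hy : y ∈ F \ segment ℝ A B) : y ∈ region F A B T :=
  ⟨y, hy, self_mem_star T y⟩

lemma sat_region : Sat T (region F A B T) :=
  fun _ _ h ⟨y, hy, hz⟩ => ⟨y, hy, signEq_star_congr h y hz⟩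

variable (D : FaceData P F A B n T)
include D

lemma FaceData.mem_body_iff {y z : E3} (hy : y ∈ F \ segment ℝ A B) (hz : z ∈ star T y) :
    z ∈ body P F A B T ↔ z ∈ cone P F T y :=
  ⟨fun ⟨_, hx, hzx, hc⟩ => D.mem_cone_of_mem_cone hy hx hz hzx hc, fun h => ⟨y, hy, hz, h⟩⟩

lemma FaceData.sat_cone (y : E3) : Sat T (cone P F T y) := by
  intro z z' h hz ν hν
  obtain ⟨-, p, hp, c, hc, hpc, hpy, hev⟩ := D.normals_plane hν
  have h1 := hz ν hν
  have h2 := h p hp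
  rw [hev, hev, sign_mul, sign_mul] at h2
  have hc' : SignType.sign c ≠ 0 := by simpa using hc
  have h3 := mul_left_cancel₀ hc' h2
  by_contra hcon
  rw [not_le] at hcon
  rw [sign_pos hcon] at h3
  exact absurd (sign_eq_one_iff.1 h3) (not_lt.2 h1)

lemma FaceData.sat_body : Sat T (body P F A B T) :=
  fun z z' h ⟨y, hy, hz, hc⟩ => ⟨y, hy, signEq_star_congr h y hz, D.sat_cone y z z' h hc⟩

lemma FaceData.mem_iff_body {z : E3} (hz : z ∈ region F A B T) :
    z ∈ P ↔ inner ℝ n (z - A) ≤ 0 ∧ z ∈ body P F A B T := by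
  obtain ⟨y, hy, hz⟩ := hz
  rw [D.mem_iff hy hz, D.mem_body_iff hy hz]

lemma FaceData.F_subset_body {y : E3} (hy : y ∈ F \ segment ℝ A B) : y ∈ body P F A B T :=
  ((D.mem_iff_body (mem_region_self hy)).1 (D.sub_P hy.1)).2

lemma FaceData.body_plane {z : E3} (hz : z ∈ body P F A B T) (h0 : inner ℝ n (z - A) = 0) :
    z ∈ F := by
  obtain ⟨y, hy, hzs, hc⟩ := hz
  exact D.mem_F hy hzs hc h0

/-- The body is a finite union of its pieces, hence the closure is the union of their closures. -/
lemma FaceData.closure_body {z : E3} (hz : z ∈ closure (body P F A B T)) :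
    ∃ y ∈ F \ segment ℝ A B, (∀ p ∈ T, ev p y ≠ 0 → 0 ≤ ev p y * ev p z) ∧
      z ∈ cone P F T y := by
  classical
  -- the pieces depend only on the sign vector of `y`
  let sg : E3 → (T → SignType) := fun y p => SignType.sign (ev p.1 y)
  let C : E3 → Set E3 := fun y => star T y ∩ cone P F T y
  have hstar : ∀ y y', sg y = sg y' → star T y = star T y' := by
    intro y y' h
    have hs : ∀ p ∈ T, SignType.sign (ev p y) = SignType.sign (ev p y') := fun p hp =>
      congrFun h ⟨p, hp⟩
    ext z
    constructor
    · intro hz p hp hpy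
      have h0 : ev p y ≠ 0 := fun h0 => hpy ((zero_iff_of_sign_eq (hs p hp)).1 h0)
      exact mul_pos_of_sign_eq ((hs p hp).symm.trans (sign_eq_of_mul_pos (hz p hp h0))) hpy
    · intro hz p hp hpy
      have h0 : ev p y' ≠ 0 := fun h0 => hpy ((zero_iff_of_sign_eq (hs p hp)).2 h0)
      exact mul_pos_of_sign_eq ((hs p hp).trans (sign_eq_of_mul_pos (hz p hp h0))) hpy
  have hun : body P F A B T = ⋃ y ∈ F \ segment ℝ A B, star T y ∩ body P F A B T := by
    ext z
    simp only [mem_iUnion, mem_inter_iff, exists_prop]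
    exact ⟨fun h => by obtain ⟨y, hy, hz, -⟩ := id h; exact ⟨y, hy, hz, h⟩, fun ⟨_, _, _, h⟩ => h⟩
  have hfin : ((fun y => star T y ∩ body P F A B T) '' (F \ segment ℝ A B)).Finite := by
    have : (fun y => star T y ∩ body P F A B T) =
        (fun σ : T → SignType => (if h : ∃ y, sg y = σ then star T h.choose else ∅) ∩
          body P F A B T) ∘ sg := by
      funext y
      have hex : ∃ y', sg y' = sg y := ⟨y, rfl⟩
      simp only [Function.comp_apply, dif_pos hex]
      rw [hstar _ _ hex.choose_spec]
    rw [this, image_comp]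
    exact (Set.toFinite _).image _
  rw [hun, ← sUnion_image, hfin.closure_sUnion] at hz
  simp only [mem_iUnion, exists_prop, exists_exists_and_eq_and, mem_image] at hz
  obtain ⟨y, hy, hz⟩ := hz
  refine ⟨y, hy, fun p hp hpy => ?_, fun ν hν => ?_⟩
  · have hcl : IsClosed {z | 0 ≤ ev p y * ev p z} :=
      isClosed_le continuous_const (continuous_const.mul (continuous_ev p))
    exact closure_minimal (fun z hz => (hz.1 p hp hpy).le) hcl hz
  · have hcl : IsClosed {z : E3 | (inner ℝ ν (z - y) : ℝ) ≤ 0} :=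
      isClosed_le (by fun_prop) continuous_const
    exact closure_minimal (fun z hz => (D.mem_body_iff hy hz.1).1 hz.2 ν hν) hcl hz

lemma FaceData.closure_body_plane {z : E3} (hz : z ∈ closure (body P F A B T))
    (h0 : inner ℝ n (z - A) = 0) : z ∈ F := by
  obtain ⟨y, hy, h1, h2⟩ := D.closure_body hz
  exact D.mem_F_of_closure hy h1 h2 h0

/-- The body is relatively closed in the region. -/
lemma FaceData.closure_body_inter : closure (body P F A B T) ∩ region F A B T = body P F A B T := by
  refine Subset.antisymm ?_ fun z hz => ⟨subset_closure hz, body_subset_region hz⟩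
  rintro z ⟨hz, y, hy, hzy⟩
  rw [D.mem_body_iff hy hzy]
  intro ν hν
  have hcl : IsClosed {z : E3 | (inner ℝ ν (z - y) : ℝ) ≤ 0} :=
    isClosed_le (by fun_prop) continuous_const
  have h2 : z ∈ closure (body P F A B T ∩ star T y) := by
    rw [inter_comm]
    exact (isOpen_star T y).inter_closure ⟨hzy, hz⟩
  exact closure_minimal (fun z hz => (D.mem_body_iff hy hz.2).1 hz.1 ν hν) hcl h2

end

end

section

/-! ### Uniform estimates near the edge -/

section
variable {T : Finset (E3 × ℝ)}

lemma star_congr {y y' : E3} (h : SignEq T y y') : star T y = star T y' := by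
  ext z
  constructor
  · intro hz p hp hpy
    have h0 : ev p y ≠ 0 := fun h0 => hpy ((zero_iff_of_sign_eq (h p hp)).1 h0)
    exact mul_pos_of_sign_eq ((h p hp).symm.trans (sign_eq_of_mul_pos (hz p hp h0))) hpy
  · intro hz p hp hpy
    have h0 : ev p y' ≠ 0 := fun h0 => hpy ((zero_iff_of_sign_eq (h p hp)).2 h0)
    exact mul_pos_of_sign_eq ((h p hp).trans (sign_eq_of_mul_pos (hz p hp h0))) hpy

/-- A positive bound that depends only on the sign vector of a point can be chosen uniformly. -/
lemma exists_uniform {S : Set E3} {Φ : E3 → ℝ → Prop}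
    (mono : ∀ y κ κ', 0 < κ' → κ' ≤ κ → Φ y κ → Φ y κ')
    (h : ∀ y ∈ S, ∃ κ > 0, ∀ y' ∈ S, SignEq T y y' → Φ y' κ) :
    ∃ κ > 0, ∀ y ∈ S, Φ y κ := by
  classical
  let sg : E3 → (T → SignType) := fun y p => SignType.sign (ev p.1 y)
  have h' : ∀ σ : T → SignType, ∃ κ > 0, ∀ y ∈ S, sg y = σ → Φ y κ := by
    intro σ
    by_cases hσ : ∃ y ∈ S, sg y = σ
    · obtain ⟨y, hy, rfl⟩ := hσ
      obtain ⟨κ, hκ, hh⟩ := h y hy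
      exact ⟨κ, hκ, fun y' hy' he => hh y' hy' fun p hp => (congrFun he ⟨p, hp⟩).symm⟩
    · push Not at hσ
      exact ⟨1, one_pos, fun y hy he => absurd he (hσ y hy)⟩
  choose f hf hf' using h'
  obtain ⟨σ0, hσ0⟩ := Finite.exists_min f
  exact ⟨f σ0, hf σ0, fun y hy => mono y _ _ (hf σ0) (hσ0 _) (hf' (sg y) y hy rfl)⟩

/-- The closed face of the arrangement spanned by `z`. -/
def closedCell (T : Finset (E3 × ℝ)) (z : E3) : Set E3 :=
  {x | ∀ p ∈ T, (ev p z = 0 → ev p x = 0) ∧ 0 ≤ ev p z * ev p x}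

lemma self_mem_closedCell (z : E3) : z ∈ closedCell T z :=
  fun _ _ => ⟨id, mul_self_nonneg _⟩

lemma isClosed_closedCell (z : E3) : IsClosed (closedCell T z) := by
  have : closedCell T z = ⋂ p ∈ T, ({x | ev p z = 0 → ev p x = 0} ∩ {x | 0 ≤ ev p z * ev p x}) := by
    ext x; simp [closedCell]
  rw [this]
  refine isClosed_biInter fun p _ => ?_
  have hc := continuous_ev p
  refine IsClosed.inter ?_ (isClosed_le continuous_const (continuous_const.mul hc))
  by_cases h : ev p z = 0
  · simpa [h] using isClosed_eq hc continuous_const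
  · simp [h]

lemma convex_closedCell (z : E3) : Convex ℝ (closedCell T z) := by
  intro x hx x' hx' a b ha hb hab p hp
  rw [ev_combo p x x' hab]
  refine ⟨fun h => by rw [(hx p hp).1 h, (hx' p hp).1 h]; ring, ?_⟩
  have := mul_nonneg ha (hx p hp).2
  have := mul_nonneg hb (hx' p hp).2
  nlinarith

lemma closedCell_congr {z z' : E3} (h : SignEq T z z') {x : E3} (hx : x ∈ closedCell T z) :
    x ∈ closedCell T z' := by
  intro p hp
  refine ⟨fun h0 => (hx p hp).1 ((zero_iff_of_sign_eq (h p hp)).2 h0), ?_⟩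
  have h1 := (hx p hp).2
  rcases lt_trichotomy (ev p z) 0 with h0 | h0 | h0
  · have h2 := h p hp
    rw [sign_neg h0, eq_comm, sign_eq_neg_one_iff] at h2
    nlinarith
  · rw [(hx p hp).1 h0, mul_zero]
  · have h2 := h p hp
    rw [sign_pos h0, eq_comm, sign_eq_one_iff] at h2
    nlinarith

/-- Distinct extreme points of a closed cell have distinct sign vectors. -/
lemma finite_extremePoints_closedCell (z : E3) : ((closedCell T z).extremePoints ℝ).Finite := by
  classical
  let sg : E3 → (T → SignType) := fun y p => SignType.sign (ev p.1 y)
  refine Set.Finite.of_finite_image (f := sg) (Set.toFinite _) ?_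
  intro x hx x' hx' he
  by_contra hne
  have hs : SignEq T x x' := fun p hp => congrFun he ⟨p, hp⟩
  have hx'star : x' ∈ star T x := by
    rw [star_congr hs]; exact self_mem_star T x'
  obtain ⟨s, hs0, hs1, hxs⟩ := exists_pos_of_eventually (x - x') (star_mem_nhds T x)
  have hmem : x + s • (x - x') ∈ closedCell T z := by
    intro p hp
    have h1 := hx.1 p hp
    by_cases h0 : ev p x = 0
    · have h0' : ev p x' = 0 := (zero_iff_of_sign_eq (hs p hp)).1 h0
      rw [ev_add, inner_smul_right, ← ev_sub, h0, h0']
      simp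
    · refine ⟨fun h => absurd (h1.1 h) h0, ?_⟩
      have h2 := hxs p hp h0
      have h3 : ev p z ≠ 0 := fun h => h0 (h1.1 h)
      have h4 : 0 < ev p z * ev p x := lt_of_le_of_ne h1.2 (mul_ne_zero h3 h0).symm
      exact (mul_pos_of_sign_eq ((sign_eq_of_mul_pos h4).trans (sign_eq_of_mul_pos h2)) h3).le
  have hseg : x ∈ openSegment ℝ (x + s • (x - x')) x' := by
    refine ⟨(1 + s)⁻¹, s * (1 + s)⁻¹, by positivity, by positivity, by field_simp, ?_⟩
    have h1 : (1 + s)⁻¹ * (1 + s) = 1 := inv_mul_cancel₀ (by positivity)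
    have : (1 + s)⁻¹ • (x + s • (x - x')) + (s * (1 + s)⁻¹) • x' = ((1 + s)⁻¹ * (1 + s)) • x := by
      module
    rw [this, h1, one_smul]
  have h3 := hx.2 hmem hx'.1 hseg
  have h4 : s • (x - x') = 0 := by simpa using h3
  rcases smul_eq_zero.1 h4 with h | h
  · exact hs0.ne' h
  · exact hne (sub_eq_zero.1 h)

/-- On a compact closed cell that meets the plane `{f = 0}` of the arrangement only inside
`{g = 0}`, the function `g` is dominated by `f`: this holds at the finitely many extreme points. -/
lemma exists_bound_closedCell {f g : E3 × ℝ} (hf : f ∈ T) {z : E3}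
    (hK : IsCompact (closedCell T z))
    (h : ∀ x ∈ closedCell T z, ev f x = 0 → ev g x = 0) :
    ∃ κ > 0, ∀ x ∈ closedCell T z, κ * |ev g x| ≤ |ev f x| := by
  classical
  by_cases hz : ev f z = 0
  · refine ⟨1, one_pos, fun x hx => ?_⟩
    rw [h x hx ((hx f hf).1 hz)]; simp
  obtain ⟨σ, hσ, hσf⟩ : ∃ σ : ℝ, |σ| = 1 ∧ ∀ x ∈ closedCell T z, 0 ≤ σ * ev f x := by
    rcases lt_or_gt_of_ne hz with h0 | h0
    · exact ⟨-1, by simp, fun x hx => by nlinarith [(hx f hf).2]⟩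
    · exact ⟨1, by simp, fun x hx => by nlinarith [(hx f hf).2]⟩
  have habs : ∀ x ∈ closedCell T z, |ev f x| = σ * ev f x := fun x hx => by
    rw [← abs_of_nonneg (hσf x hx), abs_mul, hσ, one_mul]
  have hfin := finite_extremePoints_closedCell (T := T) z
  obtain ⟨κ, hκ, hκE⟩ : ∃ κ > 0, ∀ x ∈ (closedCell T z).extremePoints ℝ,
      κ * |ev g x| ≤ |ev f x| := by
    refine hfin.induction_on_subset _ ⟨1, one_pos, by simp⟩ ?_
    rintro x S hx - - ⟨κ, hκ, hS⟩
    obtain ⟨κ', hκ', hx'⟩ : ∃ κ' > 0, κ' * |ev g x| ≤ |ev f x| := by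
      by_cases hg : ev g x = 0
      · exact ⟨1, one_pos, by simp [hg]⟩
      · have hf0 : ev f x ≠ 0 := fun h0 => hg (h x hx.1 h0)
        refine ⟨|ev f x| / |ev g x|, div_pos (abs_pos.2 hf0) (abs_pos.2 hg), ?_⟩
        rw [div_mul_cancel₀ _ (abs_pos.2 hg).ne']
    refine ⟨min κ κ', lt_min hκ hκ', fun v hv => ?_⟩
    rcases hv with rfl | hv
    · exact (mul_le_mul_of_nonneg_right (min_le_right _ _) (abs_nonneg _)).trans hx'
    · exact (mul_le_mul_of_nonneg_right (min_le_left _ _) (abs_nonneg _)).trans (hS v hv)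
  refine ⟨κ, hκ, fun x hx => ?_⟩
  rw [habs x hx]
  have hclosed : IsClosed {x : E3 | κ * |ev g x| ≤ σ * ev f x} :=
    isClosed_le (continuous_const.mul (continuous_ev g).abs)
      (continuous_const.mul (continuous_ev f))
  have hconv : Convex ℝ {x : E3 | κ * |ev g x| ≤ σ * ev f x} := by
    intro x hx x' hx' a b ha hb hab
    simp only [mem_ofPred_eq] at hx hx' ⊢
    rw [ev_combo f x x' hab, ev_combo g x x' hab]
    have h1 : |a * ev g x + b * ev g x'| ≤ a * |ev g x| + b * |ev g x'| := by
      refine (abs_add_le _ _).trans (le_of_eq ?_)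
      rw [abs_mul, abs_mul, abs_of_nonneg ha, abs_of_nonneg hb]
    have h2 := mul_le_mul_of_nonneg_left h1 hκ.le
    have h3 := mul_le_mul_of_nonneg_left hx ha
    have h4 := mul_le_mul_of_nonneg_left hx' hb
    nlinarith
  have hsub : (closedCell T z).extremePoints ℝ ⊆ {x : E3 | κ * |ev g x| ≤ σ * ev f x} :=
    fun v hv => by
      have := hκE v hv
      rwa [habs v hv.1] at this
  have hkm := closure_convexHull_extremePoints hK (convex_closedCell z)
  rw [← hkm] at hx
  exact closure_minimal (convexHull_min hsub hconv) hclosed hx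

lemma closedCell_weak {y z x : E3}
    (hz : ∀ p ∈ T, ev p y ≠ 0 → 0 ≤ ev p y * ev p z) (hx : x ∈ closedCell T z) :
    ∀ p ∈ T, ev p y ≠ 0 → 0 ≤ ev p y * ev p x := by
  intro p hp hpy
  by_cases h0 : ev p z = 0
  · rw [(hx p hp).1 h0, mul_zero]
  · have h1 : 0 < ev p y * ev p z := lt_of_le_of_ne (hz p hp hpy) (mul_ne_zero hpy h0).symm
    have h2 := mul_nonneg h1.le (hx p hp).2
    have h3 : 0 < ev p z * ev p z := mul_self_pos.2 h0
    by_contra hcon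
    have := mul_neg_of_neg_of_pos (not_le.1 hcon) h3
    nlinarith

lemma norm_le_of_weak {P : Set E3} {R : ℝ} (hR : ∀ y ∈ P, ∀ z ∈ star T y, ‖z‖ ≤ R) {y x : E3}
    (hy : y ∈ P) (hx : ∀ p ∈ T, ev p y ≠ 0 → 0 ≤ ev p y * ev p x) : ‖x‖ ≤ R := by
  have hlim : Tendsto (fun s : ℝ => y + s • (x - y)) (𝓝[<] 1) (𝓝 x) := by
    have : Continuous (fun s : ℝ => y + s • (x - y)) := by fun_prop
    simpa using (this.tendsto 1).mono_left nhdsWithin_le_nhds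
  refine le_of_tendsto hlim.norm ?_
  filter_upwards [Ioo_mem_nhdsLT (zero_lt_one (α := ℝ))] with s hs
  refine hR y hy _ fun p hp hpy => ?_
  rw [ev_add_smul_sub]
  have h1 := mul_pos (sub_pos.2 hs.2) (mul_self_pos.2 hpy)
  have h2 := mul_nonneg hs.1.le (hx p hp hpy)
  nlinarith

lemma ev_base (n A z : E3) : ev (n, inner ℝ n A) z = inner ℝ n (z - A) := by
  simp [ev, inner_sub_right]

end

section
variable {P F : Set E3} {A B n : E3} {T : Finset (E3 × ℝ)} (D : FaceData P F A B n T)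
include D

lemma FaceData.cone_of_closedCell {y z x : E3} (hz : z ∈ cone P F T y)
    (hx : x ∈ closedCell T z) : x ∈ cone P F T y := by
  intro ν hν
  obtain ⟨-, p, hp, c, hc, hpc, hpy, hev⟩ := D.normals_plane hν
  have h1 := hz ν hν
  have h2 := hx p hp
  rw [hev, hev] at h2
  rcases eq_or_lt_of_le h1 with h0 | h0
  · rw [h0] at h2
    have h3 : inner ℝ ν (x - y) = (0:ℝ) := by simpa [hc] using h2.1
    exact h3.le
  · have h3 : 0 < c * c := mul_self_pos.2 hc
    by_contra hcon
    have := mul_neg_of_neg_of_pos h0 (not_le.1 hcon)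
    nlinarith [h2.2]

/-- The points of the body that are close to the plane of `F`, compared with a function `w`
vanishing on the edge, lie in the stars of points of `F` where `w` does not vanish. -/
lemma FaceData.exists_star_of_flat (w : E3) :
    ∃ κ > 0, ∀ z ∈ closure (body P F A B T),
      |(inner ℝ n (z - A) : ℝ)| ≤ κ * |(inner ℝ w (z - A) : ℝ)| →
      inner ℝ w (z - A) ≠ (0 : ℝ) →
      ∃ v ∈ F, inner ℝ w (v - A) ≠ (0 : ℝ) ∧ z ∈ star T v := by
  obtain ⟨R, hR⟩ := D.bdd
  have hevw : ∀ z : E3, ev (w, inner ℝ w A) z = inner ℝ w (z - A) := fun z => by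
    simp [ev, inner_sub_right]
  refine exists_uniform (T := T) (S := closure (body P F A B T))
    (Φ := fun z κ => |(inner ℝ n (z - A) : ℝ)| ≤ κ * |(inner ℝ w (z - A) : ℝ)| →
      inner ℝ w (z - A) ≠ (0 : ℝ) →
      ∃ v ∈ F, inner ℝ w (v - A) ≠ (0 : ℝ) ∧ z ∈ star T v) ?_ ?_
  · intro y κ κ' _ hle h h1
    exact h (h1.trans (mul_le_mul_of_nonneg_right hle (abs_nonneg _)))
  intro z hz
  by_cases hgood : ∀ x ∈ closedCell T z, inner ℝ n (x - A) = (0:ℝ) → inner ℝ w (x - A) = (0:ℝ)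
  · have hK : IsCompact (closedCell T z) := by
      obtain ⟨y, hy, h1, -⟩ := D.closure_body hz
      refine (isCompact_closedBall (0 : E3) R).of_isClosed_subset (isClosed_closedCell z)
        fun x hx => ?_
      rw [mem_closedBall_zero_iff]
      exact norm_le_of_weak hR (D.sub_P hy.1) (closedCell_weak h1 hx)
    obtain ⟨κ, hκ, hb⟩ := exists_bound_closedCell (g := (w, inner ℝ w A)) D.base hK (by
      intro x hx h0
      rw [ev_base] at h0
      rw [hevw]; exact hgood x hx h0)
    refine ⟨κ / 2, by positivity, fun z' _ hzz' h1 h2 => ?_⟩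
    exfalso
    have h3 := hb z' (closedCell_congr hzz'.symm (self_mem_closedCell z'))
    rw [hevw, ev_base] at h3
    have := abs_pos.2 h2
    nlinarith
  · push Not at hgood
    obtain ⟨x, hx, hx0, hxw⟩ := hgood
    refine ⟨1, one_pos, fun z' hz' hzz' _ _ => ⟨x, ?_, hxw, ?_⟩⟩
    · obtain ⟨y, hy, h1, h2⟩ := D.closure_body hz
      exact D.mem_F_of_closure hy (closedCell_weak h1 hx) (D.cone_of_closedCell h2 hx) hx0
    · have hx' := closedCell_congr hzz' hx
      intro p hp hpx
      have h3 := (hx' p hp).2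
      have h4 : ev p z' ≠ 0 := fun h => hpx ((hx' p hp).1 h)
      rw [mul_comm]
      exact lt_of_le_of_ne h3 (mul_ne_zero h4 hpx).symm

/-- Interior points of `P` in the stars, uniformly steep with respect to `w`. -/
lemma FaceData.exists_steep (w : E3) :
    ∃ κ > 0, ∀ y ∈ F \ segment ℝ A B, ∃ u ∈ star T y, u ∈ interior P ∧
      κ * |(inner ℝ w (u - A) : ℝ)| < -inner ℝ n (u - A) := by
  refine exists_uniform (T := T) (S := F \ segment ℝ A B)
    (Φ := fun y κ => ∃ u ∈ star T y, u ∈ interior P ∧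
      κ * |(inner ℝ w (u - A) : ℝ)| < -inner ℝ n (u - A)) ?_ ?_
  · rintro y κ κ' _ hle ⟨u, hu, hui, h⟩
    exact ⟨u, hu, hui, (mul_le_mul_of_nonneg_right hle (abs_nonneg _)).trans_lt h⟩
  intro y hy
  have hyP : y ∈ closure (interior P) := by rw [D.regular]; exact D.sub_P hy.1
  obtain ⟨u, hu, hui⟩ := mem_closure_iff.1 hyP _ (isOpen_star T y) (self_mem_star T y)
  have hneg : inner ℝ n (u - A) < (0:ℝ) := by
    obtain ⟨x, hx, hxF, hf⟩ := D.exists_facePoint hy.1 (star_mem_nhds T y)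
    rw [← D.inner_n_sub hxF]
    exact hf.inner_neg_of_interior (D.convex_star hy) ((isOpen_star T y).mem_nhds hx) hui
      ((isOpen_star T y).mem_nhds hu)
  refine ⟨-inner ℝ n (u - A) / (|(inner ℝ w (u - A) : ℝ)| + 1),
    div_pos (by linarith) (by positivity), fun y' _ hyy' => ⟨u, star_congr hyy' ▸ hu, hui, ?_⟩⟩
  have h1 := abs_nonneg (inner ℝ w (u - A) : ℝ)
  rw [div_mul_eq_mul_div, div_lt_iff₀ (by positivity)]
  nlinarith

end

end

section

/-! ### The rotated polyhedron -/

/-- `w` is a unit vector in the plane of the face, orthogonal to the edge `AB`. -/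
structure RotDir (A B n w : E3) : Prop where
  norm_w : ‖w‖ = 1
  orth_n : inner ℝ w n = (0 : ℝ)
  orth_AB : inner ℝ w (B - A) = (0 : ℝ)

/-- The normal `n` rotated by the angle `t` towards `w`. -/
def rotNormal (n w : E3) (t : ℝ) : E3 := Real.cos t • n + Real.sin t • w

/-- The polyhedron in which the half-space of the face has been replaced by the half-space through
`A` with normal `ν`. -/
def replaced (P F : Set E3) (A B : E3) (T : Finset (E3 × ℝ)) (ν : E3) : Set E3 :=
  (P \ region F A B T) ∪ (halfspace A ν ∩ body P F A B T)

lemma inner_rotNormal (n w : E3) (t : ℝ) (v : E3) :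
    inner ℝ (rotNormal n w t) v = Real.cos t * inner ℝ n v + Real.sin t * (inner ℝ w v : ℝ) := by
  simp [rotNormal, inner_add_left, inner_smul_left]

lemma Sat.mono {T T' : Finset (E3 × ℝ)} {X : Set E3} (h : T ⊆ T') (hX : Sat T X) : Sat T' X :=
  fun z z' hz => hX z z' fun p hp => hz p (h hp)

lemma sat_halfspace {T : Finset (E3 × ℝ)} {A ν : E3} (h : (ν, inner ℝ ν A) ∈ T) :
    Sat T (halfspace A ν) := by
  intro z z' hz hzm
  have h1 := hz _ h
  rw [ev_base, ev_base] at h1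
  rw [mem_halfspace] at hzm ⊢
  by_contra hcon
  rw [sign_pos (not_le.1 hcon), sign_eq_one_iff] at h1
  linarith

lemma isClosed_halfspace (x ν : E3) : IsClosed (halfspace x ν) :=
  isClosed_le (by fun_prop) continuous_const

section
variable {P F : Set E3} {A B n w : E3} {T : Finset (E3 × ℝ)}

lemma RotDir.seg (hw : RotDir A B n w) {z : E3} (hz : z ∈ segment ℝ A B) :
    inner ℝ w (z - A) = (0 : ℝ) := by
  obtain ⟨a, b, ha, hb, hab, rfl⟩ := hz
  have : a • A + b • B - A = b • (B - A) := by
    have : a = 1 - b := by linarith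
    subst this; module
  rw [this, inner_smul_right, hw.orth_AB, mul_zero]

lemma RotDir.neg (hw : RotDir A B n w) : RotDir A B n (-w) :=
  ⟨by rw [norm_neg, hw.norm_w], by rw [inner_neg_left, hw.orth_n, neg_zero],
    by rw [inner_neg_left, hw.orth_AB, neg_zero]⟩

lemma RotDir.norm_rot (hw : RotDir A B n w) (hn : ‖n‖ = 1) (t : ℝ) : ‖rotNormal n w t‖ = 1 := by
  have h : ‖rotNormal n w t‖ ^ 2 = 1 := by
    rw [rotNormal, ← real_inner_self_eq_norm_sq, inner_add_left, inner_add_right, inner_add_right]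
    simp only [inner_smul_left, inner_smul_right, real_inner_self_eq_norm_sq, hn, hw.norm_w,
      hw.orth_n, real_inner_comm w n, conj_trivial]
    have := Real.sin_sq_add_cos_sq t
    linarith
  exact (pow_eq_one_iff_of_nonneg (norm_nonneg _) two_ne_zero).1 h

/-- Angles for which the rotated plane stays within the uniform estimates along the edge. -/
structure SmallAngle (P F : Set E3) (A B n w : E3) (T : Finset (E3 × ℝ)) (t : ℝ) : Prop where
  cos_pos : 0 < Real.cos t
  sin_nonneg : 0 ≤ Real.sin t
  flat : ∀ z ∈ closure (body P F A B T),
      Real.cos t * |(inner ℝ n (z - A) : ℝ)| ≤ Real.sin t * |(inner ℝ w (z - A) : ℝ)| →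
      inner ℝ w (z - A) ≠ (0 : ℝ) →
      ∃ v ∈ F, inner ℝ w (v - A) ≠ (0 : ℝ) ∧ z ∈ star T v
  steep : ∀ y ∈ F \ segment ℝ A B, ∃ u ∈ star T y, u ∈ interior P ∧
      Real.cos t * inner ℝ n (u - A) + Real.sin t * (inner ℝ w (u - A) : ℝ) < 0

lemma tendsto_sin_cos_zero {κ : ℝ} (hκ : 0 < κ) :
    ∀ᶠ t in 𝓝[≥] (0 : ℝ), 0 < Real.cos t ∧ 0 ≤ Real.sin t ∧ Real.sin t ≤ κ * Real.cos t := by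
  have h1 : ∀ᶠ t in 𝓝 (0:ℝ), 0 < Real.cos t :=
    (Real.continuous_cos.tendsto 0).eventually (lt_mem_nhds (by simp))
  have h2 : ∀ᶠ t in 𝓝 (0:ℝ), 0 < κ * Real.cos t - Real.sin t := by
    have hc : Continuous (fun t => κ * Real.cos t - Real.sin t) := by fun_prop
    exact (hc.tendsto 0).eventually (lt_mem_nhds (by simpa using hκ))
  have h3 : ∀ᶠ t in 𝓝 (0:ℝ), t < Real.pi := gt_mem_nhds Real.pi_pos
  filter_upwards [h1.filter_mono nhdsWithin_le_nhds, h2.filter_mono nhdsWithin_le_nhds,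
    h3.filter_mono nhdsWithin_le_nhds, self_mem_nhdsWithin] with t ht1 ht2 ht3 ht4
  exact ⟨ht1, Real.sin_nonneg_of_nonneg_of_le_pi ht4 ht3.le, by linarith⟩

lemma mem_replaced_iff {z ν : E3} (hz : z ∈ region F A B T) :
    z ∈ replaced P F A B T ν ↔ inner ℝ ν (z - A) ≤ 0 ∧ z ∈ body P F A B T := by
  simp [replaced, hz, mem_halfspace]

lemma mem_replaced_of_notMem {z ν : E3} (hz : z ∉ region F A B T) :
    z ∈ replaced P F A B T ν ↔ z ∈ P := by
  have : z ∉ body P F A B T := fun h => hz (body_subset_region h)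
  simp [replaced, hz, this]

variable (D : FaceData P F A B n T)
include D

lemma FaceData.eventually_small (w : E3) :
    ∀ᶠ t in 𝓝[≥] (0 : ℝ), SmallAngle P F A B n w T t := by
  obtain ⟨κ, hκ, h1⟩ := D.exists_star_of_flat w
  obtain ⟨κ', hκ', h2⟩ := D.exists_steep w
  filter_upwards [tendsto_sin_cos_zero hκ, tendsto_sin_cos_zero hκ'] with t ht ht'
  refine ⟨ht.1, ht.2.1, fun z hz hf hw => h1 z hz ?_ hw, fun y hy => ?_⟩
  · have := mul_le_mul_of_nonneg_right ht.2.2 (abs_nonneg (inner ℝ w (z - A) : ℝ))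
    have h3 : Real.cos t * |(inner ℝ n (z - A) : ℝ)|
        ≤ Real.cos t * (κ * |(inner ℝ w (z - A) : ℝ)|) := by linarith
    exact le_of_mul_le_mul_left h3 ht.1
  · obtain ⟨u, hu, hui, h⟩ := h2 y hy
    refine ⟨u, hu, hui, ?_⟩
    have h3 := mul_lt_mul_of_pos_left h ht.1
    have h4 := mul_le_mul_of_nonneg_right ht'.2.2 (abs_nonneg (inner ℝ w (u - A) : ℝ))
    have h5 := mul_le_mul_of_nonneg_left (le_abs_self (inner ℝ w (u - A) : ℝ)) ht'.2.1
    linarith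

lemma FaceData.replaced_self : replaced P F A B T n = P := by
  ext z
  by_cases hz : z ∈ region F A B T
  · rw [mem_replaced_iff hz, D.mem_iff_body hz]
  · rw [mem_replaced_of_notMem hz]

lemma FaceData.sat_replaced (ν : E3) :
    Sat (insert (ν, inner ℝ ν A) T) (replaced P F A B T ν) := by
  have hsub : T ⊆ insert (ν, inner ℝ ν A) T := Finset.subset_insert _ _
  have h1 := D.sat.mono hsub
  have h2 := (sat_region (F := F) (A := A) (B := B) (T := T)).mono hsub
  have h3 := D.sat_body.mono hsub
  have h4 : Sat (insert (ν, inner ℝ ν A) T) (halfspace A ν) :=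
    sat_halfspace (Finset.mem_insert_self _ _)
  rintro z z' hz (⟨a, b⟩ | ⟨a, b⟩)
  · exact Or.inl ⟨h1 z z' hz a, fun h => b (h2 z' z hz.symm h)⟩
  · exact Or.inr ⟨h4 z z' hz a, h3 z z' hz b⟩

/-- Off the region and the edge nothing changes. -/
lemma FaceData.replaced_eventually_eq (hw : RotDir A B n w) {t : ℝ}
    (ht : SmallAngle P F A B n w T t) {z : E3} (hz : z ∉ region F A B T)
    (hzs : z ∉ segment ℝ A B) :
    ∀ᶠ y in 𝓝 z, (y ∈ replaced P F A B T (rotNormal n w t) ↔ y ∈ P) := by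
  set W := closure (body P F A B T) ∩ {z | Real.cos t * |(inner ℝ n (z - A) : ℝ)| ≤
    Real.sin t * |(inner ℝ w (z - A) : ℝ)|} with hW
  have hcl : IsClosed W := isClosed_closure.inter (isClosed_le (by fun_prop) (by fun_prop))
  have hzW : z ∉ W := by
    rintro ⟨h1, h2⟩
    by_cases hw0 : inner ℝ w (z - A) = (0:ℝ)
    · have h3 : inner ℝ n (z - A) = (0:ℝ) := by
        simp only [mem_ofPred_eq, hw0, abs_zero, mul_zero] at h2
        have := abs_nonneg (inner ℝ n (z - A) : ℝ)
        have h4 : |(inner ℝ n (z - A) : ℝ)| = 0 := by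
          by_contra h5
          have := mul_pos ht.cos_pos (lt_of_le_of_ne this (Ne.symm h5))
          linarith
        exact abs_eq_zero.1 h4
      exact hz (mem_region_self ⟨D.closure_body_plane h1 h3, hzs⟩)
    · obtain ⟨v, hv, hvw, hzv⟩ := ht.flat z h1 h2 hw0
      exact hz ⟨v, ⟨hv, fun hs => hvw (hw.seg hs)⟩, hzv⟩
  filter_upwards [hcl.isOpen_compl.mem_nhds hzW] with y hy
  by_cases hyr : y ∈ region F A B T
  · rw [mem_replaced_iff hyr, D.mem_iff_body hyr]
    refine and_congr_left fun hyb => ?_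
    have h1 : ¬ (Real.cos t * |(inner ℝ n (y - A) : ℝ)| ≤
      Real.sin t * |(inner ℝ w (y - A) : ℝ)|) := fun h => hy ⟨subset_closure hyb, h⟩
    rw [not_le] at h1
    rw [inner_rotNormal]
    have h2 : |Real.sin t * (inner ℝ w (y - A) : ℝ)| = Real.sin t * |(inner ℝ w (y - A) : ℝ)| := by
      rw [abs_mul, abs_of_nonneg ht.sin_nonneg]
    rw [← h2] at h1
    obtain ⟨h3, h4⟩ := abs_lt.1 h1
    have h5 := ht.cos_pos
    constructor
    · intro h
      by_contra hcon
      rw [abs_of_pos (not_le.1 hcon)] at h3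
      linarith
    · intro h
      rw [abs_of_nonpos h] at h4
      linarith
  · rw [mem_replaced_of_notMem hyr]

lemma FaceData.notMem_segment_of_facePoint {x : E3} (hf : IsFacePoint P x n) :
    x ∉ segment ℝ A B := by
  intro hx
  rw [← insert_endpoints_openSegment] at hx
  have hx' : x ∈ facePoints P := ⟨n, hf⟩
  rcases hx with rfl | rfl | hx
  · exact D.vertex_left.2.1 hx'
  · exact D.vertex_right.2.1 hx'
  · exact (D.edge hx).2.1 hx'

lemma FaceData.F_subset_closure_body : F ⊆ closure (body P F A B T) := by
  refine D.dense.trans (closure_mono ?_)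
  rintro x ⟨hx, hf⟩
  exact D.F_subset_body ⟨hx, D.notMem_segment_of_facePoint hf⟩

/-- Every point of the closed body on the inner side of the rotated plane is a limit of interior
points of the rotated polyhedron. -/
lemma FaceData.mem_closure_interior_replaced {t : ℝ} (ht : SmallAngle P F A B n w T t) {z : E3}
    (hz : z ∈ closure (body P F A B T)) (hzt : inner ℝ (rotNormal n w t) (z - A) ≤ 0) :
    z ∈ closure (interior (replaced P F A B T (rotNormal n w t))) := by
  obtain ⟨y, hy, h1, h2⟩ := D.closure_body hz
  obtain ⟨u, hu, hui, hut⟩ := ht.steep y hy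
  rw [← inner_rotNormal] at hut
  set O := (star T y ∩ interior P) ∩ {u | inner ℝ (rotNormal n w t) (u - A) < 0} with hO
  have hOo : IsOpen O := ((isOpen_star T y).inter isOpen_interior).inter
    (isOpen_lt (by fun_prop) continuous_const)
  have hmem : ∀ s : ℝ, 0 < s → s ≤ 1 → ∀ u' ∈ O,
      z + s • (u' - z) ∈ replaced P F A B T (rotNormal n w t) := by
    rintro s hs hs1 u' ⟨⟨hu's, hu'i⟩, hu't⟩
    have hst : z + s • (u' - z) ∈ star T y := by
      intro p hp hpy
      rw [ev_add_smul_sub]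
      have k1 := mul_nonneg (sub_nonneg.2 hs1) (h1 p hp hpy)
      have k2 := mul_pos hs (hu's p hp hpy)
      nlinarith
    rw [mem_replaced_iff (star_subset_region hy hst), D.mem_body_iff hy hst]
    constructor
    · have e : z + s • (u' - z) - A = (1 - s) • (z - A) + s • (u' - A) := by module
      rw [e, inner_add_right, inner_smul_right, inner_smul_right]
      have k1 := mul_nonpos_of_nonneg_of_nonpos (sub_nonneg.2 hs1) hzt
      have k2 := mul_neg_of_pos_of_neg hs hu't
      linarith
    · intro ν hν
      have k3 := D.subset_cone hy hu's (interior_subset hu'i) ν hν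
      have e : z + s • (u' - z) - y = (1 - s) • (z - y) + s • (u' - y) := by module
      rw [e, inner_add_right, inner_smul_right, inner_smul_right]
      have k1 := mul_nonpos_of_nonneg_of_nonpos (sub_nonneg.2 hs1) (h2 ν hν)
      have k2 := mul_nonpos_of_nonneg_of_nonpos hs.le k3
      linarith
  refine mem_closure_of_tendsto (b := 𝓝[>] (0:ℝ)) (f := fun s : ℝ => z + s • (u - z))
    ((tendsto_add_smul z (u - z)).mono_left nhdsWithin_le_nhds) ?_
  filter_upwards [Ioc_mem_nhdsGT (zero_lt_one (α := ℝ))] with s hs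
  rw [mem_interior_iff_mem_nhds]
  have hcont : Continuous (fun v : E3 => z + s⁻¹ • (v - z)) := by fun_prop
  have hpre : (fun v : E3 => z + s⁻¹ • (v - z)) ⁻¹' O ∈ 𝓝 (z + s • (u - z)) := by
    refine (hOo.preimage hcont).mem_nhds ?_
    simp only [mem_preimage, add_sub_cancel_left, smul_smul, inv_mul_cancel₀ hs.1.ne', one_smul]
    rw [add_sub_cancel]
    exact ⟨⟨hu, hui⟩, hut⟩
  filter_upwards [hpre] with v hv
  have := hmem s hs.1 hs.2 _ hv
  rwa [add_sub_cancel_left, smul_smul, mul_inv_cancel₀ hs.1.ne', one_smul, add_sub_cancel] at this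

lemma FaceData.isClosed_replaced (hw : RotDir A B n w) {t : ℝ}
    (ht : SmallAngle P F A B n w T t) : IsClosed (replaced P F A B T (rotNormal n w t)) := by
  rw [← closure_subset_iff_isClosed]
  intro z hz
  by_cases hzr : z ∈ region F A B T
  · have h1 : z ∈ closure (halfspace A (rotNormal n w t) ∩ body P F A B T) := by
      have h2 : z ∈ closure (region F A B T ∩ replaced P F A B T (rotNormal n w t)) :=
        isOpen_region.inter_closure ⟨hzr, hz⟩
      refine closure_mono ?_ h2
      rintro x ⟨hx, hx'⟩
      exact (mem_replaced_iff hx).1 hx'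
    have h2 := closure_inter_subset_inter_closure _ _ h1
    rw [(isClosed_halfspace _ _).closure_eq] at h2
    rw [mem_replaced_iff hzr]
    refine ⟨h2.1, ?_⟩
    rw [← D.closure_body_inter]
    exact ⟨h2.2, hzr⟩
  · rw [mem_replaced_of_notMem hzr]
    by_cases hzs : z ∈ segment ℝ A B
    · exact D.sub_P (D.seg_sub hzs)
    · have h1 := D.replaced_eventually_eq hw ht hzr hzs
      rw [← D.isClosed.closure_eq, mem_closure_iff_frequently]
      rw [mem_closure_iff_frequently] at hz
      exact (hz.and_eventually h1).mono fun y hy => hy.2.1 hy.1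

lemma FaceData.body_bounded : ∃ R : ℝ, ∀ z ∈ body P F A B T, ‖z‖ ≤ R := by
  obtain ⟨R, hR⟩ := D.bdd
  exact ⟨R, fun z ⟨y, hy, hz, _⟩ => hR y (D.sub_P hy.1) z hz⟩

lemma FaceData.regular_replaced (hw : RotDir A B n w) {t : ℝ}
    (ht : SmallAngle P F A B n w T t) :
    closure (interior (replaced P F A B T (rotNormal n w t)))
      = replaced P F A B T (rotNormal n w t) := by
  refine Subset.antisymm (closure_minimal interior_subset (D.isClosed_replaced hw ht)) ?_
  intro z hz
  by_cases hzr : z ∈ region F A B T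
  · obtain ⟨h1, h2⟩ := (mem_replaced_iff hzr).1 hz
    exact D.mem_closure_interior_replaced ht (subset_closure h2) h1
  · by_cases hzs : z ∈ segment ℝ A B
    · refine D.mem_closure_interior_replaced ht (D.F_subset_closure_body (D.seg_sub hzs)) ?_
      rw [inner_rotNormal, hw.seg hzs, D.sub_plane z (D.seg_sub hzs)]
      simp
    · rw [mem_replaced_of_notMem hzr] at hz
      have h1 := D.replaced_eventually_eq hw ht hzr hzs
      have hzc : z ∈ closure (interior P) := by rwa [D.regular]
      rw [mem_closure_iff_frequently] at hzc ⊢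
      refine (hzc.and_eventually (eventually_eventually_nhds.2 h1)).mono fun y hy => ?_
      rw [mem_interior_iff_mem_nhds]
      filter_upwards [hy.2, mem_interior_iff_mem_nhds.1 hy.1] with x hx hx'
      exact hx.2 hx'

lemma FaceData.isPolyhedron_replaced (hw : RotDir A B n w) {t : ℝ}
    (ht : SmallAngle P F A B n w T t) :
    IsPolyhedron (replaced P F A B T (rotNormal n w t)) where
  nonempty := by
    refine ⟨A, ?_⟩
    have hA : A ∈ segment ℝ A B := left_mem_segment ℝ A B
    rw [← D.regular_replaced hw ht]
    refine D.mem_closure_interior_replaced ht (D.F_subset_closure_body (D.seg_sub hA)) ?_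
    simp
  compact := by
    obtain ⟨R, hR⟩ := D.body_bounded
    refine Metric.isCompact_of_isClosed_isBounded (D.isClosed_replaced hw ht) ?_
    refine (D.compact.isBounded.union ((Metric.isBounded_closedBall (x := (0:E3))
      (r := R)).subset fun z hz => ?_)).subset
      (union_subset_union sdiff_subset inter_subset_right)
    rw [mem_closedBall_zero_iff]; exact hR z hz
  regular := D.regular_replaced hw ht
  planes := by
    refine ⟨insert (rotNormal n w t, inner ℝ (rotNormal n w t) A) T, ?_, fun y hy => ?_⟩
    · intro p hp
      rcases Finset.mem_insert.1 hp with rfl | hp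
      · intro h
        have := hw.norm_rot D.norm_n t
        simp only at h
        rw [h, norm_zero] at this
        exact zero_ne_one this
      · exact D.nz p hp
    · obtain ⟨p, hp, hpy⟩ := (D.sat_replaced _).frontier hy
      exact ⟨p, hp, sub_eq_zero.1 hpy⟩

/-- The rotation of the face, for small angles. -/
lemma FaceData.isFaceRotation (hw : RotDir A B n w) {ε : ℝ}
    (hε : ∀ t ∈ Icc 0 ε, SmallAngle P F A B n w T t) :
    IsFaceRotation P F A B ε (fun t => replaced P F A B T (rotNormal n w t)) := by
  refine ⟨?_, fun t ht => D.isPolyhedron_replaced hw (hε t ht), n, w,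
    {U | ∃ y ∈ F \ segment ℝ A B, U = star T y}, ?_, hw.norm_w, hw.orth_n, hw.orth_AB, ?_, ?_, ?_⟩
  · simp only [rotNormal, Real.cos_zero, Real.sin_zero, one_smul, zero_smul, add_zero]
    exact D.replaced_self
  · obtain ⟨x, -, hx, hf⟩ := D.exists_facePoint (D.seg_sub (left_mem_segment ℝ A B)) univ_mem
    exact ⟨x, hx, hf⟩
  · rintro U ⟨y, hy, rfl⟩
    exact ⟨isOpen_star T y, Melzak.convex_star T y, y, self_mem_star T y, hy.1⟩
  · intro y hy
    exact ⟨_, ⟨y, hy, rfl⟩, self_mem_star T y⟩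
  · intro t _
    have hU : ⋃₀ {U | ∃ y ∈ F \ segment ℝ A B, U = star T y} = region F A B T := by
      ext z
      simp only [mem_sUnion, mem_ofPred_eq, region]
      exact ⟨fun ⟨_, ⟨y, hy, rfl⟩, hz⟩ => ⟨y, hy, hz⟩, fun ⟨y, hy, hz⟩ => ⟨_, ⟨y, hy, rfl⟩, hz⟩⟩
    refine ⟨?_, ?_⟩
    · rintro U ⟨y, hy, rfl⟩
      ext z
      simp only [mem_inter_iff]
      refine and_congr_left fun hz => ?_
      rw [mem_replaced_iff (star_subset_region hy hz), D.mem_otherHalfspaces,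
        D.mem_body_iff hy hz, mem_halfspace]
      rfl
    · rw [hU]
      ext z
      simp only [Set.mem_sdiff]
      refine and_congr_left fun hz => ?_
      exact mem_replaced_of_notMem hz

end

end

section

/-! ### Faces of a polyhedron and convexity along a face -/

/-- `P` is convex in some neighbourhood of `y`. -/
def LocConvex (P : Set E3) (y : E3) : Prop := ∃ U ∈ 𝓝 y, Convex ℝ (P ∩ U)

section
variable {P : Set E3}

lemma LocConvex.ball {y : E3} (h : LocConvex P y) :
    ∃ r > 0, ∀ r' ≤ r, Convex ℝ (P ∩ Metric.ball y r') := by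
  obtain ⟨U, hU, hc⟩ := h
  obtain ⟨r, hr, hrU⟩ := Metric.mem_nhds_iff.1 hU
  refine ⟨r, hr, fun r' hr' => ?_⟩
  have e : P ∩ Metric.ball y r' = (P ∩ U) ∩ Metric.ball y r' := by
    ext z
    simp only [mem_inter_iff]
    exact ⟨fun h => ⟨⟨h.1, hrU (Metric.ball_subset_ball hr' h.2)⟩, h.2⟩, fun h => ⟨h.1.1, h.2⟩⟩
  rw [e]
  exact hc.inter (convex_ball y r')

lemma isOpen_locConvex : IsOpen {y | LocConvex P y} := by
  rw [isOpen_iff_mem_nhds]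
  rintro y ⟨U, hU, hc⟩
  filter_upwards [eventually_mem_nhds_iff.2 hU] with z hz using ⟨U, hz, hc⟩

lemma convex_halfspace (x ν : E3) : Convex ℝ (halfspace x ν) := by
  intro a ha b hb s t hs ht hst
  rw [mem_halfspace] at *
  have : s • a + t • b - x = s • (a - x) + t • (b - x) := by
    have : t = 1 - s := by linarith
    subst this; module
  rw [this, inner_add_right, inner_smul_right, inner_smul_right]
  have := mul_nonpos_of_nonneg_of_nonpos hs ha
  have := mul_nonpos_of_nonneg_of_nonpos ht hb
  linarith

lemma IsFacePoint.locConvex {x ν : E3} (h : IsFacePoint P x ν) : LocConvex P x := by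
  obtain ⟨r, hr, hr'⟩ := Metric.eventually_nhds_iff_ball.1 h.2
  refine ⟨Metric.ball x r, Metric.ball_mem_nhds x hr, ?_⟩
  have e : P ∩ Metric.ball x r = halfspace x ν ∩ Metric.ball x r := by
    ext z
    simp only [mem_inter_iff]
    exact and_congr_left fun hz => hr' z hz
  rw [e]
  exact (convex_halfspace x ν).inter (convex_ball x r)

/-- Two face points have the same face plane. -/
def SamePlane (P : Set E3) (x y : E3) : Prop :=
  ∃ ν, IsFacePoint P x ν ∧ IsFacePoint P y ν ∧ inner ℝ ν (y - x) = (0 : ℝ)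

lemma samePlane_of_component {x y : E3} (hx : x ∈ facePoints P)
    (hy : y ∈ connectedComponentIn (facePoints P) x) : SamePlane P x y := by
  refine (isPreconnected_connectedComponentIn (F := facePoints P) (x := x)).induction₂
    (SamePlane P) ?_ ?_ ?_ (mem_connectedComponentIn hx) hy
  · intro z hz
    obtain ⟨ν, hν⟩ := connectedComponentIn_subset _ _ hz
    filter_upwards [hν.frontier_plane.filter_mono nhdsWithin_le_nhds,
      hν.nearby.filter_mono nhdsWithin_le_nhds, self_mem_nhdsWithin] with z' h1 h2 h3
    obtain ⟨ν', hν'⟩ := connectedComponentIn_subset _ _ h3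
    have h0 := h1 hν'.frontier
    exact ⟨ν, hν, h2 h0, h0⟩
  · rintro a b c ha hb hc ⟨ν, h1, h2, h3⟩ ⟨ν', h1', h2', h3'⟩
    obtain rfl := h2.unique h1'
    refine ⟨ν, h1, h2', ?_⟩
    have : c - a = (c - b) + (b - a) := by abel
    rw [this, inner_add_right, h3, h3', add_zero]
  · rintro a b ha hb ⟨ν, h1, h2, h3⟩
    exact ⟨ν, h2, h1, by rw [← neg_sub, inner_neg_right, h3, neg_zero]⟩

lemma component_of_segment {x y z : E3} (hy : y ∈ connectedComponentIn (facePoints P) x)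
    (h : segment ℝ y z ⊆ facePoints P) : z ∈ connectedComponentIn (facePoints P) x := by
  rw [connectedComponentIn_eq hy]
  exact (convex_segment (𝕜 := ℝ) y z).isPreconnected.subset_connectedComponentIn
    (left_mem_segment ℝ y z) h (right_mem_segment ℝ y z)

lemma component_of_closure {x y ν : E3} (hy : y ∈ closure (connectedComponentIn (facePoints P) x))
    (hν : IsFacePoint P y ν) : y ∈ connectedComponentIn (facePoints P) x := by
  obtain ⟨r, hr, hr'⟩ := Metric.eventually_nhds_iff_ball.1 (hν.nearby.and hν.frontier_plane)
  obtain ⟨z, hz, hzc⟩ := mem_closure_iff_nhds.1 hy _ (Metric.ball_mem_nhds y hr)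
  obtain ⟨ν', hν'⟩ := connectedComponentIn_subset _ _ hzc
  have h0 := (hr' z hz).2 hν'.frontier
  refine component_of_segment hzc fun v hv => ⟨ν, (hr' v ?_).1 ?_⟩
  · exact (convex_ball y r).segment_subset hz (Metric.mem_ball_self hr) hv
  · obtain ⟨a, b, ha, hb, hab, rfl⟩ := hv
    have : a • z + b • y - y = a • (z - y) := by
      have : b = 1 - a := by linarith
      subst this; module
    rw [this, inner_smul_right, h0, mul_zero]

/-- The union of a component of face points is invariant under small translations along the edge
direction at a point of its closure. -/
lemma closure_component_translate {x C u : E3} {δ : ℝ}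
    (hC : C ∈ closure (connectedComponentIn (facePoints P) x))
    (hδ : ∀ q ∈ Metric.ball C δ, ∀ s : ℝ, |s| < δ → (q + s • u ∈ P ↔ q ∈ P))
    {s : ℝ} (hs : |s| < δ) :
    C + s • u ∈ closure (connectedComponentIn (facePoints P) x) := by
  have hpos : 0 < δ := (abs_nonneg s).trans_lt hs
  have hcont : Continuous (fun q : E3 => q + s • u) := by fun_prop
  have hC' : C ∈ closure (connectedComponentIn (facePoints P) x ∩ Metric.ball C δ) := by
    rw [inter_comm]
    exact Metric.isOpen_ball.inter_closure ⟨Metric.mem_ball_self hpos, hC⟩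
  have him : (fun q : E3 => q + s • u) C ∈ closure ((fun q : E3 => q + s • u) ''
      (connectedComponentIn (facePoints P) x ∩ Metric.ball C δ)) :=
    mem_closure_image hcont.continuousAt hC'
  refine closure_mono ?_ him
  · rintro _ ⟨y, ⟨hy, hyb⟩, rfl⟩
    obtain ⟨ν, hν⟩ := connectedComponentIn_subset _ _ hy
    refine component_of_segment hy fun v hv => ⟨ν, ?_⟩
    obtain ⟨a, b, ha, hb, hab, rfl⟩ := hv
    have e : a • y + b • (y + s • u) = y + (b * s) • u := by
      have : b = 1 - a := by linarith
      subst this; module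
    simp only [e]
    refine ⟨hν.1, ?_⟩
    have hbs : |b * s| < δ := by
      rw [abs_mul, abs_of_nonneg hb]
      have : b ≤ 1 := by linarith
      nlinarith [abs_nonneg s]
    have hlim : Tendsto (fun z : E3 => z - (b * s) • u) (𝓝 (y + (b * s) • u)) (𝓝 y) := by
      have : Continuous (fun z : E3 => z - (b * s) • u) := by fun_prop
      simpa using this.tendsto (y + (b * s) • u)
    filter_upwards [hlim.eventually hν.2,
      hlim.eventually (Metric.isOpen_ball.mem_nhds hyb)] with z hz hzb
    have := hδ _ hzb (b * s) hbs
    rw [sub_add_cancel] at this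
    rw [this, hz, mem_halfspace, mem_halfspace, sub_sub, add_comm y]

lemma LocConvex.translate {C u : E3} {δ s : ℝ}
    (hδ : ∀ q ∈ Metric.ball C δ, ∀ s : ℝ, |s| < δ → (q + s • u ∈ P ↔ q ∈ P)) (hs : |s| < δ)
    (h : LocConvex P (C + s • u)) : LocConvex P C := by
  obtain ⟨r, hr, hr'⟩ := h.ball
  have hpos : 0 < δ := (abs_nonneg s).trans_lt hs
  refine ⟨Metric.ball C (min r δ), Metric.ball_mem_nhds C (lt_min hr hpos), ?_⟩
  have hc := hr' (min r δ) (min_le_left _ _)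
  have e : P ∩ Metric.ball C (min r δ) =
      (fun q => q + s • u) ⁻¹' (P ∩ Metric.ball (C + s • u) (min r δ)) := by
    ext q
    have h1 : q + s • u ∈ Metric.ball (C + s • u) (min r δ) ↔ q ∈ Metric.ball C (min r δ) := by
      simp [Metric.mem_ball, dist_add_right]
    simp only [mem_inter_iff, mem_preimage, h1]
    refine and_congr_left fun hq => ?_
    exact (hδ q (Metric.ball_subset_ball (min_le_right _ _) hq) s hs).symm
  rw [e]
  exact hc.translate_preimage_left (s • u)

lemma exists_ball_separating {A B y : E3} (hy : y ∉ segment ℝ A B) :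
    ∃ c : E3, ‖A - c‖ < ‖y - c‖ ∧ ‖B - c‖ < ‖y - c‖ := by
  have hcl : IsClosed (segment ℝ A B) := by
    rw [← closure_openSegment]; exact isClosed_closure
  obtain ⟨f, u, h1, h2⟩ := geometric_hahn_banach_closed_point (convex_segment A B) hcl hy
  obtain ⟨g, hg⟩ : ∃ g : E3, ∀ z, f z = (inner ℝ g z : ℝ) :=
    ⟨(InnerProductSpace.toDual ℝ E3).symm f, fun z => by simp⟩
  have hpos : 0 < f y - u := by linarith
  set R := (‖A‖ ^ 2 + ‖B‖ ^ 2 + 1) / (f y - u) with hR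
  have hR' : R * (f y - u) = ‖A‖ ^ 2 + ‖B‖ ^ 2 + 1 := by rw [hR]; field_simp
  have hRpos : 0 < R := by positivity
  have key : ∀ z : E3, f z < u → ‖z‖ ^ 2 ≤ ‖A‖ ^ 2 + ‖B‖ ^ 2 →
      ‖z - (-R) • g‖ < ‖y - (-R) • g‖ := by
    intro z hz hz2
    refine lt_of_pow_lt_pow_left₀ 2 (norm_nonneg _) ?_
    rw [norm_sub_sq_real, norm_sub_sq_real, inner_smul_right, inner_smul_right,
      real_inner_comm g z, real_inner_comm g y, ← hg, ← hg]
    nlinarith [sq_nonneg ‖y‖, mul_pos hRpos (sub_pos.2 hz)]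
  exact ⟨(-R) • g, key A (h1 A (left_mem_segment ℝ A B)) (by nlinarith [sq_nonneg ‖B‖]),
    key B (h1 B (right_mem_segment ℝ A B)) (by nlinarith [sq_nonneg ‖A‖])⟩

/-- A closed face all of whose vertices other than `A` and `B` are exposed has `P` locally convex
at all of its points off the segment `AB`. Otherwise, for a ball that contains `A` and `B` but not
all bad points, the bad point farthest from its centre is neither `A` nor `B`. It is neither an
exposed vertex, nor a face point, nor an edge point, since bad points extend in both directions
along an edge. -/
lemma locConvex_of_exposed {F : Set E3} (hF : IsFace P F) (hFc : IsCompact F)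
    (hFP : F ⊆ frontier P) {A B : E3}
    (hexp : ∀ C ∈ vertices P ∩ F, C ≠ A → C ≠ B → IsExposed P C) {y : E3}
    (hy : y ∈ F \ segment ℝ A B) : LocConvex P y := by
  by_contra hbad
  set Z := F ∩ {y | LocConvex P y}ᶜ with hZ
  have hZc : IsCompact Z := hFc.inter_right isOpen_locConvex.isClosed_compl
  have hyZ : y ∈ Z := ⟨hy.1, hbad⟩
  obtain ⟨c, hcA, hcB⟩ := exists_ball_separating hy.2
  obtain ⟨C, hCZ, hmax⟩ := hZc.exists_isMaxOn ⟨y, hyZ⟩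
    (f := fun z => ‖z - c‖) (by fun_prop)
  have hmax : ∀ z ∈ Z, ‖z - c‖ ≤ ‖C - c‖ := fun z hz => hmax hz
  have hCA : C ≠ A := fun h => by have := hmax y hyZ; rw [h] at this; linarith
  have hCB : C ≠ B := fun h => by have := hmax y hyZ; rw [h] at this; linarith
  by_cases hface : C ∈ facePoints P
  · obtain ⟨ν, hν⟩ := hface
    exact hCZ.2 hν.locConvex
  by_cases hedge : C ∈ edgePoints P
  · obtain ⟨-, -, u, hu, hinv⟩ := hedge
    obtain ⟨δ, hδ, hball⟩ := Metric.eventually_nhds_iff_ball.1 hinv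
    have hδ' : ∀ q ∈ Metric.ball C δ, ∀ s : ℝ, |s| < δ → (q + s • u ∈ P ↔ q ∈ P) := by
      intro q hq s hs
      refine hball (q, s) ?_
      rw [Metric.mem_ball, Prod.dist_eq]
      exact max_lt hq (by simpa [Real.dist_eq] using hs)
    obtain ⟨x, hx, rfl⟩ := hF
    have hmem : ∀ s : ℝ, |s| < δ → C + s • u ∈ Z := fun s hs =>
      ⟨closure_component_translate hCZ.1 hδ' hs, fun h => hCZ.2 (h.translate hδ' hs)⟩
    have h1 := hmem (δ / 2) (by rw [abs_of_pos (by positivity)]; linarith)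
    have h2 := hmem (-(δ / 2)) (by rw [abs_neg, abs_of_pos (by positivity)]; linarith)
    have h3 := hmax _ h1
    have h4 := hmax _ h2
    have e1 : C + (δ / 2) • u - c = (C - c) + (δ / 2) • u := by abel
    have e2 : C + (-(δ / 2)) • u - c = (C - c) - (δ / 2) • u := by module
    rw [e1] at h3
    rw [e2] at h4
    have h5 := parallelogram_law_with_norm ℝ (C - c) ((δ / 2) • u)
    have h6 : ‖(δ / 2) • u‖ = δ / 2 := by
      rw [norm_smul, hu, mul_one, Real.norm_eq_abs, abs_of_pos (by positivity)]
    rw [h6] at h5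
    have h7 := mul_self_le_mul_self (norm_nonneg _) h3
    have h8 := mul_self_le_mul_self (norm_nonneg _) h4
    nlinarith
  · obtain ⟨U, hU, hCU, hc⟩ := hexp C ⟨⟨hFP hCZ.1, hface, hedge⟩, hCZ.1⟩ hCA hCB
    exact hCZ.2 ⟨U, hU.mem_nhds hCU, by rwa [inter_comm]⟩

/-- A face all of whose vertices other than `A` and `B` are exposed has the properties on which the
construction of the rotated polyhedron is based. -/
theorem exists_faceData {F : Set E3} (hP : IsPolyhedron P) (hF : IsFace P F) {A B : E3}
    (hAB : IsFaceEdge P F A B)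
    (hexp : ∀ C ∈ vertices P ∩ F, C ≠ A → C ≠ B → IsExposed P C) :
    ∃ n T, FaceData P F A B n T := by
  classical
  have hF' := hF
  obtain ⟨x0, hx0, rfl⟩ := hF
  obtain ⟨n, hn⟩ := hx0
  set K := connectedComponentIn (facePoints P) x0 with hK
  have hcl := hP.compact.isClosed
  have hKn : ∀ y ∈ K, IsFacePoint P y n ∧ inner ℝ n (y - x0) = (0:ℝ) := by
    intro y hy
    obtain ⟨ν, h1, h2, h3⟩ := samePlane_of_component ⟨n, hn⟩ hy
    obtain rfl := h1.unique hn
    exact ⟨h2, h3⟩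
  have hplane0 : ∀ z ∈ closure K, inner ℝ n (z - x0) = (0:ℝ) := by
    intro z hz
    have hc : IsClosed {z : E3 | (inner ℝ n (z - x0) : ℝ) = 0} :=
      isClosed_eq (by fun_prop) continuous_const
    exact closure_minimal (fun y hy => (hKn y hy).2) hc hz
  have hplane : ∀ z ∈ closure K, inner ℝ n (z - A) = (0:ℝ) := by
    intro z hz
    have e : z - A = (z - x0) - (A - x0) := by abel
    rw [e, inner_sub_right, hplane0 z hz, hplane0 A hAB.left.2, sub_zero]
  have hfr : closure K ⊆ frontier P :=
    closure_minimal (fun y hy => (hKn y hy).1.frontier) isClosed_frontier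
  have hsubP : closure K ⊆ P := fun z hz => hcl.frontier_subset (hfr hz)
  have hFc : IsCompact (closure K) := hP.compact.of_isClosed_subset isClosed_closure hsubP
  obtain ⟨S, hS, hSf⟩ := hP.planes
  obtain ⟨R0, hR0⟩ := hP.compact.isBounded.exists_norm_le
  set R := |R0| + 1 with hR
  have hRpos : 0 < R := by positivity
  have hcoord : ∀ y ∈ P, ∀ i, |y i| < R := fun y hy i => by
    have h1 := PiLp.norm_apply_le y i
    have h2 := hR0 y hy
    have h3 := le_abs_self R0
    rw [Real.norm_eq_abs] at h1
    linarith
  let bx : Finset (E3 × ℝ) :=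
    (Finset.univ.image fun i : Fin 3 => ((EuclideanSpace.single i 1 : E3), R)) ∪
    (Finset.univ.image fun i : Fin 3 => ((EuclideanSpace.single i 1 : E3), -R))
  have hev : ∀ (i : Fin 3) (c : ℝ) (z : E3), ev ((EuclideanSpace.single i 1 : E3), c) z = z i - c :=
    fun i c z => by simp [ev, EuclideanSpace.inner_single_left]
  have hnz : ∀ p ∈ insert (n, (inner ℝ n A : ℝ)) (S ∪ bx), p.1 ≠ 0 := by
    intro p hp
    rcases Finset.mem_insert.1 hp with rfl | hp
    · intro h
      have h1 := hn.1
      simp only at h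
      rw [h, norm_zero] at h1; exact zero_ne_one h1
    rcases Finset.mem_union.1 hp with hp | hp
    · exact hS p hp
    · simp only [bx, Finset.mem_union, Finset.mem_image, Finset.mem_univ, true_and] at hp
      rcases hp with ⟨i, rfl⟩ | ⟨i, rfl⟩ <;> simp
  refine ⟨n, insert (n, inner ℝ n A) (S ∪ bx), ?_⟩
  have hsegF : segment ℝ A B ⊆ closure K := by
    rw [← insert_endpoints_openSegment]
    rintro z (rfl | rfl | hz)
    · exact hAB.left.2
    · exact hAB.right.2
    · exact (hAB.seg hz).2
  refine
    { nz := hnz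
      sat := sat_of_regular hnz hP.regular fun y hy => ?_
      compact := hP.compact
      regular := hP.regular
      base := Finset.mem_insert_self _ _
      norm_n := hn.1
      bdd := ⟨2 * R, fun y hy z hz => ?_⟩
      closed_F := isClosed_closure
      sub_P := hsubP
      sub_plane := hplane
      dense := closure_mono fun y hy => ⟨subset_closure hy, (hKn y hy).1⟩
      normal := fun x hx ν hν => ?_
      propagate := fun x hx z h => ?_
      ne := hAB.ne
      seg_sub := hsegF
      edge := fun z hz => (hAB.seg hz).1
      vertex_left := hAB.left.1
      vertex_right := hAB.right.1
      convex := fun y hy => locConvex_of_exposed hF' hFc hfr hexp hy }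
  · obtain ⟨p, hp, hpy⟩ := hSf y hy
    exact ⟨p, Finset.mem_insert_of_mem (Finset.mem_union_left _ hp), sub_eq_zero.2 hpy⟩
  · have hzi : ∀ i, |z i| ≤ R := by
      intro i
      obtain ⟨h1, h2⟩ := abs_lt.1 (hcoord y hy i)
      have k1 := hz ((EuclideanSpace.single i 1 : E3), R) (Finset.mem_insert_of_mem
        (Finset.mem_union_right _ (Finset.mem_union_left _
          (Finset.mem_image_of_mem _ (Finset.mem_univ i)))))
      have k2 := hz ((EuclideanSpace.single i 1 : E3), -R) (Finset.mem_insert_of_mem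
        (Finset.mem_union_right _ (Finset.mem_union_right _
          (Finset.mem_image_of_mem _ (Finset.mem_univ i)))))
      rw [hev, hev] at k1 k2
      have k1 := k1 (by linarith)
      have k2 := k2 (by linarith)
      rw [abs_le]
      constructor
      · by_contra hc
        have := mul_neg_of_pos_of_neg (show 0 < y i - -R by linarith) (show z i - -R < 0 by linarith)
        linarith
      · by_contra hc
        have := mul_neg_of_neg_of_pos (show y i - R < 0 by linarith) (show 0 < z i - R by linarith)
        linarith
    have h3 : ‖z‖ ^ 2 ≤ (2 * R) ^ 2 := by
      rw [EuclideanSpace.norm_sq_eq, Fin.sum_univ_three]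
      have hs : ∀ i, ‖z i‖ ^ 2 ≤ R ^ 2 := fun i => by
        rw [Real.norm_eq_abs]
        exact pow_le_pow_left₀ (abs_nonneg _) (hzi i) 2
      nlinarith [hs 0, hs 1, hs 2, sq_nonneg R]
    exact le_of_sq_le_sq h3 (by positivity)
  · have h1 := component_of_closure hx hν
    exact hν.unique (hKn x h1).1
  · have hxf : IsFacePoint P x n := by simpa using h 0 ⟨le_rfl, one_pos⟩
    have hxK := component_of_closure hx hxf
    have hlim : Tendsto (fun s : ℝ => x + s • (z - x)) (𝓝[<] 1) (𝓝 z) := by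
      have : Continuous (fun s : ℝ => x + s • (z - x)) := by fun_prop
      simpa using (this.tendsto 1).mono_left nhdsWithin_le_nhds
    refine isClosed_closure.mem_of_tendsto hlim ?_
    filter_upwards [Ioo_mem_nhdsLT (zero_lt_one (α := ℝ))] with s hs
    refine subset_closure (component_of_segment hxK fun v hv => ?_)
    obtain ⟨a, b, ha, hb, hab, rfl⟩ := hv
    have e : a • x + b • (x + s • (z - x)) = x + (b * s) • (z - x) := by
      have : b = 1 - a := by linarith
      subst this; module
    rw [e]
    have hb1 : b ≤ 1 := by linarith
    exact ⟨n, h _ ⟨mul_nonneg hb hs.1.le, by nlinarith [hs.1, hs.2]⟩⟩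

end

end

section

/-! ### Orthonormal frames -/

/-- `a`, `b`, `c` form an orthonormal basis of space. -/
structure Frame (a b c : E3) : Prop where
  na : ‖a‖ = 1
  nb : ‖b‖ = 1
  nc : ‖c‖ = 1
  ab : inner ℝ a b = (0 : ℝ)
  ac : inner ℝ a c = (0 : ℝ)
  bc : inner ℝ b c = (0 : ℝ)

lemma exists_unit_orthogonal (a b : E3) :
    ∃ c : E3, ‖c‖ = 1 ∧ inner ℝ a c = (0 : ℝ) ∧ inner ℝ b c = (0 : ℝ) := by
  classical
  set K := Submodule.span ℝ ({a, b} : Set E3) with hK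
  have h1 : Module.finrank ℝ K ≤ 2 := by
    have h := finrank_span_finset_le_card (R := ℝ) ({a, b} : Finset E3)
    rw [Finset.coe_pair] at h
    exact h.trans Finset.card_le_two
  have h2 : Module.finrank ℝ K + Module.finrank ℝ Kᗮ = 3 := by
    rw [Submodule.finrank_add_finrank_orthogonal]; simp
  obtain ⟨v, hv, hv0⟩ := (Submodule.ne_bot_iff Kᗮ).1 fun h => by
    rw [h, finrank_bot] at h2; omega
  have ha : inner ℝ a v = (0 : ℝ) := hv a (Submodule.subset_span (by simp))
  have hb : inner ℝ b v = (0 : ℝ) := hv b (Submodule.subset_span (by simp))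
  refine ⟨(‖v‖)⁻¹ • v, ?_, by rw [inner_smul_right, ha, mul_zero],
    by rw [inner_smul_right, hb, mul_zero]⟩
  rw [norm_smul, norm_inv, norm_norm, inv_mul_cancel₀ (norm_ne_zero_iff.2 hv0)]

lemma exists_frame {a b : E3} (ha : ‖a‖ = 1) (hb : ‖b‖ = 1) (hab : inner ℝ a b = (0 : ℝ)) :
    ∃ c, Frame a b c := by
  obtain ⟨c, hc, h1, h2⟩ := exists_unit_orthogonal a b
  exact ⟨c, ha, hb, hc, hab, h1, h2⟩

section
variable {a b c : E3} (f : Frame a b c)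
include f

lemma Frame.rotate : Frame b c a :=
  ⟨f.nb, f.nc, f.na, f.bc, by rw [real_inner_comm]; exact f.ab, by rw [real_inner_comm]; exact f.ac⟩

lemma Frame.neg_last : Frame a b (-c) :=
  ⟨f.na, f.nb, by rw [norm_neg, f.nc], f.ab, by rw [inner_neg_right, f.ac, neg_zero],
    by rw [inner_neg_right, f.bc, neg_zero]⟩

lemma Frame.orthonormal : Orthonormal ℝ ![a, b, c] := by
  have h1 := f.ab
  have h2 := f.ac
  have h3 := f.bc
  constructor
  · intro i
    fin_cases i
    exacts [f.na, f.nb, f.nc]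
  · intro i j hij
    fin_cases i <;> fin_cases j <;>
      first
        | exact absurd rfl hij
        | assumption
        | (rw [real_inner_comm]; assumption)

/-- The frame as an orthonormal basis. -/
def Frame.basis : OrthonormalBasis (Fin 3) ℝ E3 :=
  (basisOfOrthonormalOfCardEqFinrank f.orthonormal (by simp)).toOrthonormalBasis
    (by rw [coe_basisOfOrthonormalOfCardEqFinrank]; exact f.orthonormal)

lemma Frame.coe_basis : ⇑f.basis = ![a, b, c] := by
  simp [Frame.basis]

lemma Frame.expand (x : E3) :
    x = (inner ℝ a x : ℝ) • a + (inner ℝ b x : ℝ) • b + (inner ℝ c x : ℝ) • c := by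
  have h := f.basis.sum_repr' x
  rw [f.coe_basis, Fin.sum_univ_three] at h
  exact h.symm

lemma Frame.inner_eq (x y : E3) : (inner ℝ x y : ℝ) =
    inner ℝ a x * inner ℝ a y + inner ℝ b x * inner ℝ b y + inner ℝ c x * (inner ℝ c y : ℝ) := by
  conv_lhs => rw [f.expand x]
  simp only [inner_add_left, inner_smul_left, conj_trivial]

lemma Frame.ext {x y : E3} (h1 : inner ℝ a x = (inner ℝ a y : ℝ))
    (h2 : inner ℝ b x = (inner ℝ b y : ℝ)) (h3 : inner ℝ c x = (inner ℝ c y : ℝ)) : x = y := by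
  rw [f.expand x, f.expand y, h1, h2, h3]

end

/-- Two non-parallel vectors have a common perpendicular, completed to a frame with the first. -/
lemma exists_frame_axis {ν : E3} (hν : ‖ν‖ = 1) (ν' : E3) :
    ∃ f e, Frame ν f e ∧ inner ℝ ν' f = (0 : ℝ) := by
  obtain ⟨f, hf, h1, h2⟩ := exists_unit_orthogonal ν ν'
  obtain ⟨e, he⟩ := exists_frame hν hf h1
  exact ⟨f, e, he, h2⟩

lemma Frame.axis {ν f e ν' : E3} (fr : Frame ν f e) (h : inner ℝ ν' f = (0 : ℝ))
    (hpar : ∀ c : ℝ, ν' ≠ c • ν) {x : E3} (h1 : inner ℝ ν x = (0 : ℝ))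
    (h2 : inner ℝ ν' x = (0 : ℝ)) : x = (inner ℝ f x : ℝ) • f := by
  have h3 := fr.inner_eq ν' x
  rw [h1, h2, real_inner_comm ν' f, h] at h3
  have h4 : inner ℝ e ν' ≠ (0 : ℝ) := fun h0 => by
    have := fr.expand ν'
    rw [h0, real_inner_comm ν' f, h, zero_smul, zero_smul, add_zero, add_zero] at this
    exact hpar _ this
  have h5 : inner ℝ e x = (0 : ℝ) := by
    have : (inner ℝ e ν' : ℝ) * inner ℝ e x = 0 := by linarith
    exact (mul_eq_zero.1 this).resolve_left h4
  have h6 := fr.expand x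
  rwa [h1, h5, zero_smul, zero_smul, add_zero, zero_add] at h6

lemma exists_rotDir (A B n : E3) :
    ∃ w, RotDir A B n w := by
  obtain ⟨w, hw, h1, h2⟩ := exists_unit_orthogonal n (B - A)
  exact ⟨w, hw, by rw [real_inner_comm]; exact h1, by rw [real_inner_comm]; exact h2⟩

lemma RotDir.mem_line {A B n w z : E3} (hw : RotDir A B n w) (hn : ‖n‖ = 1) (hAB : A ≠ B)
    (h : inner ℝ n (B - A) = (0 : ℝ)) (h1 : inner ℝ n (z - A) = (0 : ℝ))
    (h2 : inner ℝ w (z - A) = (0 : ℝ)) : ∃ s : ℝ, z - A = s • (B - A) := by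
  obtain ⟨c, hc⟩ := exists_frame hw.norm_w hn hw.orth_n
  have e1 := hc.expand (B - A)
  have e2 := hc.expand (z - A)
  rw [h, hw.orth_AB, zero_smul, zero_smul, zero_add, zero_add] at e1
  rw [h1, h2, zero_smul, zero_smul, zero_add, zero_add] at e2
  have hne : inner ℝ c (B - A) ≠ (0 : ℝ) := fun h0 => by
    rw [h0, zero_smul] at e1
    exact hAB (sub_eq_zero.1 e1).symm
  refine ⟨inner ℝ c (z - A) / inner ℝ c (B - A), ?_⟩
  generalize (inner ℝ c (B - A) : ℝ) = r at e1 hne ⊢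
  rw [e1, smul_smul, div_mul_cancel₀ _ hne]
  exact e2

/-! ### Edge points of sets determined by an arrangement -/

section
variable {T : Finset (E3 × ℝ)} {X Y : Set E3}

lemma Sat.measurableSet (hX : Sat T X) : MeasurableSet X := by
  classical
  let sg : E3 → (T → SignType) := fun y p => SignType.sign (ev p.1 y)
  have hsg : ∀ σ, MeasurableSet (sg ⁻¹' {σ}) := by
    intro σ
    have : sg ⁻¹' {σ} = ⋂ p : T, {y | SignType.sign (ev p.1 y) = σ p} := by
      ext y; simp [sg, funext_iff]
    rw [this]
    refine MeasurableSet.iInter fun p => ?_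
    have hm := (continuous_ev p.1).measurable
    rcases hσ : σ p with _ | _ | _
    · have : {y | SignType.sign (ev p.1 y) = SignType.zero} = {y | ev p.1 y = 0} := by
        ext y; exact sign_eq_zero_iff
      rw [this]; exact measurableSet_eq_fun hm measurable_const
    · have : {y | SignType.sign (ev p.1 y) = SignType.neg} = {y | ev p.1 y < 0} := by
        ext y; exact sign_eq_neg_one_iff
      rw [this]; exact measurableSet_lt hm measurable_const
    · have : {y | SignType.sign (ev p.1 y) = SignType.pos} = {y | 0 < ev p.1 y} := by
        ext y; exact sign_eq_one_iff
      rw [this]; exact measurableSet_lt measurable_const hm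
  have hunion : X = ⋃ σ ∈ sg '' X, sg ⁻¹' {σ} := by
    ext y
    simp only [mem_iUnion, mem_preimage, mem_singleton_iff, exists_prop]
    constructor
    · intro hy; exact ⟨sg y, ⟨y, hy, rfl⟩, rfl⟩
    · rintro ⟨_, ⟨x, hx, rfl⟩, h⟩
      exact hX x y (fun p hp => (congrFun h ⟨p, hp⟩).symm) hx
  rw [hunion]
  exact (Set.toFinite _).measurableSet_biUnion fun σ _ => hsg σ

lemma Sat.inter (hX : Sat T X) (hY : Sat T Y) : Sat T (X ∩ Y) :=
  fun z z' h hz => ⟨hX z z' h hz.1, hY z z' h hz.2⟩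

lemma Sat.compl (hX : Sat T X) : Sat T Xᶜ := fun _ _ h hz hz' => hz (hX _ _ h.symm hz')

lemma mem_interior_iff_eventually {x : E3} : x ∈ interior X ↔ ∀ᶠ d in 𝓝 (0 : E3), x + d ∈ X := by
  rw [mem_interior_iff_mem_nhds, ← eventually_mem_set, eventually_nhds_iff_add]

lemma Sat.interior (hX : Sat T X) : Sat T (interior X) := by
  intro z z' h hz
  rw [mem_interior_iff_eventually] at hz ⊢
  filter_upwards [hz, hX.germ h] with d h1 h2
  exact h2.1 h1

lemma Sat.frontier_sat (hX : Sat T X) : Sat T (_root_.frontier X) := by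
  have h : _root_.frontier X = (_root_.interior X)ᶜ ∩ (_root_.interior Xᶜ)ᶜ := by
    rw [interior_compl, compl_compl, _root_.frontier, sdiff_eq, inter_comm]
  rw [h]
  exact hX.interior.compl.inter hX.compl.interior.compl

lemma mem_frontier_congr {x : E3} (h : ∀ᶠ y in 𝓝 x, (y ∈ X ↔ y ∈ Y)) :
    x ∈ frontier X ↔ x ∈ frontier Y := by
  have h1 : ∀ {X Y : Set E3}, (∀ᶠ y in 𝓝 x, (y ∈ X ↔ y ∈ Y)) → x ∈ interior X → x ∈ interior Y := by
    intro X Y h hx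
    rw [mem_interior_iff_mem_nhds] at hx ⊢
    filter_upwards [h, hx] with y h1 h2
    exact h1.1 h2
  have h2 : ∀ {X Y : Set E3}, (∀ᶠ y in 𝓝 x, (y ∈ X ↔ y ∈ Y)) → x ∈ frontier X →
      x ∈ frontier Y := by
    intro X Y h hx
    rw [frontier, closure_eq_compl_interior_compl] at hx ⊢
    refine ⟨fun h' => hx.1 (h1 ?_ h'), fun h' => hx.2 (h1 ?_ h')⟩
    · filter_upwards [h] with y hy; simp [hy]
    · filter_upwards [h] with y hy; exact hy.symm
  exact ⟨h2 h, h2 (h.mono fun _ hy => hy.symm)⟩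

lemma mem_facePoints_congr {x : E3} (h : ∀ᶠ y in 𝓝 x, (y ∈ X ↔ y ∈ Y)) :
    x ∈ facePoints X ↔ x ∈ facePoints Y :=
  ⟨fun ⟨ν, hν⟩ => ⟨ν, hν.congr h⟩, fun ⟨ν, hν⟩ => ⟨ν, hν.congr (h.mono fun _ hy => hy.symm)⟩⟩

lemma mem_edgePoints_congr {x : E3} (h : ∀ᶠ y in 𝓝 x, (y ∈ X ↔ y ∈ Y)) :
    x ∈ edgePoints X ↔ x ∈ edgePoints Y := by
  have key : ∀ {X Y : Set E3}, (∀ᶠ y in 𝓝 x, (y ∈ X ↔ y ∈ Y)) → x ∈ edgePoints X →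
      x ∈ edgePoints Y := by
    rintro X Y h ⟨h1, h2, u, hu, h3⟩
    refine ⟨(mem_frontier_congr h).1 h1, fun h' => h2 ((mem_facePoints_congr h).2 h'), u, hu, ?_⟩
    have c1 : Tendsto (fun q : E3 × ℝ => q.1) (𝓝 (x, 0)) (𝓝 x) := continuous_fst.tendsto _
    have c2 : Tendsto (fun q : E3 × ℝ => q.1 + q.2 • u) (𝓝 (x, 0)) (𝓝 x) := by
      have : Continuous (fun q : E3 × ℝ => q.1 + q.2 • u) := by fun_prop
      simpa using this.tendsto (x, 0)
    filter_upwards [h3, c1.eventually h, c2.eventually h] with q q1 q2 q3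
    rw [← q3, q1, q2]
  exact ⟨key h, key (h.mono fun _ hy => hy.symm)⟩

lemma Sat.edgePoints (hX : Sat T X) : Sat T (edgePoints X) := by
  rintro z z' h ⟨h1, h2, u, hu, h3⟩
  refine ⟨hX.frontier_sat z z' h h1, ?_, u, hu, ?_⟩
  · rintro ⟨ν, hν⟩
    exact h2 ⟨ν, IsFacePoint.of_signEq hX h.symm hν⟩
  · have hg := hX.germ h
    have c1 : Tendsto (fun q : E3 × ℝ => q.1 - z') (𝓝 (z', 0)) (𝓝 0) := by
      have : Continuous (fun q : E3 × ℝ => q.1 - z') := by fun_prop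
      simpa using this.tendsto (z', 0)
    have c2 : Tendsto (fun q : E3 × ℝ => q.1 + q.2 • u - z') (𝓝 (z', 0)) (𝓝 0) := by
      have : Continuous (fun q : E3 × ℝ => q.1 + q.2 • u - z') := by fun_prop
      simpa using this.tendsto (z', 0)
    have c3 : Tendsto (fun q : E3 × ℝ => (q.1 - z' + z, q.2)) (𝓝 (z', 0)) (𝓝 (z, 0)) := by
      have : Continuous (fun q : E3 × ℝ => (q.1 - z' + z, q.2)) := by fun_prop
      simpa using this.tendsto (z', 0)
    filter_upwards [c1.eventually hg, c2.eventually hg, c3.eventually h3] with q q1 q2 q3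
    rw [add_sub_cancel] at q1 q2
    rw [← q1, ← q2, ← add_comm (q.1 - z') z, ← q3]
    apply iff_of_eq
    congr 1
    abel

end

end

section

/-! ### Faces and edges of the body near a point of the face -/

/-- The normals of the faces near `y` whose planes pass through `z`. -/
def active (P F : Set E3) (T : Finset (E3 × ℝ)) (y z : E3) : Set E3 :=
  {ν | ν ∈ normals P F T y ∧ inner ℝ ν (z - y) = (0 : ℝ)}

/-- The points of the face off the edge `AB` that lie on at least two other faces. -/
def corners (P F : Set E3) (A B : E3) (T : Finset (E3 × ℝ)) : Set E3 :=
  {a | a ∈ F \ segment ℝ A B ∧ (normals P F T a).Nontrivial}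

lemma active_self {P F : Set E3} {T : Finset (E3 × ℝ)} {y : E3} :
    active P F T y y = normals P F T y := by
  ext ν; simp [active]

/-- The points of the line `AB` on planes of the arrangement not containing that line. -/
lemma finite_line_inter (T : Finset (E3 × ℝ)) (A d : E3) :
    {s : ℝ | ∃ p ∈ T, ev p (A + s • d) = 0 ∧ inner ℝ p.1 d ≠ (0 : ℝ)}.Finite := by
  refine (T.finite_toSet.image fun p => -ev p A / inner ℝ p.1 d).subset ?_
  rintro s ⟨p, hp, h0, hd⟩
  refine ⟨p, hp, ?_⟩
  rw [ev_add, inner_smul_right] at h0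
  simp only
  field_simp
  linarith

section
variable {P F : Set E3} {A B n : E3} {T : Finset (E3 × ℝ)} (D : FaceData P F A B n T)
include D

lemma FaceData.norm_normal {y ν : E3} (hν : ν ∈ normals P F T y) : ‖ν‖ = 1 :=
  (D.normals_plane hν).1

lemma FaceData.body_germ {y z : E3} (hy : y ∈ F \ segment ℝ A B) (hz : z ∈ star T y)
    (hb : z ∈ body P F A B T) :
    ∀ᶠ x in 𝓝 z, (x ∈ body P F A B T ↔ ∀ ν ∈ active P F T y z, inner ℝ ν (x - z) ≤ (0 : ℝ)) := by
  have hcone := (D.mem_body_iff hy hz).1 hb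
  have h1 : ∀ᶠ x in 𝓝 z, ∀ ν ∈ normals P F T y, inner ℝ ν (z - y) ≠ (0 : ℝ) →
      inner ℝ ν (x - y) < (0 : ℝ) := by
    refine ((D.finite_normals y).eventually_all).2 fun ν hν => ?_
    by_cases h0 : inner ℝ ν (z - y) = (0 : ℝ)
    · simp [h0]
    · have hc : Continuous (fun x : E3 => (inner ℝ ν (x - y) : ℝ)) := by fun_prop
      filter_upwards [hc.continuousAt.eventually
        (gt_mem_nhds (lt_of_le_of_ne (hcone ν hν) h0))] with x hx _ using hx
  filter_upwards [h1, (isOpen_star T y).mem_nhds hz] with x hx hxs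
  rw [D.mem_body_iff hy hxs]
  constructor
  · rintro h ν ⟨hν, h0⟩
    have e : x - z = (x - y) - (z - y) := by abel
    rw [e, inner_sub_right, h0, sub_zero]
    exact h ν hν
  · intro h ν hν
    by_cases h0 : inner ℝ ν (z - y) = (0 : ℝ)
    · have e : x - y = (x - z) + (z - y) := by abel
      rw [e, inner_add_right, h0, add_zero]
      exact h ν ⟨hν, h0⟩
    · exact (hx ν hν h0).le

lemma FaceData.normals_not_parallel {y ν ν' : E3} (hy : y ∈ F \ segment ℝ A B)
    (hν : ν ∈ normals P F T y) (hν' : ν' ∈ normals P F T y) (hne : ν ≠ ν') (c : ℝ) :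
    ν' ≠ c • ν := by
  intro h
  obtain ⟨x, -, -, hx⟩ := D.exists_inner_point hy
  have h1 := hx ν hν
  have h2 := hx ν' hν'
  have h3 : ‖ν'‖ = |c| * ‖ν‖ := by rw [h, norm_smul, Real.norm_eq_abs]
  rw [D.norm_normal hν, D.norm_normal hν', mul_one] at h3
  rw [h, inner_smul_left, conj_trivial] at h2
  rcases abs_eq (zero_le_one' ℝ) |>.1 h3.symm with h4 | h4
  · exact hne (by rw [h, h4, one_smul])
  · rw [h4] at h2; linarith

lemma FaceData.normals_not_parallel_n {y ν : E3} (hy : y ∈ F \ segment ℝ A B)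
    (hν : ν ∈ normals P F T y) (c : ℝ) : ν ≠ c • n := by
  intro h
  obtain ⟨x, -, hxF, hx⟩ := D.exists_inner_point hy
  have h1 := hx ν hν
  rw [h, inner_smul_left, D.inner_n_sub hy.1, D.sub_plane x hxF, mul_zero] at h1
  exact lt_irrefl _ h1

lemma FaceData.isFacePoint_body_iff {y z ν : E3} (hy : y ∈ F \ segment ℝ A B)
    (hz : z ∈ star T y) (hb : z ∈ body P F A B T) :
    IsFacePoint (body P F A B T) z ν ↔ active P F T y z = {ν} := by
  have hg := D.body_germ hy hz hb
  constructor
  · intro h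
    have hsub : ∀ ν' ∈ active P F T y z, ν' = ν := by
      intro ν' hν'
      refine (unit_eq_of_halfspace_subset (x := z) h.1 (D.norm_normal hν'.1) ?_).symm
      filter_upwards [hg, h.2] with x h1 h2 h3
      exact h1.1 (h2.2 h3) ν' hν'
    rcases (active P F T y z).eq_empty_or_nonempty with h0 | h0
    · exfalso
      refine h.not_interior (mem_interior_iff_mem_nhds.2 ?_)
      filter_upwards [hg] with x hx
      rw [h0] at hx
      exact hx.2 (by simp)
    · exact eq_singleton_iff_nonempty_unique_mem.2 ⟨h0, hsub⟩
  · intro h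
    have hν : ν ∈ active P F T y z := by rw [h]; rfl
    refine ⟨D.norm_normal hν.1, ?_⟩
    filter_upwards [hg] with x hx
    rw [hx, h, mem_halfspace]
    simp

lemma FaceData.mem_interior_body {y z : E3} (hy : y ∈ F \ segment ℝ A B)
    (hz : z ∈ star T y) (hb : z ∈ body P F A B T) (h : active P F T y z = ∅) :
    z ∈ interior (body P F A B T) := by
  refine mem_interior_iff_mem_nhds.2 ?_
  filter_upwards [D.body_germ hy hz hb] with x hx
  rw [h] at hx
  exact hx.2 (by simp)

lemma FaceData.nontrivial_of_edge {y z : E3} (hy : y ∈ F \ segment ℝ A B)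
    (hz : z ∈ star T y) (hb : z ∈ body P F A B T) (he : z ∈ edgePoints (body P F A B T)) :
    (active P F T y z).Nontrivial := by
  by_contra hcon
  rcases (not_nontrivial_iff.1 hcon).eq_empty_or_singleton with h | ⟨ν, h⟩
  · exact he.1.2 (D.mem_interior_body hy hz hb h)
  · exact he.2.1 ⟨ν, (D.isFacePoint_body_iff hy hz hb).2 h⟩

lemma FaceData.edge_of_nontrivial {y z : E3} (hy : y ∈ F \ segment ℝ A B)
    (hz : z ∈ star T y) (hb : z ∈ body P F A B T) (hzy : z ≠ y)
    (h : (active P F T y z).Nontrivial) : z ∈ edgePoints (body P F A B T) := by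
  have hg := D.body_germ hy hz hb
  obtain ⟨ν, hν, ν', hν', hne⟩ := h
  have h0 : ‖z - y‖ ≠ 0 := norm_ne_zero_iff.2 (sub_ne_zero.2 hzy)
  refine ⟨⟨subset_closure hb, fun hint => ?_⟩, ?_, (‖z - y‖)⁻¹ • (z - y), ?_, ?_⟩
  · obtain ⟨s, hs, -, h1, h2⟩ := exists_pos_of_eventually ν
      (hg.and (eventually_mem_set.2 (mem_interior_iff_mem_nhds.1 hint)))
    have h3 := h1.1 h2 ν hν
    rw [add_sub_cancel_left, inner_smul_right, real_inner_self_eq_norm_sq,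
      D.norm_normal hν.1] at h3
    linarith
  · rintro ⟨μ, hμ⟩
    have h1 := (D.isFacePoint_body_iff hy hz hb).1 hμ
    rw [h1] at hν hν'
    exact hne (hν.trans hν'.symm)
  · rw [norm_smul, norm_inv, norm_norm, inv_mul_cancel₀ h0]
  · set u := (‖z - y‖)⁻¹ • (z - y) with hu
    have c1 : Tendsto (fun q : E3 × ℝ => q.1) (𝓝 (z, 0)) (𝓝 z) := continuous_fst.tendsto _
    have c2 : Tendsto (fun q : E3 × ℝ => q.1 + q.2 • u) (𝓝 (z, 0)) (𝓝 z) := by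
      have : Continuous (fun q : E3 × ℝ => q.1 + q.2 • u) := by fun_prop
      simpa using this.tendsto (z, 0)
    filter_upwards [c1.eventually hg, c2.eventually hg] with q q1 q2
    rw [q1, q2]
    refine forall₂_congr fun μ hμ => ?_
    rw [add_sub_right_comm, inner_add_right, hu, inner_smul_right, inner_smul_right, hμ.2,
      mul_zero, mul_zero, add_zero]

/-- A corner is determined by the planes of the arrangement passing through it. -/
lemma FaceData.finite_corners : (corners P F A B T).Finite := by
  classical
  refine Set.Finite.of_finite_image (f := fun a => T.filter fun p => ev p a = 0)
    ((T.powerset.finite_toSet).subset ?_) ?_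
  · rintro _ ⟨a, -, rfl⟩
    exact Finset.mem_coe.2 (Finset.mem_powerset.2 (Finset.filter_subset _ _))
  · rintro a ⟨ha, ν, hν, ν', hν', hne⟩ a' ⟨ha', -⟩ he
    have key : ∀ μ ∈ normals P F T a, inner ℝ μ (a' - a) = (0 : ℝ) := by
      intro μ hμ
      obtain ⟨-, p, hp, c, hc, -, hpa, hev⟩ := D.normals_plane hμ
      have h1 : p ∈ T.filter fun p => ev p a = 0 := by simp [hp, hpa]
      have he' : (T.filter fun p => ev p a = 0) = T.filter fun p => ev p a' = 0 := he
      rw [he'] at h1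
      have h2 := (Finset.mem_filter.1 h1).2
      rw [hev] at h2
      exact (mul_eq_zero.1 h2).resolve_left hc
    have hn : inner ℝ n (a' - a) = (0 : ℝ) := by
      rw [D.inner_n_sub ha.1, D.sub_plane a' ha'.1]
    exact (sub_eq_zero.1 (D.eq_zero_of_orthogonal ha hν hν' hne hn (key ν hν) (key ν' hν'))).symm

lemma FaceData.inner_n_AB : inner ℝ n (B - A) = (0 : ℝ) :=
  D.sub_plane B (D.seg_sub (right_mem_segment ℝ A B))

/-- At a vertex some plane of the arrangement is transverse to any given direction. -/
lemma FaceData.exists_transverse {C : E3} (hC : C ∈ vertices P) {d : E3} (hd : d ≠ 0) :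
    ∃ p ∈ T, ev p C = 0 ∧ inner ℝ p.1 d ≠ (0 : ℝ) := by
  by_contra! hcon
  refine hC.2.2 ⟨hC.1, hC.2.1, (‖d‖)⁻¹ • d, ?_, D.sat.invariant fun p hp h => ?_⟩
  · rw [norm_smul, norm_inv, norm_norm, inv_mul_cancel₀ (norm_ne_zero_iff.2 hd)]
  · rw [inner_smul_right, hcon p hp h, mul_zero]

/-- At a point of the edge some plane of the arrangement is not parallel to the face. -/
lemma FaceData.exists_not_parallel {z : E3} (hz : z ∈ openSegment ℝ A B) :
    ∃ p ∈ T, ev p z = 0 ∧ ∀ c : ℝ, p.1 ≠ c • n := by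
  by_contra! hcon
  have hE := D.edge hz
  rcases exists_isFacePoint_of_parallel D.sat D.regular D.norm_n hE.1 hcon with h | h
  · exact hE.2.1 ⟨_, h⟩
  · exact hE.2.1 ⟨_, h⟩

lemma FaceData.notMem_region_of_mem_segment {z : E3} (hz : z ∈ segment ℝ A B) :
    z ∉ region F A B T := by
  rintro ⟨y, hy, hzy⟩
  have hd : B - A ≠ 0 := sub_ne_zero.2 D.ne.symm
  obtain ⟨w, hw⟩ := exists_rotDir A B n
  -- move to a point of the open edge in the star of `y`, off the planes transverse to the edge
  obtain ⟨s, hs, hsT⟩ : ∃ s : ℝ, (s ∈ Ioo (0:ℝ) 1 ∧ A + s • (B - A) ∈ star T y) ∧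
      ∀ p ∈ T, ev p (A + s • (B - A)) = 0 → inner ℝ p.1 (B - A) = (0 : ℝ) := by
    have hopen : IsOpen (Ioo (0:ℝ) 1 ∩ (fun s : ℝ => A + s • (B - A)) ⁻¹' star T y) :=
      isOpen_Ioo.inter ((isOpen_star T y).preimage (by fun_prop))
    have hne : (Ioo (0:ℝ) 1 ∩ (fun s : ℝ => A + s • (B - A)) ⁻¹' star T y).Nonempty := by
      rw [← closure_openSegment] at hz
      obtain ⟨x, hx, hxo⟩ := mem_closure_iff.1 hz _ (isOpen_star T y) hzy
      rw [openSegment_eq_image'] at hxo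
      obtain ⟨s, hs, rfl⟩ := hxo
      exact ⟨s, hs, hx⟩
    have hinf : (Ioo (0:ℝ) 1 ∩ (fun s : ℝ => A + s • (B - A)) ⁻¹' star T y).Infinite := by
      obtain ⟨x, hx⟩ := hne
      exact infinite_of_mem_nhds x (hopen.mem_nhds hx)
    obtain ⟨s, hs, hs'⟩ := (hinf.sdiff (finite_line_inter T A (B - A))).nonempty
    refine ⟨s, hs, fun p hp h0 => ?_⟩
    by_contra hne
    exact hs' ⟨p, hp, h0, hne⟩
  have hmem : A + s • (B - A) ∈ openSegment ℝ A B := by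
    rw [openSegment_eq_image']; exact ⟨s, hs.1, rfl⟩
  by_cases hWy : inner ℝ w (y - A) = (0 : ℝ)
  · -- `y` lies on the line `AB`, beyond one of the two vertices
    obtain ⟨r, hr⟩ := hw.mem_line D.norm_n D.ne D.inner_n_AB (D.sub_plane y hy.1) hWy
    have hy' : y = A + r • (B - A) := by rw [← hr]; abel
    have hr01 : r < 0 ∨ 1 < r := by
      by_contra! hcon
      exact hy.2 (by rw [segment_eq_image']; exact ⟨r, hcon, hy'.symm⟩)
    rcases hr01 with h | h
    · obtain ⟨p, hp, hpA, hpd⟩ := D.exists_transverse D.vertex_left hd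
      have h1 : ∀ s : ℝ, ev p (A + s • (B - A)) = s * inner ℝ p.1 (B - A) := fun s => by
        rw [ev_add, inner_smul_right, hpA, zero_add]
      have h2 := hs.2 p hp
      rw [hy', h1, h1] at h2
      have h3 := h2 (mul_ne_zero h.ne hpd)
      have h4 : 0 < (inner ℝ p.1 (B - A) : ℝ) * inner ℝ p.1 (B - A) := mul_self_pos.2 hpd
      nlinarith [mul_pos (neg_pos.2 h) hs.1.1]
    · obtain ⟨p, hp, hpB, hpd⟩ := D.exists_transverse D.vertex_right hd
      have h1 : ∀ s : ℝ, ev p (A + s • (B - A)) = (s - 1) * inner ℝ p.1 (B - A) := fun s => by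
        have e : A + s • (B - A) = B + (s - 1) • (B - A) := by module
        rw [e, ev_add, inner_smul_right, hpB, zero_add]
      have h2 := hs.2 p hp
      rw [hy', h1, h1] at h2
      have h3 := h2 (mul_ne_zero (by linarith) hpd)
      have h4 : 0 < (inner ℝ p.1 (B - A) : ℝ) * inner ℝ p.1 (B - A) := mul_self_pos.2 hpd
      nlinarith [mul_pos (sub_pos.2 h) (sub_pos.2 hs.1.2)]
  · obtain ⟨p, hp, hp0, hpn⟩ := D.exists_not_parallel hmem
    have hpd := hsT p hp hp0
    have hpA : ev p A = 0 := by
      rw [ev_add, inner_smul_right, hpd] at hp0; simpa using hp0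
    by_cases hpy : ev p y = 0
    · -- then `p` contains `A`, `B` and `y`, so it is the plane of the face
      have hpy' : inner ℝ p.1 (y - A) = (0 : ℝ) := by rw [← ev_sub, hpy, hpA, sub_zero]
      obtain ⟨c, hc⟩ := exists_frame hw.norm_w D.norm_n hw.orth_n
      have e1 := hc.inner_eq p.1 (B - A)
      rw [hpd, hw.orth_AB, D.inner_n_AB] at e1
      have e2 := hc.inner_eq p.1 (y - A)
      rw [hpy', D.sub_plane y hy.1] at e2
      have hcd : inner ℝ c (B - A) ≠ (0 : ℝ) := fun h0 => by
        have := hc.expand (B - A)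
        rw [hw.orth_AB, D.inner_n_AB, h0] at this
        exact hd (by simpa using this)
      have hcp : inner ℝ c p.1 = (0 : ℝ) := by
        have : (inner ℝ c p.1 : ℝ) * inner ℝ c (B - A) = 0 := by linarith
        exact (mul_eq_zero.1 this).resolve_right hcd
      have hwp : inner ℝ w p.1 = (0 : ℝ) := by
        rw [hcp] at e2
        have : (inner ℝ w p.1 : ℝ) * inner ℝ w (y - A) = 0 := by linarith
        exact (mul_eq_zero.1 this).resolve_right hWy
      have := hc.expand p.1
      rw [hcp, hwp] at this
      exact hpn _ (by simpa using this)
    · have := hs.2 p hp hpy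
      rw [hp0, mul_zero] at this
      exact lt_irrefl _ this

end

end

section

/-! ### One-dimensional measure on finitely many lines -/

/-- The line through `c` with direction `d`. -/
def line (c d : E3) : Set E3 := range fun s : ℝ => c + s • d

/-- The lines in which two non-parallel planes of the arrangement meet. -/
def arrangementLines (T : Finset (E3 × ℝ)) : Set (Set E3) :=
  {ℓ | (∃ c d : E3, ‖d‖ = 1 ∧ ℓ = line c d) ∧
    ∃ p ∈ T, ∃ p' ∈ T, ℓ = {z | ev p z = 0 ∧ ev p' z = 0}}

lemma finite_arrangementLines (T : Finset (E3 × ℝ)) : (arrangementLines T).Finite := by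
  refine ((T.finite_toSet.prod T.finite_toSet).image
    fun q => {z | ev q.1 z = 0 ∧ ev q.2 z = 0}).subset ?_
  rintro ℓ ⟨-, p, hp, p', hp', rfl⟩
  exact ⟨(p, p'), ⟨hp, hp'⟩, rfl⟩

lemma line_eq_of_mem {c d z z' : E3} (hz : z ∈ line c d) (hz' : z' ∈ line c d) (hne : z ≠ z') :
    line c d = line z (z' - z) := by
  obtain ⟨s, rfl⟩ := hz
  obtain ⟨s', rfl⟩ := hz'
  have hs : s' - s ≠ 0 := fun h => hne (by rw [sub_eq_zero.1 h])
  have e : c + s' • d - (c + s • d) = (s' - s) • d := by module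
  simp only [line, e]
  ext x
  constructor
  · rintro ⟨r, rfl⟩
    refine ⟨(r - s) / (s' - s), ?_⟩
    simp only [smul_smul, div_mul_cancel₀ _ hs]
    module
  · rintro ⟨r, rfl⟩
    refine ⟨s + r * (s' - s), ?_⟩
    module

lemma arrangementLines_inter {T : Finset (E3 × ℝ)} {ℓ ℓ' : Set E3} (h : ℓ ∈ arrangementLines T)
    (h' : ℓ' ∈ arrangementLines T) (hne : ℓ ≠ ℓ') : (ℓ ∩ ℓ').Subsingleton := by
  intro z hz z' hz'
  by_contra hzz
  obtain ⟨⟨c, d, -, rfl⟩, -⟩ := h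
  obtain ⟨⟨c', d', -, rfl⟩, -⟩ := h'
  exact hne ((line_eq_of_mem hz.1 hz'.1 hzz).trans (line_eq_of_mem hz.2 hz'.2 hzz).symm)

lemma mem_arrangementLines {T : Finset (E3 × ℝ)} {p p' : E3 × ℝ} (hp : p ∈ T) (hp' : p' ∈ T)
    (h0 : p.1 ≠ 0) (hpar : ∀ c : ℝ, p'.1 ≠ c • p.1) {z : E3} (hz : ev p z = 0) (hz' : ev p' z = 0) :
    {z | ev p z = 0 ∧ ev p' z = 0} ∈ arrangementLines T := by
  have hn : ‖p.1‖ ≠ 0 := norm_ne_zero_iff.2 h0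
  have h1 : ‖(‖p.1‖)⁻¹ • p.1‖ = 1 := by
    rw [norm_smul, norm_inv, norm_norm, inv_mul_cancel₀ hn]
  obtain ⟨f, e, fr, hf⟩ := exists_frame_axis h1 p'.1
  refine ⟨⟨z, f, fr.nb, ?_⟩, p, hp, p', hp', rfl⟩
  have hpf : inner ℝ p.1 f = (0 : ℝ) := by
    have := fr.ab
    rw [inner_smul_left, conj_trivial] at this
    exact (mul_eq_zero.1 this).resolve_left (inv_ne_zero hn)
  ext x
  constructor
  · rintro ⟨hx, hx'⟩
    have h2 : inner ℝ p.1 (x - z) = (0 : ℝ) := by rw [← ev_sub, hx, hz, sub_zero]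
    have h3 : inner ℝ p'.1 (x - z) = (0 : ℝ) := by rw [← ev_sub, hx', hz', sub_zero]
    have h4 := fr.axis hf (fun c hc => hpar (c * (‖p.1‖)⁻¹) (by rw [hc, smul_smul]))
      (x := x - z) (by rw [inner_smul_left, h2, mul_zero]) h3
    exact ⟨inner ℝ f (x - z), by simp only [← h4]; abel⟩
  · rintro ⟨s, rfl⟩
    simp only [mem_ofPred_eq, ev_add, inner_smul_right, hz, hz', hpf, hf]
    simp

lemma edgePoints_subset_lines {T : Finset (E3 × ℝ)} {X : Set E3} (hnz : ∀ p ∈ T, p.1 ≠ 0)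
    (hX : Sat T X) (hreg : closure (interior X) = X) {z : E3} (hz : z ∈ edgePoints X) :
    ∃ ℓ ∈ arrangementLines T, z ∈ ℓ := by
  obtain ⟨p, hp, hpz⟩ := hX.frontier hz.1
  have hn : ‖p.1‖ ≠ 0 := norm_ne_zero_iff.2 (hnz p hp)
  have h1 : ‖(‖p.1‖)⁻¹ • p.1‖ = 1 := by
    rw [norm_smul, norm_inv, norm_norm, inv_mul_cancel₀ hn]
  by_cases hpar : ∀ p' ∈ T, ev p' z = 0 → ∃ c : ℝ, p'.1 = c • (‖p.1‖)⁻¹ • p.1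
  · rcases exists_isFacePoint_of_parallel hX hreg h1 hz.1 hpar with h | h
    · exact absurd ⟨_, h⟩ hz.2.1
    · exact absurd ⟨_, h⟩ hz.2.1
  · push Not at hpar
    obtain ⟨p', hp', hpz', hc⟩ := hpar
    refine ⟨_, mem_arrangementLines hp hp' (hnz p hp) (fun c h => hc (c * ‖p.1‖) ?_) hpz hpz',
      hpz, hpz'⟩
    rw [smul_smul, mul_assoc, mul_inv_cancel₀ hn, mul_one, h]

/-- Length. -/
abbrev H1 : Measure E3 := Measure.hausdorffMeasure 1

instance : NullSingletonClass H1 := Measure.nullSingletonClass_hausdorff E3 one_pos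

lemma H1_line_image (c d : E3) (X : Set ℝ) :
    H1 ((fun s : ℝ => c + s • d) '' X) = ENNReal.ofReal ‖d‖ * volume X := by
  have h := hausdorffMeasure_lineMap_image c (c + d) X
  rw [hausdorffMeasure_real] at h
  have e : (fun s : ℝ => c + s • d) = AffineMap.lineMap c (c + d) := by
    ext1 s
    rw [AffineMap.lineMap_apply]
    simp [add_comm]
  rw [H1, e, h, nndist_eq_nnnorm, sub_add_cancel_left, nnnorm_neg, ENNReal.smul_def, smul_eq_mul,
    ← coe_nnnorm, ENNReal.ofReal_coe_nnreal]

lemma H1_inter_line {c d : E3} (hd : ‖d‖ = 1) (E : Set E3) :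
    H1 (E ∩ line c d) = volume {s : ℝ | c + s • d ∈ E} := by
  have : E ∩ line c d = (fun s : ℝ => c + s • d) '' {s : ℝ | c + s • d ∈ E} := by
    ext x
    constructor
    · rintro ⟨hx, s, rfl⟩; exact ⟨s, hx, rfl⟩
    · rintro ⟨s, hs, rfl⟩; exact ⟨hs, s, rfl⟩
  rw [this, H1_line_image, hd, ENNReal.ofReal_one, one_mul]

lemma volume_preimage_line_lt_top {c d : E3} (hd : ‖d‖ = 1) {E : Set E3} {R : ℝ}
    (hE : ∀ z ∈ E, ‖z‖ ≤ R) : volume {s : ℝ | c + s • d ∈ E} < ⊤ := by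
  refine (measure_mono (t := Icc (-(R + ‖c‖)) (R + ‖c‖)) fun s hs => ?_).trans_lt
    measure_Icc_lt_top
  have h1 := hE _ hs
  have h2 : ‖s • d‖ ≤ R + ‖c‖ := by
    have e : s • d = (c + s • d) - c := by abel
    rw [e]
    exact (norm_sub_le _ _).trans (by linarith)
  rw [norm_smul, hd, mul_one, Real.norm_eq_abs] at h2
  exact abs_le.1 h2

/-- The length of a set contained in finitely many lines. -/
lemma H1_eq_sum_lines {T : Finset (E3 × ℝ)} {E : Set E3} (hE : MeasurableSet E)
    (hsub : ∀ z ∈ E, ∃ ℓ ∈ arrangementLines T, z ∈ ℓ) :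
    H1 E = ∑ ℓ ∈ (finite_arrangementLines T).toFinset, H1 (E ∩ ℓ) := by
  have hU : E = ⋃ ℓ ∈ (finite_arrangementLines T).toFinset, E ∩ ℓ := by
    ext z
    simp only [mem_iUnion, Finite.mem_toFinset, exists_prop, mem_inter_iff]
    exact ⟨fun hz => by obtain ⟨ℓ, h1, h2⟩ := hsub z hz; exact ⟨ℓ, h1, hz, h2⟩,
      fun ⟨ℓ, _, h, _⟩ => h⟩
  conv_lhs => rw [hU]
  refine measure_biUnion_finset₀ ?_ ?_
  · intro ℓ hℓ ℓ' hℓ' hne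
    have hs := arrangementLines_inter (T := T) (by simpa using hℓ) (by simpa using hℓ') hne
    have hsub' : (E ∩ ℓ) ∩ (E ∩ ℓ') ⊆ ℓ ∩ ℓ' := fun z hz => ⟨hz.1.2, hz.2.2⟩
    exact measure_mono_null hsub' (hs.measure_zero _)
  · intro ℓ hℓ
    obtain ⟨-, p, -, p', -, rfl⟩ : ℓ ∈ arrangementLines T := by simpa using hℓ
    refine (hE.inter ?_).nullMeasurableSet
    exact (measurableSet_eq_fun (continuous_ev p).measurable measurable_const).inter
      (measurableSet_eq_fun (continuous_ev p').measurable measurable_const)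

lemma H1_inter_line_lt_top {T : Finset (E3 × ℝ)} {E ℓ : Set E3} (hℓ : ℓ ∈ arrangementLines T)
    {R : ℝ} (hR : ∀ z ∈ E, ‖z‖ ≤ R) : H1 (E ∩ ℓ) < ⊤ := by
  obtain ⟨⟨c, d, hd, rfl⟩, -⟩ := hℓ
  rw [H1_inter_line hd]
  exact volume_preimage_line_lt_top hd hR

lemma H1_lt_top {T : Finset (E3 × ℝ)} {E : Set E3} (hE : MeasurableSet E)
    (hsub : ∀ z ∈ E, ∃ ℓ ∈ arrangementLines T, z ∈ ℓ) {R : ℝ} (hR : ∀ z ∈ E, ‖z‖ ≤ R) :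
    H1 E < ⊤ := by
  rw [H1_eq_sum_lines hE hsub, ENNReal.sum_lt_top]
  exact fun ℓ hℓ => H1_inter_line_lt_top (by simpa using hℓ) hR

end

section

/-! ### The edges of the rotated polyhedron -/

section
variable {P F : Set E3} {A B n w : E3} {T : Finset (E3 × ℝ)} (D : FaceData P F A B n T)
include D

lemma RotDir.inner_rotNormal_seg (hw : RotDir A B n w) {z : E3} (hz : z ∈ segment ℝ A B) (t : ℝ) :
    inner ℝ (rotNormal n w t) (z - A) = (0 : ℝ) := by
  rw [inner_rotNormal, hw.seg hz, D.sub_plane z (D.seg_sub hz), mul_zero, mul_zero, add_zero]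

lemma FaceData.rotNormal_AB (hw : RotDir A B n w) (t : ℝ) :
    inner ℝ (rotNormal n w t) (B - A) = (0 : ℝ) :=
  RotDir.inner_rotNormal_seg D hw (right_mem_segment ℝ A B) t

omit D in
lemma tendsto_inner_rotNormal (v : E3) :
    Tendsto (fun t => (inner ℝ (rotNormal n w t) v : ℝ)) (𝓝 0) (𝓝 (inner ℝ n v)) := by
  have hc : Continuous fun t : ℝ => Real.cos t * inner ℝ n v + Real.sin t * (inner ℝ w v : ℝ) := by
    fun_prop
  simpa [inner_rotNormal] using hc.tendsto 0

lemma FaceData.eventually_mem_replaced {y : E3} (hy : inner ℝ n (y - A) ≠ (0 : ℝ)) :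
    ∀ᶠ t in 𝓝[≥] (0 : ℝ), (y ∈ replaced P F A B T (rotNormal n w t) ↔ y ∈ P) := by
  by_cases hV : y ∈ region F A B T
  · have hlim := tendsto_inner_rotNormal (n := n) (w := w) (y - A)
    rcases lt_or_gt_of_ne hy with h | h
    · filter_upwards [(hlim.eventually (gt_mem_nhds h)).filter_mono nhdsWithin_le_nhds] with t ht
      rw [mem_replaced_iff hV, D.mem_iff_body hV]
      simp [ht.le, h.le]
    · filter_upwards [(hlim.eventually (lt_mem_nhds h)).filter_mono nhdsWithin_le_nhds] with t ht
      rw [mem_replaced_iff hV, D.mem_iff_body hV]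
      simp [not_le.2 ht, not_le.2 h]
  · exact Eventually.of_forall fun t => mem_replaced_of_notMem hV

/-- Along the edge `AB` the rotated polyhedron is conical. -/
lemma FaceData.replaced_conical (hw : RotDir A B n w) {z y : E3} (hz : z ∈ segment ℝ A B)
    (hy : y ∈ star T z) (t : ℝ) {s : ℝ} (hs : 0 < s) (hs1 : s ≤ 1) :
    y ∈ replaced P F A B T (rotNormal n w t) ↔
      z + s • (y - z) ∈ replaced P F A B T (rotNormal n w t) := by
  refine (D.sat_replaced (rotNormal n w t)).iff fun p hp => ?_
  rcases Finset.mem_insert.1 hp with rfl | hp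
  · rw [ev_base, ev_base]
    have e : z + s • (y - z) - A = (1 - s) • (z - A) + s • (y - A) := by module
    rw [e, inner_add_right, inner_smul_right, inner_smul_right,
      RotDir.inner_rotNormal_seg D hw hz, mul_zero, zero_add, sign_smul_pos hs]
  · exact signEq_of_mem_star hy hs hs1 p hp

/-- An open set contains points off the plane of the face. -/
lemma FaceData.exists_off_plane {O : Set E3} (hO : IsOpen O) (hne : O.Nonempty) :
    ∃ z ∈ O, inner ℝ n (z - A) ≠ (0 : ℝ) := by
  obtain ⟨z, hz, h⟩ := exists_avoid {(n, (inner ℝ n A : ℝ))} (fun p hp => by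
    rw [Finset.mem_singleton] at hp
    subst hp
    exact D.nz _ D.base) hO hne
  have := h _ (Finset.mem_singleton_self _)
  rw [ev_base] at this
  exact ⟨z, hz, this⟩

lemma FaceData.not_interior_on_edge (hw : RotDir A B n w) {z : E3} (hz : z ∈ openSegment ℝ A B) :
    ∀ᶠ t in 𝓝[≥] (0 : ℝ), z ∉ interior (replaced P F A B T (rotNormal n w t)) := by
  by_contra hcon
  have hfreq : ∃ᶠ t in 𝓝[≥] (0 : ℝ), z ∈ interior (replaced P F A B T (rotNormal n w t)) :=
    (not_eventually.1 hcon).mono fun t h => not_not.1 h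
  have hzs := openSegment_subset_segment ℝ A B hz
  have key : ∀ y ∈ star T z, inner ℝ n (y - A) ≠ (0 : ℝ) → y ∈ P := by
    intro y hy hy0
    obtain ⟨t, ht, ht'⟩ := (hfreq.and_eventually (D.eventually_mem_replaced (w := w) hy0)).exists
    obtain ⟨s, hs, hs1, h⟩ := exists_pos_of_eventually (y - z)
      (eventually_mem_set.2 (mem_interior_iff_mem_nhds.1 ht))
    exact ht'.1 ((D.replaced_conical hw hzs hy t hs hs1.le).2 h)
  have hsub : star T z ⊆ P := by
    intro y hy
    rw [← D.isClosed.closure_eq]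
    refine mem_closure_iff.2 fun O hO hyO => ?_
    obtain ⟨x, hx, hx0⟩ := D.exists_off_plane (hO.inter (isOpen_star T z)) ⟨y, hyO, hy⟩
    exact ⟨x, hx.1, key x hx.2 hx0⟩
  exact (D.edge hz).1.2 (mem_interior_iff_mem_nhds.2 (mem_of_superset (star_mem_nhds T z) hsub))

/-- A point of the edge `AB` does not become a face point: otherwise a limit of the corresponding
half-spaces would be the germ of `P`. -/
lemma FaceData.not_facePoint_on_edge (hw : RotDir A B n w) {z : E3}
    (hz : z ∈ openSegment ℝ A B) :
    ∀ᶠ t in 𝓝[≥] (0 : ℝ), z ∉ facePoints (replaced P F A B T (rotNormal n w t)) := by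
  by_contra hcon
  have hfreq : ∃ᶠ t in 𝓝[≥] (0 : ℝ), z ∈ facePoints (replaced P F A B T (rotNormal n w t)) :=
    (not_eventually.1 hcon).mono fun t h => not_not.1 h
  have hzs := openSegment_subset_segment ℝ A B hz
  obtain ⟨t, htlim, ht⟩ := exists_seq_forall_of_frequently hfreq
  choose μ hμ using ht
  obtain ⟨ν, hν, φ, hφ, hlim⟩ := (isCompact_sphere (0 : E3) 1).tendsto_subseq (x := μ)
    fun i => by simpa using (hμ i).1
  have hcone : ∀ i, ∀ y ∈ star T z, (y ∈ replaced P F A B T (rotNormal n w (t i)) ↔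
      inner ℝ (μ i) (y - z) ≤ (0 : ℝ)) := by
    intro i y hy
    obtain ⟨s, hs, hs1, h⟩ := exists_pos_of_eventually (y - z) (hμ i).2
    rw [D.replaced_conical hw hzs hy (t i) hs hs1.le, h, mem_halfspace, add_sub_cancel_left,
      inner_smul_right]
    exact ⟨fun h => by by_contra hc; exact absurd h (not_le.2 (mul_pos hs (not_le.1 hc))),
      fun h => mul_nonpos_of_nonneg_of_nonpos hs.le h⟩
  have hlim' : ∀ y : E3, Tendsto (fun i => (inner ℝ (μ (φ i)) (y - z) : ℝ)) atTop
      (𝓝 (inner ℝ ν (y - z))) := fun y => hlim.inner tendsto_const_nhds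
  have hev : ∀ y : E3, inner ℝ n (y - A) ≠ (0 : ℝ) →
      ∀ᶠ i in atTop, (y ∈ replaced P F A B T (rotNormal n w (t (φ i))) ↔ y ∈ P) := fun y hy =>
    (htlim.comp hφ.tendsto_atTop).eventually (D.eventually_mem_replaced hy)
  have hin : ∀ y ∈ star T z, inner ℝ n (y - A) ≠ (0 : ℝ) → inner ℝ ν (y - z) < (0 : ℝ) → y ∈ P := by
    intro y hy h0 hneg
    obtain ⟨i, h1, h2⟩ := (((hlim' y).eventually (gt_mem_nhds hneg)).and (hev y h0)).exists
    exact h2.1 ((hcone _ y hy).2 h1.le)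
  have hout : ∀ y ∈ star T z, inner ℝ n (y - A) ≠ (0 : ℝ) → 0 < (inner ℝ ν (y - z) : ℝ) →
      y ∉ P := by
    intro y hy h0 hpos hyP
    obtain ⟨i, h1, h2⟩ := (((hlim' y).eventually (lt_mem_nhds hpos)).and (hev y h0)).exists
    exact absurd ((hcone _ y hy).1 (h2.2 hyP)) (not_le.2 h1)
  have hν1 : ‖ν‖ = 1 := by simpa using hν
  have hcont : Continuous fun y : E3 => (inner ℝ ν (y - z) : ℝ) := by fun_prop
  refine (D.edge hz).2.1 ⟨ν, hν1, ?_⟩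
  filter_upwards [star_mem_nhds T z] with y hy
  rw [mem_halfspace]
  constructor
  · intro hyP
    by_contra hcon
    rw [← D.regular] at hyP
    obtain ⟨x, ⟨hx1, hx2⟩, hx3⟩ := mem_closure_iff.1 hyP _
      ((isOpen_star T z).inter (isOpen_lt continuous_const hcont)) ⟨hy, not_le.1 hcon⟩
    obtain ⟨x', hx', h0⟩ := D.exists_off_plane (((isOpen_star T z).inter
      (isOpen_lt continuous_const hcont)).inter isOpen_interior) ⟨x, ⟨hx1, hx2⟩, hx3⟩
    exact hout x' hx'.1.1 h0 hx'.1.2 (interior_subset hx'.2)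
  · intro hle
    rw [← D.isClosed.closure_eq]
    refine mem_closure_iff.2 fun O hO hyO => ?_
    obtain ⟨s, hs, -, h1⟩ := exists_pos_of_eventually (-ν)
      (eventually_mem_set.2 ((hO.inter (isOpen_star T z)).mem_nhds ⟨hyO, hy⟩))
    have h2 : inner ℝ ν (y + s • -ν - z) < (0 : ℝ) := by
      have e : y + s • -ν - z = (y - z) - s • ν := by module
      rw [e, inner_sub_right, inner_smul_right, real_inner_self_eq_norm_sq, hν1]
      linarith
    obtain ⟨x, hx, hx0⟩ := D.exists_off_plane ((hO.inter (isOpen_star T z)).inter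
      (isOpen_lt hcont continuous_const)) ⟨_, h1, h2⟩
    exact ⟨x, hx.1.1, hin x hx.1.2 hx0 hx.2⟩

lemma FaceData.edge_on_edge (hw : RotDir A B n w) {z : E3} (hz : z ∈ openSegment ℝ A B)
    (hgen : ∀ p ∈ T, ev p z = 0 → inner ℝ p.1 (B - A) = (0 : ℝ)) :
    ∀ᶠ t in 𝓝[≥] (0 : ℝ), z ∈ edgePoints (replaced P F A B T (rotNormal n w t)) := by
  filter_upwards [D.not_interior_on_edge hw hz, D.not_facePoint_on_edge hw hz] with t h1 h2
  have hzs := openSegment_subset_segment ℝ A B hz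
  have hzQ : z ∈ replaced P F A B T (rotNormal n w t) :=
    (mem_replaced_of_notMem (D.notMem_region_of_mem_segment hzs)).2 (D.sub_P (D.seg_sub hzs))
  refine ⟨⟨subset_closure hzQ, h1⟩, h2, (‖B - A‖)⁻¹ • (B - A), ?_,
    (D.sat_replaced (rotNormal n w t)).invariant fun p hp h => ?_⟩
  · rw [norm_smul, norm_inv, norm_norm,
      inv_mul_cancel₀ (norm_ne_zero_iff.2 (sub_ne_zero.2 D.ne.symm))]
  · rw [inner_smul_right]
    rcases Finset.mem_insert.1 hp with rfl | hp
    · rw [D.rotNormal_AB hw, mul_zero]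
    · rw [hgen p hp h, mul_zero]

/-- Up to finitely many points, the edge `AB` persists under small rotations. -/
lemma FaceData.exists_edge_persists (hw : RotDir A B n w) :
    ∃ S : Set E3, S.Finite ∧ ∀ᶠ t in 𝓝[≥] (0 : ℝ), ∀ z ∈ segment ℝ A B, z ∉ S →
      z ∈ edgePoints P ∧ z ∈ edgePoints (replaced P F A B T (rotNormal n w t)) := by
  set S0 := {z | z ∈ openSegment ℝ A B ∧
    ∀ p ∈ T, ev p z = 0 → inner ℝ p.1 (B - A) = (0 : ℝ)} with hS0
  obtain ⟨κ, hκ, hκS⟩ : ∃ κ > 0, ∀ y ∈ S0, ∀ t ∈ Ico 0 κ,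
      y ∈ edgePoints (replaced P F A B T (rotNormal n w t)) := by
    refine exists_uniform (T := T) (fun y κ κ' _ hle h t ht => h t ⟨ht.1, ht.2.trans_le hle⟩) ?_
    rintro y ⟨hy, hgen⟩
    obtain ⟨κ, hκ, h⟩ := mem_nhdsGE_iff_exists_Ico_subset.1 (D.edge_on_edge hw hy hgen)
    refine ⟨κ, hκ, fun y' hy' hsign t ht => ?_⟩
    refine (D.sat_replaced (rotNormal n w t)).edgePoints y y' (fun p hp => ?_) (h ht)
    rcases Finset.mem_insert.1 hp with rfl | hp
    · rw [ev_base, ev_base,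
        RotDir.inner_rotNormal_seg D hw (openSegment_subset_segment ℝ A B hy),
        RotDir.inner_rotNormal_seg D hw (openSegment_subset_segment ℝ A B hy'.1)]
    · exact hsign p hp
  refine ⟨{A, B} ∪ (fun s : ℝ => A + s • (B - A)) ''
    {s : ℝ | ∃ p ∈ T, ev p (A + s • (B - A)) = 0 ∧ inner ℝ p.1 (B - A) ≠ (0 : ℝ)},
    (Set.toFinite _).union ((finite_line_inter T A (B - A)).image _), ?_⟩
  filter_upwards [Ico_mem_nhdsGE hκ] with t ht z hz hzS
  have hzo : z ∈ openSegment ℝ A B := by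
    rcases eq_or_ne z A with rfl | hA
    · exact absurd (Or.inl (by simp)) hzS
    rcases eq_or_ne z B with rfl | hB
    · exact absurd (Or.inl (by simp)) hzS
    exact mem_openSegment_of_ne_left_right hA.symm hB.symm hz
  refine ⟨D.edge hzo, hκS z ⟨hzo, fun p hp h0 => ?_⟩ t ht⟩
  by_contra hne
  refine hzS (Or.inr ?_)
  rw [openSegment_eq_image'] at hzo
  obtain ⟨s, -, rfl⟩ := hzo
  exact ⟨s, ⟨p, hp, h0, hne⟩, rfl⟩

lemma FaceData.H1_edges_off_region (hw : RotDir A B n w) :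
    ∀ᶠ t in 𝓝[≥] (0 : ℝ), H1 (edgePoints (replaced P F A B T (rotNormal n w t)) \ region F A B T)
      = H1 (edgePoints P \ region F A B T) := by
  obtain ⟨S, hS, hev⟩ := D.exists_edge_persists hw
  filter_upwards [hev, D.eventually_small w] with t ht hsm
  refine measure_congr ?_
  rw [Filter.eventuallyEq_set]
  have hS0 : H1 S = 0 := hS.measure_zero _
  filter_upwards [measure_eq_zero_iff_ae_notMem.1 hS0] with z hz
  simp only [Set.mem_sdiff]
  refine and_congr_left fun hV => ?_
  by_cases hzs : z ∈ segment ℝ A B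
  · exact iff_of_true (ht z hzs hz).2 (ht z hzs hz).1
  · exact mem_edgePoints_congr (D.replaced_eventually_eq hw hsm hV hzs)

end

end

section

/-- The planes of the arrangement, each encoded with both of its unit normals. -/
def unitPlanes (T : Finset (E3 × ℝ)) : Finset (E3 × ℝ) := by
  classical
  exact (T.image fun p => ((‖p.1‖)⁻¹ • p.1, (‖p.1‖)⁻¹ * p.2)) ∪
    (T.image fun p => (-((‖p.1‖)⁻¹ • p.1), -((‖p.1‖)⁻¹ * p.2)))

lemma mem_unitPlanes {T : Finset (E3 × ℝ)} {p : E3 × ℝ} (hp : p ∈ T) {ν z : E3} {c : ℝ}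
    (hν : ‖ν‖ = 1) (hc : c ≠ 0) (hpc : p.1 = c • ν) (hz : ev p z = 0) :
    (ν, (inner ℝ ν z : ℝ)) ∈ unitPlanes T := by
  classical
  have hn : ‖p.1‖ = |c| := by rw [hpc, norm_smul, hν, mul_one, Real.norm_eq_abs]
  have h2 : p.2 = c * inner ℝ ν z := by
    have := hz
    rw [ev, hpc, inner_smul_left, conj_trivial] at this
    linarith
  rw [unitPlanes, Finset.mem_union, Finset.mem_image, Finset.mem_image]
  rcases lt_or_gt_of_ne hc with h | h
  · right
    refine ⟨p, hp, ?_⟩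
    rw [hn, abs_of_neg h, hpc, h2, smul_smul, ← mul_assoc, inv_neg, neg_mul,
      inv_mul_cancel₀ hc]
    simp
  · left
    refine ⟨p, hp, ?_⟩
    rw [hn, abs_of_pos h, hpc, h2, smul_smul, ← mul_assoc, inv_mul_cancel₀ hc]
    simp

lemma norm_of_mem_unitPlanes {T : Finset (E3 × ℝ)} (hnz : ∀ p ∈ T, p.1 ≠ 0) {q : E3 × ℝ}
    (hq : q ∈ unitPlanes T) : ‖q.1‖ = 1 := by
  classical
  rw [unitPlanes, Finset.mem_union, Finset.mem_image, Finset.mem_image] at hq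
  have key : ∀ p ∈ T, ‖(‖p.1‖)⁻¹ • p.1‖ = 1 := fun p hp => by
    rw [norm_smul, norm_inv, norm_norm, inv_mul_cancel₀ (norm_ne_zero_iff.2 (hnz p hp))]
  rcases hq with ⟨p, hp, rfl⟩ | ⟨p, hp, rfl⟩
  · exact key p hp
  · simp only [norm_neg]; exact key p hp

/-- The faces of the body in the plane `q`. -/
def facet (P F : Set E3) (A B : E3) (T : Finset (E3 × ℝ)) (q : E3 × ℝ) : Set E3 :=
  {z | IsFacePoint (body P F A B T) z q.1 ∧ inner ℝ q.1 z = q.2}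

/-- The edges of the body. -/
def bodyEdges (P F : Set E3) (A B : E3) (T : Finset (E3 × ℝ)) : Set E3 :=
  edgePoints (body P F A B T) ∩ region F A B T

/-- The open side of the rotated plane on which the rotated polyhedron lies. -/
def lowerSide (A n w : E3) (t : ℝ) : Set E3 := {z | inner ℝ (rotNormal n w t) (z - A) < (0 : ℝ)}

/-- The rotated plane. -/
def rotPlane (A n w : E3) (t : ℝ) : Set E3 := {z | inner ℝ (rotNormal n w t) (z - A) = (0 : ℝ)}

lemma isOpen_lowerSide (A n w : E3) (t : ℝ) : IsOpen (lowerSide A n w t) :=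
  isOpen_lt (by fun_prop) continuous_const

lemma isClosed_rotPlane (A n w : E3) (t : ℝ) : IsClosed (rotPlane A n w t) :=
  isClosed_eq (by fun_prop) continuous_const

section
variable {P F : Set E3} {A B n w : E3} {T : Finset (E3 × ℝ)} (D : FaceData P F A B n T)
include D

/-- For small angles the rotated plane is parallel to no plane of the arrangement other than those
parallel to the face. -/
lemma FaceData.eventually_transverse (hw : RotDir A B n w) :
    ∀ᶠ t in 𝓝 (0 : ℝ), ∀ q ∈ unitPlanes T, (∀ c : ℝ, q.1 ≠ c • n) →
      ∀ c : ℝ, q.1 ≠ c • rotNormal n w t := by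
  refine ((unitPlanes T).eventually_all).2 fun q hq => ?_
  by_cases h : ∀ c : ℝ, q.1 ≠ c • n
  · have hc : Continuous fun t : ℝ => rotNormal n w t := by
      have := Real.continuous_cos
      have := Real.continuous_sin
      unfold rotNormal; fun_prop
    have h0 : rotNormal n w 0 = n := by simp [rotNormal]
    have h1 : ∀ᶠ t in 𝓝 (0 : ℝ), rotNormal n w t ≠ q.1 :=
      hc.continuousAt.eventually_ne (by rw [h0]; intro h'; exact h 1 (by simp [h']))
    have h2 : ∀ᶠ t in 𝓝 (0 : ℝ), rotNormal n w t ≠ -q.1 :=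
      hc.continuousAt.eventually_ne (by rw [h0]; intro h'; exact h (-1) (by simp [h']))
    filter_upwards [h1, h2] with t h1 h2 _ c hcq
    have h3 : ‖q.1‖ = |c| * ‖rotNormal n w t‖ := by rw [hcq, norm_smul, Real.norm_eq_abs]
    rw [norm_of_mem_unitPlanes D.nz hq, hw.norm_rot D.norm_n, mul_one] at h3
    rcases (abs_eq zero_le_one).1 h3.symm with h4 | h4
    · exact h1 (by rw [hcq, h4, one_smul])
    · exact h2 (by rw [hcq, h4]; simp)
  · exact Eventually.of_forall fun t h' => absurd h' h

lemma FaceData.mem_unitPlanes_of_normal {y ν : E3} (hν : ν ∈ normals P F T y) :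
    (ν, (inner ℝ ν y : ℝ)) ∈ unitPlanes T := by
  obtain ⟨h1, p, hp, c, hc, hpc, hpy, -⟩ := D.normals_plane hν
  exact mem_unitPlanes hp h1 hc hpc hpy

lemma FaceData.mem_unitPlanes_of_facePoint {z ν : E3} (hν : IsFacePoint (body P F A B T) z ν) :
    (ν, (inner ℝ ν z : ℝ)) ∈ unitPlanes T := by
  obtain ⟨p, hp, c, hc, hpc, hpy⟩ := hν.exists_plane D.nz D.sat_body
  exact mem_unitPlanes hp hν.1 hc hpc hpy

lemma FaceData.exists_line {y z : E3} (hy : y ∈ F \ segment ℝ A B)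
    (h : (active P F T y z).Nontrivial) :
    ∃ ℓ ∈ arrangementLines T, z ∈ ℓ ∧ y ∈ ℓ := by
  obtain ⟨ν, ⟨hν, h0⟩, ν', ⟨hν', h0'⟩, hne⟩ := h
  obtain ⟨-, p, hp, c, hc, hpc, hpy, hev⟩ := D.normals_plane hν
  obtain ⟨-, p', hp', c', hc', hpc', hpy', hev'⟩ := D.normals_plane hν'
  refine ⟨_, mem_arrangementLines hp hp' (D.nz p hp) (fun r hr => ?_) hpy hpy',
    ⟨by rw [hev, h0, mul_zero], by rw [hev', h0', mul_zero]⟩, hpy, hpy'⟩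
  rw [hpc, hpc', smul_smul] at hr
  refine D.normals_not_parallel hy hν hν' hne (c'⁻¹ * (r * c)) ?_
  rw [mul_smul, ← hr, smul_smul, inv_mul_cancel₀ hc', one_smul]

/-- Points of the rotated plane on the body lie in the star of a point of the face that is not on
the rotated plane, unless they lie on the face themselves. -/
lemma FaceData.exists_star_rotPlane (hw : RotDir A B n w) {t : ℝ} (ht : SmallAngle P F A B n w T t) {z : E3}
    (hz : z ∈ body P F A B T) (hL : z ∈ rotPlane A n w t) :
    ∃ v ∈ F \ segment ℝ A B, z ∈ star T v ∧ (v = z ∨ v ∉ rotPlane A n w t) := by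
  rw [rotPlane, mem_ofPred_eq, inner_rotNormal] at hL
  by_cases h0 : inner ℝ n (z - A) = (0 : ℝ)
  · have hzF := D.body_plane hz h0
    exact ⟨z, ⟨hzF, fun h => D.notMem_region_of_mem_segment h (body_subset_region hz)⟩,
      self_mem_star T z, Or.inl rfl⟩
  · have hsW : Real.sin t * (inner ℝ w (z - A) : ℝ) ≠ 0 := fun h => by
      rw [h, add_zero] at hL
      exact (mul_ne_zero ht.cos_pos.ne' h0) hL
    have hW := right_ne_zero_of_mul hsW
    obtain ⟨v, hv, hvW, hzv⟩ := ht.flat z (subset_closure hz) (by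
      have e : Real.cos t * (inner ℝ n (z - A) : ℝ) = -(Real.sin t * inner ℝ w (z - A)) := by
        linarith
      have e' := congrArg abs e
      rw [abs_neg, abs_mul, abs_mul, abs_of_pos ht.cos_pos, abs_of_nonneg ht.sin_nonneg] at e'
      exact e'.le) hW
    have hvL : v ∉ rotPlane A n w t := by
      rw [rotPlane, mem_ofPred_eq, inner_rotNormal, D.sub_plane v hv, mul_zero, zero_add]
      exact mul_ne_zero (left_ne_zero_of_mul hsW) hvW
    exact ⟨v, ⟨hv, fun hvs => hvW (hw.seg hvs)⟩, hzv, Or.inr hvL⟩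

omit D in
lemma mem_edge_lower {t : ℝ} {z : E3} (hV : z ∈ region F A B T)
    (hL : z ∈ lowerSide A n w t) :
    z ∈ edgePoints (replaced P F A B T (rotNormal n w t)) ↔ z ∈ edgePoints (body P F A B T) := by
  refine mem_edgePoints_congr ?_
  filter_upwards [isOpen_region.mem_nhds hV, (isOpen_lowerSide A n w t).mem_nhds hL] with y h1 h2
  rw [mem_replaced_iff h1]
  exact and_iff_right (le_of_lt h2)

omit D in
lemma notMem_edge_upper {t : ℝ} {z : E3} (hV : z ∈ region F A B T)
    (hL : 0 < (inner ℝ (rotNormal n w t) (z - A) : ℝ)) :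
    z ∉ edgePoints (replaced P F A B T (rotNormal n w t)) := by
  intro h
  have hO : IsOpen {z : E3 | 0 < (inner ℝ (rotNormal n w t) (z - A) : ℝ)} :=
    isOpen_lt continuous_const (by fun_prop)
  obtain ⟨y, ⟨hy1, hy2⟩, hy3⟩ := mem_closure_iff.1 h.1.1 _ (isOpen_region.inter hO) ⟨hV, hL⟩
  exact absurd ((mem_replaced_iff hy1).1 hy3).1 (not_le.2 hy2)

/-- A face point of the body on the rotated plane is an edge point of the rotated polyhedron. -/
lemma FaceData.edge_of_facePoint (hw : RotDir A B n w) {t : ℝ} {z ν : E3}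
    (hν : IsFacePoint (body P F A B T) z ν) (hL : z ∈ rotPlane A n w t)
    (hpar : ∀ c : ℝ, ν ≠ c • rotNormal n w t) :
    z ∈ edgePoints (replaced P F A B T (rotNormal n w t)) := by
  have hV := body_subset_region hν.mem
  have hg : ∀ᶠ y in 𝓝 z, (y ∈ replaced P F A B T (rotNormal n w t) ↔
      inner ℝ (rotNormal n w t) (y - z) ≤ (0 : ℝ) ∧ inner ℝ ν (y - z) ≤ (0 : ℝ)) := by
    filter_upwards [hν.2, isOpen_region.mem_nhds hV] with y h1 h2
    rw [mem_replaced_iff h2, h1, mem_halfspace]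
    have e : y - A = (y - z) + (z - A) := by abel
    have hL' : inner ℝ (rotNormal n w t) (z - A) = (0 : ℝ) := hL
    rw [e, inner_add_right, hL', add_zero]
  have hzQ := hg.self_of_nhds.2 (by simp)
  obtain ⟨u, hu, h1, h2⟩ := exists_unit_orthogonal (rotNormal n w t) ν
  refine ⟨⟨subset_closure hzQ, fun hint => ?_⟩, ?_, u, hu, ?_⟩
  · obtain ⟨s, hs, -, h1, h2⟩ := exists_pos_of_eventually ν
      (hg.and (eventually_mem_set.2 (mem_interior_iff_mem_nhds.1 hint)))
    have h3 := (h1.1 h2).2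
    rw [add_sub_cancel_left, inner_smul_right, real_inner_self_eq_norm_sq, hν.1] at h3
    linarith
  · rintro ⟨μ, hμ⟩
    have h3 : μ = ν := unit_eq_of_halfspace_subset (x := z) hμ.1 hν.1 (by
      filter_upwards [hμ.2, hg] with y h1 h2 h3 using (h2.1 (h1.2 h3)).2)
    have h4 : μ = rotNormal n w t :=
      unit_eq_of_halfspace_subset (x := z) hμ.1 (hw.norm_rot D.norm_n t) (by
        filter_upwards [hμ.2, hg] with y h1 h2 h3 using (h2.1 (h1.2 h3)).1)
    exact hpar 1 (by rw [one_smul, ← h3, h4])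
  · have c1 : Tendsto (fun q : E3 × ℝ => q.1) (𝓝 (z, 0)) (𝓝 z) := continuous_fst.tendsto _
    have c2 : Tendsto (fun q : E3 × ℝ => q.1 + q.2 • u) (𝓝 (z, 0)) (𝓝 z) := by
      have : Continuous (fun q : E3 × ℝ => q.1 + q.2 • u) := by fun_prop
      simpa using this.tendsto (z, 0)
    filter_upwards [c1.eventually hg, c2.eventually hg] with q q1 q2
    rw [q1, q2, add_sub_right_comm, inner_add_right, inner_add_right, inner_smul_right,
      inner_smul_right, h1, h2]
    simp

end

end

section

section
variable {P F : Set E3} {A B n w : E3} {T : Finset (E3 × ℝ)} (D : FaceData P F A B n T)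
include D

omit D in
lemma finite_line_inter_rotPlane (T : Finset (E3 × ℝ)) (A n w : E3) (t : ℝ) :
    {z | ∃ ℓ ∈ arrangementLines T, z ∈ ℓ ∧ z ∈ rotPlane A n w t ∧
      ¬ ℓ ⊆ rotPlane A n w t}.Finite := by
  have h : {z | ∃ ℓ ∈ arrangementLines T, z ∈ ℓ ∧ z ∈ rotPlane A n w t ∧
      ¬ ℓ ⊆ rotPlane A n w t} ⊆
      ⋃ ℓ ∈ arrangementLines T, {z | z ∈ ℓ ∧ z ∈ rotPlane A n w t ∧ ¬ ℓ ⊆ rotPlane A n w t} := by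
    rintro z ⟨ℓ, h1, h2⟩
    exact mem_biUnion h1 h2
  refine ((finite_arrangementLines T).biUnion fun ℓ hℓ => Set.Subsingleton.finite ?_).subset h
  rintro z ⟨hz, hzp, hn⟩ z' ⟨hz', hzp', -⟩
  by_contra hne
  obtain ⟨⟨c, d, -, rfl⟩, -⟩ := hℓ
  refine hn ?_
  rw [line_eq_of_mem hz hz' hne]
  rintro _ ⟨s, rfl⟩
  have h1 : inner ℝ (rotNormal n w t) (z - A) = (0 : ℝ) := hzp
  have h2 : inner ℝ (rotNormal n w t) (z' - A) = (0 : ℝ) := hzp'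
  have e : z + s • (z' - z) - A = (1 - s) • (z - A) + s • (z' - A) := by module
  simp only [rotPlane, mem_ofPred_eq, e, inner_add_right, inner_smul_right, h1, h2]
  ring

lemma FaceData.facePoint_not_parallel {z ν : E3} (hν : IsFacePoint (body P F A B T) z ν) (c : ℝ) :
    ν ≠ c • n := by
  obtain ⟨y, hy, hzy, -⟩ := hν.mem
  have h := (D.isFacePoint_body_iff hy hzy hν.mem).1 hν
  have h' : ν ∈ active P F T y z := by rw [h]; rfl
  exact D.normals_not_parallel_n hy h'.1 c

/-- The edges of the rotated polyhedron in the rotated plane are the traces of the faces of the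
body, up to finitely many points. -/
lemma FaceData.H1_edges_on_rotPlane (hw : RotDir A B n w) {t : ℝ}
    (ht : SmallAngle P F A B n w T t)
    (htr : ∀ q ∈ unitPlanes T, (∀ c : ℝ, q.1 ≠ c • n) → ∀ c : ℝ, q.1 ≠ c • rotNormal n w t) :
    H1 (edgePoints (replaced P F A B T (rotNormal n w t)) ∩ region F A B T ∩ rotPlane A n w t)
      = H1 (facePoints (body P F A B T) ∩ rotPlane A n w t) := by
  set exc := corners P F A B T ∪ {z | ∃ ℓ ∈ arrangementLines T, z ∈ ℓ ∧ z ∈ rotPlane A n w t ∧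
      ¬ ℓ ⊆ rotPlane A n w t} with hexc
  have hfin : H1 exc = 0 := Set.Finite.measure_zero
    (D.finite_corners.union (finite_line_inter_rotPlane T A n w t)) _
  refine measure_congr ?_
  rw [Filter.eventuallyEq_set]
  filter_upwards [measure_eq_zero_iff_ae_notMem.1 hfin] with z hz
  constructor
  · rintro ⟨⟨hzE, hzV⟩, hzp⟩
    refine ⟨?_, hzp⟩
    have hzQ : z ∈ replaced P F A B T (rotNormal n w t) :=
      (D.isClosed_replaced hw ht).frontier_subset hzE.1
    have hzG := ((mem_replaced_iff hzV).1 hzQ).2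
    obtain ⟨v, hv, hzv, hor⟩ := D.exists_star_rotPlane hw ht hzG hzp
    by_cases hnt : (active P F T v z).Nontrivial
    · exfalso
      rcases hor with rfl | hvp
      · rw [active_self] at hnt
        exact hz (Or.inl ⟨hv, hnt⟩)
      · obtain ⟨ℓ, hℓ, hzℓ, hvℓ⟩ := D.exists_line hv hnt
        exact hz (Or.inr ⟨ℓ, hℓ, hzℓ, hzp, fun hsub => hvp (hsub hvℓ)⟩)
    · rcases (not_nontrivial_iff.1 hnt).eq_empty_or_singleton with h | ⟨ν, h⟩
      · exfalso
        refine hzE.2.1 ⟨rotNormal n w t, hw.norm_rot D.norm_n t, ?_⟩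
        filter_upwards [mem_interior_iff_mem_nhds.1 (D.mem_interior_body hv hzv hzG h),
          isOpen_region.mem_nhds hzV] with y h1 h2
        rw [mem_replaced_iff h2, mem_halfspace, and_iff_left h1]
        have e : y - A = (y - z) + (z - A) := by abel
        have hL' : inner ℝ (rotNormal n w t) (z - A) = (0 : ℝ) := hzp
        rw [e, inner_add_right, hL', add_zero]
      · exact ⟨ν, (D.isFacePoint_body_iff hv hzv hzG).2 h⟩
  · rintro ⟨⟨ν, hν⟩, hzp⟩
    refine ⟨⟨D.edge_of_facePoint hw hν hzp ?_, body_subset_region hν.mem⟩, hzp⟩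
    exact htr _ (D.mem_unitPlanes_of_facePoint hν) (D.facePoint_not_parallel hν)

lemma FaceData.sat_bodyEdges : Sat T (bodyEdges P F A B T) := D.sat_body.edgePoints.inter sat_region

lemma FaceData.measurableSet_facet (q : E3 × ℝ) : MeasurableSet (facet P F A B T q) := by
  have h : Sat T {z | IsFacePoint (body P F A B T) z q.1} :=
    fun z z' h hz => IsFacePoint.of_signEq D.sat_body h hz
  exact h.measurableSet.inter (measurableSet_eq_fun (by fun_prop) measurable_const)

lemma FaceData.bodyEdges_subset_body : bodyEdges P F A B T ⊆ body P F A B T := fun z hz => by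
  rw [← D.closure_body_inter]
  exact ⟨hz.1.1.1, hz.2⟩

lemma FaceData.bodyEdges_subset_lines {z : E3} (hz : z ∈ bodyEdges P F A B T) :
    ∃ ℓ ∈ arrangementLines T, z ∈ ℓ := by
  have hzG := D.bodyEdges_subset_body hz
  obtain ⟨y, hy, hzy, -⟩ := id hzG
  obtain ⟨ℓ, hℓ, h, -⟩ := D.exists_line hy (D.nontrivial_of_edge hy hzy hzG hz.1)
  exact ⟨ℓ, hℓ, h⟩

lemma FaceData.H1_facePoints_inter {X : Set E3} (hX : MeasurableSet X) :
    H1 (facePoints (body P F A B T) ∩ X) = ∑ q ∈ unitPlanes T, H1 (facet P F A B T q ∩ X) := by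
  have hU : facePoints (body P F A B T) ∩ X = ⋃ q ∈ unitPlanes T, facet P F A B T q ∩ X := by
    ext z
    simp only [mem_iUnion, exists_prop, mem_inter_iff]
    constructor
    · rintro ⟨⟨ν, hν⟩, hz⟩
      exact ⟨_, D.mem_unitPlanes_of_facePoint hν, ⟨hν, rfl⟩, hz⟩
    · rintro ⟨q, -, h, hz⟩
      exact ⟨⟨_, h.1⟩, hz⟩
  rw [hU]
  refine measure_biUnion_finset ?_ fun q _ => (D.measurableSet_facet q).inter hX
  intro q _ q' _ hne
  refine Set.disjoint_left.2 fun z hz hz' => hne ?_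
  have h1 : q.1 = q'.1 := hz.1.1.unique hz'.1.1
  exact Prod.ext h1 (by rw [← hz.1.2, ← hz'.1.2, h1])

/-- The edge length of the rotated polyhedron: a constant, the parts of the edges of the body below
the rotated plane, and the traces of the faces of the body on the rotated plane. -/
theorem FaceData.edgeLength_replaced (hw : RotDir A B n w) :
    ∀ᶠ t in 𝓝[≥] (0 : ℝ), edgeLength (replaced P F A B T (rotNormal n w t)) =
      (H1 (edgePoints P \ region F A B T)).toReal +
      ∑ ℓ ∈ (finite_arrangementLines T).toFinset,
        (H1 (bodyEdges P F A B T ∩ lowerSide A n w t ∩ ℓ)).toReal +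
      ∑ q ∈ unitPlanes T, (H1 (facet P F A B T q ∩ rotPlane A n w t)).toReal := by
  filter_upwards [D.eventually_small w, D.H1_edges_off_region hw,
    (D.eventually_transverse hw).filter_mono nhdsWithin_le_nhds] with t ht hoff htr
  set Q := replaced P F A B T (rotNormal n w t) with hQ
  set T' : Finset (E3 × ℝ) := insert (rotNormal n w t, (inner ℝ (rotNormal n w t) A : ℝ)) T with hT'
  have hsat : Sat T' Q := D.sat_replaced _
  have hpoly := D.isPolyhedron_replaced hw ht
  have hEm : MeasurableSet (edgePoints Q) := hsat.edgePoints.measurableSet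
  have hVm : MeasurableSet (region F A B T) := isOpen_region.measurableSet
  have hLm : MeasurableSet (lowerSide A n w t) := (isOpen_lowerSide A n w t).measurableSet
  obtain ⟨R, hR⟩ := hpoly.compact.isBounded.exists_norm_le
  have hfin : H1 (edgePoints Q) < ⊤ := by
    refine H1_lt_top hEm (fun z hz => edgePoints_subset_lines (T := T') ?_ hsat hpoly.regular hz)
      (R := R) fun z hz => hR z (hpoly.compact.isClosed.frontier_subset hz.1)
    intro p hp
    rcases Finset.mem_insert.1 hp with rfl | hp
    · intro h0
      have h1 := hw.norm_rot D.norm_n t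
      simp only at h0
      rw [h0, norm_zero] at h1
      exact zero_ne_one h1
    · exact D.nz p hp
  have hlow : edgePoints Q ∩ region F A B T ∩ lowerSide A n w t =
      bodyEdges P F A B T ∩ lowerSide A n w t := by
    ext z
    simp only [bodyEdges, mem_inter_iff]
    constructor
    · rintro ⟨⟨h1, h2⟩, h3⟩; exact ⟨⟨(mem_edge_lower h2 h3).1 h1, h2⟩, h3⟩
    · rintro ⟨⟨h1, h2⟩, h3⟩; exact ⟨⟨(mem_edge_lower h2 h3).2 h1, h2⟩, h3⟩
  have hup : (edgePoints Q ∩ region F A B T) \ lowerSide A n w t =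
      edgePoints Q ∩ region F A B T ∩ rotPlane A n w t := by
    ext z
    simp only [Set.mem_sdiff, mem_inter_iff]
    refine and_congr_right fun ⟨h1, h2⟩ => ⟨fun h => ?_, fun h h' => ?_⟩
    · refine le_antisymm ?_ (not_lt.1 h)
      by_contra hcon
      exact notMem_edge_upper h2 (not_le.1 hcon) h1
    · have h3 : inner ℝ (rotNormal n w t) (z - A) = (0 : ℝ) := h
      exact absurd h3 (ne_of_lt h')
  have e1 := measure_inter_add_sdiff (μ := H1) (edgePoints Q) hVm
  have e2 := measure_inter_add_sdiff (μ := H1) (edgePoints Q ∩ region F A B T) hLm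
  rw [hup, hlow, D.H1_edges_on_rotPlane hw ht htr,
    D.H1_facePoints_inter (isClosed_rotPlane A n w t).measurableSet,
    H1_eq_sum_lines (T := T) (D.sat_bodyEdges.measurableSet.inter hLm)
      (fun z hz => D.bodyEdges_subset_lines hz.1)] at e2
  rw [← e2, hoff] at e1
  have htop := e1 ▸ hfin
  rw [edgeLength, ← H1, ← e1]
  have h1 := (ENNReal.add_lt_top.1 htop).1
  have h2 := (ENNReal.add_lt_top.1 htop).2
  have h3 := (ENNReal.add_lt_top.1 h1).1
  have h4 := (ENNReal.add_lt_top.1 h1).2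
  rw [ENNReal.toReal_add h1.ne h2.ne, ENNReal.toReal_add h3.ne h4.ne, ENNReal.toReal_sum,
    ENNReal.toReal_sum]
  · ring
  · exact fun q hq => (ENNReal.sum_lt_top.1 h4 q hq).ne
  · exact fun q hq => (ENNReal.sum_lt_top.1 h3 q hq).ne

end

end

section

/-! ### One-sided derivatives of lengths of subsets of a line -/

/-- `f` has right derivative `c` at `0`. -/
def RightDeriv (f : ℝ → ℝ) (c : ℝ) : Prop := HasDerivWithinAt f c (Ici 0) 0

lemma rightDeriv_iff {f : ℝ → ℝ} {c : ℝ} (h0 : f 0 = 0) :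
    RightDeriv f c ↔ Tendsto (fun t => t⁻¹ * f t) (𝓝[>] 0) (𝓝 c) := by
  rw [RightDeriv, hasDerivWithinAt_iff_tendsto_slope, Ici_sdiff_left]
  refine tendsto_congr fun t => ?_
  rw [slope_def_field, h0, sub_zero, sub_zero]
  ring

lemma RightDeriv.congr {f g : ℝ → ℝ} {c : ℝ} (h : RightDeriv g c)
    (hfg : ∀ᶠ t in 𝓝[≥] (0 : ℝ), f t = g t) : RightDeriv f c :=
  HasDerivWithinAt.congr_of_eventuallyEq h hfg (hfg.self_of_nhdsWithin (mem_Ici.2 le_rfl))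

lemma RightDeriv.const_add {f : ℝ → ℝ} {c : ℝ} (h : RightDeriv f c) (b : ℝ) :
    RightDeriv (fun t => b + f t) c := HasDerivWithinAt.const_add b h

lemma rightDeriv_const (b : ℝ) : RightDeriv (fun _ => b) 0 := hasDerivWithinAt_const _ _ _

lemma rightDeriv_inf' {ι : Type*} {s : Finset ι} (hs : s.Nonempty) {κ : ι → ℝ → ℝ} {k : ι → ℝ}
    (h0 : ∀ j ∈ s, κ j 0 = 0) (h : ∀ j ∈ s, RightDeriv (κ j) (k j)) :
    RightDeriv (fun t => s.inf' hs fun j => κ j t) (s.inf' hs k) := by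
  rw [rightDeriv_iff]
  · have h1 := Filter.Tendsto.finset_inf'_nhds_apply hs fun j hj => (rightDeriv_iff (h0 j hj)).1 (h j hj)
    refine h1.congr' ?_
    filter_upwards [self_mem_nhdsWithin] with t ht
    have ht' : 0 < t⁻¹ := inv_pos.2 ht
    exact (Finset.apply_inf'_eq_inf'_comp hs (fun x => t⁻¹ * x)
      (fun x y => mul_min_of_nonneg x y ht'.le)).symm
  · rw [Finset.inf'_congr hs rfl h0, Finset.inf'_const]

lemma rightDeriv_sup' {ι : Type*} {s : Finset ι} (hs : s.Nonempty) {κ : ι → ℝ → ℝ} {k : ι → ℝ}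
    (h0 : ∀ j ∈ s, κ j 0 = 0) (h : ∀ j ∈ s, RightDeriv (κ j) (k j)) :
    RightDeriv (fun t => s.sup' hs fun j => κ j t) (s.sup' hs k) := by
  rw [rightDeriv_iff]
  · have h1 := Filter.Tendsto.finset_sup'_nhds_apply hs fun j hj => (rightDeriv_iff (h0 j hj)).1 (h j hj)
    refine h1.congr' ?_
    filter_upwards [self_mem_nhdsWithin] with t ht
    have ht' : 0 < t⁻¹ := inv_pos.2 ht
    exact (Finset.apply_sup'_eq_sup'_comp hs (fun x => t⁻¹ * x)
      (fun x y => mul_max_of_nonneg x y ht'.le)).symm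
  · rw [Finset.sup'_congr hs rfl h0, Finset.sup'_const]

lemma rightDeriv_max_zero {f : ℝ → ℝ} {c : ℝ} (h0 : f 0 = 0) (h : RightDeriv f c) :
    RightDeriv (fun t => max 0 (f t)) (max 0 c) := by
  rw [rightDeriv_iff (by simp [h0])]
  refine (tendsto_const_nhds.max ((rightDeriv_iff h0).1 h)).congr' ?_
  filter_upwards [self_mem_nhdsWithin] with t ht
  have ht' : 0 < t⁻¹ := inv_pos.2 ht
  rw [mul_max_of_nonneg _ _ ht'.le, mul_zero]

/-- The rate of change of the length of an interval whose left end is the largest of the moving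
thresholds in `Lo` and whose right end is the smallest of those in `Hi`, all starting at one point
with velocities `k`. A missing threshold means that the interval extends beyond the
neighbourhood considered. -/
def gapRate {ι : Type*} (Lo Hi : Finset ι) (k : ι → ℝ) : ℝ := by
  classical
  exact if hL : Lo.Nonempty then
    (if hH : Hi.Nonempty then max 0 (Hi.inf' hH k - Lo.sup' hL k) else -Lo.sup' hL k)
    else (if hH : Hi.Nonempty then Hi.inf' hH k else 0)

lemma volume_toReal_congr {X Y : Set ℝ} (s : ℝ) (h : ∀ x, x ≠ s → (x ∈ X ↔ x ∈ Y)) :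
    (volume X).toReal = (volume Y).toReal := by
  congr 1
  refine measure_congr ?_
  rw [Filter.eventuallyEq_set]
  have h0 : volume ({s} : Set ℝ) = 0 := measure_singleton s
  filter_upwards [measure_eq_zero_iff_ae_notMem.1 h0] with x hx
  exact h x hx

/-- The local contribution of a point at which finitely many thresholds meet. -/
lemma rightDeriv_gap {ι : Type*} {Lo Hi : Finset ι} {κ : ι → ℝ → ℝ} {k : ι → ℝ} {X : ℝ → Set ℝ}
    {s δ : ℝ} (hδ : 0 < δ) (hL0 : ∀ j ∈ Lo, κ j 0 = 0) (hH0 : ∀ j ∈ Hi, κ j 0 = 0)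
    (hL : ∀ j ∈ Lo, RightDeriv (κ j) (k j)) (hH : ∀ j ∈ Hi, RightDeriv (κ j) (k j))
    (hX : ∀ᶠ t in 𝓝[≥] (0 : ℝ), ∀ x ∈ Metric.ball s δ, x ≠ s →
      (x ∈ X t ↔ (∀ j ∈ Lo, κ j t < x - s) ∧ ∀ j ∈ Hi, x - s < κ j t)) :
    RightDeriv (fun t => (volume (X t ∩ Metric.ball s δ)).toReal) (gapRate Lo Hi k) := by
  classical
  have hball : ∀ x, x ∈ Metric.ball s δ ↔ -δ < x - s ∧ x - s < δ := fun x => by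
    rw [Metric.mem_ball, Real.dist_eq, abs_lt]
  have hsmall : ∀ {f : ℝ → ℝ} {c : ℝ}, f 0 = 0 → RightDeriv f c →
      ∀ᶠ t in 𝓝[≥] (0 : ℝ), -δ < f t ∧ f t < δ := by
    intro f c h0 h
    have hc : Tendsto f (𝓝[≥] 0) (𝓝 0) := by
      have := HasDerivWithinAt.continuousWithinAt h
      rwa [ContinuousWithinAt, h0] at this
    exact (hc.eventually (lt_mem_nhds (by linarith))).and (hc.eventually (gt_mem_nhds hδ))
  by_cases hLo : Lo.Nonempty <;> by_cases hHi : Hi.Nonempty <;>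
    simp only [gapRate, hLo, hHi, dif_pos, dif_neg, not_false_eq_true]
  · have d1 := rightDeriv_sup' hLo hL0 hL
    have d2 := rightDeriv_inf' hHi hH0 hH
    have z1 : (Lo.sup' hLo fun j => κ j 0) = 0 := by
      rw [Finset.sup'_congr hLo rfl hL0, Finset.sup'_const]
    have z2 : (Hi.inf' hHi fun j => κ j 0) = 0 := by
      rw [Finset.inf'_congr hHi rfl hH0, Finset.inf'_const]
    refine (rightDeriv_max_zero (by rw [z1, z2, sub_zero]) (HasDerivWithinAt.fun_sub d2 d1)).congr ?_
    filter_upwards [hX, hsmall z1 d1, hsmall z2 d2] with t ht h1 h2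
    rw [volume_toReal_congr (Y := Ioo (s + Lo.sup' hLo fun j => κ j t)
      (s + Hi.inf' hHi fun j => κ j t)) s, Real.volume_Ioo, ENNReal.toReal_ofReal', max_comm]
    · congr 1; ring
    · intro x hx
      rw [mem_inter_iff, mem_Ioo, ← lt_sub_iff_add_lt', ← sub_lt_iff_lt_add', Finset.sup'_lt_iff,
        Finset.lt_inf'_iff]
      constructor
      · rintro ⟨h3, h4⟩; exact (ht x h4 hx).1 h3
      · intro h3
        have h4 : x ∈ Metric.ball s δ := (hball x).2
          ⟨h1.1.trans ((Finset.sup'_lt_iff hLo).2 h3.1), ((Finset.lt_inf'_iff hHi).2 h3.2).trans h2.2⟩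
        exact ⟨(ht x h4 hx).2 h3, h4⟩
  · have d1 := rightDeriv_sup' hLo hL0 hL
    have z1 : (Lo.sup' hLo fun j => κ j 0) = 0 := by
      rw [Finset.sup'_congr hLo rfl hL0, Finset.sup'_const]
    refine RightDeriv.congr (g := fun t => δ + -(Lo.sup' hLo fun j => κ j t))
      (RightDeriv.const_add (HasDerivWithinAt.neg d1) δ) ?_
    filter_upwards [hX, hsmall z1 d1] with t ht h1
    rw [volume_toReal_congr (Y := Ioo (s + Lo.sup' hLo fun j => κ j t) (s + δ)) s,
      Real.volume_Ioo, ENNReal.toReal_ofReal (by linarith)]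
    · ring
    · intro x hx
      rw [mem_inter_iff, mem_Ioo, ← lt_sub_iff_add_lt', ← sub_lt_iff_lt_add', Finset.sup'_lt_iff]
      constructor
      · rintro ⟨h3, h4⟩; exact ⟨((ht x h4 hx).1 h3).1, ((hball x).1 h4).2⟩
      · intro h3
        have h4 : x ∈ Metric.ball s δ := (hball x).2
          ⟨h1.1.trans ((Finset.sup'_lt_iff hLo).2 h3.1), h3.2⟩
        exact ⟨(ht x h4 hx).2 ⟨h3.1, fun j hj => absurd ⟨j, hj⟩ hHi⟩, h4⟩
  · have d2 := rightDeriv_inf' hHi hH0 hH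
    have z2 : (Hi.inf' hHi fun j => κ j 0) = 0 := by
      rw [Finset.inf'_congr hHi rfl hH0, Finset.inf'_const]
    refine RightDeriv.congr (g := fun t => δ + (Hi.inf' hHi fun j => κ j t))
      (RightDeriv.const_add d2 δ) ?_
    filter_upwards [hX, hsmall z2 d2] with t ht h2
    rw [volume_toReal_congr (Y := Ioo (s + -δ) (s + Hi.inf' hHi fun j => κ j t)) s,
      Real.volume_Ioo, ENNReal.toReal_ofReal (by linarith)]
    · ring
    · intro x hx
      rw [mem_inter_iff, mem_Ioo, ← lt_sub_iff_add_lt', ← sub_lt_iff_lt_add', Finset.lt_inf'_iff]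
      constructor
      · rintro ⟨h3, h4⟩; exact ⟨((hball x).1 h4).1, ((ht x h4 hx).1 h3).2⟩
      · intro h3
        have h4 : x ∈ Metric.ball s δ := (hball x).2
          ⟨h3.1, ((Finset.lt_inf'_iff hHi).2 h3.2).trans h2.2⟩
        exact ⟨(ht x h4 hx).2 ⟨fun j hj => absurd ⟨j, hj⟩ hLo, h3.2⟩, h4⟩
  · refine (rightDeriv_const (volume (Metric.ball s δ)).toReal).congr ?_
    filter_upwards [hX] with t ht
    refine volume_toReal_congr s fun x hx => ?_
    rw [mem_inter_iff]
    refine and_iff_right_of_imp fun h4 => (ht x h4 hx).2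
      ⟨fun j hj => absurd ⟨j, hj⟩ hLo, fun j hj => absurd ⟨j, hj⟩ hHi⟩

/-- A bounded family of subsets of the line that is locally constant away from finitely many
points: the derivative of its length is the sum of the local contributions of these points. -/
theorem rightDeriv_volume {X : ℝ → Set ℝ} {R : ℝ}
    (hR : ∀ᶠ t in 𝓝[≥] (0 : ℝ), X t ⊆ Icc (-R) R)
    (hm : ∀ᶠ t in 𝓝[≥] (0 : ℝ), MeasurableSet (X t)) (J : Finset ℝ) {c : ℝ → ℝ}
    (hconst : ∀ s ∉ J, ∃ δ > 0, ∀ᶠ t in 𝓝[≥] (0 : ℝ), ∀ x ∈ Metric.ball s δ, (x ∈ X t ↔ x ∈ X 0))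
    (hJ : ∀ s ∈ J, ∃ δ₀ > 0, ∀ δ > 0, δ ≤ δ₀ →
      RightDeriv (fun t => (volume (X t ∩ Metric.ball s δ)).toReal) (c s)) :
    RightDeriv (fun t => (volume (X t)).toReal) (∑ s ∈ J, c s) := by
  choose! δ₀ hδ₀ hJ using hJ
  have hex : ∀ᶠ δ in 𝓝[>] (0 : ℝ), ∀ s ∈ J, δ ≤ δ₀ s ∧ ∀ s' ∈ J, s ≠ s' → 2 * δ < dist s s' := by
    refine (Finset.eventually_all J).2 fun s hs => ?_
    have hle : ∀ᶠ δ in 𝓝 (0 : ℝ), δ ≤ δ₀ s := Iic_mem_nhds (hδ₀ s hs)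
    refine (hle.filter_mono nhdsWithin_le_nhds).and ((Finset.eventually_all J).2 fun s' _ => ?_)
    by_cases h : s = s'
    · simp [h]
    · have h1 : (2 : ℝ) * 0 < dist s s' := by simpa using h
      have h2 : Continuous fun δ : ℝ => 2 * δ := by fun_prop
      filter_upwards [(h2.continuousAt.eventually (gt_mem_nhds h1)).filter_mono
        nhdsWithin_le_nhds] with δ hδ _ using hδ
  obtain ⟨δ, hδJ, hδ⟩ := (hex.and self_mem_nhdsWithin).exists
  have hδ : 0 < δ := hδ
  set U := ⋃ s ∈ J, Metric.ball s δ with hU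
  have hUo : IsOpen U := isOpen_biUnion fun s _ => Metric.isOpen_ball
  have hK : IsCompact (Icc (-R) R \ U) := isCompact_Icc.diff hUo
  have hKc : ∀ᶠ t in 𝓝[≥] (0 : ℝ), ∀ x ∈ Icc (-R) R \ U, (x ∈ X t ↔ x ∈ X 0) := by
    refine hK.induction_on (p := fun S => ∀ᶠ t in 𝓝[≥] (0 : ℝ), ∀ x ∈ S, (x ∈ X t ↔ x ∈ X 0))
      (by simp) (fun S S' hs h => h.mono fun t ht x hx => ht x (hs hx))
      (fun S S' h h' => ?_) fun x hx => ?_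
    · filter_upwards [h, h'] with t h1 h2 x hx
      exact hx.elim (h1 x) (h2 x)
    · have hxJ : x ∉ J := fun h => hx.2 (mem_biUnion h (Metric.mem_ball_self hδ))
      obtain ⟨r, hr, h⟩ := hconst x hxJ
      exact ⟨Metric.ball x r, mem_nhdsWithin_of_mem_nhds (Metric.ball_mem_nhds x hr), h⟩
  have hfin : ∀ {Y : Set ℝ}, Y ⊆ Icc (-R) R → volume Y ≠ ⊤ := fun h =>
    ((measure_mono h).trans_lt measure_Icc_lt_top).ne
  have hsum : RightDeriv (fun t => (volume (X 0 \ U)).toReal +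
      ∑ s ∈ J, (volume (X t ∩ Metric.ball s δ)).toReal) (∑ s ∈ J, c s) := by
    refine RightDeriv.const_add ?_ _
    exact HasDerivWithinAt.fun_sum fun s hs => hJ s hs δ hδ (hδJ s hs).1
  refine hsum.congr ?_
  have hR0 := hR.self_of_nhdsWithin (mem_Ici.2 le_rfl)
  filter_upwards [hR, hm, hKc] with t hRt hmt hKt
  have e1 : X t \ U = X 0 \ U := by
    ext x
    simp only [Set.mem_sdiff]
    refine and_congr_left fun hxU => ⟨fun h => ?_, fun h => ?_⟩
    · exact (hKt x ⟨hRt h, hxU⟩).1 h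
    · exact (hKt x ⟨hR0 h, hxU⟩).2 h
  have e2 : volume (X t ∩ U) = ∑ s ∈ J, volume (X t ∩ Metric.ball s δ) := by
    rw [hU, inter_iUnion₂]
    refine measure_biUnion_finset ?_ fun s _ => hmt.inter Metric.isOpen_ball.measurableSet
    intro s hs s' hs' hne
    refine Set.disjoint_left.2 fun x hx hx' => ?_
    have h1 := (hδJ s hs).2 s' hs' hne
    have h2 := dist_triangle_left s s' x
    have h3 := Metric.mem_ball.1 hx.2
    have h4 := Metric.mem_ball.1 hx'.2
    linarith
  rw [← measure_inter_add_sdiff (X t) hUo.measurableSet, e1, e2, ENNReal.toReal_add,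
    ENNReal.toReal_sum, add_comm]
  · exact fun s _ => hfin (inter_subset_left.trans hRt)
  · rw [← e2]; exact hfin (inter_subset_left.trans hRt)
  · exact hfin (sdiff_subset.trans hR0)

end

section

/-! ### The edges that are cut or prolonged -/

/-- Along a ray, a set determined by an arrangement is eventually constant. -/
lemma Sat.ray {T : Finset (E3 × ℝ)} {X : Set E3} (hX : Sat T X) (a d : E3) :
    ∃ δ > 0, ∃ e : Prop, ∀ s ∈ Ioo (0 : ℝ) δ, (a + s • d ∈ X ↔ e) := by
  obtain ⟨r, hr, hr'⟩ := Metric.eventually_nhds_iff_ball.1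
    ((tendsto_add_smul a d).eventually (star_mem_nhds T a))
  have hmem : ∀ s ∈ Ioo (0 : ℝ) r, a + s • d ∈ star T a := fun s hs => hr' s (by
    rw [Metric.mem_ball, Real.dist_eq, sub_zero, abs_of_pos hs.1]; exact hs.2)
  have key : ∀ s ∈ Ioo (0 : ℝ) r, ∀ s' ∈ Ioo (0 : ℝ) r, s ≤ s' →
      (a + s • d ∈ X ↔ a + s' • d ∈ X) := by
    intro s hs s' hs' hle
    have h := signEq_of_mem_star (hmem s' hs') (s := s / s') (div_pos hs.1 hs'.1)
      ((div_le_one hs'.1).2 hle)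
    rw [add_sub_cancel_left, smul_smul, div_mul_cancel₀ _ hs'.1.ne'] at h
    exact (hX.iff h).symm
  refine ⟨r, hr, a + (r / 2) • d ∈ X, fun s hs => ?_⟩
  have h2 : r / 2 ∈ Ioo (0 : ℝ) r := ⟨by linarith, by linarith⟩
  rcases le_total s (r / 2) with h | h
  · exact key s hs _ h2 h
  · exact (key _ h2 s hs h).symm

lemma ray_in_line {a d c f : E3} (h : ∀ᶠ s in 𝓝[>] (0 : ℝ), a + s • d ∈ line c f) :
    a ∈ line c f ∧ ∃ μ : ℝ, d = μ • f := by
  obtain ⟨r, hr, hr'⟩ := mem_nhdsGT_iff_exists_Ioo_subset.1 h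
  have hr : (0:ℝ) < r := hr
  obtain ⟨x, hx⟩ : a + (r / 2) • d ∈ line c f := hr' ⟨by linarith, by linarith⟩
  obtain ⟨y, hy⟩ : a + (r / 4) • d ∈ line c f := hr' ⟨by linarith, by linarith⟩
  simp only at hx hy
  have hd : d = ((x - y) * (4 / r)) • f := by
    have e : (r / 4) • d = (x - y) • f := by
      have e1 : (r / 4) • d = (a + (r / 2) • d) - (a + (r / 4) • d) := by module
      rw [e1, ← hx, ← hy]; module
    rw [mul_comm, mul_smul, ← e, smul_smul]
    field_simp
    simp
  refine ⟨⟨x - r / 2 * ((x - y) * (4 / r)), ?_⟩, _, hd⟩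
  have e2 : a = (a + (r / 2) • d) - (r / 2) • d := by abel
  simp only
  rw [e2, ← hx]
  rw [hd]
  module

section
variable {P F : Set E3} {A B n w : E3} {T : Finset (E3 × ℝ)} (D : FaceData P F A B n T)
include D

/-- In the plane of the face the body has edge points only at the corners. -/
lemma FaceData.bodyEdges_plane {z : E3} (hz : z ∈ bodyEdges P F A B T)
    (h0 : inner ℝ n (z - A) = (0 : ℝ)) : z ∈ corners P F A B T := by
  have hzG := D.bodyEdges_subset_body hz
  have hzF : z ∈ F \ segment ℝ A B :=
    ⟨D.body_plane hzG h0, fun h => D.notMem_region_of_mem_segment h hz.2⟩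
  have h1 := D.nontrivial_of_edge hzF (self_mem_star T z) hzG hz.1
  rw [active_self] at h1
  exact ⟨hzF, h1⟩

/-- Points of the plane of the face at which the body has no edges nearby. -/
lemma FaceData.no_bodyEdges_near {z : E3} (h0 : inner ℝ n (z - A) = (0 : ℝ))
    (hz : z ∉ segment ℝ A B) (hc : z ∉ corners P F A B T) :
    ∀ᶠ y in 𝓝 z, y ∉ bodyEdges P F A B T := by
  by_cases hzF : z ∈ F
  · filter_upwards [star_mem_nhds T z] with y hy hyE
    have hyG := D.bodyEdges_subset_body hyE
    obtain ⟨ν, hν, ν', hν', hne⟩ := D.nontrivial_of_edge ⟨hzF, hz⟩ hy hyG hyE.1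
    exact hc ⟨⟨hzF, hz⟩, ν, hν.1, ν', hν'.1, hne⟩
  · have h1 : z ∉ closure (body P F A B T) := fun h => hzF (D.closure_body_plane h h0)
    filter_upwards [isClosed_closure.isOpen_compl.mem_nhds h1] with y hy hyE
    exact hy (subset_closure (D.bodyEdges_subset_body hyE))

omit D in
lemma eventually_inner_rotNormal_pos {v : E3} (h : 0 < (inner ℝ n v : ℝ)) :
    ∀ᶠ t in 𝓝[≥] (0 : ℝ), 0 < (inner ℝ (rotNormal n w t) v : ℝ) :=
  ((tendsto_inner_rotNormal v).eventually (lt_mem_nhds h)).filter_mono nhdsWithin_le_nhds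

omit D in
/-- Off the plane of the face, being below the rotated plane is locally constant. -/
lemma eventually_lowerSide_const {c f : E3} {s : ℝ} (h : inner ℝ n (c + s • f - A) ≠ (0 : ℝ)) :
    ∃ δ > 0, ∀ᶠ t in 𝓝[≥] (0 : ℝ), ∀ x ∈ Metric.ball s δ,
      (c + x • f ∈ lowerSide A n w t ↔ c + x • f ∈ lowerSide A n w 0) := by
  set g : ℝ × ℝ → ℝ := fun q => inner ℝ (rotNormal n w q.1) (c + q.2 • f - A) with hg
  have hc : Continuous g := by
    have h1 := Real.continuous_cos
    have h2 := Real.continuous_sin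
    simp only [hg, rotNormal]
    fun_prop
  have h0 : g (0, s) = inner ℝ n (c + s • f - A) := by simp [hg, rotNormal]
  have hev : ∀ᶠ q in 𝓝 ((0 : ℝ), s), 0 < g (0, s) * g q := by
    have h3 : Continuous fun q => g (0, s) * g q := by fun_prop
    refine h3.continuousAt.eventually (lt_mem_nhds (mul_self_pos.2 ?_))
    rwa [h0]
  rw [nhds_prod_eq, Filter.eventually_prod_iff] at hev
  obtain ⟨p, hp, q, hq, hpq⟩ := hev
  obtain ⟨δ, hδ, hq'⟩ := Metric.eventually_nhds_iff_ball.1 hq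
  refine ⟨δ, hδ, ?_⟩
  filter_upwards [hp.filter_mono nhdsWithin_le_nhds] with t ht x hx
  have h1 := hpq ht (hq' x hx)
  have h2 := hpq hp.self_of_nhds (hq' x hx)
  simp only [lowerSide, mem_ofPred_eq]
  change g (t, x) < 0 ↔ g (0, x) < 0
  rcases lt_trichotomy (g (0, s)) 0 with h3 | h3 | h3
  · exact ⟨fun _ => by nlinarith, fun _ => by nlinarith⟩
  · rw [h3, zero_mul] at h1; exact absurd h1 (lt_irrefl _)
  · exact ⟨fun _ => by nlinarith, fun _ => by nlinarith⟩

omit D in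
/-- The derivative of the moving threshold at which an edge meets the rotated plane. -/
lemma rightDeriv_threshold {u v α : ℝ} (hα : α ≠ 0) :
    RightDeriv (fun t => Real.sin t * u / (Real.cos t * α + Real.sin t * v)) (u / α) := by
  have h1 : HasDerivAt (fun t => Real.sin t * u) (Real.cos 0 * u) 0 :=
    (Real.hasDerivAt_sin 0).mul_const u
  have h2 : HasDerivAt (fun t => Real.cos t * α + Real.sin t * v)
      (-Real.sin 0 * α + Real.cos 0 * v) 0 :=
    ((Real.hasDerivAt_cos 0).mul_const α).add ((Real.hasDerivAt_sin 0).mul_const v)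
  have h3 := h1.div h2 (by simpa using hα)
  refine HasDerivAt.hasDerivWithinAt (h3.congr_deriv ?_)
  simp
  field_simp

omit D in
/-- The rate of change at an edge crossing, according to whether the edge continues below (`em`)
and above (`ep`) the crossing. -/
lemma exists_gapRate_crossing (ep em : Prop) (k : ℝ) : ∃ (Lo Hi : Finset Bool),
    (∀ (σ κ : ℝ), σ ≠ 0 → (((0 < σ ∧ ep ∨ σ < 0 ∧ em) ∧ σ < κ) ↔
      (∀ j ∈ Lo, (if j then κ else 0) < σ) ∧ ∀ j ∈ Hi, σ < if j then κ else 0)) ∧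
    (k ≤ 0 → gapRate Lo Hi (fun j => if j then k else 0) ≤ 0 ∧
      (em → gapRate Lo Hi (fun j => if j then k else 0) ≤ k)) ∧
    (0 < k → gapRate Lo Hi (fun j => if j then k else 0) ≤ 0 ∨ ep ∧
      gapRate Lo Hi (fun j => if j then k else 0) ≤ k) := by
  by_cases hp : ep <;> by_cases hm : em
  · refine ⟨∅, {true}, fun σ κ hσ => ?_, fun hk => ?_, fun hk => ?_⟩
    · have := lt_or_gt_of_ne hσ.symm
      simp [hp, hm, this]
    · simp [gapRate, hk]
    · simp [gapRate, hp]
  · refine ⟨{false}, {true}, fun σ κ hσ => ?_, fun hk => ?_, fun hk => ?_⟩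
    · simp [hp, hm]
    · simp [gapRate, hk, hm]
    · simp [gapRate, hp, hk.le]
  · refine ⟨∅, {true, false}, fun σ κ hσ => ?_, fun hk => ?_, fun hk => ?_⟩
    · simp [hp, hm, and_comm]
    · simp [gapRate, hk]
    · simp [gapRate]
  · refine ⟨{false}, {true, false}, fun σ κ hσ => ?_, fun hk => ?_, fun hk => ?_⟩
    · simp only [hp, hm, and_false, or_self, false_and, false_iff]
      simp only [Finset.mem_singleton, forall_eq, Finset.mem_insert, forall_eq_or_imp]
      simp
      intro h1 h2
      exact h1.le
    · simp [gapRate, hm]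
    · simp [gapRate]

/-- Change of the length of the edges of the body lying on one line. Only corners contribute. Where
the rotated plane moves into the polyhedron, edges descending from the corner are cut; where it
moves out, edges ascending from the corner are prolonged. -/
theorem FaceData.rightDeriv_bodyEdges (hw : RotDir A B n w) {ℓ : Set E3}
    (hℓ : ℓ ∈ arrangementLines T) : ∃ r : E3 → ℝ,
    RightDeriv (fun t => (H1 (bodyEdges P F A B T ∩ lowerSide A n w t ∩ ℓ)).toReal)
      (∑ a ∈ D.finite_corners.toFinset, r a) ∧
    ∀ a ∈ corners P F A B T,
      (0 ≤ (inner ℝ w (a - A) : ℝ) → r a ≤ 0 ∧ ∀ d : E3, inner ℝ n d = (-1 : ℝ) →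
        (∀ᶠ s in 𝓝[>] (0 : ℝ), a + s • d ∈ bodyEdges P F A B T ∩ ℓ) →
        r a ≤ -(inner ℝ w (a - A) * ‖d‖)) ∧
      ((inner ℝ w (a - A) : ℝ) < 0 → r a ≤ 0 ∨ ∃ d : E3, inner ℝ n d = (1 : ℝ) ∧
        (∀ᶠ s in 𝓝[>] (0 : ℝ), a + s • d ∈ bodyEdges P F A B T ∩ ℓ) ∧
        r a ≤ -(inner ℝ w (a - A) * ‖d‖)) := by
  classical
  -- orient the line upwards
  obtain ⟨c, f, hf, hnf0, rfl⟩ : ∃ c f : E3, ‖f‖ = 1 ∧ 0 ≤ (inner ℝ n f : ℝ) ∧ ℓ = line c f := by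
    obtain ⟨⟨c, f, hf, rfl⟩, -⟩ := hℓ
    rcases le_total 0 (inner ℝ n f : ℝ) with h | h
    · exact ⟨c, f, hf, h, rfl⟩
    · refine ⟨c, -f, by rw [norm_neg, hf], by rw [inner_neg_right]; linarith, ?_⟩
      ext x
      constructor
      · rintro ⟨s, rfl⟩; exact ⟨-s, by simp⟩
      · rintro ⟨s, rfl⟩; exact ⟨-s, by simp⟩
  set X : ℝ → Set ℝ := fun t => {s | c + s • f ∈ bodyEdges P F A B T ∩ lowerSide A n w t} with hX
  have hH : (fun t => (H1 (bodyEdges P F A B T ∩ lowerSide A n w t ∩ line c f)).toReal) =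
      fun t => (volume (X t)).toReal := by
    ext t; rw [H1_inter_line hf]
  rw [hH]
  have hlin : ∀ x : ℝ, (inner ℝ n (c + x • f - A) : ℝ) = inner ℝ n (c - A) + x * inner ℝ n f := by
    intro x
    have e : c + x • f - A = (c - A) + x • f := by abel
    rw [e, inner_add_right, inner_smul_right]
  have hmeas : ∀ t, MeasurableSet (X t) := fun t =>
    (D.sat_bodyEdges.measurableSet.inter (isOpen_lowerSide A n w t).measurableSet).preimage
      (by fun_prop)
  obtain ⟨R0, hR0⟩ := D.body_bounded
  set R := R0 + ‖c‖ with hR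
  have hbdd : ∀ t, X t ⊆ Icc (-R) R := by
    intro t s hs
    have h1 := hR0 _ (D.bodyEdges_subset_body hs.1)
    have h2 : ‖s • f‖ ≤ R := by
      have e : s • f = (c + s • f) - c := by abel
      rw [e]
      exact (norm_sub_le _ _).trans (by linarith)
    rw [norm_smul, hf, mul_one, Real.norm_eq_abs] at h2
    exact abs_le.1 h2
  by_cases hnf : inner ℝ n f = (0 : ℝ)
  · -- lines parallel to the face contain no rays leaving its plane
    refine ⟨fun _ => 0, ?_, fun a _ => ⟨fun _ => ⟨le_rfl, fun d hd hray => ?_⟩,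
      fun _ => Or.inl le_rfl⟩⟩
    · rw [Finset.sum_const_zero]
      by_cases h0 : inner ℝ n (c - A) = (0 : ℝ)
      · refine (rightDeriv_const 0).congr (Eventually.of_forall fun t => ?_)
        have hfin : (X t).Finite := by
          refine Set.Finite.preimage (f := fun s : ℝ => c + s • f) ?_ D.finite_corners |>.subset ?_
          · intro x _ y _ hxy
            have h1 : (x - y) • f = 0 := by
              have : (x - y) • f = (c + x • f) - (c + y • f) := by module
              rw [this]; exact sub_eq_zero.2 hxy
            rcases smul_eq_zero.1 h1 with h | h
            · exact sub_eq_zero.1 h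
            · rw [h, norm_zero] at hf; exact absurd hf zero_ne_one
          · intro s hs
            exact D.bodyEdges_plane hs.1 (by rw [hlin, h0, hnf, mul_zero, add_zero])
        rw [hfin.measure_zero, ENNReal.toReal_zero]
      · have := rightDeriv_volume (X := X) (R := R) (Eventually.of_forall hbdd)
          (Eventually.of_forall hmeas) ∅ (c := fun _ => 0) (fun s _ => ?_) (by simp)
        · simpa using this
        · obtain ⟨δ, hδ, h⟩ := eventually_lowerSide_const (n := n) (w := w) (A := A) (c := c)
            (f := f) (s := s) (by rw [hlin, hnf, mul_zero, add_zero]; exact h0)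
          exact ⟨δ, hδ, h.mono fun t ht x hx => and_congr_right fun _ => ht x hx⟩
    · obtain ⟨-, μ, rfl⟩ := ray_in_line (hray.mono fun s hs => hs.2)
      rw [inner_smul_right, hnf, mul_zero] at hd
      norm_num at hd
  have hpos : 0 < (inner ℝ n f : ℝ) := lt_of_le_of_ne hnf0 (Ne.symm hnf)
  set s₀ : ℝ := -inner ℝ n (c - A) / inner ℝ n f with hs₀
  set a := c + s₀ • f with ha
  have ha0 : inner ℝ n (a - A) = (0 : ℝ) := by
    rw [ha, hlin, hs₀, div_mul_cancel₀ _ hnf]; ring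
  have hzero : ∀ x : ℝ, inner ℝ n (c + x • f - A) = (0 : ℝ) → x = s₀ := by
    intro x hx
    rw [hlin] at hx
    rw [hs₀, eq_div_iff hnf]; linarith
  have hshift : ∀ x : ℝ, c + x • f = a + (x - s₀) • f := fun x => by rw [ha]; module
  have hL : ∀ t x, (c + x • f ∈ lowerSide A n w t ↔ (x - s₀) *
      (Real.cos t * inner ℝ n f + Real.sin t * inner ℝ w f) <
        Real.sin t * -(inner ℝ w (a - A) : ℝ)) := by
    intro t x
    have e : c + x • f - A = (a - A) + (x - s₀) • f := by rw [hshift]; abel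
    rw [lowerSide, mem_ofPred_eq, inner_rotNormal, e, inner_add_right, inner_add_right, ha0,
      inner_smul_right, inner_smul_right]
    constructor <;> intro h <;> linarith
  have hden : ∀ᶠ t in 𝓝[≥] (0 : ℝ),
      0 < Real.cos t * inner ℝ n f + Real.sin t * (inner ℝ w f : ℝ) := by
    filter_upwards [eventually_inner_rotNormal_pos (w := w) hpos] with t ht
    rwa [inner_rotNormal] at ht
  have hoff : ∀ s, s ≠ s₀ → ∃ δ > 0, ∀ᶠ t in 𝓝[≥] (0 : ℝ), ∀ x ∈ Metric.ball s δ,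
      (x ∈ X t ↔ x ∈ X 0) := by
    intro s hs
    obtain ⟨δ, hδ, h⟩ := eventually_lowerSide_const (n := n) (w := w) (A := A) (c := c)
      (f := f) (s := s) (fun h => hs (hzero s h))
    exact ⟨δ, hδ, h.mono fun t ht x hx => and_congr_right fun _ => ht x hx⟩
  have hcont : Continuous fun x : ℝ => c + x • f := by fun_prop
  -- a ray in the line starting at a corner starts at `a`
  have hrays : ∀ a' ∈ corners P F A B T, ∀ d : E3,
      (∀ᶠ s in 𝓝[>] (0 : ℝ), a' + s • d ∈ bodyEdges P F A B T ∩ line c f) →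
      a' = a ∧ ∃ μ : ℝ, d = μ • f := by
    intro a' ha' d hray
    obtain ⟨⟨x, hx⟩, hμ⟩ := ray_in_line (hray.mono fun s hs => hs.2)
    simp only at hx
    have : x = s₀ := hzero x (by rw [hx]; exact D.sub_plane a' ha'.1.1)
    exact ⟨by rw [← hx, this], hμ⟩
  by_cases hac : a ∈ corners P F A B T
  · obtain ⟨δ₁, hδ₁, ep, hep⟩ := D.sat_bodyEdges.ray a f
    obtain ⟨δ₂, hδ₂, em, hem⟩ := D.sat_bodyEdges.ray a (-f)
    set k : ℝ := -(inner ℝ w (a - A) : ℝ) / inner ℝ n f with hk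
    obtain ⟨Lo, Hi, hiff, hneg, hpk⟩ := exists_gapRate_crossing ep em k
    set κ : ℝ → ℝ := fun t => Real.sin t * -(inner ℝ w (a - A) : ℝ) /
      (Real.cos t * inner ℝ n f + Real.sin t * (inner ℝ w f : ℝ)) with hκ
    have hκd : RightDeriv κ k := rightDeriv_threshold hnf
    set K := gapRate Lo Hi (fun j => if j then k else 0) with hK
    have hloc : ∀ δ > 0, δ ≤ min δ₁ δ₂ →
        RightDeriv (fun t => (volume (X t ∩ Metric.ball s₀ δ)).toReal) K := by
      intro δ hδ hle
      have hb0 : ∀ j : Bool, (fun (j : Bool) t => if j then κ t else 0) j 0 = 0 := by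
        intro j; cases j <;> simp [hκ]
      have hbd : ∀ j : Bool, RightDeriv ((fun (j : Bool) t => if j then κ t else 0) j)
          (if j then k else 0) := by
        intro j
        cases j
        · simpa using rightDeriv_const 0
        · simpa using hκd
      refine rightDeriv_gap (κ := fun (j : Bool) t => if j then κ t else 0) hδ (fun j _ => hb0 j) (fun j _ => hb0 j) (fun j _ => hbd j)
        (fun j _ => hbd j) ?_
      filter_upwards [hden] with t ht x hx hxs
      rw [← hiff _ _ (sub_ne_zero.2 hxs)]
      rw [Metric.mem_ball, Real.dist_eq] at hx
      have hx' : |x - s₀| < min δ₁ δ₂ := hx.trans_le hle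
      refine and_congr ?_ ?_
      · rcases lt_or_gt_of_ne (sub_ne_zero.2 hxs) with h | h
        · rw [abs_of_neg h] at hx'
          have h1 := hem (-(x - s₀)) ⟨by linarith, hx'.trans_le (min_le_right _ _)⟩
          rw [neg_smul_neg, ← hshift] at h1
          rw [h1]
          simp [h, not_lt.2 h.le]
        · rw [abs_of_pos h] at hx'
          have h1 := hep (x - s₀) ⟨h, hx'.trans_le (min_le_left _ _)⟩
          rw [← hshift] at h1
          rw [h1]
          simp [h, not_lt.2 h.le]
      · rw [hL, hκ, lt_div_iff₀ ht]
    refine ⟨fun a' => if a' = a then K else 0, ?_, fun a' ha' => ⟨fun hW => ?_, fun hW => ?_⟩⟩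
    · rw [Finset.sum_ite_eq' _ a, if_pos (by simpa using hac)]
      have := rightDeriv_volume (X := X) (R := R) (Eventually.of_forall hbdd)
          (Eventually.of_forall hmeas) {s₀} (c := fun _ => K)
          (fun s hs => hoff s (by simpa using hs))
          (fun s hs => by
            rw [Finset.mem_singleton] at hs
            subst hs
            exact ⟨min δ₁ δ₂, lt_min hδ₁ hδ₂, hloc⟩)
      simpa using this
    · by_cases haa : a' = a
      · subst haa
        have hk0 : k ≤ 0 := by
          rw [hk]; exact div_nonpos_of_nonpos_of_nonneg (by linarith) hpos.le
        simp only [if_true]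
        refine ⟨(hneg hk0).1, fun d hd hray => ?_⟩
        obtain ⟨-, μ, hμ⟩ := hrays _ ha' d hray
        have hμn : μ = -(inner ℝ n f : ℝ)⁻¹ := by
          rw [hμ, inner_smul_right] at hd
          rw [eq_neg_iff_add_eq_zero, ← mul_left_inj' hnf, add_mul, inv_mul_cancel₀ hnf, hd]
          ring
        have hinv : 0 < (inner ℝ n f : ℝ)⁻¹ := inv_pos.2 hpos
        have hme : em := by
          obtain ⟨s, hs1, hs2, hs3⟩ := (hray.and ((eventually_mem_set.2
            self_mem_nhdsWithin).and (eventually_mem_set.2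
            (mem_nhdsWithin_of_mem_nhds (Iio_mem_nhds (mul_pos hδ₂ hpos)))))).exists
          have hs2 : 0 < s := hs2
          have hs3 : s < δ₂ * inner ℝ n f := hs3
          refine (hem (s * (inner ℝ n f : ℝ)⁻¹) ⟨mul_pos hs2 hinv, ?_⟩).1 ?_
          · rw [← div_eq_mul_inv, div_lt_iff₀ hpos]; exact hs3
          · have := hs1.1
            rw [hμ, hμn, smul_smul] at this
            convert this using 2
            rw [mul_neg, neg_smul, smul_neg]
        have hdn : ‖d‖ = (inner ℝ n f : ℝ)⁻¹ := by
          rw [hμ, norm_smul, hf, mul_one, hμn, Real.norm_eq_abs, abs_neg, abs_of_pos hinv]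
        refine ((hneg hk0).2 hme).trans_eq ?_
        rw [hdn, hk, div_eq_mul_inv, neg_mul]
      · simp only [haa, if_false]
        exact ⟨le_rfl, fun d _ hray => absurd (hrays a' ha' d hray).1 haa⟩
    · by_cases haa : a' = a
      · subst haa
        have hk0 : 0 < k := by rw [hk]; exact div_pos (by linarith) hpos
        have hinv : 0 < (inner ℝ n f : ℝ)⁻¹ := inv_pos.2 hpos
        simp only [if_true]
        rcases hpk hk0 with h | ⟨h1, h2⟩
        · exact Or.inl h
        · refine Or.inr ⟨(inner ℝ n f : ℝ)⁻¹ • f, ?_, ?_, h2.trans_eq ?_⟩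
          · rw [inner_smul_right, inv_mul_cancel₀ hnf]
          · filter_upwards [self_mem_nhdsWithin,
              mem_nhdsWithin_of_mem_nhds (Iio_mem_nhds (mul_pos hδ₁ hpos))] with s hs hs'
            have hs : 0 < s := hs
            have hs' : s < δ₁ * inner ℝ n f := hs'
            rw [smul_smul]
            refine ⟨(hep _ ⟨mul_pos hs hinv, ?_⟩).2 h1, s₀ + s * (inner ℝ n f : ℝ)⁻¹, ?_⟩
            · rw [← div_eq_mul_inv, div_lt_iff₀ hpos]; exact hs'
            · simp only [hshift, add_sub_cancel_left]
          · rw [norm_smul, hf, mul_one, Real.norm_eq_abs, abs_of_pos hinv, hk, div_eq_mul_inv,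
              neg_mul]
      · simp only [haa, if_false]
        exact Or.inl le_rfl
  · refine ⟨fun _ => 0, ?_, fun a' ha' => ⟨fun _ => ⟨le_rfl, fun d hd hray => ?_⟩,
      fun _ => Or.inl le_rfl⟩⟩
    · have := rightDeriv_volume (X := X) (R := R) (Eventually.of_forall hbdd)
        (Eventually.of_forall hmeas) ∅ (c := fun _ => 0) (fun s _ => ?_) (by simp)
      · simpa using this
      · by_cases hs : s = s₀
        · subst hs
          by_cases has : a ∈ segment ℝ A B
          · refine ⟨1, one_pos, ?_⟩
            filter_upwards [hden] with t ht x _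
            refine and_congr_right fun _ => ?_
            rw [hL, hL, hw.seg has]
            simp only [neg_zero, mul_zero, Real.cos_zero, Real.sin_zero, zero_mul, one_mul,
              add_zero]
            have key : ∀ r : ℝ, 0 < r → ((x - s₀) * r < 0 ↔ x - s₀ < 0) := fun r hr =>
              ⟨fun h => by by_contra hc; exact absurd h (not_lt.2 (mul_nonneg (not_lt.1 hc) hr.le)),
                fun h => mul_neg_of_neg_of_pos h hr⟩
            rw [key _ ht, key _ hpos]
          · have h1 := D.no_bodyEdges_near ha0 has hac
            obtain ⟨δ, hδ, h2⟩ := Metric.eventually_nhds_iff_ball.1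
              ((hcont.tendsto s₀).eventually h1)
            exact ⟨δ, hδ, Eventually.of_forall fun t x hx =>
              iff_of_false (fun h => h2 x hx h.1) fun h => h2 x hx h.1⟩
        · exact hoff s hs
    · exact absurd ((hrays a' ha' d hray).1 ▸ ha') hac

end

end

section

/-! ### The traces of the faces on the rotated plane -/

section
variable {P F : Set E3} {A B n w : E3} {T : Finset (E3 × ℝ)} (D : FaceData P F A B n T)
include D

lemma FaceData.sat_isFacePoint (ν : E3) : Sat T {z | IsFacePoint (body P F A B T) z ν} :=
  fun _ _ h hz => IsFacePoint.of_signEq D.sat_body h hz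

/-- In the star of a point of the face, a point of the plane of a face of the body lies in the
relative interior of that face if it is strictly inside the other half-spaces. -/
lemma FaceData.isFacePoint_iff_of_plane {a z ν : E3} (ha : a ∈ F \ segment ℝ A B)
    (hz : z ∈ star T a) (h0 : inner ℝ ν (z - a) = (0 : ℝ)) :
    IsFacePoint (body P F A B T) z ν ↔ ν ∈ normals P F T a ∧
      ∀ ν' ∈ normals P F T a, ν' ≠ ν → inner ℝ ν' (z - a) < (0 : ℝ) := by
  constructor
  · intro h
    have hcone := (D.mem_body_iff ha hz).1 h.mem
    have hact := (D.isFacePoint_body_iff ha hz h.mem).1 h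
    have hν : ν ∈ active P F T a z := by rw [hact]; rfl
    refine ⟨hν.1, fun ν' hν' hne => lt_of_le_of_ne (hcone ν' hν') fun h' => hne ?_⟩
    have : ν' ∈ active P F T a z := ⟨hν', h'⟩
    rw [hact] at this
    exact this
  · rintro ⟨hν, h⟩
    have hb : z ∈ body P F A B T := (D.mem_body_iff ha hz).2 fun ν' hν' => by
      by_cases hne : ν' = ν
      · rw [hne, h0]
      · exact (h ν' hν' hne).le
    rw [D.isFacePoint_body_iff ha hz hb]
    ext ν'
    constructor
    · rintro ⟨hν', h'⟩
      by_contra hne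
      exact absurd h' (h ν' hν' hne).ne
    · rintro rfl
      exact ⟨hν, h0⟩

/-- Near the edge `AB` the trace of a face on the rotated plane is conical, and does not change
its shape: a ray of the trace moves with the plane, since at most finitely many points of the face
are corners. -/
lemma FaceData.facePoint_germ_on_edge (hw : RotDir A B n w) {a f e ν : E3}
    (ha : a ∈ segment ℝ A B) (hnf : inner ℝ n f = (0 : ℝ)) (hwf : inner ℝ w f ≠ (0 : ℝ))
    (hνe : inner ℝ ν e = (0 : ℝ)) :
    ∃ δ > 0, ∃ η₀ > 0, ∀ r ∈ Ioo (0 : ℝ) δ, ∀ η ∈ Ico (0 : ℝ) η₀,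
      (IsFacePoint (body P F A B T) (a + r • (f - η • e)) ν ↔
        IsFacePoint (body P F A B T) (a + r • f) ν) := by
  set X := {z | IsFacePoint (body P F A B T) z ν} with hX
  have hsat : Sat T X := D.sat_isFacePoint ν
  obtain ⟨δ, hδ, -, hδs⟩ := exists_pos_of_eventually f (star_mem_nhds T a)
  set y₀ := a + δ • f with hy₀
  obtain ⟨δ', hδ', E, hE⟩ := hsat.ray y₀ (-e)
  have hcont : Continuous fun η : ℝ => a + δ • (f - η • e) := by fun_prop
  obtain ⟨η₁, hη₁, hη₁s⟩ := Metric.eventually_nhds_iff_ball.1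
    ((hcont.tendsto 0).eventually (p := fun z => z ∈ star T a)
      (by simpa using (isOpen_star T a).mem_nhds hδs))
  have hscale : ∀ r ∈ Ioo (0 : ℝ) δ, ∀ d : E3, a + δ • d ∈ star T a →
      (a + r • d ∈ X ↔ a + δ • d ∈ X) := by
    intro r hr d hd
    have h := signEq_of_mem_star hd (s := r / δ) (div_pos hr.1 hδ) ((div_le_one hδ).2 hr.2.le)
    rw [add_sub_cancel_left, smul_smul, div_mul_cancel₀ _ hδ.ne'] at h
    exact (hsat.iff h).symm
  have hflat : ∀ r : ℝ, inner ℝ n (a + r • f - A) = (0 : ℝ) := fun r => by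
    have e : a + r • f - A = (a - A) + r • f := by abel
    rw [e, inner_add_right, inner_smul_right, hnf, D.sub_plane a (D.seg_sub ha)]; simp
  have hoffseg : ∀ r : ℝ, 0 < r → a + r • f ∉ segment ℝ A B := fun r hr hs => by
    have h1 := hw.seg hs
    have e : a + r • f - A = (a - A) + r • f := by abel
    rw [e, inner_add_right, inner_smul_right, hw.seg ha, zero_add] at h1
    exact (mul_ne_zero hr.ne' hwf) h1
  have key : E ↔ y₀ ∈ X := by
    constructor
    · intro hE1
      -- the points `a + r • f` lie on the face and have the normal `ν`
      have hmem : ∀ r ∈ Ioo (0 : ℝ) δ, a + r • f ∈ F \ segment ℝ A B ∧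
          ν ∈ normals P F T (a + r • f) := by
        intro r hr
        have hlim : Tendsto (fun η : ℝ => a + r • (f - η • e)) (𝓝[>] 0) (𝓝 (a + r • f)) := by
          have hc : Continuous fun η : ℝ => a + r • (f - η • e) := by fun_prop
          have := hc.tendsto 0
          simp only [zero_smul, sub_zero] at this
          exact this.mono_left nhdsWithin_le_nhds
        have hev : ∀ᶠ η in 𝓝[>] (0 : ℝ), a + r • (f - η • e) ∈ X := by
          filter_upwards [Ioo_mem_nhdsGT hη₁, Ioo_mem_nhdsGT (div_pos hδ' hδ)] with η h1 h2
          rw [hscale r hr _ (hη₁s η (by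
            rw [Metric.mem_ball, Real.dist_eq, sub_zero, abs_of_pos h1.1]; exact h1.2))]
          have h3 := (hE (δ * η) ⟨mul_pos hδ h1.1, by
            rw [mul_comm, ← lt_div_iff₀ hδ]; exact h2.2⟩).2 hE1
          convert h3 using 1
          rw [hy₀]; module
        have hF : a + r • f ∈ F := by
          refine D.closure_body_plane (mem_closure_of_tendsto hlim ?_) (hflat r)
          filter_upwards [hev] with η hη using IsFacePoint.mem hη
        have hF' : a + r • f ∈ F \ segment ℝ A B := ⟨hF, hoffseg r hr.1⟩
        obtain ⟨η, h1, h2⟩ := (hev.and (hlim.eventually (star_mem_nhds T (a + r • f)))).exists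
        refine ⟨hF', ((D.isFacePoint_iff_of_plane hF' h2 ?_).1 h1).1⟩
        have e1 : a + r • (f - η • e) - (a + r • f) = -(r * η) • e := by module
        rw [e1, inner_smul_right, hνe, mul_zero]
      by_contra hy
      have hcor : (fun r : ℝ => a + r • f) '' Ioo 0 δ ⊆ corners P F A B T := by
        rintro _ ⟨r, hr, rfl⟩
        obtain ⟨h1, h2⟩ := hmem r hr
        refine ⟨h1, ?_⟩
        by_contra hnt
        refine hy ((hscale r hr f hδs).1 ?_)
        have h3 : normals P F T (a + r • f) = {ν} := by
          rcases (not_nontrivial_iff.1 hnt).eq_empty_or_singleton with h | ⟨μ, h⟩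
          · rw [h] at h2; exact absurd h2 (notMem_empty _)
          · rw [h] at h2 ⊢; rw [mem_singleton_iff.1 h2]
        refine (D.isFacePoint_iff_of_plane h1 (self_mem_star T _) (by simp)).2 ⟨h2, ?_⟩
        intro ν' hν' hne
        rw [h3] at hν'
        exact absurd hν' hne
      refine (Ioo_infinite hδ) (Set.Finite.of_finite_image (D.finite_corners.subset hcor) ?_)
      intro r _ r' _ h
      have h1 : (r - r') • f = 0 := by
        have : (r - r') • f = (a + r • f) - (a + r' • f) := by module
        rw [this]; exact sub_eq_zero.2 h
      rcases smul_eq_zero.1 h1 with h | h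
      · exact sub_eq_zero.1 h
      · rw [h, inner_zero_right] at hwf; exact absurd rfl hwf
    · intro hy
      have hyX : IsFacePoint (body P F A B T) y₀ ν := hy
      have hF : y₀ ∈ F := D.body_plane hyX.mem (hflat δ)
      have hF' : y₀ ∈ F \ segment ℝ A B := ⟨hF, hoffseg δ hδ⟩
      have h1 := (D.isFacePoint_iff_of_plane hF' (self_mem_star T _) (by simp)).1 hyX
      obtain ⟨s, h2, h3⟩ := (((tendsto_add_smul y₀ (-e)).eventually
        (star_mem_nhds T y₀)).filter_mono nhdsWithin_le_nhds |>.and (Ioo_mem_nhdsGT hδ')).exists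
      refine (hE s h3).1 ((D.isFacePoint_iff_of_plane hF' h2 ?_).2 ⟨h1.1, ?_⟩)
      · rw [add_sub_cancel_left, inner_smul_right, inner_neg_right, hνe]; simp
      · intro ν' hν' hne
        have := h1.2 ν' hν' hne
        rw [sub_self, inner_zero_right] at this
        exact absurd this (lt_irrefl _)
  refine ⟨δ, hδ, min η₁ (δ' / δ), lt_min hη₁ (div_pos hδ' hδ), fun r hr η hη => ?_⟩
  rcases eq_or_lt_of_le hη.1 with h0 | h0
  · rw [← h0, zero_smul, sub_zero]
  · have h1 := hscale r hr (f - η • e) (hη₁s η (by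
      rw [Metric.mem_ball, Real.dist_eq, sub_zero, abs_of_pos h0]
      exact hη.2.trans_le (min_le_left _ _)))
    have h2 := hE (δ * η) ⟨mul_pos hδ h0, by
      rw [mul_comm, ← lt_div_iff₀ hδ]; exact hη.2.trans_le (min_le_right _ _)⟩
    have e1 : y₀ + (δ * η) • -e = a + δ • (f - η • e) := by rw [hy₀]; module
    rw [e1] at h2
    exact h1.trans (h2.trans (key.trans (hscale r hr f hδs).symm))

end

end

section

/-- In a plane with adapted frame `ν`, `f`, `e`, the trace of the rotated plane arises from that of
the original plane by moving each point `z` along `-e` by this multiple of `⟪w, z - A⟫`. -/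
def displacement (n w e : E3) (t : ℝ) : ℝ :=
  Real.sin t / (Real.cos t * inner ℝ n e + Real.sin t * inner ℝ w e)

lemma displacement_zero (n w e : E3) : displacement n w e 0 = 0 := by simp [displacement]

lemma hasDerivAt_displacement {n w e : E3} (he : inner ℝ n e ≠ (0 : ℝ)) :
    HasDerivAt (displacement n w e) (1 / inner ℝ n e) 0 := by
  have h2 : HasDerivAt (fun t => Real.cos t * (inner ℝ n e : ℝ) + Real.sin t * inner ℝ w e)
      (-Real.sin 0 * inner ℝ n e + Real.cos 0 * inner ℝ w e) 0 :=
    ((Real.hasDerivAt_cos 0).mul_const _).add ((Real.hasDerivAt_sin 0).mul_const _)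
  refine ((Real.hasDerivAt_sin 0).div h2 (by simpa using he)).congr_deriv ?_
  simp
  field_simp

lemma eventually_displacement_nonneg {n w e : E3} (he : 0 < (inner ℝ n e : ℝ)) {η : ℝ}
    (hη : 0 < η) : ∀ᶠ t in 𝓝[≥] (0 : ℝ), displacement n w e t ∈ Ico 0 η := by
  have h1 := (hasDerivAt_displacement (w := w) he.ne').continuousAt.eventually
    (gt_mem_nhds (show displacement n w e 0 < η by rw [displacement_zero]; exact hη))
  have h2 : ∀ᶠ t in 𝓝 (0:ℝ), t < Real.pi := gt_mem_nhds Real.pi_pos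
  filter_upwards [h1.filter_mono nhdsWithin_le_nhds, h2.filter_mono nhdsWithin_le_nhds,
    self_mem_nhdsWithin, eventually_inner_rotNormal_pos (w := w) he] with t h1 h2 h3 h4
  rw [inner_rotNormal] at h4
  exact ⟨div_nonneg (Real.sin_nonneg_of_nonneg_of_le_pi h3 h2.le) h4.le, h1⟩

lemma rightDeriv_norm_displacement {n w e f : E3} (he : inner ℝ n e ≠ (0 : ℝ)) (hf : ‖f‖ = 1)
    (he1 : ‖e‖ = 1) (hfe : inner ℝ f e = (0 : ℝ)) (r : ℝ) :
    RightDeriv (fun t => ‖f - (displacement n w e t * r) • e‖) 0 := by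
  have h1 : ∀ t, ‖f - (displacement n w e t * r) • e‖ =
      √(1 + (displacement n w e t * r) ^ 2) := fun t => by
    rw [eq_comm, Real.sqrt_eq_iff_mul_self_eq (by positivity) (norm_nonneg _), ← pow_two,
      norm_sub_sq_real, inner_smul_right, hfe, norm_smul, hf, he1, Real.norm_eq_abs, mul_one,
      sq_abs]
    ring
  have h2 : HasDerivAt (fun t => 1 + (displacement n w e t * r) ^ 2)
      (2 * (displacement n w e 0 * r) ^ (2 - 1) * (1 / inner ℝ n e * r)) 0 :=
    (((hasDerivAt_displacement he).mul_const r).pow 2).const_add 1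
  have h3 := h2.sqrt (by rw [displacement_zero]; norm_num)
  refine HasDerivAt.hasDerivWithinAt ?_
  rw [show (fun t => ‖f - (displacement n w e t * r) • e‖) =
    fun t => √(1 + (displacement n w e t * r) ^ 2) from funext h1]
  refine h3.congr_deriv ?_
  rw [displacement_zero]; simp

section
variable {P F : Set E3} {A B n w : E3} {T : Finset (E3 × ℝ)} (D : FaceData P F A B n T)
include D

open Classical in
/-- The faces at `a`, other than the one with normal `ν`, that cut off the negative side of the
trace of that face. -/
def FaceData.lowNormals (ν f a : E3) : Finset E3 :=
  (D.finite_normals a).toFinset.filter fun ν' => ν' ≠ ν ∧ inner ℝ ν' f < (0 : ℝ)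

open Classical in
/-- The faces at `a`, other than the one with normal `ν`, that cut off the positive side of the
trace of that face. -/
def FaceData.highNormals (ν f a : E3) : Finset E3 :=
  (D.finite_normals a).toFinset.filter fun ν' => ν' ≠ ν ∧ 0 < (inner ℝ ν' f : ℝ)

/-- The velocity of the point at which the trace meets the plane with normal `ν'`. -/
def traceSpeed (A n w f e a ν' : E3) : ℝ :=
  inner ℝ w (a - A) * inner ℝ ν' e / (inner ℝ n e * inner ℝ ν' f)

open Classical in
/-- Change of the length of the trace of the faces in one plane on the rotated plane. -/
theorem FaceData.rightDeriv_facet (hw : RotDir A B n w) {q : E3 × ℝ} {f e : E3}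
    (fr : Frame q.1 f e) (hnf : inner ℝ n f = (0 : ℝ)) (hne : 0 < (inner ℝ n e : ℝ)) :
    RightDeriv (fun t => (H1 (facet P F A B T q ∩ rotPlane A n w t)).toReal)
      (∑ a ∈ D.finite_corners.toFinset.filter
          (fun a => inner ℝ q.1 a = q.2 ∧ q.1 ∈ normals P F T a),
        gapRate (D.lowNormals q.1 f a) (D.highNormals q.1 f a) (traceSpeed A n w f e a)) := by
  obtain ⟨ν, b⟩ := q
  simp only at fr ⊢
  set ρ := displacement n w e with hρ
  -- a base point on the intersection of the plane with the plane of the face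
  obtain ⟨c, hc0, hcb⟩ : ∃ c : E3, inner ℝ n (c - A) = (0 : ℝ) ∧ inner ℝ ν c = b := by
    set x := b - inner ℝ ν A with hx
    refine ⟨A + x • ν - (x * inner ℝ n ν / inner ℝ n e) • e, ?_, ?_⟩
    · have e1 : A + x • ν - (x * inner ℝ n ν / inner ℝ n e) • e - A =
          x • ν - (x * inner ℝ n ν / inner ℝ n e) • e := by abel
      rw [e1, inner_sub_right, inner_smul_right, inner_smul_right, div_mul_cancel₀ _ hne.ne',
        sub_self]
    · rw [inner_sub_right, inner_add_right, inner_smul_right, inner_smul_right, fr.ac,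
        real_inner_self_eq_norm_sq, fr.na, hx]
      ring
  set M : ℝ → ℝ := fun s => inner ℝ w (c + s • f - A) with hM
  have hMlin : ∀ s s', M s' = M s + (s' - s) * inner ℝ w f := fun s s' => by
    have e1 : c + s' • f - A = (c + s • f - A) + (s' - s) • f := by module
    simp only [hM]
    rw [e1, inner_add_right, inner_smul_right]
  set z : ℝ → ℝ → E3 := fun r s => c + s • f - (r * M s) • e with hz
  have hzn : ∀ s : ℝ, inner ℝ n (c + s • f - A) = (0 : ℝ) := fun s => by
    have e1 : c + s • f - A = (c - A) + s • f := by abel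
    rw [e1, inner_add_right, inner_smul_right, hc0, hnf]; simp
  have hzν : ∀ r s : ℝ, inner ℝ ν (z r s) = b := fun r s => by
    simp only [hz]
    rw [inner_sub_right, inner_add_right, inner_smul_right, inner_smul_right, hcb, fr.ab, fr.ac]
    simp
  have hz0 : ∀ s : ℝ, z 0 s = c + s • f := fun s => by simp [hz]
  have hzcont : Continuous fun p : ℝ × ℝ => z p.1 p.2 := by
    simp only [hz, hM]; fun_prop
  have hρ0 : Tendsto ρ (𝓝[≥] 0) (𝓝 0) := by
    have := (hasDerivAt_displacement (w := w) hne.ne').continuousAt.tendsto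
    rw [displacement_zero] at this
    exact this.mono_left nhdsWithin_le_nhds
  have hden : ∀ᶠ t in 𝓝[≥] (0 : ℝ),
      0 < Real.cos t * inner ℝ n e + Real.sin t * (inner ℝ w e : ℝ) := by
    filter_upwards [eventually_inner_rotNormal_pos (w := w) hne] with t ht
    rwa [inner_rotNormal] at ht
  set X : ℝ → Set ℝ := fun t => {s | z (ρ t) s ∈ facet P F A B T (ν, b)} with hX
  have hXiff : ∀ t s, s ∈ X t ↔ IsFacePoint (body P F A B T) (z (ρ t) s) ν := fun t s =>
    and_iff_left (hzν (ρ t) s)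
  have hmeas : ∀ t, MeasurableSet (X t) := fun t => by
    have h1 : Continuous fun s => z (ρ t) s := hzcont.comp (by fun_prop : Continuous fun s => (ρ t, s))
    exact (D.measurableSet_facet (ν, b)).preimage h1.measurable
  obtain ⟨R0, hR0⟩ := D.body_bounded
  have hbdd : ∀ t, X t ⊆ Icc (-(R0 + ‖c‖)) (R0 + ‖c‖) := by
    intro t s hs
    have h1 := hR0 _ ((hXiff t s).1 hs).mem
    have h2 : inner ℝ f (z (ρ t) s - c) = s := by
      have e1 : z (ρ t) s - c = s • f - (ρ t * M s) • e := by simp only [hz]; abel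
      rw [e1, inner_sub_right, inner_smul_right, inner_smul_right, fr.bc,
        real_inner_self_eq_norm_sq, fr.nb]
      ring
    have h3 := abs_real_inner_le_norm f (z (ρ t) s - c)
    rw [h2, fr.nb, one_mul] at h3
    exact abs_le.1 (h3.trans ((norm_sub_le _ _).trans (by linarith)))
  -- the trace is parametrised by `z (ρ t)`
  have htrace : ∀ᶠ t in 𝓝[≥] (0 : ℝ), (H1 (facet P F A B T (ν, b) ∩ rotPlane A n w t)).toReal =
      ‖f - (ρ t * inner ℝ w f) • e‖ * (volume (X t)).toReal := by
    filter_upwards [hden] with t ht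
    have hset : facet P F A B T (ν, b) ∩ rotPlane A n w t =
        (fun s : ℝ => (c - (ρ t * M 0) • e) + s • (f - (ρ t * inner ℝ w f) • e)) '' X t := by
      have hpar : ∀ s : ℝ, (c - (ρ t * M 0) • e) + s • (f - (ρ t * inner ℝ w f) • e) =
          z (ρ t) s := fun s => by
        simp only [hz]; rw [hMlin 0 s]; module
      simp only [hpar]
      have hρt : ρ t * (Real.cos t * inner ℝ n e + Real.sin t * (inner ℝ w e : ℝ)) = Real.sin t := by
        rw [hρ, displacement, div_mul_cancel₀ _ ht.ne']
      ext x
      constructor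
      · rintro ⟨hx, hxp⟩
        have hx1 : inner ℝ ν (x - c) = (0 : ℝ) := by rw [inner_sub_right, hx.2, hcb]; simp
        have hexp := fr.expand (x - c)
        rw [hx1, zero_smul, zero_add] at hexp
        set s : ℝ := inner ℝ f (x - c)
        set r : ℝ := inner ℝ e (x - c)
        have hxA : x - A = (c + s • f - A) + r • e := by
          have e1 : x - A = (x - c) + (c - A) := by abel
          rw [e1, hexp]; abel
        have hr : r = -(ρ t * M s) := by
          have h1 : inner ℝ (rotNormal n w t) (x - A) = (0 : ℝ) := hxp
          rw [inner_rotNormal, hxA, inner_add_right, inner_add_right, hzn, inner_smul_right,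
            inner_smul_right] at h1
          have h2 : r * (Real.cos t * inner ℝ n e + Real.sin t * (inner ℝ w e : ℝ)) =
              -(ρ t * M s) * (Real.cos t * inner ℝ n e + Real.sin t * (inner ℝ w e : ℝ)) := by
            have : M s = inner ℝ w (c + s • f - A) := rfl
            linear_combination h1 + M s * hρt
          exact mul_right_cancel₀ ht.ne' h2
        have hxz : z (ρ t) s = x := by
          have e1 : x = (x - A) + A := by abel
          rw [e1, hxA, hr]; simp only [hz]; module
        exact ⟨s, by rw [hX, mem_ofPred_eq, hxz]; exact hx, hxz⟩
      · rintro ⟨s, hs, rfl⟩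
        refine ⟨hs, ?_⟩
        have e1 : z (ρ t) s - A = (c + s • f - A) + (-(ρ t * M s)) • e := by
          simp only [hz]; module
        rw [rotPlane, mem_ofPred_eq, inner_rotNormal, e1, inner_add_right, inner_add_right, hzn,
          inner_smul_right, inner_smul_right]
        have : M s = inner ℝ w (c + s • f - A) := rfl
        linear_combination -M s * hρt
    rw [hset, H1_line_image, ENNReal.toReal_mul, ENNReal.toReal_ofReal (norm_nonneg _)]
  -- joint continuity
  have hnear : ∀ s : ℝ, ∀ N ∈ 𝓝 (c + s • f), ∃ δ > 0, ∀ᶠ t in 𝓝[≥] (0 : ℝ),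
      ∀ x ∈ Metric.ball s δ, z (ρ t) x ∈ N := by
    intro s N hN
    have h1 := hzcont.tendsto (0, s)
    simp only [hz0] at h1
    have h2 := h1.eventually (eventually_mem_set.2 hN)
    rw [nhds_prod_eq, Filter.eventually_prod_iff] at h2
    obtain ⟨p, hp, p', hp', hpp⟩ := h2
    obtain ⟨δ, hδ, hq⟩ := Metric.eventually_nhds_iff_ball.1 hp'
    exact ⟨δ, hδ, (hρ0.eventually hp).mono fun t ht x hx => hpp ht (hq x hx)⟩
  have hdiff : ∀ s x r : ℝ, z r x - (c + s • f) = (x - s) • f - (r * M x) • e := fun s x r => by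
    simp only [hz]; module
  have hface : ∀ s : ℝ, c + s • f ∈ F \ segment ℝ A B → ∃ δ > 0, ∀ᶠ t in 𝓝[≥] (0 : ℝ),
      ∀ x ∈ Metric.ball s δ, (x ∈ X t ↔ ν ∈ normals P F T (c + s • f) ∧
        ∀ ν' ∈ normals P F T (c + s • f), ν' ≠ ν →
          (x - s) * inner ℝ ν' f - ρ t * M x * inner ℝ ν' e < (0 : ℝ)) := by
    intro s ha
    obtain ⟨δ, hδ, h⟩ := hnear s _ (star_mem_nhds T (c + s • f))
    refine ⟨δ, hδ, h.mono fun t ht x hx => ?_⟩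
    rw [hXiff, D.isFacePoint_iff_of_plane ha (ht x hx)]
    · simp only [hdiff, inner_sub_right, inner_smul_right]
    · rw [hdiff, inner_sub_right, inner_smul_right, inner_smul_right, fr.ab, fr.ac]; simp
  have hback : ∀ a : E3, inner ℝ n (a - A) = (0 : ℝ) → inner ℝ ν a = b →
      c + (inner ℝ f (a - c) : ℝ) • f = a := by
    intro a h1 h2
    have h3 : inner ℝ ν (a - c) = (0 : ℝ) := by rw [inner_sub_right, h2, hcb, sub_self]
    have h4 := fr.expand (a - c)
    rw [h3, zero_smul, zero_add] at h4
    have h5 : inner ℝ n (a - c) = (0 : ℝ) := by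
      have e1 : a - c = (a - A) - (c - A) := by abel
      rw [e1, inner_sub_right, h1, hc0, sub_zero]
    rw [h4, inner_add_right, inner_smul_right, inner_smul_right, hnf, mul_zero, zero_add] at h5
    have h6 := (mul_eq_zero.1 h5).resolve_right hne.ne'
    rw [h6, zero_smul, add_zero] at h4
    rw [← h4, add_sub_cancel]
  set Jc := D.finite_corners.toFinset.filter
    (fun a => inner ℝ ν a = b ∧ ν ∈ normals P F T a) with hJc
  set rate : E3 → ℝ := fun a =>
    gapRate (D.lowNormals ν f a) (D.highNormals ν f a) (traceSpeed A n w f e a) with hrate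
  set J := Jc.image (fun a => (inner ℝ f (a - c) : ℝ)) with hJ
  have hJcmem : ∀ a ∈ Jc, a ∈ corners P F A B T ∧ inner ℝ ν a = b ∧ ν ∈ normals P F T a ∧
      c + (inner ℝ f (a - c) : ℝ) • f = a := by
    intro a ha
    rw [hJc, Finset.mem_filter, Finite.mem_toFinset] at ha
    exact ⟨ha.1, ha.2.1, ha.2.2, hback a (D.sub_plane a ha.1.1.1) ha.2.1⟩
  have hsum : ∑ a ∈ Jc, rate a = ∑ s ∈ J, rate (c + s • f) := by
    rw [hJ, Finset.sum_image]
    · exact Finset.sum_congr rfl fun a ha => by rw [(hJcmem a ha).2.2.2]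
    · intro a ha a' ha' h
      have h' : (inner ℝ f (a - c) : ℝ) = inner ℝ f (a' - c) := h
      have e1 := (hJcmem a ha).2.2.2
      have e2 := (hJcmem a' ha').2.2.2
      rw [h'] at e1
      exact e1.symm.trans e2
  rw [hsum]
  have hconst : ∀ s ∉ J, ∃ δ > 0, ∀ᶠ t in 𝓝[≥] (0 : ℝ), ∀ x ∈ Metric.ball s δ,
      (x ∈ X t ↔ x ∈ X 0) := by
    intro s hs
    set a := c + s • f with ha
    by_cases haF : a ∈ F
    · by_cases has : a ∈ segment ℝ A B
      · have hMs : M s = 0 := hw.seg has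
        have hMx : ∀ x, M x = (x - s) * inner ℝ w f := fun x => by rw [hMlin s x, hMs, zero_add]
        by_cases hwf : inner ℝ w f = (0 : ℝ)
        · refine ⟨1, one_pos, Eventually.of_forall fun t x _ => ?_⟩
          have : z (ρ t) x = z (ρ 0) x := by simp only [hz]; rw [hMx, hwf]; simp
          rw [hXiff, hXiff, this]
        · obtain ⟨δ₁, hδ₁, η₁, hη₁, h1⟩ := D.facePoint_germ_on_edge hw has hnf hwf (ν := ν)
            (e := (inner ℝ w f : ℝ) • e) (by rw [inner_smul_right, fr.ac, mul_zero])
          obtain ⟨δ₂, hδ₂, η₂, hη₂, h2⟩ := D.facePoint_germ_on_edge hw has (f := -f)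
            (by rw [inner_neg_right, hnf, neg_zero]) (by rw [inner_neg_right]; simpa using hwf)
            (ν := ν) (e := -((inner ℝ w f : ℝ) • e))
            (by rw [inner_neg_right, inner_smul_right, fr.ac]; simp)
          refine ⟨min δ₁ δ₂, lt_min hδ₁ hδ₂, ?_⟩
          filter_upwards [eventually_displacement_nonneg (w := w) hne hη₁,
            eventually_displacement_nonneg (w := w) hne hη₂] with t ht1 ht2 x hx
          rw [Metric.mem_ball, Real.dist_eq] at hx
          rw [hXiff, hXiff, hρ, displacement_zero, hz0, ← hρ]
          rcases lt_trichotomy (x - s) 0 with h | h | h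
          · rw [abs_of_neg h] at hx
            have := h2 (-(x - s)) ⟨by linarith, hx.trans_le (min_le_right _ _)⟩ _ ht2
            rw [show a + -(x - s) • (-f - displacement n w e t • -((inner ℝ w f : ℝ) • e)) =
              z (ρ t) x by simp only [hz, hMx, ha, hρ]; module,
              show a + -(x - s) • -f = c + x • f by rw [ha]; module] at this
            exact this
          · have hxs : x = s := by linarith
            have : z (ρ t) x = c + x • f := by simp only [hz]; rw [hMx, hxs]; simp
            rw [this]
          · rw [abs_of_pos h] at hx
            have := h1 (x - s) ⟨h, hx.trans_le (min_le_left _ _)⟩ _ ht1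
            rw [show a + (x - s) • (f - displacement n w e t • ((inner ℝ w f : ℝ) • e)) =
              z (ρ t) x by simp only [hz, hMx, ha, hρ]; module,
              show a + (x - s) • f = c + x • f by rw [ha]; module] at this
            exact this
      · obtain ⟨δ, hδ, h⟩ := hface s ⟨haF, has⟩
        refine ⟨δ, hδ, ?_⟩
        have h0 := h.self_of_nhdsWithin (mem_Ici.2 le_rfl)
        filter_upwards [h] with t ht x hx
        rw [ht x hx, h0 x hx]
        refine and_congr_right fun hν => ?_
        have hsing : ∀ ν' ∈ normals P F T (c + s • f), ν' = ν := by
          by_contra! hcon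
          obtain ⟨ν', hν', hne'⟩ := hcon
          refine hs (Finset.mem_image.2 ⟨a, ?_, ?_⟩)
          · rw [hJc, Finset.mem_filter, Finite.mem_toFinset]
            refine ⟨⟨⟨haF, has⟩, ν', hν', ν, hν, hne'⟩, ?_, hν⟩
            have := hzν 0 s
            rwa [hz0] at this
          · rw [ha, add_sub_cancel_left, inner_smul_right, real_inner_self_eq_norm_sq, fr.nb]
            ring
        exact iff_of_true (fun ν' h1 h2 => absurd (hsing ν' h1) h2)
          fun ν' h1 h2 => absurd (hsing ν' h1) h2
    · have hcl : a ∉ closure (body P F A B T) := fun h => haF (D.closure_body_plane h (hzn s))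
      obtain ⟨δ, hδ, h⟩ := hnear s _ (isClosed_closure.isOpen_compl.mem_nhds hcl)
      refine ⟨δ, hδ, ?_⟩
      have h0 := h.self_of_nhdsWithin (mem_Ici.2 le_rfl)
      filter_upwards [h] with t ht x hx
      exact iff_of_false (fun h' => ht x hx (subset_closure ((hXiff t x).1 h').mem))
        fun h' => h0 x hx (subset_closure ((hXiff 0 x).1 h').mem)
  have hgap : ∀ s ∈ J, ∃ δ₀ > 0, ∀ δ > 0, δ ≤ δ₀ →
      RightDeriv (fun t => (volume (X t ∩ Metric.ball s δ)).toReal) (rate (c + s • f)) := by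
    intro s hs
    obtain ⟨a, haJ, has⟩ := Finset.mem_image.1 hs
    obtain ⟨hac, hab, haν, hacf⟩ := hJcmem a haJ
    rw [has] at hacf
    obtain ⟨δ₀, hδ₀, h⟩ := hface s (by rw [hacf]; exact hac.1)
    refine ⟨δ₀, hδ₀, fun δ hδ hle => ?_⟩
    rw [hacf] at h ⊢
    have hMs : M s = inner ℝ w (a - A) := by simp only [hM]; rw [hacf]
    set κ : E3 → ℝ → ℝ := fun ν' t => Real.sin t * (M s * inner ℝ ν' e) /
      (Real.cos t * (inner ℝ n e * inner ℝ ν' f) +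
        Real.sin t * (inner ℝ w e * inner ℝ ν' f - inner ℝ w f * (inner ℝ ν' e : ℝ))) with hκ
    have hκ0 : ∀ ν', κ ν' 0 = 0 := fun ν' => by simp [hκ]
    have hκd : ∀ ν', inner ℝ ν' f ≠ (0 : ℝ) → RightDeriv (κ ν') (traceSpeed A n w f e a ν') := by
      intro ν' hν'
      have := rightDeriv_threshold (u := M s * inner ℝ ν' e)
        (v := inner ℝ w e * inner ℝ ν' f - inner ℝ w f * (inner ℝ ν' e : ℝ))
        (mul_ne_zero hne.ne' hν')
      rw [traceSpeed, ← hMs]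
      exact this
    have hαne : ∀ ν' ∈ normals P F T a, ν' ≠ ν → inner ℝ ν' f ≠ (0 : ℝ) := by
      intro ν' hν' hne' h0
      have := D.eq_zero_of_orthogonal hac.1 haν hν' (Ne.symm hne') hnf fr.ab h0
      have hf := fr.nb
      rw [this, norm_zero] at hf
      exact zero_ne_one hf
    -- the sign of the denominators of the thresholds
    have hdsign : ∀ᶠ t in 𝓝[≥] (0 : ℝ), ∀ ν' ∈ normals P F T a, inner ℝ ν' f ≠ (0 : ℝ) →
        0 < (inner ℝ ν' f : ℝ) * (Real.cos t * (inner ℝ n e * inner ℝ ν' f) +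
          Real.sin t * (inner ℝ w e * inner ℝ ν' f - inner ℝ w f * (inner ℝ ν' e : ℝ))) := by
      refine ((D.finite_normals a).eventually_all).2 fun ν' hν' => ?_
      by_cases h0 : inner ℝ ν' f = (0 : ℝ)
      · simp [h0]
      · have hc : Continuous fun t : ℝ => (inner ℝ ν' f : ℝ) *
            (Real.cos t * (inner ℝ n e * inner ℝ ν' f) +
            Real.sin t * (inner ℝ w e * inner ℝ ν' f - inner ℝ w f * (inner ℝ ν' e : ℝ))) := by
          fun_prop
        have hp : (0:ℝ) < inner ℝ ν' f * (Real.cos 0 * (inner ℝ n e * inner ℝ ν' f) +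
            Real.sin 0 * (inner ℝ w e * inner ℝ ν' f - inner ℝ w f * (inner ℝ ν' e : ℝ))) := by
          have := mul_pos hne (mul_self_pos.2 h0)
          simp only [Real.cos_zero, Real.sin_zero]
          linarith
        filter_upwards [(hc.continuousAt.eventually (lt_mem_nhds hp)).filter_mono
          nhdsWithin_le_nhds] with t ht _ using ht
    have hlow : ∀ ν', ν' ∈ D.lowNormals ν f a ↔
        ν' ∈ normals P F T a ∧ ν' ≠ ν ∧ inner ℝ ν' f < (0 : ℝ) := fun ν' => by
      simp [FaceData.lowNormals]
    have hhigh : ∀ ν', ν' ∈ D.highNormals ν f a ↔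
        ν' ∈ normals P F T a ∧ ν' ≠ ν ∧ 0 < (inner ℝ ν' f : ℝ) := fun ν' => by
      simp [FaceData.highNormals]
    refine rightDeriv_gap (κ := κ) hδ (fun j _ => hκ0 j) (fun j _ => hκ0 j)
      (fun j hj => hκd j ((hlow j).1 hj).2.2.ne) (fun j hj => hκd j ((hhigh j).1 hj).2.2.ne') ?_
    filter_upwards [h, hden, hdsign] with t ht htd hts x hx _
    rw [ht x (Metric.ball_subset_ball hle hx), and_iff_right haν]
    -- multiplied by the denominator of `ρ`, the constraint is linear in `x - s`
    have hlin : ∀ ν' : E3, ((x - s) * inner ℝ ν' f - ρ t * M x * inner ℝ ν' e < (0 : ℝ) ↔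
        (x - s) * (Real.cos t * (inner ℝ n e * inner ℝ ν' f) +
          Real.sin t * (inner ℝ w e * inner ℝ ν' f - inner ℝ w f * (inner ℝ ν' e : ℝ))) <
        Real.sin t * (M s * inner ℝ ν' e)) := by
      intro ν'
      have hρt : ρ t * (Real.cos t * inner ℝ n e + Real.sin t * (inner ℝ w e : ℝ)) = Real.sin t := by
        rw [hρ, displacement, div_mul_cancel₀ _ htd.ne']
      have e1 : ((x - s) * inner ℝ ν' f - ρ t * M x * inner ℝ ν' e) *
          (Real.cos t * inner ℝ n e + Real.sin t * (inner ℝ w e : ℝ)) =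
          (x - s) * (Real.cos t * (inner ℝ n e * inner ℝ ν' f) +
          Real.sin t * (inner ℝ w e * inner ℝ ν' f - inner ℝ w f * (inner ℝ ν' e : ℝ))) -
          Real.sin t * (M s * inner ℝ ν' e) := by
        rw [hMlin s x]
        linear_combination -((M s + (x - s) * inner ℝ w f) * inner ℝ ν' e) * hρt
      rw [← sub_neg (b := Real.sin t * (M s * inner ℝ ν' e)), ← e1]
      exact ⟨fun h => mul_neg_of_neg_of_pos h htd,
        fun h => by by_contra hc; exact absurd h (not_lt.2 (mul_nonneg (not_lt.1 hc) htd.le))⟩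
    have hL : ∀ ν' ∈ normals P F T a, inner ℝ ν' f < (0 : ℝ) →
        ((x - s) * inner ℝ ν' f - ρ t * M x * inner ℝ ν' e < (0 : ℝ) ↔ κ ν' t < x - s) := by
      intro ν' hν' hneg
      have hd := neg_of_mul_pos_right (hts ν' hν' hneg.ne) hneg.le
      rw [hlin, hκ, div_lt_iff_of_neg hd]
    have hH : ∀ ν' ∈ normals P F T a, 0 < (inner ℝ ν' f : ℝ) →
        ((x - s) * inner ℝ ν' f - ρ t * M x * inner ℝ ν' e < (0 : ℝ) ↔ x - s < κ ν' t) := by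
      intro ν' hν' hpos
      have hd := pos_of_mul_pos_right (hts ν' hν' hpos.ne') hpos.le
      rw [hlin, hκ, lt_div_iff₀ hd]
    constructor
    · intro hall
      constructor
      · intro ν' hν'
        obtain ⟨h1, h2, h3⟩ := (hlow ν').1 hν'
        exact (hL ν' h1 h3).1 (hall ν' h1 h2)
      · intro ν' hν'
        obtain ⟨h1, h2, h3⟩ := (hhigh ν').1 hν'
        exact (hH ν' h1 h3).1 (hall ν' h1 h2)
    · rintro ⟨h1, h2⟩ ν' hν' hne'
      rcases lt_or_gt_of_ne (hαne ν' hν' hne') with h3 | h3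
      · exact (hL ν' hν' h3).2 (h1 ν' ((hlow ν').2 ⟨hν', hne', h3⟩))
      · exact (hH ν' hν' h3).2 (h2 ν' ((hhigh ν').2 ⟨hν', hne', h3⟩))
  have hvol := rightDeriv_volume (Eventually.of_forall hbdd) (Eventually.of_forall hmeas) J
    (c := fun s => rate (c + s • f)) hconst hgap
  have hnorm := rightDeriv_norm_displacement (w := w) hne.ne' fr.nb fr.nc fr.bc (inner ℝ w f : ℝ)
  refine RightDeriv.congr (g := fun t => ‖f - (ρ t * inner ℝ w f) • e‖ * (volume (X t)).toReal)
    ?_ htrace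
  have hprod := HasDerivWithinAt.fun_mul hnorm hvol
  refine HasDerivWithinAt.congr_deriv hprod ?_
  have hρz : displacement n w e 0 = 0 := displacement_zero n w e
  simp [hρz, fr.nb]

end

end

section

/-! ### The planar section below a corner -/

/-- Finitely many lines `Y ↦ θ i * Y - ζ i`, `i ≤ k`, ordered by slope, each of which is the
strict maximum of all at some abscissa `y i`. -/
structure Envelope (k : ℕ) (θ ζ y : ℕ → ℝ) : Prop where
  mono : ∀ i j, i < j → j ≤ k → θ i < θ j
  peak : ∀ i j, i ≤ k → j ≤ k → i ≠ j → θ j * y i - ζ j < θ i * y i - ζ i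

/-- The abscissa at which the lines `i` and `j` meet. -/
def meet (θ ζ : ℕ → ℝ) (i j : ℕ) : ℝ := (ζ j - ζ i) / (θ j - θ i)

lemma meet_comm (θ ζ : ℕ → ℝ) (i j : ℕ) : meet θ ζ i j = meet θ ζ j i := by
  rw [meet, meet, ← neg_sub (ζ i), ← neg_sub (θ i), neg_div_neg_eq]

section
variable {k : ℕ} {θ ζ y : ℕ → ℝ} (E : Envelope k θ ζ y)
include E

lemma Envelope.meet_mul {i j : ℕ} (hij : i < j) (hj : j ≤ k) :
    meet θ ζ i j * (θ j - θ i) = ζ j - ζ i :=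
  div_mul_cancel₀ _ (sub_pos.2 (E.mono i j hij hj)).ne'

lemma Envelope.lt_meet {i j : ℕ} (hij : i < j) (hj : j ≤ k) : y i < meet θ ζ i j := by
  rw [meet, lt_div_iff₀ (sub_pos.2 (E.mono i j hij hj))]
  linarith [E.peak i j (hij.le.trans hj) hj hij.ne]

lemma Envelope.meet_lt {i j : ℕ} (hij : i < j) (hj : j ≤ k) : meet θ ζ i j < y j := by
  rw [meet, div_lt_iff₀ (sub_pos.2 (E.mono i j hij hj))]
  linarith [E.peak j i hj (hij.le.trans hj) hij.ne']

/-- To the right of `y i` the lines of smaller slope are below the line `i`. -/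
lemma Envelope.line_lt_right {i j : ℕ} {v : ℝ} (hji : j < i) (hi : i ≤ k) (hv : y i ≤ v) :
    θ j * v - ζ j < θ i * v - ζ i := by
  nlinarith [E.peak i j hi (hji.le.trans hi) hji.ne', E.mono j i hji hi]

/-- To the left of `y i` the lines of larger slope are below the line `i`. -/
lemma Envelope.line_lt_left {i j : ℕ} {v : ℝ} (hij : i < j) (hj : j ≤ k) (hv : v ≤ y i) :
    θ j * v - ζ j < θ i * v - ζ i := by
  nlinarith [E.peak i j (hij.le.trans hj) hj hij.ne, E.mono i j hij hj]

/-- At the point where consecutive lines meet no line is above them. -/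
lemma Envelope.le_at_meet {i j : ℕ} (hi : i + 1 ≤ k) (hj : j ≤ k) :
    θ j * meet θ ζ i (i + 1) - ζ j ≤ θ i * meet θ ζ i (i + 1) - ζ i := by
  have h1 := E.lt_meet (Nat.lt_succ_self i) hi
  have h2 := E.meet_lt (Nat.lt_succ_self i) hi
  have h3 := E.meet_mul (Nat.lt_succ_self i) hi
  rcases lt_trichotomy j i with h | h | h
  · exact (E.line_lt_right h (by omega) h1.le).le
  · rw [h]
  · rcases (Nat.succ_le_of_lt h).eq_or_lt with h' | h'
    · rw [← h', Nat.succ_eq_add_one]; linarith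
    · have := E.line_lt_left h' hj h2.le
      rw [Nat.succ_eq_add_one] at this
      linarith

/-- Two lines whose meeting point is below all the others are the two extreme ones. -/
lemma Envelope.extreme {i j : ℕ} (hij : i < j) (hj : j ≤ k)
    (h : ∀ l ≤ k, θ i * meet θ ζ i j - ζ i ≤ θ l * meet θ ζ i j - ζ l) : i = 0 ∧ j = k := by
  have h1 := E.lt_meet hij hj
  have h2 := E.meet_lt hij hj
  have h3 := E.meet_mul hij hj
  constructor
  · by_contra h0
    exact absurd (h 0 (Nat.zero_le k)) (not_le.2
      (E.line_lt_right (Nat.pos_of_ne_zero h0) (hij.le.trans hj) h1.le))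
  · by_contra h0
    have := E.line_lt_left (lt_of_le_of_ne hj h0) le_rfl h2.le
    linarith [h k le_rfl]

lemma Envelope.meet_lt_succ {i : ℕ} (hi : i + 2 ≤ k) :
    meet θ ζ i (i + 1) < meet θ ζ (i + 1) (i + 2) :=
  (E.meet_lt (Nat.lt_succ_self i) (by omega)).trans (E.lt_meet (Nat.lt_succ_self (i + 1)) hi)

end

/-- The point at height `-1` below the corner, in the plane of the `i`-th face, with abscissa `v`,
in coordinates with axes `X`, `Y`, `n`. -/
def sectionPoint (X Y n : E3) (θ ζ : ℕ → ℝ) (i : ℕ) (v : ℝ) : E3 :=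
  (θ i * v - ζ i) • X + v • Y - n

section
variable {k : ℕ} {θ ζ y : ℕ → ℝ} {X Y n : E3}

lemma sectionPoint_sub (i : ℕ) (v v' : ℝ) :
    sectionPoint X Y n θ ζ i v - sectionPoint X Y n θ ζ i v' = (v - v') • (θ i • X + Y) := by
  simp only [sectionPoint]; module

lemma Envelope.sectionPoint_meet (E : Envelope k θ ζ y) {i j : ℕ} (hij : i < j) (hj : j ≤ k) :
    sectionPoint X Y n θ ζ i (meet θ ζ i j) = sectionPoint X Y n θ ζ j (meet θ ζ i j) := by
  have h3 := E.meet_mul hij hj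
  rw [sectionPoint, sectionPoint, show θ i * meet θ ζ i j - ζ i = θ j * meet θ ζ i j - ζ j by
    linarith]

lemma Envelope.sum_left (E : Envelope k θ ζ y) {l : ℕ} (hl : l + 1 ≤ k) :
    ∑ i ∈ Finset.range l, (θ k - θ (i + 1)) *
      (meet θ ζ (i + 1) (i + 2) - meet θ ζ i (i + 1)) =
    ((θ k - θ l) * meet θ ζ l (l + 1) + ζ l) - ((θ k - θ 0) * meet θ ζ 0 1 + ζ 0) := by
  induction l with
  | zero => simp
  | succ l ih =>
    rw [Finset.sum_range_succ, ih (by omega)]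
    have := E.meet_mul (Nat.lt_succ_self l) (by omega)
    rw [Nat.succ_eq_add_one] at this
    linear_combination this

/-- The heart of the inequality between lengths: the polygon of the consecutive meeting points is
compared with the two sides of the triangle that it forms with the extreme meeting point. -/
lemma Envelope.perimeter_le (E : Envelope k θ ζ y) {l : ℕ} (hk : k = l + 1) :
    ∑ i ∈ Finset.range l, ‖θ (i + 1) • X + Y‖ *
      (meet θ ζ (i + 1) (i + 2) - meet θ ζ i (i + 1)) ≤
    ‖θ 0 • X + Y‖ * (meet θ ζ 0 k - meet θ ζ 0 1) +
      ‖θ k • X + Y‖ * (meet θ ζ l k - meet θ ζ 0 k) := by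
  have h0k := E.mono 0 k (by omega) le_rfl
  have hpos : 0 < θ k - θ 0 := sub_pos.2 h0k
  -- the slope vector of a line is a convex combination of the extreme ones
  have key : ∀ i ∈ Finset.range l, (θ k - θ 0) * (‖θ (i + 1) • X + Y‖ *
      (meet θ ζ (i + 1) (i + 2) - meet θ ζ i (i + 1))) ≤
      ‖θ 0 • X + Y‖ * ((θ k - θ (i + 1)) * (meet θ ζ (i + 1) (i + 2) - meet θ ζ i (i + 1))) +
      ‖θ k • X + Y‖ * ((θ k - θ 0) * (meet θ ζ (i + 1) (i + 2) - meet θ ζ i (i + 1)) -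
        (θ k - θ (i + 1)) * (meet θ ζ (i + 1) (i + 2) - meet θ ζ i (i + 1))) := by
    intro i hi
    have hi := Finset.mem_range.1 hi
    have h1 := sub_pos.2 (E.meet_lt_succ (i := i) (by omega))
    have h2 := E.mono 0 (i + 1) (by omega) (by omega)
    have h3 := E.mono (i + 1) k (by omega) le_rfl
    have h4 : (θ k - θ 0) * ‖θ (i + 1) • X + Y‖ ≤
        (θ k - θ (i + 1)) * ‖θ 0 • X + Y‖ + (θ (i + 1) - θ 0) * ‖θ k • X + Y‖ := by
      have e : (θ k - θ 0) • (θ (i + 1) • X + Y) = (θ k - θ (i + 1)) • (θ 0 • X + Y) +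
          (θ (i + 1) - θ 0) • (θ k • X + Y) := by module
      have := norm_add_le ((θ k - θ (i + 1)) • (θ 0 • X + Y)) ((θ (i + 1) - θ 0) • (θ k • X + Y))
      rwa [← e, norm_smul, norm_smul, norm_smul, Real.norm_eq_abs, Real.norm_eq_abs,
        Real.norm_eq_abs, abs_of_pos hpos, abs_of_pos (sub_pos.2 h3),
        abs_of_pos (sub_pos.2 h2)] at this
    nlinarith
  have h1 := Finset.sum_le_sum key
  rw [← Finset.mul_sum, Finset.sum_add_distrib, ← Finset.mul_sum, ← Finset.mul_sum,
    Finset.sum_sub_distrib, ← Finset.mul_sum, E.sum_left (by omega),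
    Finset.sum_range_sub (fun i => meet θ ζ i (i + 1))] at h1
  have h2 := E.meet_mul (Nat.lt_succ_self l) (by omega)
  have h3 := E.meet_mul (i := 0) (j := k) (by omega) le_rfl
  rw [Nat.succ_eq_add_one] at h2
  have e1 : (θ k - θ l) * meet θ ζ l (l + 1) + ζ l - ((θ k - θ 0) * meet θ ζ 0 1 + ζ 0) =
      (θ k - θ 0) * (meet θ ζ 0 k - meet θ ζ 0 1) := by
    subst hk; linear_combination h2 - h3
  rw [e1] at h1
  refine le_of_mul_le_mul_left (h1.trans_eq ?_) hpos
  subst hk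
  simp only [zero_add]
  ring

lemma Envelope.meet_zero_lt (E : Envelope k θ ζ y) (hk : 2 ≤ k) :
    meet θ ζ 0 1 < meet θ ζ 0 k := by
  have h1 := E.meet_mul (i := 0) (j := 1) (by omega) (by omega)
  have h2 := E.meet_mul (i := 0) (j := k) (by omega) le_rfl
  have h3 := E.meet_mul (i := 1) (j := k) (by omega) le_rfl
  have h4 := (E.meet_lt (i := 0) (j := 1) (by omega) (by omega)).trans
    (E.lt_meet (i := 1) (j := k) (by omega) le_rfl)
  have h5 := E.mono 1 k (by omega) le_rfl
  have h6 := E.mono 0 k (by omega) le_rfl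
  nlinarith

lemma Envelope.lt_meet_last (E : Envelope k θ ζ y) {l : ℕ} (hk : k = l + 1) (hl : 1 ≤ l) :
    meet θ ζ 0 k < meet θ ζ l k := by
  have h1 := E.meet_mul (i := 0) (j := l) (by omega) (by omega)
  have h2 := E.meet_mul (i := 0) (j := k) (by omega) le_rfl
  have h3 := E.meet_mul (i := l) (j := k) (by omega) le_rfl
  have h4 := (E.meet_lt (i := 0) (j := l) (by omega) (by omega)).trans
    (E.lt_meet (i := l) (j := k) (by omega) le_rfl)
  have h5 := E.mono 0 l (by omega) (by omega)
  have h6 := E.mono 0 k (by omega) le_rfl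
  nlinarith

/-- The balance, at one corner, of the lengths of the edges cut or prolonged and of the edges of
the rotated face, summed over the two senses of rotation. -/
theorem Envelope.balance (E : Envelope k θ ζ y) (fr : Frame X Y n) {l : ℕ} (hk : k = l + 1) :
    (∑ i ∈ Finset.range l, ‖θ (i + 1) • X + Y‖ *
        (meet θ ζ (i + 1) (i + 2) - meet θ ζ i (i + 1)))
      - ‖θ 0 • X + Y‖ * (meet θ ζ 0 k - meet θ ζ 0 1)
      - ‖θ k • X + Y‖ * (meet θ ζ l k - meet θ ζ 0 k)
      + ‖sectionPoint X Y n θ ζ 0 (meet θ ζ 0 k)‖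
      - ∑ i ∈ Finset.range k, ‖sectionPoint X Y n θ ζ i (meet θ ζ i (i + 1))‖ ≤ 0 ∧
    (2 ≤ k → (∑ i ∈ Finset.range l, ‖θ (i + 1) • X + Y‖ *
        (meet θ ζ (i + 1) (i + 2) - meet θ ζ i (i + 1)))
      - ‖θ 0 • X + Y‖ * (meet θ ζ 0 k - meet θ ζ 0 1)
      - ‖θ k • X + Y‖ * (meet θ ζ l k - meet θ ζ 0 k)
      + ‖sectionPoint X Y n θ ζ 0 (meet θ ζ 0 k)‖
      - ∑ i ∈ Finset.range k, ‖sectionPoint X Y n θ ζ i (meet θ ζ i (i + 1))‖ < 0) := by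
  set p : ℕ → E3 := fun i => sectionPoint X Y n θ ζ i (meet θ ζ i (i + 1)) with hp
  set G := sectionPoint X Y n θ ζ 0 (meet θ ζ 0 k) with hG
  have hdist : ∀ i v v', v' ≤ v → ‖sectionPoint X Y n θ ζ i v - sectionPoint X Y n θ ζ i v'‖ =
      ‖θ i • X + Y‖ * (v - v') := fun i v v' h => by
    rw [sectionPoint_sub, norm_smul, Real.norm_eq_abs, abs_of_nonneg (sub_nonneg.2 h), mul_comm]
  have hside : ∀ i ∈ Finset.range l, ‖θ (i + 1) • X + Y‖ *
      (meet θ ζ (i + 1) (i + 2) - meet θ ζ i (i + 1)) ≤ ‖p (i + 1)‖ + ‖p i‖ := by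
    intro i hi
    have hi := Finset.mem_range.1 hi
    rw [← hdist _ _ _ (E.meet_lt_succ (i := i) (by omega)).le,
      ← E.sectionPoint_meet (Nat.lt_succ_self i) (by omega)]
    exact norm_sub_le _ _
  have h1 := Finset.sum_le_sum hside
  rw [Finset.sum_add_distrib] at h1
  have h2 := E.perimeter_le (X := X) (Y := Y) hk
  have h3 : ∑ i ∈ Finset.range k, ‖p i‖ = ∑ i ∈ Finset.range l, ‖p i‖ + ‖p l‖ := by
    rw [hk, Finset.sum_range_succ]
  have h4 : ∑ i ∈ Finset.range k, ‖p i‖ = ∑ i ∈ Finset.range l, ‖p (i + 1)‖ + ‖p 0‖ := by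
    rw [hk, Finset.sum_range_succ']
  have hn : ∀ i v, inner ℝ n (sectionPoint X Y n θ ζ i v) = (-1 : ℝ) := fun i v => by
    have h1 := fr.ac
    have h2 := fr.bc
    rw [real_inner_comm] at h1 h2
    rw [sectionPoint, inner_sub_right, inner_add_right, inner_smul_right, inner_smul_right, h1, h2,
      real_inner_self_eq_norm_sq, fr.nc]
    norm_num
  have hGl : G = sectionPoint X Y n θ ζ k (meet θ ζ 0 k) := E.sectionPoint_meet (by omega) le_rfl
  have hpl : p l = sectionPoint X Y n θ ζ k (meet θ ζ l k) := by
    subst hk; exact E.sectionPoint_meet (by omega) le_rfl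
  rcases Nat.eq_zero_or_pos l with hl | hl
  · subst hl
    subst hk
    refine ⟨?_, fun h => absurd h (by norm_num)⟩
    simp only [Finset.range_zero, Finset.sum_empty, zero_add, Finset.range_one,
      Finset.sum_singleton, sub_self, mul_zero]
    exact (sub_self ‖G‖).le
  · have hlt := E.meet_zero_lt (by omega)
    have hlt' := E.lt_meet_last hk hl
    have d1 : ‖θ 0 • X + Y‖ * (meet θ ζ 0 k - meet θ ζ 0 1) = ‖G - p 0‖ :=
      (hdist _ _ _ hlt.le).symm
    have d2 : ‖θ k • X + Y‖ * (meet θ ζ l k - meet θ ζ 0 k) = ‖p l - G‖ := by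
      rw [← hdist _ _ _ hlt'.le, hpl, hGl]
    have t2 : ‖G‖ ≤ ‖p l‖ + ‖p l - G‖ := by
      have := norm_sub_le (p l) (p l - G)
      rwa [sub_sub_cancel] at this
    have t1 : ‖G‖ < ‖p 0‖ + ‖G - p 0‖ := by
      have h := norm_add_le (p 0) (G - p 0)
      rw [add_sub_cancel] at h
      refine lt_of_le_of_ne h fun he => ?_
      -- equality would make `p 0` and the horizontal vector `G - p 0` parallel
      have hray : SameRay ℝ (p 0) (G - p 0) := by
        rw [sameRay_iff_norm_add, add_sub_cancel, he]
      have hd0 : G - p 0 ≠ 0 := fun h0 => by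
        rw [h0, norm_zero] at d1
        have hz : 0 < ‖θ 0 • X + Y‖ := by
          refine norm_pos_iff.2 fun h0 => ?_
          have : inner ℝ Y (θ 0 • X + Y) = (1 : ℝ) := by
            rw [inner_add_right, inner_smul_right, real_inner_self_eq_norm_sq, fr.nb,
              real_inner_comm, fr.ab]
            norm_num
          rw [h0, inner_zero_right] at this
          exact zero_ne_one this
        exact (mul_pos hz (sub_pos.2 hlt)).ne' d1
      have hp0 : p 0 ≠ 0 := fun h0 => by
        have := hn 0 (meet θ ζ 0 (0 + 1))
        rw [show sectionPoint X Y n θ ζ 0 (meet θ ζ 0 (0 + 1)) = 0 from h0, inner_zero_right] at this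
        norm_num at this
      obtain ⟨r, s, hr, hs, hrs⟩ := hray.exists_pos hp0 hd0
      have := congrArg (fun v => (inner ℝ n v : ℝ)) hrs
      simp only [inner_smul_right, inner_sub_right] at this
      have e1 : inner ℝ n (p 0) = (-1 : ℝ) := hn _ _
      have e2 : inner ℝ n G = (-1 : ℝ) := hn _ _
      rw [e1, e2] at this
      linarith
    rw [d1, d2] at h2
    rw [d1, d2, show ∑ i ∈ Finset.range k, ‖sectionPoint X Y n θ ζ i (meet θ ζ i (i + 1))‖ =
      ∑ i ∈ Finset.range k, ‖p i‖ from rfl]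
    constructor
    · linarith
    · intro _
      linarith

end

end

section

/-! ### Coordinates at a corner -/

lemma exists_enumeration {α : Type*} [Inhabited α] (s : Finset α) (f : α → ℝ)
    (hf : InjOn f s) : ∃ g : ℕ → α, (∀ i < s.card, g i ∈ s) ∧
      (∀ i j, i < j → j < s.card → f (g i) < f (g j)) ∧ ∀ x ∈ s, ∃ i < s.card, g i = x := by
  classical
  induction s using Finset.induction_on_max_value f with
  | empty => exact ⟨fun _ => default, by simp, by simp, by simp⟩
  | insert a s has hmax ih =>
    obtain ⟨g, h1, h2, h3⟩ := ih (hf.mono (by simp))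
    rw [Finset.card_insert_of_notMem has]
    have hlt : ∀ i < s.card, Function.update g s.card a i = g i := fun i hi =>
      Function.update_of_ne hi.ne _ _
    refine ⟨Function.update g s.card a, fun i hi => ?_, fun i j hij hj => ?_, fun x hx => ?_⟩
    · rcases (Nat.lt_succ_iff.1 hi).lt_or_eq with h | rfl
      · rw [hlt i h]; exact Finset.mem_insert_of_mem (h1 i h)
      · simp
    · rcases (Nat.lt_succ_iff.1 hj).lt_or_eq with h | rfl
      · rw [hlt j h, hlt i (hij.trans h)]; exact h2 i j hij h
      · rw [hlt i hij, Function.update_self]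
        refine lt_of_le_of_ne (hmax _ (h1 i hij)) fun he => has ?_
        rw [← hf (by simp [h1 i hij]) (by simp) he]
        exact h1 i hij
    · rcases Finset.mem_insert.1 hx with rfl | hx
      · exact ⟨s.card, Nat.lt_succ_self _, Function.update_self ..⟩
      · obtain ⟨i, hi, rfl⟩ := h3 x hx
        exact ⟨i, hi.trans (Nat.lt_succ_self _), hlt i hi⟩

/-- Coordinates at a corner with set of normals `Q`: `X` points from the corner into the face, `n`
is the normal of the face, and up to the positive factor `m i` the `i`-th normal is
`-X + θ i • Y + ζ i • n`, so that in the plane at height `-1` the cone of the corner is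
`{X ≥ θ i * Y - ζ i for all i}`. -/
structure CornerChart (Q : Set E3) (n X Y : E3) (k : ℕ) (ν : ℕ → E3) (m θ ζ y : ℕ → ℝ) :
    Prop where
  frame : Frame X Y n
  env : Envelope k θ ζ y
  mem : ∀ i ≤ k, ν i ∈ Q
  surj : ∀ μ ∈ Q, ∃ i ≤ k, ν i = μ
  m_pos : ∀ i ≤ k, 0 < m i
  eq : ∀ i ≤ k, ν i = m i • (-X + θ i • Y + ζ i • n)

lemma FaceData.exists_cornerChart {P F : Set E3} {A B n : E3} {T : Finset (E3 × ℝ)}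
    (D : FaceData P F A B n T) {a : E3} (ha : a ∈ corners P F A B T) :
    ∃ (X Y : E3) (k : ℕ) (ν : ℕ → E3) (m θ ζ y : ℕ → ℝ),
      CornerChart (normals P F T a) n X Y k ν m θ ζ y ∧
        k + 1 = (D.finite_normals a).toFinset.card := by
  obtain ⟨haF, μ, hμ, μ', hμ', hμne⟩ := ha
  obtain ⟨x, -, hxF, hx⟩ := D.exists_inner_point haF
  have hx0 : ‖x - a‖ ≠ 0 := fun h0 => by
    have := hx μ hμ
    rw [norm_eq_zero.1 h0, inner_zero_right] at this
    exact lt_irrefl _ this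
  have hxpos : 0 < ‖x - a‖⁻¹ := inv_pos.2 (lt_of_le_of_ne (norm_nonneg _) (Ne.symm hx0))
  set X := ‖x - a‖⁻¹ • (x - a) with hX
  have hX1 : ‖X‖ = 1 := by rw [hX, norm_smul, norm_inv, norm_norm, inv_mul_cancel₀ hx0]
  have hnX : inner ℝ n X = (0 : ℝ) := by
    rw [hX, inner_smul_right, D.inner_n_sub haF.1, D.sub_plane x hxF, mul_zero]
  have hνX : ∀ ν ∈ normals P F T a, (inner ℝ ν X : ℝ) < 0 := fun ν hν => by
    rw [hX, inner_smul_right]; exact mul_neg_of_pos_of_neg hxpos (hx ν hν)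
  clear_value X
  obtain ⟨Y, hfr⟩ := exists_frame D.norm_n hX1 hnX
  have fr : Frame X Y n := hfr.rotate
  set Θ : E3 → ℝ := fun ν => inner ℝ Y ν / -inner ℝ X ν with hΘ
  have hmpos : ∀ ν ∈ normals P F T a, 0 < (-inner ℝ X ν : ℝ) := fun ν hν => by
    have := hνX ν hν
    rw [real_inner_comm] at this
    linarith
  have hrep : ∀ ν ∈ normals P F T a, ν = (-inner ℝ X ν : ℝ) •
      (-X + Θ ν • Y + (inner ℝ n ν / -inner ℝ X ν : ℝ) • n) := fun ν hν => by
    have h0 := (hmpos ν hν).ne'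
    have e1 : (-inner ℝ X ν : ℝ) • (-X + Θ ν • Y + (inner ℝ n ν / -inner ℝ X ν : ℝ) • n) =
        (inner ℝ X ν : ℝ) • X + (-inner ℝ X ν * Θ ν : ℝ) • Y +
          (-inner ℝ X ν * (inner ℝ n ν / -inner ℝ X ν) : ℝ) • n := by module
    rw [e1, hΘ, mul_div_cancel₀ _ h0, mul_div_cancel₀ _ h0]
    exact fr.expand ν
  have hinj : InjOn Θ ((D.finite_normals a).toFinset : Set E3) := by
    intro ν hν ν' hν' he
    rw [Finite.coe_toFinset] at hν hν'
    by_contra hne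
    -- both normals would be orthogonal to a horizontal direction
    have horth : ∀ μ ∈ normals P F T a, inner ℝ μ (Θ μ • X + Y) = (0 : ℝ) := fun μ hμ => by
      rw [inner_add_right, inner_smul_right, real_inner_comm X μ, real_inner_comm Y μ]
      have e1 : Θ μ * -inner ℝ X μ = inner ℝ Y μ := div_mul_cancel₀ _ (hmpos μ hμ).ne'
      linarith
    have h0 := D.eq_zero_of_orthogonal haF hν hν' hne
      (u := Θ ν • X + Y) (by rw [inner_add_right, inner_smul_right, hnX, hfr.ac]; ring)
      (horth ν hν) (by rw [he]; exact horth ν' hν')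
    have h1 := congrArg (fun v => (inner ℝ Y v : ℝ)) h0
    simp only [inner_add_right, inner_smul_right, inner_zero_right, real_inner_self_eq_norm_sq,
      fr.nb] at h1
    rw [real_inner_comm, fr.ab] at h1
    norm_num at h1
  obtain ⟨g, g1, g2, g3⟩ := exists_enumeration _ Θ hinj
  set K := (D.finite_normals a).toFinset.card with hK
  have hK1 : 0 < K := Finset.card_pos.2 ⟨μ, by simpa using hμ⟩
  have hg : ∀ i ≤ K - 1, g i ∈ normals P F T a := fun i hi => by
    have := g1 i (by omega)
    rwa [Finite.mem_toFinset] at this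
  have hwit : ∀ i, ∃ v : ℝ, i ≤ K - 1 → ∀ j ≤ K - 1, i ≠ j →
      Θ (g j) * v - inner ℝ n (g j) / -inner ℝ X (g j) <
        Θ (g i) * v - (inner ℝ n (g i) / -inner ℝ X (g i) : ℝ) := by
    intro i
    by_cases hi : i ≤ K - 1
    · obtain ⟨z, -, hz1, hz2, hz3⟩ := D.exists_witness haF (hg i hi)
      refine ⟨inner ℝ Y (z - a) / -inner ℝ n (z - a), fun _ j hj hij => ?_⟩
      have hne : g j ≠ g i := fun h => by
        rcases lt_or_gt_of_ne hij with h' | h'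
        · exact (g2 i j h' (by omega)).ne' (by rw [h])
        · exact (g2 j i h' (by omega)).ne (by rw [h])
      have h3 := hz3 _ (hg j hj) hne
      rw [hrep _ (hg j hj)] at h3
      rw [hrep _ (hg i hi)] at hz2
      rw [inner_smul_left, inner_add_left, inner_add_left, inner_neg_left, inner_smul_left,
        inner_smul_left] at h3 hz2
      simp only [conj_trivial] at h3 hz2
      have h2 := (mul_eq_zero.1 hz2).resolve_left (hmpos _ (hg i hi)).ne'
      have h4 := lt_of_not_ge fun h =>
        absurd h3 (not_lt.2 (mul_nonneg (hmpos _ (hg j hj)).le h))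
      have hγ : 0 < (-inner ℝ n (z - a) : ℝ) := by linarith
      refine lt_of_mul_lt_mul_right ?_ hγ.le
      rw [sub_mul, sub_mul, mul_assoc, mul_assoc, div_mul_cancel₀ _ hγ.ne']
      linarith
    · exact ⟨0, fun h => absurd h hi⟩
  choose y hy using hwit
  refine ⟨X, Y, K - 1, g, fun i => -inner ℝ X (g i), fun i => Θ (g i),
    fun i => inner ℝ n (g i) / -inner ℝ X (g i), y, ⟨fr, ⟨fun i j hij hj => g2 i j hij (by omega),
      fun i j hi hj hij => hy i hi j hj hij⟩, hg, fun μ hμ => ?_, fun i hi => hmpos _ (hg i hi),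
      fun i hi => hrep _ (hg i hi)⟩, by omega⟩
  obtain ⟨i, hi, rfl⟩ := g3 μ (by simpa using hμ)
  exact ⟨i, by omega, rfl⟩

section
variable {Q : Set E3} {n X Y : E3} {k : ℕ} {ν : ℕ → E3} {m θ ζ y : ℕ → ℝ}
  (K : CornerChart Q n X Y k ν m θ ζ y)
include K

lemma CornerChart.inner_eq {i : ℕ} (hi : i ≤ k) (v : E3) :
    (inner ℝ (ν i) v : ℝ) =
      m i * (-inner ℝ X v + θ i * inner ℝ Y v + ζ i * (inner ℝ n v : ℝ)) := by
  rw [K.eq i hi, inner_smul_left, inner_add_left, inner_add_left, inner_neg_left, inner_smul_left,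
    inner_smul_left]
  simp only [conj_trivial]

lemma CornerChart.ne {i j : ℕ} (hi : i ≤ k) (hj : j ≤ k) (hij : i ≠ j) : ν i ≠ ν j := by
  have hX : ∀ i ≤ k, (inner ℝ (ν i) X : ℝ) = -m i := fun i hi => by
    rw [K.inner_eq hi, real_inner_self_eq_norm_sq, K.frame.na, real_inner_comm X Y, K.frame.ab,
      real_inner_comm X n, K.frame.ac]
    ring
  have hY : ∀ i ≤ k, (inner ℝ (ν i) Y : ℝ) = m i * θ i := fun i hi => by
    rw [K.inner_eq hi, real_inner_self_eq_norm_sq, K.frame.nb, K.frame.ab,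
      real_inner_comm Y n, K.frame.bc]
    ring
  intro h
  have h1 := hX i hi
  have h2 := hY i hi
  rw [h, hX j hj, neg_inj] at h1
  rw [h, hY j hj, h1] at h2
  have h3 := mul_left_cancel₀ (K.m_pos i hi).ne' h2
  rcases lt_or_gt_of_ne hij with h' | h'
  · exact (K.env.mono i j h' hj).ne' h3
  · exact (K.env.mono j i h' hi).ne h3

lemma CornerChart.sum_normals {s : Finset E3} (hs : ∀ μ, μ ∈ s ↔ μ ∈ Q) (G : E3 → ℝ) :
    ∑ μ ∈ s, G μ = ∑ i ∈ Finset.range (k + 1), G (ν i) := by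
  classical
  have : s = (Finset.range (k + 1)).image ν := by
    ext μ
    rw [hs, Finset.mem_image]
    constructor
    · intro h
      obtain ⟨i, hi, rfl⟩ := K.surj μ h
      exact ⟨i, Finset.mem_range.2 (by omega), rfl⟩
    · rintro ⟨i, hi, rfl⟩
      exact K.mem i (by have := Finset.mem_range.1 hi; omega)
  rw [this, Finset.sum_image]
  intro i hi j hj h
  by_contra hne
  have hi := Finset.mem_range.1 (Finset.mem_coe.1 hi)
  have hj := Finset.mem_range.1 (Finset.mem_coe.1 hj)
  exact K.ne (by omega) (by omega) hne h

lemma CornerChart.inner_sectionPoint (i : ℕ) (v : ℝ) :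
    inner ℝ X (sectionPoint X Y n θ ζ i v) = θ i * v - ζ i ∧
    inner ℝ Y (sectionPoint X Y n θ ζ i v) = v ∧
    inner ℝ n (sectionPoint X Y n θ ζ i v) = (-1 : ℝ) := by
  have h1 := K.frame.ab
  have h2 := K.frame.ac
  have h3 := K.frame.bc
  have h1' := h1
  have h2' := h2
  have h3' := h3
  rw [real_inner_comm] at h1' h2' h3'
  refine ⟨?_, ?_, ?_⟩ <;>
    simp [sectionPoint, inner_sub_right, inner_add_right, inner_smul_right, h1, h2, h3, h1', h2',
      h3', K.frame.na, K.frame.nb, K.frame.nc]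

lemma CornerChart.inner_normal_sectionPoint {i j : ℕ} (hj : j ≤ k) (v : ℝ) :
    inner ℝ (ν j) (sectionPoint X Y n θ ζ i v) =
      m j * ((θ j * v - ζ j) - (θ i * v - ζ i)) := by
  obtain ⟨h1, h2, h3⟩ := K.inner_sectionPoint i v
  rw [K.inner_eq hj, h1, h2, h3]; ring

lemma CornerChart.norm_slope_sq (i : ℕ) : ‖θ i • X + Y‖ ^ 2 = θ i ^ 2 + 1 := by
  rw [norm_add_sq_real, norm_smul, inner_smul_left, K.frame.ab, K.frame.na, K.frame.nb]
  simp

lemma CornerChart.norm_slope_pos (i : ℕ) : 0 < ‖θ i • X + Y‖ := by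
  refine lt_of_le_of_ne (norm_nonneg _) fun h => ?_
  have := K.norm_slope_sq i
  rw [← h] at this
  nlinarith [sq_nonneg (θ i)]

/-- The speeds of the thresholds on the trace of the `i`-th face, in any frame of that face. -/
lemma CornerChart.traceSpeed_eq {A w a f e : E3} {i : ℕ} (hi : i ≤ k)
    (fr : Frame (ν i) f e) (hnf : inner ℝ n f = (0 : ℝ)) (hne : 0 < (inner ℝ n e : ℝ)) :
    ∃ t : ℝ, |t| * ‖θ i • X + Y‖ = 1 ∧ ∀ j ≤ k, j ≠ i →
      inner ℝ (ν j) f = m j * (t * (θ j - θ i)) ∧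
      traceSpeed A n w f e a (ν j) =
        inner ℝ w (a - A) * (t * (‖θ i • X + Y‖ ^ 2 * meet θ ζ i j - θ i * ζ i)) := by
  set t : ℝ := inner ℝ Y f with ht
  have h1 : inner ℝ X f = θ i * t := by
    have := K.inner_eq hi f
    rw [fr.ab, hnf] at this
    have := (mul_eq_zero.1 this.symm).resolve_left (K.m_pos i hi).ne'
    linarith
  have hf : f = t • (θ i • X + Y) := by
    have := K.frame.expand f
    rw [hnf, h1, ← ht, zero_smul, add_zero] at this
    rw [this]; module
  refine ⟨t, ?_, fun j hj hji => ?_⟩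
  · have := fr.nb
    rwa [hf, norm_smul, Real.norm_eq_abs] at this
  have hα : inner ℝ (ν j) f = m j * (t * (θ j - θ i)) := by
    rw [K.inner_eq hj, h1, hnf, ← ht]; ring
  refine ⟨hα, ?_⟩
  have ht0 : t ≠ 0 := fun h0 => by
    have := fr.nb
    rw [hf, h0, zero_smul, norm_zero] at this
    exact zero_ne_one this
  have hθ : θ j - θ i ≠ 0 := by
    rcases lt_or_gt_of_ne hji with h | h
    · exact (sub_neg.2 (K.env.mono j i h hi)).ne
    · exact (sub_pos.2 (K.env.mono i j h hj)).ne'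
  have hα0 : inner ℝ (ν j) f ≠ (0 : ℝ) := by
    rw [hα]; exact mul_ne_zero (K.m_pos j hj).ne' (mul_ne_zero ht0 hθ)
  have hmeet : meet θ ζ i j * (θ j - θ i) = ζ j - ζ i := div_mul_cancel₀ _ hθ
  set d := sectionPoint X Y n θ ζ i (meet θ ζ i j) with hd
  obtain ⟨d1, d2, d3⟩ := K.inner_sectionPoint i (meet θ ζ i j)
  rw [← hd] at d1 d2 d3
  have hdi : inner ℝ (ν i) d = (0 : ℝ) := by rw [hd, K.inner_normal_sectionPoint hi]; ring
  have hdj : inner ℝ (ν j) d = (0 : ℝ) := by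
    rw [hd, K.inner_normal_sectionPoint hj]
    rw [mul_eq_zero]; right; linarith
  have hfd : inner ℝ f d = t * (‖θ i • X + Y‖ ^ 2 * meet θ ζ i j - θ i * ζ i) := by
    rw [hf, inner_smul_left, inner_add_left, inner_smul_left, d1, d2, K.norm_slope_sq]
    simp only [conj_trivial]; ring
  -- the direction `d` of the edge, expanded in the frame
  have hexp := fr.expand d
  rw [hdi, zero_smul, zero_add] at hexp
  have e1 : inner ℝ e d * inner ℝ n e = (-1 : ℝ) := by
    have := congrArg (fun v => (inner ℝ n v : ℝ)) hexp
    simp only [inner_add_right, inner_smul_right, hnf, mul_zero, zero_add, d3] at this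
    linarith
  have e2 : inner ℝ f d * inner ℝ (ν j) f + inner ℝ e d * inner ℝ (ν j) e = (0 : ℝ) := by
    have := congrArg (fun v => (inner ℝ (ν j) v : ℝ)) hexp
    simp only [inner_add_right, inner_smul_right, hdj] at this
    linarith
  rw [traceSpeed, ← hfd, div_eq_iff (mul_ne_zero hne.ne' hα0)]
  linear_combination (-(inner ℝ w (a - A) * inner ℝ n e : ℝ)) * e2 +
    (inner ℝ w (a - A) * inner ℝ (ν j) e : ℝ) * e1

end

end

section

/-! ### The rate of change of the edge length at one corner -/

section
variable {ι : Type*} {Lo Hi : Finset ι} {κ : ι → ℝ}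

lemma gapRate_le_high (h : ¬Lo.Nonempty) {j : ι} (hj : j ∈ Hi) : gapRate Lo Hi κ ≤ κ j := by
  rw [gapRate, dif_neg h, dif_pos ⟨j, hj⟩]
  exact Finset.inf'_le _ hj

lemma gapRate_le_low (h : ¬Hi.Nonempty) {j : ι} (hj : j ∈ Lo) : gapRate Lo Hi κ ≤ -κ j := by
  rw [gapRate, dif_pos ⟨j, hj⟩, dif_neg h]
  exact neg_le_neg (Finset.le_sup' _ hj)

lemma gapRate_le_max {i j : ι} (hi : i ∈ Lo) (hj : j ∈ Hi) :
    gapRate Lo Hi κ ≤ max 0 (κ j - κ i) := by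
  rw [gapRate, dif_pos ⟨i, hi⟩, dif_pos ⟨j, hj⟩]
  exact max_le_max le_rfl (sub_le_sub (Finset.inf'_le _ hj) (Finset.le_sup' _ hi))

end

section
variable {P F : Set E3} {A B n w : E3} {T : Finset (E3 × ℝ)} (D : FaceData P F A B n T)
  {X Y : E3} {k : ℕ} {ν : ℕ → E3} {m θ ζ y : ℕ → ℝ} {a : E3}

include D in
lemma FaceData.mem_lowNormals {ν f a ν' : E3} :
    ν' ∈ D.lowNormals ν f a ↔ ν' ∈ normals P F T a ∧ ν' ≠ ν ∧ (inner ℝ ν' f : ℝ) < 0 := by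
  simp [FaceData.lowNormals]

include D in
lemma FaceData.mem_highNormals {ν f a ν' : E3} :
    ν' ∈ D.highNormals ν f a ↔ ν' ∈ normals P F T a ∧ ν' ≠ ν ∧ 0 < (inner ℝ ν' f : ℝ) := by
  simp [FaceData.highNormals]

/-- The rate of change of the length of the trace of the face with normal `μ` at the corner `a`. -/
def FaceData.faceRate (w : E3) (f e : E3 → E3) (a μ : E3) : ℝ :=
  gapRate (D.lowNormals μ (f μ) a) (D.highNormals μ (f μ) a) (traceSpeed A n w (f μ) (e μ) a)

/-- A choice, for each normal `μ`, of a frame with the trace direction as its second vector. -/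
def IsTraceFrame (Q : Set E3) (n : E3) (f e : E3 → E3) : Prop :=
  ∀ μ ∈ Q, Frame μ (f μ) (e μ) ∧ inner ℝ n (f μ) = (0 : ℝ) ∧ 0 < (inner ℝ n (e μ) : ℝ)

variable (K : CornerChart (normals P F T a) n X Y k ν m θ ζ y) {f e : E3 → E3}
  (hfe : IsTraceFrame (normals P F T a) n f e)
include K hfe

/-- Signs and speeds of the thresholds, according to the direction of the trace. -/
lemma CornerChart.thresholds (w : E3) {i : ℕ} (hi : i ≤ k) :
    (∀ j ≤ k, (j < i → ν j ∈ D.lowNormals (ν i) (f (ν i)) a) ∧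
      (i < j → ν j ∈ D.highNormals (ν i) (f (ν i)) a) ∧
      (j ≠ i → traceSpeed A n w (f (ν i)) (e (ν i)) a (ν j) = inner ℝ w (a - A) *
        (‖θ i • X + Y‖ * meet θ ζ i j - θ i * ζ i / ‖θ i • X + Y‖))) ∨
    (∀ j ≤ k, (j < i → ν j ∈ D.highNormals (ν i) (f (ν i)) a) ∧
      (i < j → ν j ∈ D.lowNormals (ν i) (f (ν i)) a) ∧
      (j ≠ i → traceSpeed A n w (f (ν i)) (e (ν i)) a (ν j) = -(inner ℝ w (a - A) *
        (‖θ i • X + Y‖ * meet θ ζ i j - θ i * ζ i / ‖θ i • X + Y‖)))) := by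
  obtain ⟨fr, hnf, hne⟩ := hfe _ (K.mem i hi)
  obtain ⟨t, ht, h⟩ := K.traceSpeed_eq (A := A) (w := w) (a := a) hi fr hnf hne
  have hS := K.norm_slope_pos i
  set S := ‖θ i • X + Y‖ with hSdef
  have hspeed : ∀ r : ℝ, t = r / S → ∀ j, inner ℝ w (a - A) * (t * (S ^ 2 * meet θ ζ i j - θ i * ζ i)) =
      r * (inner ℝ w (a - A) * (S * meet θ ζ i j - θ i * ζ i / S)) := fun r hr j => by
    rw [hr]; field_simp
  rcases le_or_gt 0 t with h0 | h0
  · rw [abs_of_nonneg h0] at ht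
    have ht' : t = 1 / S := by rw [eq_div_iff hS.ne', ht]
    have htpos : 0 < t := by rw [ht']; positivity
    refine Or.inl fun j hj => ⟨fun hji => ?_, fun hij => ?_, fun hne => ?_⟩
    · rw [D.mem_lowNormals, (h j hj hji.ne).1]
      exact ⟨K.mem j hj, K.ne hj hi hji.ne, mul_neg_of_pos_of_neg (K.m_pos j hj)
        (mul_neg_of_pos_of_neg htpos (sub_neg.2 (K.env.mono j i hji hi)))⟩
    · rw [D.mem_highNormals, (h j hj hij.ne').1]
      exact ⟨K.mem j hj, K.ne hj hi hij.ne', mul_pos (K.m_pos j hj)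
        (mul_pos htpos (sub_pos.2 (K.env.mono i j hij hj)))⟩
    · rw [(h j hj hne).2, hspeed 1 ht', one_mul]
  · rw [abs_of_neg h0] at ht
    have ht' : t = -1 / S := by rw [eq_div_iff hS.ne']; linarith
    refine Or.inr fun j hj => ⟨fun hji => ?_, fun hij => ?_, fun hne => ?_⟩
    · rw [D.mem_highNormals, (h j hj hji.ne).1]
      exact ⟨K.mem j hj, K.ne hj hi hji.ne, mul_pos (K.m_pos j hj)
        (mul_pos_of_neg_of_neg h0 (sub_neg.2 (K.env.mono j i hji hi)))⟩
    · rw [D.mem_lowNormals, (h j hj hij.ne').1]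
      exact ⟨K.mem j hj, K.ne hj hi hij.ne', mul_neg_of_pos_of_neg (K.m_pos j hj)
        (mul_neg_of_neg_of_pos h0 (sub_pos.2 (K.env.mono i j hij hj)))⟩
    · rw [(h j hj hne).2, hspeed (-1) ht', neg_one_mul]

lemma CornerChart.faceRate_first (w : E3) {j : ℕ} (h0 : 0 < j) (hj : j ≤ k) :
    D.faceRate w f e a (ν 0) ≤ inner ℝ w (a - A) *
      (‖θ 0 • X + Y‖ * meet θ ζ 0 j - θ 0 * ζ 0 / ‖θ 0 • X + Y‖) := by
  rcases K.thresholds D hfe w (Nat.zero_le k) with h | h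
  · rw [← (h j hj).2.2 h0.ne']
    refine gapRate_le_high ?_ ((h j hj).2.1 h0)
    rintro ⟨μ, hμ⟩
    rw [D.mem_lowNormals] at hμ
    obtain ⟨l, hl, rfl⟩ := K.surj μ hμ.1
    have hl0 : 0 < l := Nat.pos_of_ne_zero fun h => hμ.2.1 (by rw [h])
    have := (D.mem_highNormals.1 ((h l hl).2.1 hl0)).2.2
    linarith [hμ.2.2]
  · rw [← neg_neg (inner ℝ w (a - A) * _), ← (h j hj).2.2 h0.ne']
    refine gapRate_le_low ?_ ((h j hj).2.1 h0)
    rintro ⟨μ, hμ⟩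
    rw [D.mem_highNormals] at hμ
    obtain ⟨l, hl, rfl⟩ := K.surj μ hμ.1
    have hl0 : 0 < l := Nat.pos_of_ne_zero fun h => hμ.2.1 (by rw [h])
    have := (D.mem_lowNormals.1 ((h l hl).2.1 hl0)).2.2
    linarith [hμ.2.2]

lemma CornerChart.faceRate_last (w : E3) {j : ℕ} (hj : j < k) :
    D.faceRate w f e a (ν k) ≤ -(inner ℝ w (a - A) *
      (‖θ k • X + Y‖ * meet θ ζ j k - θ k * ζ k / ‖θ k • X + Y‖)) := by
  rw [meet_comm θ ζ j k]
  rcases K.thresholds D hfe w le_rfl with h | h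
  · rw [← (h j hj.le).2.2 hj.ne]
    refine gapRate_le_low ?_ ((h j hj.le).1 hj)
    rintro ⟨μ, hμ⟩
    rw [D.mem_highNormals] at hμ
    obtain ⟨l, hl, rfl⟩ := K.surj μ hμ.1
    have hl0 : l < k := lt_of_le_of_ne hl fun h => hμ.2.1 (by rw [h])
    have := (D.mem_lowNormals.1 ((h l hl).1 hl0)).2.2
    linarith [hμ.2.2]
  · rw [← (h j hj.le).2.2 hj.ne]
    refine gapRate_le_high ?_ ((h j hj.le).1 hj)
    rintro ⟨μ, hμ⟩
    rw [D.mem_lowNormals] at hμ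
    obtain ⟨l, hl, rfl⟩ := K.surj μ hμ.1
    have hl0 : l < k := lt_of_le_of_ne hl fun h => hμ.2.1 (by rw [h])
    have := (D.mem_highNormals.1 ((h l hl).1 hl0)).2.2
    linarith [hμ.2.2]

lemma CornerChart.faceRate_mid (w : E3) {i j l : ℕ} (hji : j < i) (hil : i < l) (hl : l ≤ k) :
    D.faceRate w f e a (ν i) ≤ max 0 (inner ℝ w (a - A) *
      (‖θ i • X + Y‖ * (meet θ ζ i l - meet θ ζ j i))) := by
  rw [meet_comm θ ζ j i]
  have hi := hil.le.trans hl
  have hj := hji.le.trans hi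
  rcases K.thresholds D hfe w hi with h | h
  · refine (gapRate_le_max ((h j hj).1 hji) ((h l hl).2.1 hil)).trans_eq ?_
    rw [(h j hj).2.2 hji.ne, (h l hl).2.2 hil.ne']
    congr 1; ring
  · refine (gapRate_le_max ((h l hl).2.1 hil) ((h j hj).1 hji)).trans_eq ?_
    rw [(h j hj).2.2 hji.ne, (h l hl).2.2 hil.ne']
    congr 1; ring

/-- The traces of all faces at the corner, summed over the two senses of rotation. -/
lemma CornerChart.sum_faceRate {l : ℕ} (hk : k = l + 1) (hW : 0 ≤ (inner ℝ w (a - A) : ℝ)) :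
    ∑ μ ∈ (D.finite_normals a).toFinset, D.faceRate w f e a μ +
      ∑ μ ∈ (D.finite_normals a).toFinset, D.faceRate (-w) f e a μ ≤ inner ℝ w (a - A) *
    ((∑ i ∈ Finset.range l, ‖θ (i + 1) • X + Y‖ *
        (meet θ ζ (i + 1) (i + 2) - meet θ ζ i (i + 1)))
      - ‖θ 0 • X + Y‖ * (meet θ ζ 0 k - meet θ ζ 0 1)
      - ‖θ k • X + Y‖ * (meet θ ζ l k - meet θ ζ 0 k)) := by
  have hsum : ∀ G : E3 → ℝ, ∑ μ ∈ (D.finite_normals a).toFinset, G μ =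
      G (ν 0) + ∑ i ∈ Finset.range l, G (ν (i + 1)) + G (ν k) := fun G => by
    rw [K.sum_normals (by simp) G, Finset.sum_range_succ, hk, Finset.sum_range_succ']
    ring
  rw [hsum, hsum]
  have hW' : (inner ℝ (-w) (a - A) : ℝ) = -inner ℝ w (a - A) := inner_neg_left _ _
  have hstep : ∀ i ∈ Finset.range l,
      0 ≤ ‖θ (i + 1) • X + Y‖ * (meet θ ζ (i + 1) (i + 2) - meet θ ζ i (i + 1)) := fun i hi => by
    have hi := Finset.mem_range.1 hi
    exact mul_nonneg (norm_nonneg _) (sub_nonneg.2 (K.env.meet_lt_succ (by omega)).le)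
  have a1 := K.faceRate_first D hfe w (j := 1) one_pos (by omega)
  have a2 := K.faceRate_last D hfe w (j := l) (by omega)
  have a3 : ∑ i ∈ Finset.range l, D.faceRate w f e a (ν (i + 1)) ≤ inner ℝ w (a - A) *
      ∑ i ∈ Finset.range l, ‖θ (i + 1) • X + Y‖ *
        (meet θ ζ (i + 1) (i + 2) - meet θ ζ i (i + 1)) := by
    rw [Finset.mul_sum]
    refine Finset.sum_le_sum fun i hi => ?_
    have hi' := Finset.mem_range.1 hi
    refine (K.faceRate_mid D hfe w (i := i + 1) (j := i) (l := i + 2) (by omega) (by omega)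
      (by omega)).trans_eq ?_
    rw [max_eq_right (mul_nonneg hW (hstep i hi))]
  have b1 := K.faceRate_first D hfe (-w) (j := k) (by omega) le_rfl
  have b2 := K.faceRate_last D hfe (-w) (j := 0) (by omega)
  have b3 : ∑ i ∈ Finset.range l, D.faceRate (-w) f e a (ν (i + 1)) ≤ 0 := by
    refine Finset.sum_nonpos fun i hi => ?_
    have hi' := Finset.mem_range.1 hi
    refine (K.faceRate_mid D hfe (-w) (i := i + 1) (j := i) (l := i + 2) (by omega) (by omega)
      (by omega)).trans_eq ?_
    rw [max_eq_left]
    rw [hW', neg_mul]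
    exact neg_nonpos.2 (mul_nonneg hW (hstep i hi))
  rw [hW'] at b1 b2
  linarith

include D in
omit hfe in
/-- Below the corner the edges of the body are the rays through the consecutive meeting points. -/
lemma CornerChart.descending_ray (ha : a ∈ F \ segment ℝ A B) {i : ℕ} (hi : i < k) :
    (∀ᶠ s in 𝓝[>] (0 : ℝ), a + s • sectionPoint X Y n θ ζ i (meet θ ζ i (i + 1)) ∈
      bodyEdges P F A B T) ∧ ∃ ℓ ∈ arrangementLines T,
      ∀ s : ℝ, a + s • sectionPoint X Y n θ ζ i (meet θ ζ i (i + 1)) ∈ ℓ := by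
  set d := sectionPoint X Y n θ ζ i (meet θ ζ i (i + 1)) with hd
  have hact : ∀ s : ℝ, (active P F T a (a + s • d)).Nontrivial := by
    intro s
    refine ⟨ν i, ⟨K.mem i hi.le, ?_⟩, ν (i + 1), ⟨K.mem _ hi, ?_⟩, K.ne hi.le hi (by omega)⟩
    · rw [add_sub_cancel_left, inner_smul_right, hd, K.inner_normal_sectionPoint hi.le]; ring
    · rw [add_sub_cancel_left, inner_smul_right, hd, K.inner_normal_sectionPoint hi]
      have := K.env.meet_mul (Nat.lt_succ_self i) hi
      rw [Nat.succ_eq_add_one] at this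
      rw [show θ (i + 1) * meet θ ζ i (i + 1) - ζ (i + 1) = θ i * meet θ ζ i (i + 1) - ζ i by
        linarith]
      ring
  have hd0 : d ≠ 0 := fun h0 => by
    have := (K.inner_sectionPoint i (meet θ ζ i (i + 1))).2.2
    rw [← hd, h0, inner_zero_right] at this
    norm_num at this
  constructor
  · filter_upwards [((tendsto_add_smul a d).eventually (star_mem_nhds T a)).filter_mono
      nhdsWithin_le_nhds, self_mem_nhdsWithin] with s hs hs0
    have hs0 : 0 < s := hs0
    have hb : a + s • d ∈ body P F A B T := by
      refine (D.mem_body_iff ha hs).2 fun μ hμ => ?_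
      obtain ⟨j, hj, rfl⟩ := K.surj μ hμ
      rw [add_sub_cancel_left, inner_smul_right, hd, K.inner_normal_sectionPoint hj]
      exact mul_nonpos_of_nonneg_of_nonpos hs0.le (mul_nonpos_of_nonneg_of_nonpos
        (K.m_pos j hj).le (sub_nonpos.2 (K.env.le_at_meet hi hj)))
    refine ⟨D.edge_of_nontrivial ha hs hb ?_ (hact s), a, ha, hs⟩
    simpa [hs0.ne'] using hd0
  · obtain ⟨ℓ, hℓ, h1, h2⟩ := D.exists_line ha (hact 1)
    refine ⟨ℓ, hℓ, ?_⟩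
    obtain ⟨⟨c, v, -, rfl⟩, -⟩ := hℓ
    obtain ⟨x, hx⟩ := h1
    obtain ⟨x', hx'⟩ := h2
    simp only at hx hx'
    intro s
    refine ⟨x' + s * (x - x'), ?_⟩
    have e1 : d = (x - x') • v := by
      have e2 : d = (a + (1 : ℝ) • d) - a := by module
      rw [e2, ← hx, ← hx']; module
    simp only
    rw [e1]
    nth_rw 1 [← hx']
    module

include D in
omit hfe in
/-- Above the corner the body has an edge at most on the ray opposite to the extreme meeting
point. -/
lemma CornerChart.ascending_ray (ha : a ∈ F \ segment ℝ A B) {d : E3}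
    (hd : inner ℝ n d = (1 : ℝ))
    (h : ∀ᶠ s in 𝓝[>] (0 : ℝ), a + s • d ∈ bodyEdges P F A B T) :
    d = -sectionPoint X Y n θ ζ 0 (meet θ ζ 0 k) := by
  obtain ⟨s, ⟨hs, hstar⟩, hs0⟩ := ((h.and (((tendsto_add_smul a d).eventually
    (star_mem_nhds T a)).filter_mono nhdsWithin_le_nhds)).and
      (eventually_mem_set.2 self_mem_nhdsWithin)).exists
  have hs0 : 0 < s := hs0
  have hb := D.bodyEdges_subset_body hs
  have hcone := (D.mem_body_iff ha hstar).1 hb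
  have hle : ∀ j ≤ k, -inner ℝ X d + θ j * inner ℝ Y d + ζ j ≤ 0 := fun j hj => by
    have := hcone _ (K.mem j hj)
    rw [add_sub_cancel_left, inner_smul_right, K.inner_eq hj, hd, mul_one] at this
    by_contra hc
    exact absurd this (not_le.2 (mul_pos hs0 (mul_pos (K.m_pos j hj) (not_le.1 hc))))
  have hact : ∀ j ≤ k, inner ℝ (ν j) (a + s • d - a) = (0 : ℝ) →
      -inner ℝ X d + θ j * inner ℝ Y d + ζ j = 0 := fun j hj h0 => by
    rw [add_sub_cancel_left, inner_smul_right, K.inner_eq hj, hd, mul_one] at h0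
    exact (mul_eq_zero.1 ((mul_eq_zero.1 h0).resolve_left hs0.ne')).resolve_left (K.m_pos j hj).ne'
  -- two normals are orthogonal to the ray; order them by slope
  obtain ⟨i, j, hij, hj, hi0, hj0⟩ : ∃ i j, i < j ∧ j ≤ k ∧
      -inner ℝ X d + θ i * inner ℝ Y d + ζ i = 0 ∧ -inner ℝ X d + θ j * inner ℝ Y d + ζ j = 0 := by
    obtain ⟨μ, hμ, μ', hμ', hne⟩ := D.nontrivial_of_edge ha hstar hb hs.1
    obtain ⟨i, hi, rfl⟩ := K.surj μ hμ.1
    obtain ⟨j, hj, rfl⟩ := K.surj μ' hμ'.1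
    rcases lt_trichotomy i j with hij | rfl | hij
    · exact ⟨i, j, hij, hj, hact i hi hμ.2, hact j hj hμ'.2⟩
    · exact absurd rfl hne
    · exact ⟨j, i, hij, hi, hact j hj hμ'.2, hact i hi hμ.2⟩
  have hY : inner ℝ Y d = -meet θ ζ i j := by
    have h1 := K.env.meet_mul hij hj
    have h2 := sub_pos.2 (K.env.mono i j hij hj)
    refine mul_right_cancel₀ h2.ne' ?_
    linarith
  obtain ⟨rfl, rfl⟩ := K.env.extreme hij hj fun l hl => by
    have := hle l hl
    rw [hY] at hi0 this
    linarith
  obtain ⟨e1, e2, e3⟩ := K.inner_sectionPoint 0 (meet θ ζ 0 j)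
  refine K.frame.ext ?_ ?_ ?_
  · rw [inner_neg_right, e1]; rw [hY] at hi0; linarith
  · rw [inner_neg_right, e2, hY]
  · rw [inner_neg_right, e3, hd, neg_neg]

end

/-- The properties of the rate of change at the corner `a` of the length of the edges on the line
`ℓ`: descending edges are cut when the rotated plane moves into the polyhedron, ascending edges
are prolonged when it moves out. -/
def IsEdgeRate (P F : Set E3) (A B n w : E3) (T : Finset (E3 × ℝ)) (ℓ : Set E3) (a : E3)
    (r : ℝ) : Prop :=
  (0 ≤ (inner ℝ w (a - A) : ℝ) → r ≤ 0 ∧ ∀ d : E3, inner ℝ n d = (-1 : ℝ) →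
    (∀ᶠ s in 𝓝[>] (0 : ℝ), a + s • d ∈ bodyEdges P F A B T ∩ ℓ) →
    r ≤ -(inner ℝ w (a - A) * ‖d‖)) ∧
  ((inner ℝ w (a - A) : ℝ) < 0 → r ≤ 0 ∨ ∃ d : E3, inner ℝ n d = (1 : ℝ) ∧
    (∀ᶠ s in 𝓝[>] (0 : ℝ), a + s • d ∈ bodyEdges P F A B T ∩ ℓ) ∧
    r ≤ -(inner ℝ w (a - A) * ‖d‖))

section
variable {P F : Set E3} {A B n w : E3} {T : Finset (E3 × ℝ)} (D : FaceData P F A B n T)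
  {X Y : E3} {k : ℕ} {ν : ℕ → E3} {m θ ζ y : ℕ → ℝ} {a : E3}
  (K : CornerChart (normals P F T a) n X Y k ν m θ ζ y) {r : Set E3 → ℝ}
include D K

lemma CornerChart.sum_edgeRate_inward (ha : a ∈ F \ segment ℝ A B)
    (hW : 0 ≤ (inner ℝ w (a - A) : ℝ))
    (hr : ∀ ℓ ∈ arrangementLines T, IsEdgeRate P F A B n w T ℓ a (r ℓ)) :
    ∑ ℓ ∈ (finite_arrangementLines T).toFinset, r ℓ ≤ -(inner ℝ w (a - A) *
      ∑ i ∈ Finset.range k, ‖sectionPoint X Y n θ ζ i (meet θ ζ i (i + 1))‖) := by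
  classical
  set p : ℕ → E3 := fun i => sectionPoint X Y n θ ζ i (meet θ ζ i (i + 1)) with hp
  have hpn : ∀ i, inner ℝ n (p i) = (-1 : ℝ) := fun i => (K.inner_sectionPoint i _).2.2
  have h1 : ∀ i, ∃ ℓ, i < k → ℓ ∈ arrangementLines T ∧ ∀ s : ℝ, a + s • p i ∈ ℓ := fun i => by
    by_cases hi : i < k
    · obtain ⟨ℓ, h1, h2⟩ := (K.descending_ray D ha hi).2
      exact ⟨ℓ, fun _ => ⟨h1, h2⟩⟩
    · exact ⟨∅, fun h => absurd h hi⟩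
  choose L hL using h1
  have hmono : ∀ i j, i < j → j < k → meet θ ζ i (i + 1) < meet θ ζ j (j + 1) := by
    intro i j hij
    induction j, hij using Nat.le_induction with
    | base => intro h; exact K.env.meet_lt_succ (by omega)
    | succ j _ ih => intro h; exact (ih (by omega)).trans (K.env.meet_lt_succ (by omega))
  have hinj : InjOn L (Finset.range k : Set ℕ) := by
    intro i hi j hj hij
    have hi := Finset.mem_range.1 (Finset.mem_coe.1 hi)
    have hj := Finset.mem_range.1 (Finset.mem_coe.1 hj)
    obtain ⟨⟨⟨c, v, -, hcv⟩, -⟩, hi2⟩ := hL i hi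
    have hj2 := (hL j hj).2
    rw [← hij] at hj2
    rw [hcv] at hi2 hj2
    obtain ⟨-, μ, hμ⟩ := ray_in_line (Eventually.of_forall (f := 𝓝[>] (0:ℝ)) hi2)
    obtain ⟨-, μ', hμ'⟩ := ray_in_line (Eventually.of_forall (f := 𝓝[>] (0:ℝ)) hj2)
    have e1 := hpn i
    have e2 := hpn j
    rw [hμ, inner_smul_right] at e1
    rw [hμ', inner_smul_right] at e2
    have hv : (inner ℝ n v : ℝ) ≠ 0 := fun h0 => by rw [h0, mul_zero] at e1; norm_num at e1
    have e3 : μ = μ' := mul_right_cancel₀ hv (e1.trans e2.symm)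
    have e4 : p i = p j := by rw [hμ, hμ', e3]
    have e5 : meet θ ζ i (i + 1) = meet θ ζ j (j + 1) := by
      rw [← (K.inner_sectionPoint i (meet θ ζ i (i + 1))).2.1,
        ← (K.inner_sectionPoint j (meet θ ζ j (j + 1))).2.1]
      exact congrArg (fun v => (inner ℝ Y v : ℝ)) e4
    rcases lt_trichotomy i j with h | h | h
    · exact absurd e5 (hmono i j h hj).ne
    · exact h
    · exact absurd e5 (hmono j i h hi).ne'
  have hsub : (Finset.range k).image L ⊆ (finite_arrangementLines T).toFinset := by
    intro ℓ hℓ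
    obtain ⟨i, hi, rfl⟩ := Finset.mem_image.1 hℓ
    rw [Finite.mem_toFinset]
    exact (hL i (Finset.mem_range.1 hi)).1
  calc ∑ ℓ ∈ (finite_arrangementLines T).toFinset, r ℓ
      ≤ ∑ ℓ ∈ (Finset.range k).image L, r ℓ := by
        rw [← Finset.sum_sdiff hsub]
        have : ∑ ℓ ∈ (finite_arrangementLines T).toFinset \ (Finset.range k).image L, r ℓ ≤ 0 :=
          Finset.sum_nonpos fun ℓ hℓ => by
            have h := (Finset.mem_sdiff.1 hℓ).1
            rw [Finite.mem_toFinset] at h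
            exact ((hr ℓ h).1 hW).1
        linarith
    _ = ∑ i ∈ Finset.range k, r (L i) := Finset.sum_image hinj
    _ ≤ ∑ i ∈ Finset.range k, -(inner ℝ w (a - A) * ‖p i‖) := by
        refine Finset.sum_le_sum fun i hi => ?_
        have hi := Finset.mem_range.1 hi
        refine ((hr _ (hL i hi).1).1 hW).2 (p i) (hpn i) ?_
        filter_upwards [(K.descending_ray D ha hi).1] with s hs
        exact ⟨hs, (hL i hi).2 s⟩
    _ = _ := by rw [Finset.sum_neg_distrib, Finset.mul_sum]

lemma CornerChart.sum_edgeRate_outward (ha : a ∈ F \ segment ℝ A B)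
    (hW : (inner ℝ w (a - A) : ℝ) < 0)
    (hr : ∀ ℓ ∈ arrangementLines T, IsEdgeRate P F A B n w T ℓ a (r ℓ)) :
    ∑ ℓ ∈ (finite_arrangementLines T).toFinset, r ℓ ≤ -(inner ℝ w (a - A) *
      ‖sectionPoint X Y n θ ζ 0 (meet θ ζ 0 k)‖) := by
  classical
  set G := sectionPoint X Y n θ ζ 0 (meet θ ζ 0 k) with hG
  have key : ∀ ℓ ∈ arrangementLines T, r ℓ ≤ 0 ∨
      ((∀ᶠ s in 𝓝[>] (0 : ℝ), a + s • (-G) ∈ ℓ) ∧ r ℓ ≤ -(inner ℝ w (a - A) * ‖G‖)) := by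
    intro ℓ hℓ
    rcases (hr ℓ hℓ).2 hW with h | ⟨d, hd, h1, h2⟩
    · exact Or.inl h
    · have := K.ascending_ray D ha hd (h1.mono fun s hs => hs.1)
      subst this
      exact Or.inr ⟨h1.mono fun s hs => hs.2, by rwa [norm_neg] at h2⟩
  have hpos : 0 ≤ -(inner ℝ w (a - A) * ‖G‖) := by
    rw [← neg_mul]; exact mul_nonneg (by linarith) (norm_nonneg _)
  by_cases hall : ∀ ℓ ∈ arrangementLines T, r ℓ ≤ 0
  · refine (Finset.sum_nonpos fun ℓ hℓ => hall ℓ ?_).trans hpos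
    rwa [Finite.mem_toFinset] at hℓ
  · push Not at hall
    obtain ⟨ℓ₀, hℓ₀, h0⟩ := hall
    obtain ⟨h1, h2⟩ := (key ℓ₀ hℓ₀).resolve_left (not_le.2 h0)
    rw [← Finset.add_sum_erase _ _ ((finite_arrangementLines T).mem_toFinset.2 hℓ₀)]
    have : ∑ ℓ ∈ (finite_arrangementLines T).toFinset.erase ℓ₀, r ℓ ≤ 0 := by
      refine Finset.sum_nonpos fun ℓ hℓ => ?_
      have hne := (Finset.mem_erase.1 hℓ).1
      replace hℓ := (finite_arrangementLines T).mem_toFinset.1 (Finset.mem_erase.1 hℓ).2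
      rcases key ℓ hℓ with h | ⟨h3, -⟩
      · exact h
      · -- two different lines cannot contain the same ray
        exfalso
        have hG0 : -G ≠ 0 := fun h0 => by
          have := (K.inner_sectionPoint 0 (meet θ ζ 0 k)).2.2
          rw [← hG, ← neg_neg G, h0, neg_zero, inner_zero_right] at this
          norm_num at this
        obtain ⟨s, hs1, hs2⟩ := ((h1.and h3).and
          (eventually_mem_set.2 self_mem_nhdsWithin)).exists
        have hs2 : 0 < s := hs2
        obtain ⟨⟨c, v, -, rfl⟩, -⟩ := id hℓ
        obtain ⟨⟨c', v', -, rfl⟩, -⟩ := id hℓ₀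
        have := arrangementLines_inter hℓ hℓ₀ hne
          ⟨(ray_in_line h3).1, (ray_in_line h1).1⟩ ⟨hs1.2, hs1.1⟩
        rw [left_eq_add, smul_eq_zero] at this
        exact this.elim hs2.ne' hG0
    linarith

end

/-- The rates at one corner, summed over the two senses of rotation, do not increase the edge
length, and they decrease it if at least three other faces meet there. -/
theorem FaceData.corner_balance {P F : Set E3} {A B n w : E3} {T : Finset (E3 × ℝ)}
    (D : FaceData P F A B n T) {a : E3} (ha : a ∈ corners P F A B T) {f e : E3 → E3}
    (hfe : IsTraceFrame (normals P F T a) n f e) {r r' : Set E3 → ℝ}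
    (hr : ∀ ℓ ∈ arrangementLines T, IsEdgeRate P F A B n w T ℓ a (r ℓ))
    (hr' : ∀ ℓ ∈ arrangementLines T, IsEdgeRate P F A B n (-w) T ℓ a (r' ℓ)) :
    (∑ μ ∈ (D.finite_normals a).toFinset, D.faceRate w f e a μ +
      ∑ ℓ ∈ (finite_arrangementLines T).toFinset, r ℓ) +
      (∑ μ ∈ (D.finite_normals a).toFinset, D.faceRate (-w) f e a μ +
      ∑ ℓ ∈ (finite_arrangementLines T).toFinset, r' ℓ) ≤ 0 ∧
    (inner ℝ w (a - A) ≠ (0 : ℝ) → 3 ≤ (D.finite_normals a).toFinset.card →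
      (∑ μ ∈ (D.finite_normals a).toFinset, D.faceRate w f e a μ +
      ∑ ℓ ∈ (finite_arrangementLines T).toFinset, r ℓ) +
      (∑ μ ∈ (D.finite_normals a).toFinset, D.faceRate (-w) f e a μ +
      ∑ ℓ ∈ (finite_arrangementLines T).toFinset, r' ℓ) < 0) := by
  wlog hW : 0 ≤ (inner ℝ w (a - A) : ℝ) generalizing w r r'
  · have hneg : (inner ℝ (-w) (a - A) : ℝ) = -inner ℝ w (a - A) := inner_neg_left _ _
    have := this (w := -w) (r := r') (r' := r) hr' (by rwa [neg_neg])
      (by rw [hneg]; linarith)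
    rw [neg_neg, add_comm, hneg, neg_ne_zero] at this
    exact this
  obtain ⟨X, Y, k, ν, m, θ, ζ, y, K, hcard⟩ := D.exists_cornerChart ha
  obtain ⟨l, hk⟩ : ∃ l, k = l + 1 := by
    refine ⟨k - 1, ?_⟩
    have : 1 < (D.finite_normals a).toFinset.card := by
      rw [Finset.one_lt_card_iff_nontrivial, Finset.Nontrivial, Finite.coe_toFinset]
      exact ha.2
    omega
  have h1 := K.sum_faceRate (w := w) D hfe hk hW
  have h2 := K.sum_edgeRate_inward D ha.1 hW hr
  have h3 := K.env.balance K.frame hk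
  rcases hW.eq_or_lt with h0 | h0
  · have hW' : 0 ≤ (inner ℝ (-w) (a - A) : ℝ) := by rw [inner_neg_left]; linarith
    have h4 := K.sum_edgeRate_inward D ha.1 hW' hr'
    rw [inner_neg_left, ← h0] at h4
    rw [← h0] at h1 h2
    refine ⟨by linarith, fun h => absurd h0.symm h⟩
  · have hW' : (inner ℝ (-w) (a - A) : ℝ) < 0 := by rw [inner_neg_left]; linarith
    have h4 := K.sum_edgeRate_outward D ha.1 hW' hr'
    rw [inner_neg_left] at h4
    constructor
    · have := mul_nonpos_of_nonneg_of_nonpos hW h3.1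
      linarith
    · intro _ hc
      have := mul_neg_of_pos_of_neg h0 (h3.2 (by omega))
      linarith

end

section

/-! ### The rate of change of the edge length -/

lemma exists_traceFrame {n μ : E3} (hn1 : ‖n‖ = 1) (hμ : ‖μ‖ = 1) (h : ∀ c : ℝ, μ ≠ c • n) :
    ∃ f e : E3, Frame μ f e ∧ inner ℝ n f = (0 : ℝ) ∧ 0 < (inner ℝ n e : ℝ) := by
  obtain ⟨f, hf, h1, h2⟩ := exists_unit_orthogonal μ n
  obtain ⟨e, fr⟩ := exists_frame hμ hf h1
  have hne : inner ℝ n e ≠ (0 : ℝ) := fun h0 => by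
    have hn := fr.expand n
    rw [real_inner_comm n f, h2, real_inner_comm n e, h0, zero_smul, zero_smul, add_zero,
      add_zero] at hn
    by_cases hc : inner ℝ μ n = (0 : ℝ)
    · rw [hc, zero_smul] at hn
      rw [hn, norm_zero] at hn1
      exact zero_ne_one hn1
    · refine h (inner ℝ μ n : ℝ)⁻¹ ?_
      have h4 := congrArg (fun v => (inner ℝ μ n : ℝ)⁻¹ • v) hn
      simp only [smul_smul, inv_mul_cancel₀ hc, one_smul] at h4
      exact h4.symm
  rcases lt_or_gt_of_ne hne with h3 | h3
  · exact ⟨f, -e, fr.neg_last, h2, by rw [inner_neg_right]; linarith⟩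
  · exact ⟨f, e, fr, h2, h3⟩

section
variable {P F : Set E3} {A B n w : E3} {T : Finset (E3 × ℝ)} (D : FaceData P F A B n T)
include D

lemma FaceData.sum_facets (G : E3 → E3 → ℝ) :
    (∑ q ∈ unitPlanes T, open Classical in ∑ a ∈ D.finite_corners.toFinset.filter
      (fun a => inner ℝ q.1 a = q.2 ∧ q.1 ∈ normals P F T a), G a q.1) =
    ∑ a ∈ D.finite_corners.toFinset, ∑ μ ∈ (D.finite_normals a).toFinset, G a μ := by
  classical
  simp_rw [Finset.sum_filter]
  rw [Finset.sum_comm]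
  refine Finset.sum_congr rfl fun a _ => ?_
  rw [← Finset.sum_filter]
  refine Finset.sum_bij' (fun q _ => q.1) (fun μ _ => (μ, (inner ℝ μ a : ℝ))) ?_ ?_ ?_ ?_ ?_
  · intro q hq
    rw [Finite.mem_toFinset]
    exact (Finset.mem_filter.1 hq).2.2
  · intro μ hμ
    rw [Finite.mem_toFinset] at hμ
    exact Finset.mem_filter.2 ⟨D.mem_unitPlanes_of_normal hμ, rfl, hμ⟩
  · intro q hq
    exact Prod.ext rfl (Finset.mem_filter.1 hq).2.1
  · intro μ _; rfl
  · intro q _; rfl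

/-- The right derivative of the edge length is a sum over the corners. -/
theorem FaceData.rightDeriv_edgeLength (hw : RotDir A B n w) {f e : E3 → E3}
    (hfe : IsTraceFrame {μ | ‖μ‖ = 1 ∧ ∀ c : ℝ, μ ≠ c • n} n f e) :
    ∃ r : Set E3 → E3 → ℝ, (∀ ℓ ∈ arrangementLines T, ∀ a ∈ corners P F A B T,
        IsEdgeRate P F A B n w T ℓ a (r ℓ a)) ∧
      RightDeriv (fun t => edgeLength (replaced P F A B T (rotNormal n w t)))
        (∑ a ∈ D.finite_corners.toFinset,
          (∑ μ ∈ (D.finite_normals a).toFinset, D.faceRate w f e a μ +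
            ∑ ℓ ∈ (finite_arrangementLines T).toFinset, r ℓ a)) := by
  classical
  have h1 : ∀ ℓ : Set E3, ∃ r : E3 → ℝ, ℓ ∈ arrangementLines T →
      RightDeriv (fun t => (H1 (bodyEdges P F A B T ∩ lowerSide A n w t ∩ ℓ)).toReal)
      (∑ a ∈ D.finite_corners.toFinset, r a) ∧
      ∀ a ∈ corners P F A B T, IsEdgeRate P F A B n w T ℓ a (r a) := fun ℓ => by
    by_cases hℓ : ℓ ∈ arrangementLines T
    · obtain ⟨r, h⟩ := D.rightDeriv_bodyEdges hw hℓ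
      exact ⟨r, fun _ => h⟩
    · exact ⟨0, fun h => absurd h hℓ⟩
  choose r hr using h1
  refine ⟨r, fun ℓ hℓ => (hr ℓ hℓ).2, ?_⟩
  have hfacet : ∀ q ∈ unitPlanes T,
      RightDeriv (fun t => (H1 (facet P F A B T q ∩ rotPlane A n w t)).toReal)
      (∑ a ∈ D.finite_corners.toFinset.filter
        (fun a => inner ℝ q.1 a = q.2 ∧ q.1 ∈ normals P F T a), D.faceRate w f e a q.1) := by
    intro q hq
    by_cases hpar : ∀ c : ℝ, q.1 ≠ c • n
    · obtain ⟨h1, h2, h3⟩ := hfe q.1 ⟨norm_of_mem_unitPlanes D.nz hq, hpar⟩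
      exact D.rightDeriv_facet hw h1 h2 h3
    · push Not at hpar
      obtain ⟨c, hc⟩ := hpar
      rw [Finset.filter_false_of_mem (fun a ha h => D.normals_not_parallel_n
        (((D.finite_corners).mem_toFinset.1 ha).1) h.2 c hc), Finset.sum_empty]
      have : facet P F A B T q = ∅ := eq_empty_of_forall_notMem fun z hz =>
        D.facePoint_not_parallel hz.1 c hc
      simp only [this, empty_inter, measure_empty, ENNReal.toReal_zero]
      exact rightDeriv_const 0
  have h2 := HasDerivWithinAt.fun_sum (u := unitPlanes T) hfacet
  have h3 := HasDerivWithinAt.fun_sum (u := (finite_arrangementLines T).toFinset)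
    fun ℓ hℓ => (hr ℓ ((finite_arrangementLines T).mem_toFinset.1 hℓ)).1
  refine RightDeriv.congr (g := fun t => (H1 (edgePoints P \ region F A B T)).toReal +
    ∑ ℓ ∈ (finite_arrangementLines T).toFinset,
      (H1 (bodyEdges P F A B T ∩ lowerSide A n w t ∩ ℓ)).toReal +
    ∑ q ∈ unitPlanes T, (H1 (facet P F A B T q ∩ rotPlane A n w t)).toReal) ?_
    (D.edgeLength_replaced hw)
  refine HasDerivWithinAt.congr_deriv ((h3.const_add _).fun_add h2) ?_
  have h4 := D.sum_facets (fun a μ => D.faceRate w f e a μ)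
  rw [h4, Finset.sum_comm, ← Finset.sum_add_distrib]
  exact Finset.sum_congr rfl fun a _ => add_comm _ _

/-- If three other faces meet at some corner off the line `AB`, the derivatives of the edge length
for the two senses of rotation have a negative sum. -/
theorem FaceData.exists_rightDeriv_edgeLength (hw : RotDir A B n w) {a : E3}
    (ha : a ∈ corners P F A B T) (hW : inner ℝ w (a - A) ≠ (0 : ℝ))
    (hcard : 3 ≤ (D.finite_normals a).toFinset.card) :
    ∃ c c' : ℝ, RightDeriv (fun t => edgeLength (replaced P F A B T (rotNormal n w t))) c ∧
      RightDeriv (fun t => edgeLength (replaced P F A B T (rotNormal n (-w) t))) c' ∧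
      c + c' < 0 := by
  have h : ∀ μ : E3, ∃ f e : E3, (‖μ‖ = 1 ∧ ∀ c : ℝ, μ ≠ c • n) →
      Frame μ f e ∧ inner ℝ n f = (0 : ℝ) ∧ 0 < (inner ℝ n e : ℝ) := fun μ => by
    by_cases h : ‖μ‖ = 1 ∧ ∀ c : ℝ, μ ≠ c • n
    · obtain ⟨f, e, h1⟩ := exists_traceFrame D.norm_n h.1 h.2
      exact ⟨f, e, fun _ => h1⟩
    · exact ⟨0, 0, fun h' => absurd h' h⟩
  choose f e hfe using h
  have hfe' : IsTraceFrame {μ | ‖μ‖ = 1 ∧ ∀ c : ℝ, μ ≠ c • n} n f e := fun μ hμ => hfe μ hμ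
  obtain ⟨r, hr, h1⟩ := D.rightDeriv_edgeLength hw hfe'
  obtain ⟨r', hr', h2⟩ := D.rightDeriv_edgeLength hw.neg hfe'
  refine ⟨_, _, h1, h2, ?_⟩
  rw [← Finset.sum_add_distrib]
  have hb : ∀ b ∈ D.finite_corners.toFinset, b ∈ corners P F A B T := fun b hb =>
    D.finite_corners.mem_toFinset.1 hb
  have hframe : ∀ b ∈ corners P F A B T, IsTraceFrame (normals P F T b) n f e :=
    fun b hb μ hμ => hfe μ ⟨D.norm_normal hμ, D.normals_not_parallel_n hb.1 hμ⟩
  refine Finset.sum_neg' (fun b hb' => ?_) ⟨a, D.finite_corners.mem_toFinset.2 ha, ?_⟩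
  · exact (D.corner_balance (hb b hb') (hframe b (hb b hb')) (fun ℓ hℓ => hr ℓ hℓ b (hb b hb'))
      (fun ℓ hℓ => hr' ℓ hℓ b (hb b hb'))).1
  · exact (D.corner_balance ha (hframe a ha) (fun ℓ hℓ => hr ℓ hℓ a ha)
      (fun ℓ hℓ => hr' ℓ hℓ a ha)).2 hW hcard

end

end

section

/-! ### The degree of a corner -/

section
variable {P F : Set E3} {A B n w : E3} {T : Finset (E3 × ℝ)} (D : FaceData P F A B n T)
include D

/-- A vertex of the face off the edge `AB` lies on at least two other faces. -/
lemma FaceData.corner_of_vertex {H : E3} (hH : H ∈ F \ segment ℝ A B) (hv : H ∈ vertices P) :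
    H ∈ corners P F A B T := by
  refine ⟨hH, ?_⟩
  by_contra hcon
  obtain ⟨u, hu, hnu, hνu⟩ : ∃ u : E3, ‖u‖ = 1 ∧ inner ℝ n u = (0 : ℝ) ∧
      ∀ ν ∈ normals P F T H, inner ℝ ν u = (0 : ℝ) := by
    rcases (not_nontrivial_iff.1 hcon).eq_empty_or_singleton with h | ⟨ν, h⟩
    · obtain ⟨u, h1, h2, -⟩ := exists_unit_orthogonal n n
      exact ⟨u, h1, h2, by simp [h]⟩
    · obtain ⟨u, h1, h2, h3⟩ := exists_unit_orthogonal n ν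
      exact ⟨u, h1, h2, by simp [h, h3]⟩
  refine hv.2.2 ⟨hv.1, hv.2.1, u, hu, ?_⟩
  have c1 : Tendsto (fun q : E3 × ℝ => q.1) (𝓝 (H, 0)) (𝓝 H) := continuous_fst.tendsto _
  have c2 : Tendsto (fun q : E3 × ℝ => q.1 + q.2 • u) (𝓝 (H, 0)) (𝓝 H) := by
    have : Continuous (fun q : E3 × ℝ => q.1 + q.2 • u) := by fun_prop
    simpa using this.tendsto (H, 0)
  filter_upwards [c1.eventually (star_mem_nhds T H), c2.eventually (star_mem_nhds T H)] with q h1 h2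
  have e : ∀ v : E3, q.1 + q.2 • u - v = (q.1 - v) + q.2 • u := fun v => by abel
  rw [D.mem_iff hH h1, D.mem_iff hH h2, e, inner_add_right, inner_smul_right, hnu, mul_zero,
    add_zero]
  refine and_congr_right fun _ => forall₂_congr fun ν hν => ?_
  rw [e, inner_add_right, inner_smul_right, hνu ν hν, mul_zero, add_zero]

/-- The planes containing an edge that leaves a corner. -/
lemma FaceData.edge_direction {H d : E3} (hH : H ∈ F \ segment ℝ A B)
    (hd : ∀ᶠ s : ℝ in 𝓝[>] 0, H + s • d ∈ edgePoints P) :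
    inner ℝ n d ≤ (0 : ℝ) ∧ (∀ ν ∈ normals P F T H, inner ℝ ν d ≤ (0 : ℝ)) ∧
    ((inner ℝ n d : ℝ) < 0 → {ν ∈ normals P F T H | inner ℝ ν d = (0 : ℝ)}.Nontrivial) ∧
    (inner ℝ n d = (0 : ℝ) → ∃ ν ∈ normals P F T H, inner ℝ ν d = (0 : ℝ)) := by
  obtain ⟨s, ⟨hs, hstar⟩, hs0⟩ := ((hd.and (((tendsto_add_smul H d).eventually
    (star_mem_nhds T H)).filter_mono nhdsWithin_le_nhds)).and
      (eventually_mem_set.2 self_mem_nhdsWithin)).exists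
  have hs0 : 0 < s := hs0
  set z := H + s • d with hz
  have hzP : z ∈ P := D.compact.isClosed.frontier_subset hs.1
  have hzV : z ∈ region F A B T := ⟨H, hH, hstar⟩
  have hzG : z ∈ body P F A B T := ((D.mem_iff_body hzV).1 hzP).2
  have hsign : ∀ v : E3, inner ℝ v (z - H) = s * inner ℝ v d := fun v => by
    rw [hz, add_sub_cancel_left, inner_smul_right]
  have hzn : inner ℝ n (z - A) = s * inner ℝ n d := by rw [← D.inner_n_sub hH.1, hsign]
  have hle : ∀ v : E3, inner ℝ v (z - H) ≤ (0 : ℝ) → inner ℝ v d ≤ (0 : ℝ) := fun v h => by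
    rw [hsign] at h
    by_contra hc
    exact absurd h (not_le.2 (mul_pos hs0 (not_le.1 hc)))
  have hact : active P F T H z = {ν ∈ normals P F T H | inner ℝ ν d = (0 : ℝ)} := by
    ext ν
    simp [active, hsign, hs0.ne']
  obtain ⟨h1, h2⟩ := (D.mem_iff hH hstar).1 hzP
  rw [← D.inner_n_sub hH.1] at h1
  refine ⟨hle n h1, fun ν hν => hle ν (h2 ν hν), fun h => ?_, fun h => ?_⟩
  · rw [← hact]
    refine D.nontrivial_of_edge hH hstar hzG ((mem_edgePoints_congr ?_).1 hs)
    have hlt : (inner ℝ n (z - A) : ℝ) < 0 := by rw [hzn]; exact mul_neg_of_pos_of_neg hs0 h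
    have hc : Continuous (fun x : E3 => (inner ℝ n (x - A) : ℝ)) := by fun_prop
    filter_upwards [isOpen_region.mem_nhds hzV, hc.continuousAt.eventually (gt_mem_nhds hlt)]
      with x hx hx'
    rw [D.mem_iff_body hx]
    exact and_iff_right hx'.le
  · by_contra! hcon
    have hempty : active P F T H z = ∅ := by
      rw [hact]
      exact eq_empty_of_forall_notMem fun ν hν => hcon ν hν.1 hν.2
    -- near the point the polyhedron is the half-space of the face
    refine hs.2.1 ⟨n, D.norm_n, ?_⟩
    filter_upwards [isOpen_region.mem_nhds hzV,
      mem_interior_iff_mem_nhds.1 (D.mem_interior_body hH hstar hzG hempty)] with x hx hx'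
    rw [D.mem_iff_body hx, mem_halfspace, and_iff_left hx']
    have e : x - A = (x - z) + (z - A) := by abel
    rw [e, inner_add_right, hzn, h, mul_zero, add_zero]

/-- Two directions orthogonal to the normals of two faces, and on the same side of a third plane,
coincide. -/
lemma FaceData.direction_unique {H ν ν' v d d' : E3} (hH : H ∈ F \ segment ℝ A B)
    (hν : ν ∈ normals P F T H) (hν' : ν' ∈ normals P F T H) (hne : ν ≠ ν')
    {p q : E3} (hpq : ({p, q, v} : Set E3) = {n, ν, ν'}) (hd : ‖d‖ = 1) (hd' : ‖d'‖ = 1)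
    (hp : inner ℝ p d = (0 : ℝ)) (hp' : inner ℝ p d' = (0 : ℝ)) (hq : inner ℝ q d = (0 : ℝ))
    (hq' : inner ℝ q d' = (0 : ℝ)) (hv : (inner ℝ v d : ℝ) ≤ 0) (hv' : (inner ℝ v d' : ℝ) ≤ 0) :
    d = d' := by
  -- a combination of the two directions orthogonal to `v` is orthogonal to all three normals
  set u := (inner ℝ v d' : ℝ) • d - (inner ℝ v d : ℝ) • d' with hu
  have hall : ∀ x ∈ ({p, q, v} : Set E3), inner ℝ x u = (0 : ℝ) := by
    rintro x (rfl | rfl | rfl)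
    · rw [hu, inner_sub_right, inner_smul_right, inner_smul_right, hp, hp']; ring
    · rw [hu, inner_sub_right, inner_smul_right, inner_smul_right, hq, hq']; ring
    · rw [hu, inner_sub_right, inner_smul_right, inner_smul_right]; ring
  have hzero : ∀ y : E3, (∀ x ∈ ({p, q, v} : Set E3), inner ℝ x y = (0 : ℝ)) → y = 0 := by
    intro y hy
    rw [hpq] at hy
    exact D.eq_zero_of_orthogonal hH hν hν' hne (hy n (by simp)) (hy ν (by simp)) (hy ν' (by simp))
  have hu0 := hzero u hall
  have hne0 : inner ℝ v d ≠ (0 : ℝ) := fun h0 => by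
    have := hzero d (by rintro x (rfl | rfl | rfl) <;> assumption)
    rw [this, norm_zero] at hd
    exact zero_ne_one hd
  have heq : (inner ℝ v d' : ℝ) • d = (inner ℝ v d : ℝ) • d' := sub_eq_zero.1 hu0
  have hnorm := congrArg norm heq
  rw [norm_smul, norm_smul, hd, hd', Real.norm_eq_abs, Real.norm_eq_abs, mul_one, mul_one,
    abs_of_nonpos hv, abs_of_nonpos hv', neg_inj] at hnorm
  rw [hnorm] at heq
  exact smul_right_injective E3 hne0 heq

lemma FaceData.card_normals_of_degree {H : E3} (hH : H ∈ corners P F A B T)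
    (hdeg : 3 < degree P H) : 3 ≤ (D.finite_normals H).toFinset.card := by
  classical
  by_contra hcon
  have h1 : 1 < (D.finite_normals H).toFinset.card := by
    rw [Finset.one_lt_card_iff_nontrivial, Finset.Nontrivial, Finite.coe_toFinset]
    exact hH.2
  obtain ⟨ν, ν', hne, hQ⟩ := Finset.card_eq_two.1 (show (D.finite_normals H).toFinset.card = 2 by
    omega)
  have hQ' : ∀ μ, μ ∈ normals P F T H ↔ μ = ν ∨ μ = ν' := fun μ => by
    rw [← (D.finite_normals H).mem_toFinset, hQ]; simp
  have hν := (hQ' ν).2 (Or.inl rfl)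
  have hν' := (hQ' ν').2 (Or.inr rfl)
  set E := {d : E3 | ‖d‖ = 1 ∧ ∀ᶠ s : ℝ in 𝓝[>] 0, H + s • d ∈ edgePoints P} with hE
  set E1 := {d ∈ E | inner ℝ ν d = (0 : ℝ) ∧ inner ℝ ν' d = (0 : ℝ)}
  set E2 := {d ∈ E | inner ℝ n d = (0 : ℝ) ∧ inner ℝ ν d = (0 : ℝ)}
  set E3' := {d ∈ E | inner ℝ n d = (0 : ℝ) ∧ inner ℝ ν' d = (0 : ℝ)}
  have s1 : E1.Subsingleton := fun d hd d' hd' =>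
    D.direction_unique hH.1 hν hν' hne (v := n) (by ext x; simp; tauto) hd.1.1 hd'.1.1 hd.2.1
      hd'.2.1 hd.2.2 hd'.2.2 (D.edge_direction hH.1 hd.1.2).1 (D.edge_direction hH.1 hd'.1.2).1
  have s2 : E2.Subsingleton := fun d hd d' hd' =>
    D.direction_unique hH.1 hν hν' hne (v := ν') rfl hd.1.1 hd'.1.1 hd.2.1
      hd'.2.1 hd.2.2 hd'.2.2 ((D.edge_direction hH.1 hd.1.2).2.1 ν' hν')
      ((D.edge_direction hH.1 hd'.1.2).2.1 ν' hν')
  have s3 : E3'.Subsingleton := fun d hd d' hd' =>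
    D.direction_unique hH.1 hν hν' hne (v := ν) (by ext x; simp; tauto) hd.1.1 hd'.1.1 hd.2.1
      hd'.2.1 hd.2.2 hd'.2.2 ((D.edge_direction hH.1 hd.1.2).2.1 ν hν)
      ((D.edge_direction hH.1 hd'.1.2).2.1 ν hν)
  have hsub : E ⊆ E1 ∪ E2 ∪ E3' := by
    intro d hd
    obtain ⟨h1, -, h3, h4⟩ := D.edge_direction hH.1 hd.2
    rcases h1.lt_or_eq with h | h
    · obtain ⟨μ, ⟨hμ, h0⟩, μ', ⟨hμ', h0'⟩, hμμ⟩ := h3 h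
      refine Or.inl (Or.inl ⟨hd, ?_⟩)
      rcases (hQ' μ).1 hμ with rfl | rfl <;> rcases (hQ' μ').1 hμ' with rfl | rfl
      · exact absurd rfl hμμ
      · exact ⟨h0, h0'⟩
      · exact ⟨h0', h0⟩
      · exact absurd rfl hμμ
    · obtain ⟨μ, hμ, h0⟩ := h4 h
      rcases (hQ' μ).1 hμ with rfl | rfl
      · exact Or.inl (Or.inr ⟨hd, h, h0⟩)
      · exact Or.inr ⟨hd, h, h0⟩
  have hfin : (E1 ∪ E2 ∪ E3').Finite := (s1.finite.union s2.finite).union s3.finite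
  have hle := (ncard_le_ncard hsub hfin).trans ((ncard_union_le _ _).trans
    (Nat.add_le_add_right (ncard_union_le _ _) _))
  have n1 := (ncard_le_one s1.finite).2 fun a ha b hb => s1 ha hb
  have n2 := (ncard_le_one s2.finite).2 fun a ha b hb => s2 ha hb
  have n3 := (ncard_le_one s3.finite).2 fun a ha b hb => s3 ha hb
  have : degree P H = E.ncard := rfl
  omega

end

end

section

/-! ### The rate of change of the volume -/

/-- Cartesian coordinates in a frame preserve the volume. -/
lemma Frame.measurePreserving_coord {a b c : E3} (f : Frame a b c) (A : E3) :
    MeasurePreserving (fun q : ℝ × (Fin 2 → ℝ) => A + (q.1 • a + q.2 0 • b + q.2 1 • c)) := by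
  have h := (measurePreserving_add_left (volume : Measure E3) A).comp
    ((f.basis.measurePreserving_repr_symm).comp ((PiLp.volume_preserving_toLp (Fin 3)).comp
      (volume_preserving_piFinSuccAbove (fun _ : Fin 3 => ℝ) 0).symm))
  have e : (fun q : ℝ × (Fin 2 → ℝ) => A + (q.1 • a + q.2 0 • b + q.2 1 • c)) =
      (fun x => A + x) ∘ f.basis.repr.symm ∘ WithLp.toLp 2 ∘
        (MeasurableEquiv.piFinSuccAbove (fun _ : Fin 3 => ℝ) 0).symm := by
    funext q
    simp only [Function.comp]
    rw [← f.basis.sum_repr_symm, Fin.sum_univ_three, f.coe_basis]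
    rfl
  rw [e]
  exact h

section
variable {X : Set ℝ}

lemma real_inter_Iic_le (hX : volume X ≠ ⊤) {s s' : ℝ} (h : s' ≤ s) :
    volume.real (X ∩ Iic s') ≤ volume.real (X ∩ Iic s) ∧
    volume.real (X ∩ Iic s) ≤ volume.real (X ∩ Iic s') + (s - s') := by
  have hfin : ∀ r : ℝ, volume (X ∩ Iic r) ≠ ⊤ := fun r => measure_ne_top_of_subset inter_subset_left hX
  refine ⟨measureReal_mono (inter_subset_inter_right _ (Iic_subset_Iic.2 h)) (hfin s), ?_⟩
  have hsub : X ∩ Iic s ⊆ (X ∩ Iic s') ∪ Ioc s' s := by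
    rintro x ⟨hx, hxs⟩
    rcases le_or_gt x s' with h' | h'
    · exact Or.inl ⟨hx, h'⟩
    · exact Or.inr ⟨h', hxs⟩
  refine (measureReal_mono hsub (measure_union_ne_top (hfin s') (by simp))).trans
    ((measureReal_union_le _ _).trans ?_)
  rw [Real.volume_real_Ioc_of_le h]

lemma abs_real_inter_Iic_sub_le (hX : volume X ≠ ⊤) (s s' : ℝ) :
    |volume.real (X ∩ Iic s) - volume.real (X ∩ Iic s')| ≤ |s - s'| := by
  rcases le_total s' s with h | h
  · obtain ⟨h1, h2⟩ := real_inter_Iic_le hX h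
    rw [abs_of_nonneg (by linarith), abs_of_nonneg (by linarith)]; linarith
  · obtain ⟨h1, h2⟩ := real_inter_Iic_le hX h
    rw [abs_of_nonpos (by linarith), abs_of_nonpos (by linarith)]; linarith

lemma hasDerivAt_real_inter_Iic_of_mem (hX : volume X ≠ ⊤) (h : ∀ᶠ x in 𝓝 (0 : ℝ), x ∈ X) :
    HasDerivAt (fun s => volume.real (X ∩ Iic s)) 1 0 := by
  obtain ⟨δ, hδ, hball⟩ := Metric.eventually_nhds_iff_ball.1 h
  have hfin : ∀ r : ℝ, volume (X ∩ Iic r) ≠ ⊤ := fun r => measure_ne_top_of_subset inter_subset_left hX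
  have key : ∀ s' s : ℝ, -δ < s' → s' ≤ s → s < δ →
      volume.real (X ∩ Iic s) = volume.real (X ∩ Iic s') + (s - s') := by
    intro s' s h1 h2 h3
    have hu : X ∩ Iic s = (X ∩ Iic s') ∪ Ioc s' s := by
      ext x
      constructor
      · rintro ⟨hx, hxs⟩
        rcases le_or_gt x s' with h' | h'
        · exact Or.inl ⟨hx, h'⟩
        · exact Or.inr ⟨h', hxs⟩
      · rintro (⟨hx, hxs⟩ | ⟨hx, hxs⟩)
        · exact ⟨hx, le_trans hxs h2⟩
        · refine ⟨hball x ?_, hxs⟩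
          rw [Metric.mem_ball, Real.dist_eq, sub_zero, abs_lt]
          exact ⟨h1.trans hx, lt_of_le_of_lt hxs h3⟩
    rw [hu, measureReal_union ?_ measurableSet_Ioc (hfin s') (by simp),
      Real.volume_real_Ioc_of_le h2]
    exact Set.disjoint_left.2 fun x hx hx' => absurd hx.2 (not_le.2 hx'.1)
  have hd : HasDerivAt (fun s : ℝ => volume.real (X ∩ Iic 0) + s) 1 0 :=
    (hasDerivAt_id (0 : ℝ)).const_add _
  refine hd.congr_of_eventuallyEq ?_
  filter_upwards [Ioo_mem_nhds (neg_lt_zero.2 hδ) hδ] with s hs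
  rcases le_total 0 s with h0 | h0
  · rw [key 0 s (by linarith) h0 hs.2, sub_zero]
  · rw [key s 0 hs.1 h0 hδ]; ring

lemma hasDerivAt_real_inter_Iic_of_notMem (h : ∀ᶠ x in 𝓝 (0 : ℝ), x ∉ X) :
    HasDerivAt (fun s => volume.real (X ∩ Iic s)) 0 0 := by
  obtain ⟨δ, hδ, hball⟩ := Metric.eventually_nhds_iff_ball.1 h
  refine (hasDerivAt_const (0 : ℝ) (volume.real (X ∩ Iic 0))).congr_of_eventuallyEq ?_
  filter_upwards [Ioo_mem_nhds (neg_lt_zero.2 hδ) hδ] with s hs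
  congr 1
  ext x
  refine and_congr_right fun hx => ?_
  have hx' : x ≤ -δ ∨ δ ≤ x := by
    by_contra! hc
    exact hball x (by rw [Metric.mem_ball, Real.dist_eq, sub_zero, abs_lt]; exact hc) hx
  simp only [mem_Iic]
  rcases hx' with h | h
  · exact iff_of_true (by linarith [hs.1]) (by linarith)
  · exact iff_of_false (by linarith [hs.2]) (by linarith)

end

/-- Differentiability of the volume cut off by planes rotating about an axis: almost every vertical
fibre is, near the horizontal plane, either contained in the solid or disjoint from it. -/
lemma exists_hasDerivAt_volume_cut {S : Set (ℝ × (Fin 2 → ℝ))} (hS : MeasurableSet S) {R : ℝ}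
    (hR : ∀ q ∈ S, |q.1| ≤ R ∧ ∀ i, |q.2 i| ≤ R) {Φ : Set (Fin 2 → ℝ)} (hΦ : MeasurableSet Φ)
    (hfull : ∀ᵐ x, (x ∈ Φ ∧ ∀ᶠ h in 𝓝 (0 : ℝ), (h, x) ∈ S) ∨
      (x ∉ Φ ∧ ∀ᶠ h in 𝓝 (0 : ℝ), (h, x) ∉ S)) :
    ∃ c, HasDerivAt (fun τ : ℝ => (volume (S ∩ {q | q.1 ≤ -τ * q.2 0})).toReal) c 0 := by
  classical
  set X : (Fin 2 → ℝ) → Set ℝ := fun x => (fun h => (h, x)) ⁻¹' S with hX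
  have hXsub : ∀ x, X x ⊆ Icc (-R) R := fun x h hh => abs_le.1 (hR _ hh).1
  have hXfin : ∀ x, volume (X x) ≠ ⊤ := fun x =>
    measure_ne_top_of_subset (hXsub x) (by simp)
  set box : Set (Fin 2 → ℝ) := Icc (fun _ => -R) (fun _ => R) with hbox
  have hXempty : ∀ x ∉ box, X x = ∅ := fun x hx => eq_empty_of_forall_notMem fun h hh => by
    have := (hR _ hh).2
    exact hx ⟨fun i => (abs_le.1 (this i)).1, fun i => (abs_le.1 (this i)).2⟩
  set G : ℝ → (Fin 2 → ℝ) → ℝ := fun τ x => volume.real (X x ∩ Iic (-τ * x 0)) with hG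
  have hcut : ∀ τ : ℝ, MeasurableSet (S ∩ {q : ℝ × (Fin 2 → ℝ) | q.1 ≤ -τ * q.2 0}) := fun τ =>
    hS.inter (measurableSet_le (by fun_prop) (by fun_prop))
  have hGmeas : ∀ τ, Measurable (G τ) := fun τ =>
    (measurable_measure_prodMk_right (hcut τ)).ennreal_toReal
  have hint : ∀ τ : ℝ, (volume (S ∩ {q : ℝ × (Fin 2 → ℝ) | q.1 ≤ -τ * q.2 0})).toReal =
      ∫ x, G τ x := by
    intro τ
    rw [Measure.volume_eq_prod, Measure.prod_apply_symm (hcut τ), ← integral_toReal]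
    · rfl
    · exact (measurable_measure_prodMk_right (hcut τ)).aemeasurable
    · exact Eventually.of_forall fun x =>
        (measure_ne_top_of_subset (s := X x) inter_subset_left (hXfin x)).lt_top
  have hboxint : ∀ r : ℝ, Integrable (box.indicator fun _ => r) := fun r =>
    (integrable_indicator_iff measurableSet_Icc).2
      (integrableOn_const (isCompact_Icc.measure_lt_top.ne))
  refine ⟨∫ x, Φ.indicator (fun x => -x 0) x, ?_⟩
  simp_rw [hint]
  refine (hasDerivAt_integral_of_dominated_loc_of_lip (s := univ) (bound := box.indicator fun _ => R)
    univ_mem (Eventually.of_forall fun τ => (hGmeas τ).aestronglyMeasurable) ?_ ?_ ?_ (hboxint R)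
    ?_).2
  · refine (hboxint (2 * R)).mono' (hGmeas 0).aestronglyMeasurable (Eventually.of_forall fun x => ?_)
    rw [Real.norm_eq_abs, abs_of_nonneg measureReal_nonneg]
    by_cases hx : x ∈ box
    · rw [indicator_of_mem hx]
      have h0 : -R ≤ R := (hx.1 0).trans (hx.2 0)
      refine (measureReal_mono (inter_subset_left.trans (hXsub x)) (by simp)).trans_eq ?_
      rw [Real.volume_real_Icc_of_le h0]; ring
    · rw [indicator_of_notMem hx]
      simp [hXempty x hx]
  · exact ((Measurable.neg (measurable_pi_apply 0)).indicator hΦ).aestronglyMeasurable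
  · refine Eventually.of_forall fun x => LipschitzOnWith.of_dist_le_mul fun τ _ τ' _ => ?_
    rw [Real.dist_eq, Real.dist_eq, Real.coe_nnabs]
    by_cases hx : x ∈ box
    · rw [indicator_of_mem hx]
      refine (abs_real_inter_Iic_sub_le (hXfin x) _ _).trans ?_
      have e : -τ * x 0 - -τ' * x 0 = -(x 0 * (τ - τ')) := by ring
      rw [e, abs_neg, abs_mul]
      exact mul_le_mul_of_nonneg_right ((abs_le.2 ⟨hx.1 0, hx.2 0⟩).trans (le_abs_self R))
        (abs_nonneg _)
    · simp only [hG, hXempty x hx, empty_inter, sub_self, abs_zero]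
      positivity
  · filter_upwards [hfull] with x hx
    have hlin : HasDerivAt (fun τ : ℝ => -τ * x 0) (-x 0) 0 := by
      simpa using ((hasDerivAt_id (0 : ℝ)).neg.mul_const (x 0))
    have hz : -(0 : ℝ) * x 0 = 0 := by ring
    rcases hx with ⟨h1, h2⟩ | ⟨h1, h2⟩
    · rw [indicator_of_mem h1]
      have := (hz.symm ▸ hasDerivAt_real_inter_Iic_of_mem (hXfin x) h2 :
        HasDerivAt (fun s => volume.real (X x ∩ Iic s)) 1 (-(0 : ℝ) * x 0)).comp 0 hlin
      rwa [one_mul] at this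
    · rw [indicator_of_notMem h1]
      have := (hz.symm ▸ hasDerivAt_real_inter_Iic_of_notMem (X := X x) h2 :
        HasDerivAt (fun s => volume.real (X x ∩ Iic s)) 0 (-(0 : ℝ) * x 0)).comp 0 hlin
      rwa [zero_mul] at this

/-- A line in the coordinate plane is a null set. -/
lemma volume_line_eq_zero {u v : ℝ} (h : u ≠ 0 ∨ v ≠ 0) (r : ℝ) :
    volume {x : Fin 2 → ℝ | x 0 * u + x 1 * v = r} = 0 := by
  set L : (Fin 2 → ℝ) →ₗ[ℝ] ℝ := u • LinearMap.proj 0 + v • LinearMap.proj 1 with hL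
  have hLx : ∀ x, L x = x 0 * u + x 1 * v := fun x => by simp [hL, mul_comm]
  have hker : LinearMap.ker L ≠ ⊤ := fun ht => by
    rw [LinearMap.ker_eq_top] at ht
    have h0 := hLx ![1, 0]
    have h1 := hLx ![0, 1]
    rw [ht] at h0 h1
    simp at h0 h1
    rcases h with h | h
    · exact h h0.symm
    · exact h h1.symm
  rcases eq_empty_or_nonempty {x : Fin 2 → ℝ | x 0 * u + x 1 * v = r} with he | ⟨x₀, hx₀⟩
  · rw [he, measure_empty]
  · have hx₀ : L x₀ = r := by rw [hLx]; exact hx₀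
    rw [← measure_preimage_add volume x₀]
    refine measure_mono_null ?_ (Measure.addHaar_submodule volume (LinearMap.ker L) hker)
    intro x hx
    have hx : L (x₀ + x) = r := by rw [hLx]; exact hx
    rw [map_add, hx₀] at hx
    exact LinearMap.mem_ker.2 (by linarith)

section
variable {P F : Set E3} {A B n w : E3} {T : Finset (E3 × ℝ)} (D : FaceData P F A B n T)
include D

/-- The volume of the rotated polyhedron is differentiable, on both sides. -/
theorem FaceData.exists_hasDerivAt_vol (hw : RotDir A B n w) :
    ∃ c, HasDerivAt (fun t => vol (replaced P F A B T (rotNormal n w t))) c 0 := by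
  obtain ⟨u, fr⟩ := exists_frame D.norm_n hw.norm_w (by rw [real_inner_comm]; exact hw.orth_n)
  set g : ℝ × (Fin 2 → ℝ) → E3 := fun q => A + (q.1 • n + q.2 0 • w + q.2 1 • u) with hg
  have hgm : MeasurePreserving g := fr.measurePreserving_coord A
  have hgc : Continuous g := by fun_prop
  have hgA : ∀ q, g q - A = q.1 • n + q.2 0 • w + q.2 1 • u := fun q => add_sub_cancel_left _ _
  have hgn : ∀ q, inner ℝ n (g q - A) = q.1 := fun q => by
    rw [hgA, inner_add_right, inner_add_right, inner_smul_right, inner_smul_right, inner_smul_right,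
      real_inner_self_eq_norm_sq, fr.na, fr.ab, fr.ac]
    ring
  have hgw : ∀ q, inner ℝ w (g q - A) = q.2 0 := fun q => by
    rw [hgA, inner_add_right, inner_add_right, inner_smul_right, inner_smul_right, inner_smul_right,
      real_inner_self_eq_norm_sq, fr.nb, real_inner_comm, fr.ab, fr.bc]
    ring
  have hgu : ∀ q, inner ℝ u (g q - A) = q.2 1 := fun q => by
    rw [hgA, inner_add_right, inner_add_right, inner_smul_right, inner_smul_right, inner_smul_right,
      real_inner_self_eq_norm_sq, fr.nc, real_inner_comm, fr.ac, real_inner_comm, fr.bc]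
    ring
  have hbm : MeasurableSet (body P F A B T) := D.sat_body.measurableSet
  have hVm : MeasurableSet (region F A B T) := isOpen_region.measurableSet
  set S : Set (ℝ × (Fin 2 → ℝ)) := g ⁻¹' body P F A B T with hS
  obtain ⟨R, hR⟩ := D.body_bounded
  have hSR : ∀ q ∈ S, |q.1| ≤ R + ‖A‖ ∧ ∀ i, |q.2 i| ≤ R + ‖A‖ := by
    intro q hq
    have hnorm : ‖g q - A‖ ≤ R + ‖A‖ := (norm_sub_le _ _).trans (by linarith [hR _ hq])
    have hi : ∀ v : E3, ‖v‖ = 1 → |(inner ℝ v (g q - A) : ℝ)| ≤ R + ‖A‖ := fun v hv =>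
      (abs_real_inner_le_norm _ _).trans (by rw [hv, one_mul]; exact hnorm)
    refine ⟨by rw [← hgn q]; exact hi n fr.na, fun i => ?_⟩
    fin_cases i
    · exact (hgw q) ▸ hi w fr.nb
    · exact (hgu q) ▸ hi u fr.nc
  set Φ : Set (Fin 2 → ℝ) := {x | g (0, x) ∈ F} with hΦ
  have hΦm : MeasurableSet Φ :=
    (D.closed_F.preimage (hgc.comp (continuous_const.prodMk continuous_id))).measurableSet
  have hfib : ∀ x : Fin 2 → ℝ, Tendsto (fun h : ℝ => g (h, x)) (𝓝 0) (𝓝 (g (0, x))) := fun x =>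
    (hgc.comp (continuous_id.prodMk continuous_const)).tendsto 0
  have hfull : ∀ᵐ x : Fin 2 → ℝ, (x ∈ Φ ∧ ∀ᶠ h in 𝓝 (0 : ℝ), (h, x) ∈ S) ∨
      (x ∉ Φ ∧ ∀ᶠ h in 𝓝 (0 : ℝ), (h, x) ∉ S) := by
    -- avoid the traces of the other planes and the line `AB`
    have h1 : ∀ᵐ x : Fin 2 → ℝ, x 0 ≠ 0 := by
      have := volume_line_eq_zero (u := 1) (v := 0) (Or.inl one_ne_zero) 0
      rw [measure_eq_zero_iff_ae_notMem] at this
      filter_upwards [this] with x hx h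
      exact hx (by simp [h])
    have h2 : ∀ᵐ x : Fin 2 → ℝ, ∀ p ∈ T, (∀ c : ℝ, p.1 ≠ c • n) → ev p (g (0, x)) ≠ 0 := by
      refine (Finset.eventually_all T).2 fun p hp => ?_
      by_cases hpar : ∀ c : ℝ, p.1 ≠ c • n
      · have huv : inner ℝ p.1 w ≠ (0 : ℝ) ∨ inner ℝ p.1 u ≠ (0 : ℝ) := by
          by_contra! hc
          refine hpar (inner ℝ n p.1) ?_
          have := fr.expand p.1
          rw [real_inner_comm p.1 w, hc.1, real_inner_comm p.1 u, hc.2] at this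
          simpa using this
        have := volume_line_eq_zero huv (-ev p A)
        rw [measure_eq_zero_iff_ae_notMem] at this
        filter_upwards [this] with x hx _ h0
        refine hx ?_
        simp only [hg] at h0
        rw [ev_add, inner_add_right, inner_add_right, inner_smul_right, inner_smul_right,
          inner_smul_right] at h0
        simp only [zero_mul, zero_add] at h0
        linarith
      · exact Eventually.of_forall fun x h => absurd h hpar
    filter_upwards [h1, h2] with x hx1 hx2
    by_cases hxF : x ∈ Φ
    · refine Or.inl ⟨hxF, ?_⟩
      have hseg : g (0, x) ∉ segment ℝ A B := fun h => hx1 ((hgw (0, x)).symm.trans (hw.seg h))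
      have hy : g (0, x) ∈ F \ segment ℝ A B := ⟨hxF, hseg⟩
      filter_upwards [(hfib x).eventually (star_mem_nhds T _)] with h hh
      refine (D.mem_body_iff hy hh).2 fun ν hν => ?_
      obtain ⟨-, p, hp, c, hc, hpc, hpy, -⟩ := D.normals_plane hν
      refine absurd hpy (hx2 p hp fun r hr => D.normals_not_parallel_n hy hν (c⁻¹ * r) ?_)
      rw [mul_smul, ← hr, hpc, smul_smul, inv_mul_cancel₀ hc, one_smul]
    · refine Or.inr ⟨hxF, ?_⟩
      have hcl : g (0, x) ∉ closure (body P F A B T) := fun h =>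
        hxF (D.closure_body_plane h (hgn _))
      filter_upwards [(hfib x).eventually (isClosed_closure.isOpen_compl.mem_nhds hcl)] with h hh hb
      exact hh (subset_closure hb)
  obtain ⟨c, hc⟩ := exists_hasDerivAt_volume_cut (hbm.preimage hgc.measurable) hSR hΦm hfull
  have hbfin : volume (body P F A B T) ≠ ⊤ :=
    measure_ne_top_of_subset (fun z hz => mem_closedBall_zero_iff.2 (hR z hz))
      (isCompact_closedBall (0 : E3) R).measure_lt_top.ne
  have hvol : ∀ᶠ t in 𝓝 (0 : ℝ), vol (replaced P F A B T (rotNormal n w t)) =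
      volume.real (P \ region F A B T) +
        (volume (S ∩ {q : ℝ × (Fin 2 → ℝ) | q.1 ≤ -Real.tan t * q.2 0})).toReal := by
    have hcos : ∀ᶠ t in 𝓝 (0 : ℝ), 0 < Real.cos t :=
      Real.continuous_cos.continuousAt.eventually (lt_mem_nhds (by simp))
    filter_upwards [hcos] with t ht
    have hhm : MeasurableSet (halfspace A (rotNormal n w t) ∩ body P F A B T) :=
      (measurableSet_le (by fun_prop) measurable_const).inter hbm
    have hpre : S ∩ {q : ℝ × (Fin 2 → ℝ) | q.1 ≤ -Real.tan t * q.2 0} =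
        g ⁻¹' (halfspace A (rotNormal n w t) ∩ body P F A B T) := by
      ext q
      rw [preimage_inter, mem_inter_iff, mem_inter_iff, and_comm]
      refine and_congr_left fun _ => ?_
      rw [mem_preimage, mem_halfspace, inner_rotNormal, hgn, hgw, mem_ofPred_eq,
        Real.tan_eq_sin_div_cos, ← neg_div, div_mul_eq_mul_div, le_div_iff₀ ht]
      constructor <;> intro h <;> linarith
    rw [hpre, hgm.measure_preimage hhm.nullMeasurableSet]
    refine measureReal_union ?_ hhm
      (measure_ne_top_of_subset sdiff_subset D.compact.measure_lt_top.ne)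
      (measure_ne_top_of_subset inter_subset_right hbfin)
    exact Set.disjoint_left.2 fun z hz hz' => hz.2 (body_subset_region hz'.2)
  refine ⟨c, HasDerivAt.congr_of_eventuallyEq ?_ hvol⟩
  have htan : HasDerivAt Real.tan 1 0 := by
    simpa using Real.hasDerivAt_tan (x := 0) (by simp)
  have := HasDerivAt.comp (0 : ℝ) (h₂ := fun τ : ℝ =>
    (volume (S ∩ {q : ℝ × (Fin 2 → ℝ) | q.1 ≤ -τ * q.2 0})).toReal) (by rw [Real.tan_zero]; exact hc)
    htan
  rw [mul_one] at this
  exact this.const_add _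

end

end

section

/-! ### The rate of change of the Melzak ratio -/

lemma IsPolyhedron.vol_pos {P : Set E3} (hP : IsPolyhedron P) : 0 < vol P := by
  refine ENNReal.toReal_pos ?_ hP.compact.measure_lt_top.ne
  have hne : (interior P).Nonempty := by
    rw [← closure_nonempty_iff, hP.regular]; exact hP.nonempty
  exact ((isOpen_interior.measure_pos volume hne).trans_le (measure_mono interior_subset)).ne'

section
variable {P F : Set E3} {A B n w : E3} {T : Finset (E3 × ℝ)} (D : FaceData P F A B n T)
include D

lemma FaceData.edgeLength_pos : 0 < edgeLength P := by
  obtain ⟨R, hR⟩ := D.compact.isBounded.exists_norm_le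
  have hfin : H1 (edgePoints P) < ⊤ :=
    H1_lt_top D.sat.edgePoints.measurableSet
      (fun z hz => edgePoints_subset_lines D.nz D.sat D.regular hz) (R := R)
      fun z hz => hR z (D.compact.isClosed.frontier_subset hz.1)
  refine ENNReal.toReal_pos ?_ hfin.ne
  -- the middle third of the edge `AB`
  have hm : ∀ r ∈ Ioo (0 : ℝ) 1, A + r • (B - A) ∈ openSegment ℝ A B := fun r hr => by
    rw [openSegment_eq_image']; exact ⟨r, hr, rfl⟩
  have hsub : segment ℝ (A + (1 / 3 : ℝ) • (B - A)) (A + (2 / 3 : ℝ) • (B - A)) ⊆ edgePoints P :=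
    ((convex_openSegment A B).segment_subset (hm _ ⟨by norm_num, by norm_num⟩)
      (hm _ ⟨by norm_num, by norm_num⟩)).trans D.edge
  have hpos : 0 < H1 (segment ℝ (A + (1 / 3 : ℝ) • (B - A)) (A + (2 / 3 : ℝ) • (B - A))) := by
    rw [H1, hausdorffMeasure_segment, edist_pos]
    intro h
    have e : (1 / 3 : ℝ) • (B - A) = 0 := by
      have h' := add_left_cancel h
      have e1 : (1 / 3 : ℝ) • (B - A) = (2 / 3 : ℝ) • (B - A) - (1 / 3 : ℝ) • (B - A) := by module
      rw [e1, ← h', sub_self]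
    rcases smul_eq_zero.1 e with h1 | h1
    · norm_num at h1
    · exact D.ne (sub_eq_zero.1 h1).symm
  exact (hpos.trans_le (measure_mono hsub)).ne'

lemma FaceData.rightDeriv_melzakRatio (hv : 0 < vol P) {c d : ℝ}
    (h1 : RightDeriv (fun t => edgeLength (replaced P F A B T (rotNormal n w t))) c)
    (h2 : HasDerivAt (fun t => vol (replaced P F A B T (rotNormal n w t))) d 0) :
    RightDeriv (fun t => melzakRatio (replaced P F A B T (rotNormal n w t)))
      (edgeLength P ^ 2 / vol P * (3 * c) - edgeLength P ^ 3 / vol P ^ 2 * d) := by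
  have h0 : replaced P F A B T (rotNormal n w 0) = P := by
    have : rotNormal n w 0 = n := by simp [rotNormal]
    rw [this, D.replaced_self]
  have h3 := HasDerivWithinAt.fun_div (HasDerivWithinAt.fun_pow h1 3)
    (h2.hasDerivWithinAt (s := Ici 0)) (by rw [h0]; exact hv.ne')
  refine HasDerivWithinAt.congr_deriv h3 ?_
  rw [h0]
  have := hv.ne'
  field_simp
  norm_num
  ring

/-- One of the two senses of rotation decreases the Melzak ratio to first order. -/
theorem FaceData.exists_rotDir_neg (hv : 0 < vol P) {H : E3} (hH : H ∈ vertices P ∩ F)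
    (hline : H ∉ affineSpan ℝ {A, B}) (hdeg : 3 < degree P H) :
    ∃ w, RotDir A B n w ∧ ∃ d < 0,
      RightDeriv (fun t => melzakRatio (replaced P F A B T (rotNormal n w t))) d := by
  obtain ⟨w, hw⟩ := exists_rotDir A B n
  have hoff : ∀ s : ℝ, H - A ≠ s • (B - A) := fun s hs => hline <| by
    have e : H = AffineMap.lineMap A B s := by
      rw [AffineMap.lineMap_apply, vsub_eq_sub, vadd_eq_add, ← hs, sub_add_cancel]
    rw [e]
    exact AffineMap.lineMap_mem_affineSpan_pair s A B
  have hHF : H ∈ F \ segment ℝ A B := ⟨hH.2, fun h => by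
    rw [segment_eq_image'] at h
    obtain ⟨s, -, hs⟩ := h
    exact hoff s (by rw [← hs]; simp)⟩
  have hc := D.corner_of_vertex hHF hH.1
  have hW : inner ℝ w (H - A) ≠ (0 : ℝ) := fun h0 => by
    obtain ⟨s, hs⟩ := hw.mem_line D.norm_n D.ne D.inner_n_AB (D.sub_plane H hH.2) h0
    exact hoff s hs
  obtain ⟨c, c', h1, h2, hsum⟩ := D.exists_rightDeriv_edgeLength hw hc hW
    (D.card_normals_of_degree hc hdeg)
  obtain ⟨d, h3⟩ := D.exists_hasDerivAt_vol hw
  -- rotating in the opposite sense is rotating by negative angles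
  have hneg : ∀ t, rotNormal n (-w) t = rotNormal n w (-t) := fun t => by simp [rotNormal]
  have h4 : HasDerivAt (fun t => vol (replaced P F A B T (rotNormal n (-w) t))) (-d) 0 := by
    simp_rw [hneg]
    have h5 : HasDerivAt (fun t : ℝ => -t) (-1) 0 := hasDerivAt_neg 0
    have := HasDerivAt.comp (0 : ℝ)
      (h₂ := fun t => vol (replaced P F A B T (rotNormal n w t))) (by rw [neg_zero]; exact h3) h5
    rwa [mul_neg_one] at this
  have m1 := D.rightDeriv_melzakRatio hv h1 h3
  have m2 := D.rightDeriv_melzakRatio hv h2 h4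
  have hk : 0 < edgeLength P ^ 2 / vol P := div_pos (pow_pos D.edgeLength_pos 2) hv
  have hlt := mul_neg_of_pos_of_neg hk hsum
  by_cases hd : edgeLength P ^ 2 / vol P * (3 * c) - edgeLength P ^ 3 / vol P ^ 2 * d < 0
  · exact ⟨w, hw, _, hd, m1⟩
  · exact ⟨-w, hw.neg, _, by linarith, m2⟩

end

lemma eventually_lt_of_rightDeriv_neg {f : ℝ → ℝ} {d : ℝ} (h : RightDeriv f d) (hd : d < 0) :
    ∀ᶠ t in 𝓝[>] (0 : ℝ), f t < f 0 := by
  rw [RightDeriv, hasDerivWithinAt_iff_tendsto_slope, Ici_sdiff_left] at h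
  filter_upwards [h.eventually (gt_mem_nhds hd), self_mem_nhdsWithin] with t ht ht0
  have ht0 : 0 < t := ht0
  rw [slope_def_field, sub_zero, div_lt_iff₀ ht0, zero_mul] at ht
  linarith

end

end Melzak

end


theorem mainTheorem7 (P F : Set Melzak.E3) (hP : Melzak.IsPolyhedron P)
    (hF : Melzak.IsFace P F) (A B : Melzak.E3) (hAB : Melzak.IsFaceEdge P F A B)
    (hexp : ∀ C ∈ Melzak.vertices P ∩ F, C ≠ A → C ≠ B → Melzak.IsExposed P C)
    (H : Melzak.E3) (hH : H ∈ Melzak.vertices P ∩ F) (hHexp : Melzak.IsExposed P H)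
    (hline : H ∉ affineSpan ℝ {A, B}) (hdeg : 3 < Melzak.degree P H) :
    ∃ (ε : ℝ) (Q : ℝ → Set Melzak.E3), 0 < ε ∧ Melzak.IsFaceRotation P F A B ε Q ∧
      (∃ d < 0, HasDerivWithinAt (fun t => Melzak.melzakRatio (Q t)) d (Set.Ici 0) 0) ∧
      ∀ t ∈ Set.Ioc 0 ε, Melzak.melzakRatio (Q t) < Melzak.melzakRatio P := by
  obtain ⟨n, T, D⟩ := Melzak.exists_faceData hP hF hAB hexp
  obtain ⟨w, hw, d, hd, hderiv⟩ := D.exists_rotDir_neg hP.vol_pos hH hline hdeg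
  have h0 : Melzak.replaced P F A B T (Melzak.rotNormal n w 0) = P := by
    have : Melzak.rotNormal n w 0 = n := by simp [Melzak.rotNormal]
    rw [this, D.replaced_self]
  have hlt := Melzak.eventually_lt_of_rightDeriv_neg hderiv hd
  rw [h0] at hlt
  obtain ⟨ε₁, hε₁, hsmall⟩ := mem_nhdsGE_iff_exists_Icc_subset.1 (D.eventually_small w)
  obtain ⟨ε₂, hε₂, hless⟩ := mem_nhdsGT_iff_exists_Ioc_subset.1 hlt
  refine ⟨min ε₁ ε₂, _, lt_min hε₁ hε₂, D.isFaceRotation hw fun t ht =>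
    hsmall ⟨ht.1, ht.2.trans (min_le_left _ _)⟩, ⟨d, hd, hderiv⟩, fun t ht => ?_⟩
  exact hless ⟨ht.1, ht.2.trans (min_le_right _ _)⟩
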